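/- **Setting.** Let $\mathbb K\supset\mathbb C(r,s)$ be an algebraically closed field, with $r,s$ algebraically independent over $\mathbb C$, let $n\ge 2$, $N=2n+1$, $i'=N+1-i$, and let $V=\mathbb K^{N}$ with matrix units $E_{ij}$. Let $\alpha_i=\varepsilon_i-\varepsilon_{i+1}$ ($1\le i<n$), $\alpha_n=\varepsilon_n$ be the simple roots of type $B_n$, $(\varepsilon_i,\varepsilon_j)=2\delta_{ij}$, $\theta=\varepsilon_1+\varepsilon_2=\alpha_1+2\alpha_2+\dots+2\alpha_n$ the highest root, and write $\bar\alpha_i=\alpha_i$ for $i\geq 1$, $\bar\alpha_0=-\theta$. Put $d_i=\frac12(\bar\alpha_i,\bar\alpha_i)$, $c_{ij}=2(\bar\alpha_i,\bar\alpha_j)/(\bar\alpha_i,\bar\alpha_i)$, $r_i=r^{d_i}$, $s_i=s^{d_i}$ for $0\le i,j\le n$. Let $\langle\cdot,\cdot\rangle$ be the bilinear form on the root lattice with $\langle\alpha_i,\alpha_j\rangle=(\alpha_i,\alpha_j)$ for $i<j$, $d_i$ for $i=j$, and $0$ for $i>j$ ($1\le i,j\le n$), and put $\Omega_{ij}=r^{\langle\bar\alpha_i,\bar\alpha_j\rangle}s^{-\langle\bar\alpha_j,\bar\alpha_i\rangle}$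 for $0\le i,j\le n$. Put $[m]_{r,s}=\frac{r^m-s^m}{r-s}$, $[m]_{r,s}!=[1]_{r,s}\cdots[m]_{r,s}$, ${m\brack k}_{r,s}=\frac{[m]_{r,s}!}{[m-k]_{r,s}![k]_{r,s}!}$. **The algebras.** $U'_{r,s}(\widehat{\mathfrak{so}}_{2n+1})$ is the unital associative $\mathbb K$-algebra generated by $e_i,f_i,\omega_i^{\pm1},(\omega_i')^{\pm1}$ ($0\le i\le n$), $\gamma^{\pm1},(\gamma')^{\pm1}$, with the relations: $\gamma=\omega_0\,\omega_1\omega_2^2\cdots\omega_n^2$ and $\gamma'=\omega'_0\,\omega'_1(\omega'_2)^2\cdots(\omega'_n)^2$ are central; all $\omega_i,\omega'_j$ commute; elements written as inverses are two-sided inverses; for all $i,j$ $$\omega_ie_j=\Omega_{ji}e_j\omega_i,\quad \omega_if_j=\Omega_{ji}^{-1}f_j\omega_i,\quad \omega'_ie_j=\Omega_{ij}^{-1}e_j\omega'_i,\quad \omega'_if_j=\Omega_{ij}f_j\omega'_i,\quad e_if_j-f_je_i=\delta_{ij}\frac{\omega_i-\omega_i'}{r_i-s_i};$$ and for $i\ne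 j$, with $m=1-c_{ij}$ and $\kappa_k=(-1)^k{m\brack k}_{r_i,s_i}(r_is_i)^{k(k-1)/2}\,\Omega_{ji}^k\,s_i^{kc_{ij}}$, $$\sum_{k=0}^{m}\kappa_k\, e_i^{m-k}e_je_i^k=0,\qquad \sum_{k=0}^{m}\kappa_k\, f_i^{k}f_jf_i^{m-k}=0 .$$ $U_{r,s}(\widehat{\mathfrak{so}}_{2n+1})$ has in addition generators $D^{\pm1},(D')^{\pm1}$, which commute with each other and with all $\omega_i,\omega_i'$ and satisfy $De_iD^{-1}=r_i^{\delta_{0i}}e_i$, $Df_iD^{-1}=r_i^{-\delta_{0i}}f_i$, $D'e_i(D')^{-1}=s_i^{\delta_{0i}}e_i$, $D'f_i(D')^{-1}=s_i^{-\delta_{0i}}f_i$. Tensor products of modules are formed with the coproduct, an algebra homomorphism given by $\Delta(e_i)=e_i\otimes1+\omega_i\otimes e_i$, $\Delta(f_i)=1\otimes f_i+f_i\otimes\omega'_i$ and $\Delta(x)=x\otimes x$ for each remaining generator $x$. **Evaluation modules.** For nonzero $a,b\in\mathbb K$ put $c=(rs)^2ab$. For $u\in\mathbb K^\times$ the $U'_{r,s}(\widehat{\mathfrak{so}}_{2n+1})$-module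 $V(u)=V$, with action $\rho_u^{a,b}$, is given by $$e_i\mapsto E_{i,i+1}-E_{(i+1)',i'}\ (1\le i\le n),\qquad f_i\mapsto E_{i+1,i}-(rs)^{-2}E_{i',(i+1)'}\ (1\le i<n),\qquad f_n\mapsto(r^{-1}+s^{-1})(E_{n+1,n}-E_{n',n+1}),$$ $$e_0\mapsto au\,(E_{1'2}-r^2s^2E_{2'1}),\qquad f_0\mapsto bu^{-1}(E_{21'}-E_{12'}),\qquad \gamma,\gamma'\mapsto c\,\mathrm{Id},$$ $$\omega_i\mapsto r^2E_{ii}+s^2E_{i+1,i+1}+r^{-2}E_{i'i'}+s^{-2}E_{(i+1)',(i+1)'}+\sum_{j\ne i,i+1,i',(i+1)'}E_{jj}\quad(1\le i<n),$$ $$\omega_n\mapsto rs^{-1}E_{nn}+E_{n+1,n+1}+r^{-1}sE_{n'n'}+\sum_{j<n}\big((rs)^{-1}E_{jj}+rsE_{j'j'}\big),$$ $$\omega_0\mapsto c\Big(s^2E_{11}+r^{-2}E_{22}+\sum_{i=3}^n\big((rs)^{-2}E_{ii}+(rs)^2E_{i'i'}\big)+r^2E_{2'2'}+s^{-2}E_{1'1'}+E_{n+1,n+1}\Big),$$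 and $\omega_i'$ acts by the formula for $\omega_i$ with $r$ and $s$ interchanged. For an indeterminate $u$, the $U_{r,s}(\widehat{\mathfrak{so}}_{2n+1})$-module $V(u)=V\otimes_{\mathbb K}\mathbb K[u,u^{-1}]$, with action $\rho^{a,b}_u$, is given by the same formulas together with $D(x\,u^k)=r_0^k\,x\,u^k$ and $D'(x\,u^k)=s_0^k\,x\,u^k$ for $x\in V$, $k\in\mathbb Z$. **The operator.** Let $\xi=r^{-2n+1}s^{2n-1}$, let $\sigma_i=-1,0,1$ for $i<n+1$, $i=n+1$, $i>n+1$ respectively, and let $t_i=s^{2(i-n)-1}$, $s^{-1}$, $r^{2(n+1-i)+1}$ in these three cases. Define an operator on $V\otimes V$, quadratic in $z$, by $$\hat R(z)=(z-r^{-2}s^2)(z-\xi)\sum_{i\ne n+1}E_{ii}\otimes E_{ii}+\sum_{j\ne i,i'}a_{ij}(z)E_{ij}\otimes E_{ji}+(1-r^{-2}s^2)(z-\xi)\sum_{i>j,\,j\ne i'}E_{ii}\otimes E_{jj}$$ $$\qquad+(1-r^{-2}s^2)z(z-\xi)\sum_{i<j,\,j\ne i'}E_{ii}\otimes E_{jj}+\sum_{i,j=1}^{N}b_{ij}(z)E_{i'j}\otimes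 E_{ij'},$$ where $a_{ij}(z)=r^{-1}s(z-1)(z-\xi)(rs)^{-\sigma_i\sigma_j}$ if $i<j,j'$ or $i>j,j'$; $a_{ij}(z)=r^{-1}s(z-1)(z-\xi)(rs)^{\sigma_i\sigma_j}$ if $j<i<j'$ or $j'<i<j$; and $$b_{ij}(z)=\begin{cases}(r^{-2}s^2z-\xi)(z-1)& i=j\ne n+1,\\ r^{-1}s(z-1)(z-\xi)+(r^{-2}s^2-1)(\xi-1)z& i=j=n+1,\\ (r^{-2}s^2-1)\big(\xi t_it_j^{-1}(z-1)-\delta_{ij'}(z-\xi)\big)& i<j,\\ (r^{-2}s^2-1)z\big(t_it_j^{-1}(z-1)-\delta_{ij'}(z-\xi)\big)& i>j.\end{cases}$$ **Theorem.** (a) The coproducts above are well defined, and if $a,b\in\mathbb K$ satisfy $ab=(rs)^{-2}$, then the formulas above define modules over $U_{r,s}(\widehat{\mathfrak{so}}_{2n+1})$ (for an indeterminate $u$) and over $U'_{r,s}(\widehat{\mathfrak{so}}_{2n+1})$ (for $u\in\mathbb K^\times$), and $\hat R(u/v)\colon V(u)\otimes V(v)\to V(v)\otimes V(u)$ satisfies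 $$\hat R(u/v)\circ(\rho^{a,b}_u\otimes\rho^{a,b}_v)(x)=(\rho^{a,b}_v\otimes\rho^{a,b}_u)(x)\circ\hat R(u/v)$$ both for indeterminates $u,v$ and all $x\in U_{r,s}(\widehat{\mathfrak{so}}_{2n+1})$, and for all $u,v\in\mathbb K^\times$ and all $x\in U'_{r,s}(\widehat{\mathfrak{so}}_{2n+1})$. For indeterminates, $V(u)\otimes V(v)$ and $V(v)\otimes V(u)$ are both identified with $(V\otimes V)\otimes\mathbb K[u^{\pm1},v^{\pm1}]$. (b) Let $\tau(x\otimes y)=y\otimes x$. The operator $R(z)=\hat R(z)\circ\tau$ satisfies the Yang–Baxter equation with a spectral parameter: on $V\otimes V\otimes V$, for all $u,v,w\in\mathbb K^\times$, $$R_{12}(v/w)R_{13}(u/w)R_{23}(u/v)=R_{23}(u/v)R_{13}(u/w)R_{12}(v/w),$$ $$\hat R_{12}(v/w)\hat R_{23}(u/w)\hat R_{12}(u/v)=\hat R_{23}(u/v)\hat R_{12}(u/w)\hat R_{23}(v/w),$$ where the subscripts indicate the tensor factors acted on. -/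

import Mathlib

open scoped TensorProduct

namespace BnAffine

/-! ## Root data of type `B_n` and its affinization

Vertices are numbered `0, 1, …, n`. The simple roots are `α_k = ε_k - ε_{k+1}` for `k < n` and
`α_n = ε_n`, where `(ε_k, ε_l) = 2 δ_{kl}`; the highest root is
`θ = ε_1 + ε_2 = α_1 + 2 α_2 + ⋯ + 2 α_n`. -/

/-- The coefficient of `α_k` (`1 ≤ k ≤ n`) in the finite root attached to the vertex `i`, which is
`α_i` for `1 ≤ i ≤ n` and `-θ` for `i = 0`. -/
def rootCoeff (i k : ℕ) : ℤ :=
  if i = 0 then (if k = 1 then -1 else -2) else (if k = i then 1 else 0)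

/-- The scalar product `(α_k, α_l)` of simple roots, `1 ≤ k, l ≤ n`. -/
def simpleForm (n k l : ℕ) : ℤ :=
  if k = l then (if k = n then 2 else 4) else (if k + 1 = l ∨ l + 1 = k then -2 else 0)

/-- The Ringel form on simple roots: `d_k c_{kl} = (α_k, α_l)` for `k < l`,
`d_k = (α_k, α_k) / 2` for `k = l`, and `0` for `k > l`. -/
def simpleRingel (n k l : ℕ) : ℤ :=
  if k < l then simpleForm n k l else (if k = l then simpleForm n k k / 2 else 0)

/-- The value on the finite roots attached to the vertices `i` and `j` of the bilinear form with
values `B k l` on the simple roots. -/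
def extendForm (n : ℕ) (B : ℕ → ℕ → ℤ) (i j : ℕ) : ℤ :=
  ∑ k ∈ Finset.Icc 1 n, ∑ l ∈ Finset.Icc 1 n, rootCoeff i k * rootCoeff j l * B k l

/-- The scalar product of the finite roots attached to two vertices. -/
def form (n i j : ℕ) : ℤ := extendForm n (simpleForm n) i j

/-- The Ringel form of the finite roots attached to two vertices. -/
def ringel (n i j : ℕ) : ℤ := extendForm n (simpleRingel n) i j

/-- The extended Cartan matrix `c_{ij} = 2 (α_i, α_j) / (α_i, α_i)`, with `-θ` for `α_0`
(the division is exact). -/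
def cartan (n i j : ℕ) : ℤ := 2 * form n i j / form n i i

/-- `d_i = (α_i, α_i) / 2`, with `-θ` for `α_0` (the division is exact). -/
def halfNorm (n i : ℕ) : ℤ := form n i i / 2

section Scalars

variable {K : Type*} [Field K] (r s : K)

/-- `r_i = r ^ d_i`; also used for `s_i = s ^ d_i`. -/
def vertexParam (r : K) (n i : ℕ) : K := r ^ halfNorm n i

/-- The structural constants `Ω_{ij} = (ω'_i, ω_j) = r ^ ⟨α_i, α_j⟩ * s ^ (-⟨α_j, α_i⟩)`, with `-θ`
for `α_0`. -/
def Om (n i j : ℕ) : K := r ^ ringel n i j * s ^ (-ringel n j i)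

/-- The two-parameter integer `[m]_{r,s}`. -/
def qInt (m : ℕ) : K := (r ^ m - s ^ m) / (r - s)

/-- The two-parameter factorial `[m]_{r,s}!`. -/
def qFactorial (m : ℕ) : K := ∏ t ∈ Finset.range m, qInt r s (t + 1)

/-- The two-parameter Gaussian binomial coefficient. -/
def qBinomial (m k : ℕ) : K := qFactorial r s m / (qFactorial r s (m - k) * qFactorial r s k)

/-- The degree `1 - c_{ij}` of the Serre relation. -/
def serreDegree (n i j : ℕ) : ℕ := (1 - cartan n i j).toNat

/-- The coefficient of index `k` in the Serre relation for the pair `(i, j)`. -/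
def serreCoeff (n i j k : ℕ) : K :=
  (-1) ^ k * qBinomial (vertexParam r n i) (vertexParam s n i) (serreDegree n i j) k
    * (vertexParam r n i * vertexParam s n i) ^ (k * (k - 1) / 2)
    * Om r s n j i ^ k * vertexParam s n i ^ ((k : ℤ) * cartan n i j)

end Scalars

/-! ## The two-parameter quantum affine algebras -/

/-- Generators other than the degree generators:
`e_i, f_i, ω_i^{±1}, (ω'_i)^{±1}` for `0 ≤ i ≤ n`, and `γ^{±1}, (γ')^{±1}`. -/
inductive Gen (n : ℕ) : Type
  | e (i : Fin (n + 1)) : Gen n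
  | f (i : Fin (n + 1)) : Gen n
  | om (i : Fin (n + 1)) : Gen n
  | omInv (i : Fin (n + 1)) : Gen n
  | omp (i : Fin (n + 1)) : Gen n
  | ompInv (i : Fin (n + 1)) : Gen n
  | ga : Gen n
  | gaInv : Gen n
  | gap : Gen n
  | gapInv : Gen n

/-- The degree generators `D^{±1}` and `(D')^{±1}`. -/
inductive DegGen : Type
  | D : DegGen
  | DInv : DegGen
  | Dp : DegGen
  | DpInv : DegGen

section Algebras

variable {K : Type*} [Field K] (r s : K) {n : ℕ} {A : Type*} [Ring A] [Algebra K A]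

/-- The product `y_1 * y_2 ^ 2 * ⋯ * y_n ^ 2` (in this order), whose exponents are the coefficients
of `θ` in the simple roots. -/
def thetaProd (y : Fin (n + 1) → A) : A :=
  ((List.finRange n).map fun k : Fin n => y k.succ ^ (if (k : ℕ) = 0 then 1 else 2)).prod

/-- The defining relations of the algebra without degree generators, imposed on a family `x` of
elements of an algebra: `AffRel r s x p q` says that `p = q` is one of them. -/
inductive AffRel (x : Gen n → A) : A → A → Prop
  | ga_eq : AffRel x (x .ga) (x (.om 0) * thetaProd fun i => x (.om i))
  | gap_eq : AffRel x (x .gap) (x (.omp 0) * thetaProd fun i => x (.omp i))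
  | ga_central (g : Gen n) : AffRel x (x .ga * x g) (x g * x .ga)
  | gap_central (g : Gen n) : AffRel x (x .gap * x g) (x g * x .gap)
  | ga_inv : AffRel x (x .ga * x .gaInv) 1
  | ga_inv' : AffRel x (x .gaInv * x .ga) 1
  | gap_inv : AffRel x (x .gap * x .gapInv) 1
  | gap_inv' : AffRel x (x .gapInv * x .gap) 1
  | om_om (i j : Fin (n + 1)) : AffRel x (x (.om i) * x (.om j)) (x (.om j) * x (.om i))
  | om_omp (i j : Fin (n + 1)) : AffRel x (x (.om i) * x (.omp j)) (x (.omp j) * x (.om i))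
  | omp_omp (i j : Fin (n + 1)) : AffRel x (x (.omp i) * x (.omp j)) (x (.omp j) * x (.omp i))
  | om_inv (i : Fin (n + 1)) : AffRel x (x (.om i) * x (.omInv i)) 1
  | om_inv' (i : Fin (n + 1)) : AffRel x (x (.omInv i) * x (.om i)) 1
  | omp_inv (i : Fin (n + 1)) : AffRel x (x (.omp i) * x (.ompInv i)) 1
  | omp_inv' (i : Fin (n + 1)) : AffRel x (x (.ompInv i) * x (.omp i)) 1
  | om_e (i j : Fin (n + 1)) :
      AffRel x (x (.om i) * x (.e j)) (Om r s n j i • (x (.e j) * x (.om i)))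
  | om_f (i j : Fin (n + 1)) :
      AffRel x (x (.om i) * x (.f j)) ((Om r s n j i)⁻¹ • (x (.f j) * x (.om i)))
  | omp_e (i j : Fin (n + 1)) :
      AffRel x (x (.omp i) * x (.e j)) ((Om r s n i j)⁻¹ • (x (.e j) * x (.omp i)))
  | omp_f (i j : Fin (n + 1)) :
      AffRel x (x (.omp i) * x (.f j)) (Om r s n i j • (x (.f j) * x (.omp i)))
  | e_f (i : Fin (n + 1)) :
      AffRel x (x (.e i) * x (.f i) - x (.f i) * x (.e i))
        ((vertexParam r n i - vertexParam s n i)⁻¹ • (x (.om i) - x (.omp i)))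
  | e_f_ne (i j : Fin (n + 1)) (h : i ≠ j) :
      AffRel x (x (.e i) * x (.f j) - x (.f j) * x (.e i)) 0
  | serre_e (i j : Fin (n + 1)) (h : i ≠ j) :
      AffRel x (∑ k ∈ Finset.range (serreDegree n i j + 1),
        serreCoeff r s n i j k •
          (x (.e i) ^ (serreDegree n i j - k) * x (.e j) * x (.e i) ^ k)) 0
  | serre_f (i j : Fin (n + 1)) (h : i ≠ j) :
      AffRel x (∑ k ∈ Finset.range (serreDegree n i j + 1),
        serreCoeff r s n i j k •
          (x (.f i) ^ k * x (.f j) * x (.f i) ^ (serreDegree n i j - k))) 0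

/-- The defining relations of the algebra with degree generators. Only `e_0` and `f_0` fail to
commute with `D` and `D'`. -/
inductive AffDegRel (x : Gen n ⊕ DegGen → A) : A → A → Prop
  | base {p q : A} (h : AffRel r s (fun g => x (.inl g)) p q) : AffDegRel x p q
  | D_inv : AffDegRel x (x (.inr .D) * x (.inr .DInv)) 1
  | D_inv' : AffDegRel x (x (.inr .DInv) * x (.inr .D)) 1
  | Dp_inv : AffDegRel x (x (.inr .Dp) * x (.inr .DpInv)) 1
  | Dp_inv' : AffDegRel x (x (.inr .DpInv) * x (.inr .Dp)) 1
  | D_Dp : AffDegRel x (x (.inr .D) * x (.inr .Dp)) (x (.inr .Dp) * x (.inr .D))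
  | D_om (i : Fin (n + 1)) :
      AffDegRel x (x (.inr .D) * x (.inl (.om i))) (x (.inl (.om i)) * x (.inr .D))
  | D_omp (i : Fin (n + 1)) :
      AffDegRel x (x (.inr .D) * x (.inl (.omp i))) (x (.inl (.omp i)) * x (.inr .D))
  | Dp_om (i : Fin (n + 1)) :
      AffDegRel x (x (.inr .Dp) * x (.inl (.om i))) (x (.inl (.om i)) * x (.inr .Dp))
  | Dp_omp (i : Fin (n + 1)) :
      AffDegRel x (x (.inr .Dp) * x (.inl (.omp i))) (x (.inl (.omp i)) * x (.inr .Dp))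
  | D_e (i : Fin (n + 1)) :
      AffDegRel x (x (.inr .D) * x (.inl (.e i)) * x (.inr .DInv))
        ((if i = 0 then vertexParam r n i else 1) • x (.inl (.e i)))
  | D_f (i : Fin (n + 1)) :
      AffDegRel x (x (.inr .D) * x (.inl (.f i)) * x (.inr .DInv))
        ((if i = 0 then (vertexParam r n i)⁻¹ else 1) • x (.inl (.f i)))
  | Dp_e (i : Fin (n + 1)) :
      AffDegRel x (x (.inr .Dp) * x (.inl (.e i)) * x (.inr .DpInv))
        ((if i = 0 then vertexParam s n i else 1) • x (.inl (.e i)))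
  | Dp_f (i : Fin (n + 1)) :
      AffDegRel x (x (.inr .Dp) * x (.inl (.f i)) * x (.inr .DpInv))
        ((if i = 0 then (vertexParam s n i)⁻¹ else 1) • x (.inl (.f i)))

variable (n)

/-- The algebra `U'_{r,s}` of affine type `B_n`, without degree generators. -/
abbrev UPrime : Type _ :=
  RingQuot (AffRel r s (FreeAlgebra.ι K : Gen n → FreeAlgebra K (Gen n)))

/-- The two-parameter quantum affine algebra `U_{r,s}` of affine type `B_n`. -/
abbrev UAff : Type _ :=
  RingQuot (AffDegRel r s
    (FreeAlgebra.ι K : Gen n ⊕ DegGen → FreeAlgebra K (Gen n ⊕ DegGen)))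

/-- The generators of `U'_{r,s}`. -/
def UPrime.gen (g : Gen n) : UPrime r s n := RingQuot.mkAlgHom K _ (FreeAlgebra.ι K g)

/-- The generators of `U_{r,s}`. -/
def UAff.gen (g : Gen n ⊕ DegGen) : UAff r s n := RingQuot.mkAlgHom K _ (FreeAlgebra.ι K g)

/-- An algebra homomorphism from `U'_{r,s}` is determined by its values on the generators. -/
theorem UPrime.hom_ext {B : Type*} [Ring B] [Algebra K B] {φ ψ : UPrime r s n →ₐ[K] B}
    (h : ∀ g, φ (UPrime.gen r s n g) = ψ (UPrime.gen r s n g)) : φ = ψ :=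
  RingQuot.ringQuot_ext' _ _ _ (FreeAlgebra.hom_ext (funext h))

/-- An algebra homomorphism from `U_{r,s}` is determined by its values on the generators. -/
theorem UAff.hom_ext {B : Type*} [Ring B] [Algebra K B] {φ ψ : UAff r s n →ₐ[K] B}
    (h : ∀ g, φ (UAff.gen r s n g) = ψ (UAff.gen r s n g)) : φ = ψ :=
  RingQuot.ringQuot_ext' _ _ _ (FreeAlgebra.hom_ext (funext h))

variable {n}

/-- The values of the coproduct on the generators other than the degree generators. -/
structure IsCoproductOn (x : Gen n → A) (Δ : A →ₐ[K] A ⊗[K] A) : Prop where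
  e (i : Fin (n + 1)) : Δ (x (.e i)) = x (.e i) ⊗ₜ[K] 1 + x (.om i) ⊗ₜ[K] x (.e i)
  f (i : Fin (n + 1)) : Δ (x (.f i)) = 1 ⊗ₜ[K] x (.f i) + x (.f i) ⊗ₜ[K] x (.omp i)
  om (i : Fin (n + 1)) : Δ (x (.om i)) = x (.om i) ⊗ₜ[K] x (.om i)
  omInv (i : Fin (n + 1)) : Δ (x (.omInv i)) = x (.omInv i) ⊗ₜ[K] x (.omInv i)
  omp (i : Fin (n + 1)) : Δ (x (.omp i)) = x (.omp i) ⊗ₜ[K] x (.omp i)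
  ompInv (i : Fin (n + 1)) : Δ (x (.ompInv i)) = x (.ompInv i) ⊗ₜ[K] x (.ompInv i)
  ga : Δ (x .ga) = x .ga ⊗ₜ[K] x .ga
  gaInv : Δ (x .gaInv) = x .gaInv ⊗ₜ[K] x .gaInv
  gap : Δ (x .gap) = x .gap ⊗ₜ[K] x .gap
  gapInv : Δ (x .gapInv) = x .gapInv ⊗ₜ[K] x .gapInv

/-- `Δ` is the coproduct of `U'_{r,s}`. -/
def UPrime.IsCoproduct (Δ : UPrime r s n →ₐ[K] UPrime r s n ⊗[K] UPrime r s n) : Prop :=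
  IsCoproductOn (UPrime.gen r s n) Δ

/-- `Δ` is the coproduct of `U_{r,s}`; the degree generators are group-like. -/
def UAff.IsCoproduct (Δ : UAff r s n →ₐ[K] UAff r s n ⊗[K] UAff r s n) : Prop :=
  IsCoproductOn (fun g => UAff.gen r s n (.inl g)) Δ ∧
    ∀ d : DegGen, Δ (UAff.gen r s n (.inr d)) =
      UAff.gen r s n (.inr d) ⊗ₜ[K] UAff.gen r s n (.inr d)

/-- The tensor product `x ↦ (ρ ⊗ σ)(Δ x)` of two representations. -/
noncomputable def tensorRep {M N : Type*} [AddCommGroup M] [Module K M] [AddCommGroup N]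
    [Module K N] (Δ : A →ₐ[K] A ⊗[K] A) (ρ : A →ₐ[K] Module.End K M)
    (σ : A →ₐ[K] Module.End K N) : A →ₐ[K] Module.End K (M ⊗[K] N) :=
  (Module.endTensorEndAlgHom (R := K) (S := K) (A := K) (M := M) (N := N)).comp
    ((Algebra.TensorProduct.map ρ σ).comp Δ)

end Algebras

/-! ## The evaluation modules -/

section Evaluation

variable (K : Type*) [Field K]

/-- The space `V = K ^ (2 n + 1)`. -/
abbrev V (n : ℕ) : Type _ := Fin (2 * n + 1) → K

/-- The matrix unit `E_{ij}` acting on `V`, with indices `1 ≤ i, j ≤ 2 n + 1`. -/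
noncomputable def E (n i j : ℕ) : Module.End K (V K n) :=
  Matrix.toLin' (Matrix.of fun p q : Fin (2 * n + 1) =>
    if (p : ℕ) + 1 = i ∧ (q : ℕ) + 1 = j then (1 : K) else 0)

/-- The involution `i ↦ i' = N + 1 - i` of `{1, …, N}`, where `N = 2 n + 1`. -/
def inv (n i : ℕ) : ℕ := 2 * n + 2 - i

variable {K}

/-- The diagonal operator on `V` with eigenvalues `w 1, …, w (2 n + 1)`. -/
noncomputable def diag (n : ℕ) (w : ℕ → K) : Module.End K (V K n) :=
  ∑ k ∈ Finset.Icc 1 (2 * n + 1), w k • E K n k k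

/-- The eigenvalue of `ω_i` on `v_k`, up to the factor `c` when `i = 0`. Interchanging `r` and `s`
gives that of `ω'_i`. -/
def omWeight (r s : K) (n i k : ℕ) : K :=
  if i = 0 then
    if k = 1 then s ^ (2 : ℤ)
    else if k = 2 then r ^ (-2 : ℤ)
    else if k = inv n 2 then r ^ (2 : ℤ)
    else if k = inv n 1 then s ^ (-2 : ℤ)
    else if k = n + 1 then 1
    else if k ≤ n then r ^ (-2 : ℤ) * s ^ (-2 : ℤ)
    else r ^ (2 : ℤ) * s ^ (2 : ℤ)
  else if i < n then
    if k = i then r ^ (2 : ℤ)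
    else if k = i + 1 then s ^ (2 : ℤ)
    else if k = inv n i then r ^ (-2 : ℤ)
    else if k = inv n (i + 1) then s ^ (-2 : ℤ)
    else 1
  else
    if k = n then r * s⁻¹
    else if k = n + 1 then 1
    else if k = inv n n then r⁻¹ * s
    else if k < n then r⁻¹ * s⁻¹
    else r * s

/-- The scalar `c = (r s) ^ 2 a b` by which `γ` and `γ'` act. -/
def level (r s a b : K) : K := (r * s) ^ 2 * (a * b)

/-- The action of the generators on `V` for the spectral parameter `u = 1`. -/
noncomputable def genOp (r s a b : K) (n : ℕ) : Gen n → Module.End K (V K n)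
  | .e i =>
      if (i : ℕ) = 0 then
        a • (E K n (inv n 1) 2 - (r ^ 2 * s ^ 2) • E K n (inv n 2) 1)
      else E K n (i : ℕ) ((i : ℕ) + 1) - E K n (inv n ((i : ℕ) + 1)) (inv n (i : ℕ))
  | .f i =>
      if (i : ℕ) = 0 then b • (E K n 2 (inv n 1) - E K n 1 (inv n 2))
      else if (i : ℕ) < n then
        E K n ((i : ℕ) + 1) (i : ℕ)
          - (r * s) ^ (-2 : ℤ) • E K n (inv n (i : ℕ)) (inv n ((i : ℕ) + 1))
      else
        (r⁻¹ + s⁻¹) • E K n (n + 1) n - (r⁻¹ + s⁻¹) • E K n (inv n n) (n + 1)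
  | .om i => (if (i : ℕ) = 0 then level r s a b else 1) • diag n (omWeight r s n i)
  | .omInv i =>
      (if (i : ℕ) = 0 then level r s a b else 1)⁻¹ • diag n fun k => (omWeight r s n i k)⁻¹
  | .omp i => (if (i : ℕ) = 0 then level r s a b else 1) • diag n (omWeight s r n i)
  | .ompInv i =>
      (if (i : ℕ) = 0 then level r s a b else 1)⁻¹ • diag n fun k => (omWeight s r n i k)⁻¹
  | .ga => level r s a b • 1
  | .gaInv => (level r s a b)⁻¹ • 1
  | .gap => level r s a b • 1
  | .gapInv => (level r s a b)⁻¹ • 1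

/-- The power of the spectral parameter in the action of a generator. -/
def genDeg {n : ℕ} : Gen n → ℤ
  | .e i => if (i : ℕ) = 0 then 1 else 0
  | .f i => if (i : ℕ) = 0 then -1 else 0
  | _ => 0

/-- `ρ` is the evaluation representation `ρ_u^{a,b}` of `U'_{r,s}` on `V(u) = V`, where `u` is a
nonzero scalar. -/
def IsEvaluation (r s a b u : K) (n : ℕ) (ρ : UPrime r s n →ₐ[K] Module.End K (V K n)) : Prop :=
  ∀ g : Gen n, ρ (UPrime.gen r s n g) = u ^ genDeg g • genOp r s a b n g

/-- The space `V(u) = V ⊗ K[u, u⁻¹]` for an indeterminate `u`. -/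
abbrev VLaurent (K : Type*) [Field K] (n : ℕ) : Type _ := V K n ⊗[K] LaurentPolynomial K

/-- `ρ` is the evaluation representation `ρ_u^{a,b}` of `U_{r,s}` on `V(u) = V ⊗ K[u, u⁻¹]`, where
`u` is an indeterminate. Here `D` and `D'` act on `v ⊗ u ^ k` by `r_0 ^ k` and `s_0 ^ k`. -/
structure IsFormalEvaluation (r s a b : K) (n : ℕ)
    (ρ : UAff r s n →ₐ[K] Module.End K (VLaurent K n)) : Prop where
  gen (g : Gen n) (v : V K n) (k : ℤ) :
    ρ (UAff.gen r s n (.inl g)) (v ⊗ₜ LaurentPolynomial.T k) =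
      genOp r s a b n g v ⊗ₜ LaurentPolynomial.T (k + genDeg g)
  D (v : V K n) (k : ℤ) :
    ρ (UAff.gen r s n (.inr .D)) (v ⊗ₜ LaurentPolynomial.T k) =
      vertexParam r n 0 ^ k • (v ⊗ₜ LaurentPolynomial.T k)
  DInv (v : V K n) (k : ℤ) :
    ρ (UAff.gen r s n (.inr .DInv)) (v ⊗ₜ LaurentPolynomial.T k) =
      vertexParam r n 0 ^ (-k) • (v ⊗ₜ LaurentPolynomial.T k)
  Dp (v : V K n) (k : ℤ) :
    ρ (UAff.gen r s n (.inr .Dp)) (v ⊗ₜ LaurentPolynomial.T k) =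
      vertexParam s n 0 ^ k • (v ⊗ₜ LaurentPolynomial.T k)
  DpInv (v : V K n) (k : ℤ) :
    ρ (UAff.gen r s n (.inr .DpInv)) (v ⊗ₜ LaurentPolynomial.T k) =
      vertexParam s n 0 ^ (-k) • (v ⊗ₜ LaurentPolynomial.T k)

end Evaluation

/-! ## The operator `R̂(z)` -/

section RMatrix

open Polynomial

variable {K : Type*} [Field K] (r s : K) (n : ℕ)

/-- `ξ = r ^ (-2 n + 1) * s ^ (2 n - 1)`. -/
def xi : K := r ^ (-2 * (n : ℤ) + 1) * s ^ (2 * (n : ℤ) - 1)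

/-- The signs `σ_i`. -/
def sgn (i : ℕ) : ℤ := if i < n + 1 then -1 else if i = n + 1 then 0 else 1

/-- The constants `t_i`. -/
def tConst (i : ℕ) : K :=
  if i < n + 1 then s ^ (2 * ((i : ℤ) - n) - 1)
  else if i = n + 1 then s⁻¹
  else r ^ (2 * ((n : ℤ) + 1 - i) + 1)

/-- The polynomial `a_{ij}(z)`, used only for `j ≠ i, i'`; the second case is then
`j < i < j'` or `j' < i < j`. -/
noncomputable def aCoeff (i j : ℕ) : K[X] :=
  if (i < j ∧ i < inv n j) ∨ (j < i ∧ inv n j < i) then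
    C (r⁻¹ * s) * (X - 1) * (X - C (xi r s n)) * C ((r * s) ^ (-(sgn n i * sgn n j)))
  else
    C (r⁻¹ * s) * (X - 1) * (X - C (xi r s n)) * C ((r * s) ^ (sgn n i * sgn n j))

/-- The polynomial `b_{ij}(z)`. -/
noncomputable def bCoeff (i j : ℕ) : K[X] :=
  if i = j then
    if i ≠ n + 1 then (C (r ^ (-2 : ℤ) * s ^ 2) * X - C (xi r s n)) * (X - 1)
    else
      C (r⁻¹ * s) * (X - 1) * (X - C (xi r s n))
        + C ((r ^ (-2 : ℤ) * s ^ 2 - 1) * (xi r s n - 1)) * X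
  else if i < j then
    C (r ^ (-2 : ℤ) * s ^ 2 - 1) *
      (C (xi r s n * tConst r s n i * (tConst r s n j)⁻¹) * (X - 1)
        - if i = inv n j then X - C (xi r s n) else 0)
  else
    C (r ^ (-2 : ℤ) * s ^ 2 - 1) * X *
      (C (tConst r s n i * (tConst r s n j)⁻¹) * (X - 1)
        - if i = inv n j then X - C (xi r s n) else 0)

/-- The operator `E_{ij} ⊗ E_{kl}` on `V ⊗ V`. -/
noncomputable def EE (K : Type*) [Field K] (n i j k l : ℕ) : Module.End K (V K n ⊗[K] V K n) :=
  TensorProduct.map (E K n i j) (E K n k l)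

/-- The sum defining `R̂(z)`, each term being (a polynomial in `z`) times (an operator on `V ⊗ V`);
the argument `φ` prescribes how a polynomial `p(z)` and an operator `A` are combined, that is, how
`z` is specialized. -/
noncomputable def RhatSum {M : Type*} [AddCommMonoid M]
    (φ : K[X] → Module.End K (V K n ⊗[K] V K n) → M) : M :=
  ∑ i ∈ Finset.Icc 1 (2 * n + 1) with i ≠ n + 1,
      φ ((X - C (r ^ (-2 : ℤ) * s ^ 2)) * (X - C (xi r s n))) (EE K n i i i i)
  + ∑ i ∈ Finset.Icc 1 (2 * n + 1), ∑ j ∈ Finset.Icc 1 (2 * n + 1) with j ≠ i ∧ j ≠ inv n i,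
      φ (aCoeff r s n i j) (EE K n i j j i)
  + ∑ i ∈ Finset.Icc 1 (2 * n + 1), ∑ j ∈ Finset.Icc 1 (2 * n + 1) with j < i ∧ j ≠ inv n i,
      φ (C (1 - r ^ (-2 : ℤ) * s ^ 2) * (X - C (xi r s n))) (EE K n i i j j)
  + ∑ i ∈ Finset.Icc 1 (2 * n + 1), ∑ j ∈ Finset.Icc 1 (2 * n + 1) with i < j ∧ j ≠ inv n i,
      φ (C (1 - r ^ (-2 : ℤ) * s ^ 2) * X * (X - C (xi r s n))) (EE K n i i j j)
  + ∑ i ∈ Finset.Icc 1 (2 * n + 1), ∑ j ∈ Finset.Icc 1 (2 * n + 1),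
      φ (bCoeff r s n i j) (EE K n (inv n i) j i (inv n j))

/-- The operator `R̂(z)` on `V ⊗ V` for a scalar `z`. -/
noncomputable def Rhat (z : K) : Module.End K (V K n ⊗[K] V K n) :=
  RhatSum r s n fun p A => p.eval z • A

/-- The operator `R(z) = R̂(z) ∘ τ`, where `τ` is the flip. -/
noncomputable def Rmat (z : K) : Module.End K (V K n ⊗[K] V K n) :=
  Rhat r s n z ∘ₗ (TensorProduct.comm K (V K n) (V K n)).toLinearMap

/-- The element `z = u / v` of `K[u, u⁻¹] ⊗ K[v, v⁻¹]`. -/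
noncomputable def ratio (K : Type*) [Field K] :
    LaurentPolynomial K ⊗[K] LaurentPolynomial K :=
  LaurentPolynomial.T 1 ⊗ₜ LaurentPolynomial.T (-1)

/-- The canonical identification of `(V ⊗ K[u, u⁻¹]) ⊗ (V ⊗ K[v, v⁻¹])` with
`(V ⊗ V) ⊗ (K[u, u⁻¹] ⊗ K[v, v⁻¹])`. -/
noncomputable def regroup (K : Type*) [Field K] (n : ℕ) :
    VLaurent K n ⊗[K] VLaurent K n ≃ₗ[K]
      (V K n ⊗[K] V K n) ⊗[K] (LaurentPolynomial K ⊗[K] LaurentPolynomial K) :=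
  TensorProduct.tensorTensorTensorComm K (V K n) (LaurentPolynomial K) (V K n)
    (LaurentPolynomial K)

/-- The operator `R̂(u/v) : V(u) ⊗ V(v) → V(v) ⊗ V(u)` for indeterminates `u` and `v`: each term
`p(z) A` acts by `A` on `V ⊗ V` and by multiplication by `p(u/v)` on Laurent polynomials in `u, v`;
in the target, the first tensor factor carries the variable `v` and the second one `u`. -/
noncomputable def RhatFormal :
    VLaurent K n ⊗[K] VLaurent K n →ₗ[K] VLaurent K n ⊗[K] VLaurent K n :=
  RhatSum r s n fun p A =>
    (regroup K n).symm.toLinearMap ∘ₗ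
      TensorProduct.map A
        ((TensorProduct.comm K (LaurentPolynomial K) (LaurentPolynomial K)).toLinearMap ∘ₗ
          LinearMap.mulLeft K (aeval (ratio K) p)) ∘ₗ
      (regroup K n).toLinearMap

/-- `A` acting on the first two factors of `V ⊗ V ⊗ V`. -/
noncomputable def op12 {K : Type*} [Field K] {n : ℕ} (A : Module.End K (V K n ⊗[K] V K n)) :
    Module.End K (V K n ⊗[K] (V K n ⊗[K] V K n)) :=
  (TensorProduct.assoc K (V K n) (V K n) (V K n)).toLinearMap ∘ₗ
    A.rTensor (V K n) ∘ₗ (TensorProduct.assoc K (V K n) (V K n) (V K n)).symm.toLinearMap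

/-- `A` acting on the last two factors of `V ⊗ V ⊗ V`. -/
noncomputable def op23 {K : Type*} [Field K] {n : ℕ} (A : Module.End K (V K n ⊗[K] V K n)) :
    Module.End K (V K n ⊗[K] (V K n ⊗[K] V K n)) :=
  A.lTensor (V K n)

/-- `A` acting on the first and third factors of `V ⊗ V ⊗ V`, namely
`(Id ⊗ τ) A_{12} (Id ⊗ τ)`. -/
noncomputable def op13 {K : Type*} [Field K] {n : ℕ} (A : Module.End K (V K n ⊗[K] V K n)) :
    Module.End K (V K n ⊗[K] (V K n ⊗[K] V K n)) :=
  op23 (TensorProduct.comm K (V K n) (V K n)).toLinearMap ∘ₗ op12 A ∘ₗ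
    op23 (TensorProduct.comm K (V K n) (V K n)).toLinearMap

end RMatrix

end BnAffine

set_option linter.unusedSimpArgs false

namespace BnAffine

/-! ## Root data -/

/-! About the scalars the argument uses only that `r` and `s` are nonzero, that `r ^ k ≠ s ^ k` for
`k > 0` (`IsGeneric`), and that `K` is infinite.

Coproduct. Most relations are immediate for group-like elements. In `[e_i, f_j]` the mixed terms
cancel because the same constant `Ω` appears twice. For the Serre relations put `q = Ω_ii`, `w =
Ω_ji`, `w' = Ω_ij`. Then `q ^ (m - 1) * w * w' = 1`, and this makes the Serre expression of `Δ(e_i),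
Δ(e_j)` split into those of `e_i ⊗ 1, e_j ⊗ 1` and of `ω_i ⊗ e_i, ω_j ⊗ e_j` (`serreSum_add`), both
of which vanish.

Modules. The relations are checked on matrix units for `u = 1` (`affSat_genOp`). They are
homogeneous for the degree of `e_0` and `f_0`, so the operators may be multiplied by powers of any
unit of a commutative algebra (`AffSat.twist`): a scalar gives the modules over `U'`, the variable
of the Laurent polynomials gives the module over `U`.

Intertwining. Unless `d = c'`, the operator `R̂(z)` sends `v_c ⊗ v_d` to a combination of itself and
`v_d ⊗ v_c`, and it preserves the span of the vectors `v_{i'} ⊗ v_i`. Compatibility with `Δ(e_i)` is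
therefore a finite list of scalar identities (`LongHalf`, `ShortConds`), in which the constants
`t_i` enter through a few ratios. The flip composed with `k ↦ k'` carries `Δ(f_i)` to an expression
of the shape of `Δ(e_i)` and amounts to replacing `(r, s)` by `(s⁻¹, r⁻¹)`, so the same list settles
`f_i`. The statement for indeterminates follows by specializing them at all nonzero scalars
(`eq_zero_of_evalPair`).

Yang–Baxter. Let `X` be the difference of the two sides of the braid form. It is a difference of
intertwiners from `V(u) ⊗ V(v) ⊗ V(w)` to `V(w) ⊗ V(v) ⊗ V(u)`, so its kernel is a submodule. On
`v_a ⊗ v_b ⊗ v_c` without conjugate letters `R̂` looks like an `R`-matrix of type `A`, and `X`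
vanishes by computation (`ybDefect_conjFree`). For generic `u, v, w` these vectors generate
everything, which is shown directly, without irreducibility (`KillsConjFree.eq_zero`). A vector with
a conjugate pair and third letter `o` has the weight of `v_o`. For `o = 1` the operators `e_2, …,
e_n` leave three unknown values of `X`, and relations involving `e_0` form a triangular system for
them, nondegenerate when no ratio of parameters equals `ξ`. The other nonzero weights are reached
because `[e_i, f_i]` acts on them by a nonzero scalar, and weight zero is reached by `f_n` and
`f_{n-1}`. Since `R̂(z)` is polynomial in `z`, the equation extends to all parameters
(`ybDefect_eq_zero`). The form with `R = R̂ τ` follows by moving the flips past the other operators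
(`yangBaxter_of_braid`). -/

theorem sum_mul_simpleRingel_left (n j : ℕ) (hj : 1 ≤ j) (hjn : j ≤ n) (f : ℕ → ℤ) :
    ∑ k ∈ Finset.Icc 1 n, f k * simpleRingel n k j =
      f j * (if j = n then 1 else 2) - (if 2 ≤ j then 2 * f (j - 1) else 0) := by
  -- Column `j` of the Ringel matrix is supported on `k = j` and `k = j - 1`; for `j = 1` the second
  -- position is `0`, outside the range of summation.
  have key : ∀ k ∈ Finset.Icc 1 n, f k * simpleRingel n k j =
      (if k = j then f j * (if j = n then 1 else 2) else 0)
        + (if k = j - 1 then (if 2 ≤ j then -2 * f (j - 1) else 0) else 0) := by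
    intro k hk
    simp only [Finset.mem_Icc] at hk
    rcases lt_trichotomy k j with h | h | h
    · rcases eq_or_ne (k + 1) j with h' | h'
      · subst h'
        simp [simpleRingel, simpleForm, show 2 ≤ k + 1 by omega, mul_comm]
      · simp [simpleRingel, simpleForm, h, h.ne, h', show ¬ j + 1 = k by omega,
          show ¬ k = j - 1 by omega]
    · subst h
      rw [if_neg (show ¬ k = k - 1 by omega)]
      by_cases hn : k = n <;> simp [simpleRingel, simpleForm, hn]
    · simp [simpleRingel, h.ne', show ¬ k < j by omega, show ¬ k = j - 1 by omega]
  rw [Finset.sum_congr rfl key, Finset.sum_add_distrib, Finset.sum_ite_eq', Finset.sum_ite_eq']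
  simp only [Finset.mem_Icc]
  split_ifs <;> omega

theorem sum_mul_simpleRingel_right (n j : ℕ) (hj : 1 ≤ j) (hjn : j ≤ n) (f : ℕ → ℤ) :
    ∑ k ∈ Finset.Icc 1 n, f k * simpleRingel n j k =
      f j * (if j = n then 1 else 2) - (if j < n then 2 * f (j + 1) else 0) := by
  have key : ∀ k ∈ Finset.Icc 1 n, f k * simpleRingel n j k =
      (if k = j then f j * (if j = n then 1 else 2) else 0)
        + (if k = j + 1 then -2 * f (j + 1) else 0) := by
    intro k hk
    simp only [Finset.mem_Icc] at hk
    rcases lt_trichotomy j k with h | h | h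
    · rcases eq_or_ne (j + 1) k with h' | h'
      · subst h'
        simp [simpleRingel, simpleForm, mul_comm]
      · simp [simpleRingel, simpleForm, h, h.ne, h.ne', h'.symm, h', show ¬ k + 1 = j by omega]
    · subst h
      by_cases hn : j = n <;> simp [simpleRingel, simpleForm, hn]
    · simp [simpleRingel, h.ne, h.ne', show ¬ j < k by omega, show ¬ k = j + 1 by omega]
  rw [Finset.sum_congr rfl key, Finset.sum_add_distrib, Finset.sum_ite_eq', Finset.sum_ite_eq']
  simp only [Finset.mem_Icc]
  split_ifs <;> omega

theorem sum_rootCoeff_mul (n i : ℕ) (hi : 1 ≤ i) (hin : i ≤ n) (f : ℕ → ℤ) :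
    ∑ k ∈ Finset.Icc 1 n, rootCoeff i k * f k = f i := by
  have : ∀ k ∈ Finset.Icc 1 n, rootCoeff i k * f k = if k = i then f i else 0 := by
    intro k _
    by_cases h : k = i
    · subst h; simp [rootCoeff, show k ≠ 0 by omega]
    · simp [rootCoeff, show i ≠ 0 by omega, h]
  rw [Finset.sum_congr rfl this, Finset.sum_ite_eq', if_pos (by simp; omega)]

theorem extendForm_eq (n : ℕ) (B : ℕ → ℕ → ℤ) (i j : ℕ) :
    extendForm n B i j =
      ∑ k ∈ Finset.Icc 1 n, rootCoeff i k * ∑ l ∈ Finset.Icc 1 n, rootCoeff j l * B k l := by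
  simp [extendForm, Finset.mul_sum, mul_assoc]

theorem extendForm_eq' (n : ℕ) (B : ℕ → ℕ → ℤ) (i j : ℕ) :
    extendForm n B i j =
      ∑ l ∈ Finset.Icc 1 n, rootCoeff j l * ∑ k ∈ Finset.Icc 1 n, rootCoeff i k * B k l := by
  rw [extendForm, Finset.sum_comm]
  simp [Finset.mul_sum, mul_left_comm, mul_assoc]

/-- The values of the Ringel form on the finite roots attached to the vertices. -/
def ringelValue (n i j : ℕ) : ℤ :=
  if i = 0 then
    if j = 0 then 2
    else if j = 1 then -2
    else if j = 2 then (if n = 2 then 0 else -2)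
    else if j = n then 2 else 0
  else if j = 0 then
    if i = 1 then 2 else if i = n then -2 else 0
  else simpleRingel n i j

theorem ringel_pos (n i j : ℕ) (hi : 1 ≤ i) (hin : i ≤ n) (hj : 1 ≤ j) (hjn : j ≤ n) :
    ringel n i j = simpleRingel n i j := by
  rw [ringel, extendForm_eq, sum_rootCoeff_mul n i hi hin, sum_rootCoeff_mul n j hj hjn]

theorem ringel_zero_left (n j : ℕ) (hn : 2 ≤ n) (hj : 1 ≤ j) (hjn : j ≤ n) :
    ringel n 0 j = ringelValue n 0 j := by
  rw [ringel, extendForm_eq', sum_rootCoeff_mul n j hj hjn, sum_mul_simpleRingel_left n j hj hjn]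
  simp only [rootCoeff, ringelValue]
  split_ifs <;> omega

theorem ringel_zero_right (n i : ℕ) (hn : 2 ≤ n) (hi : 1 ≤ i) (hin : i ≤ n) :
    ringel n i 0 = ringelValue n i 0 := by
  rw [ringel, extendForm_eq, sum_rootCoeff_mul n i hi hin, sum_mul_simpleRingel_right n i hi hin]
  simp only [rootCoeff, ringelValue]
  split_ifs <;> omega

theorem ringel_zero_zero (n : ℕ) (hn : 2 ≤ n) : ringel n 0 0 = 2 := by
  have h : ringel n 0 0 = ∑ l ∈ Finset.Icc 1 n, rootCoeff 0 l * ringelValue n 0 l := by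
    rw [ringel, extendForm_eq']
    refine Finset.sum_congr rfl fun l hl => ?_
    simp only [Finset.mem_Icc] at hl
    rw [← ringel_zero_left n l hn hl.1 hl.2, ringel, extendForm_eq',
      sum_rootCoeff_mul n l hl.1 hl.2]
  -- Only `l = 1, 2, n` contribute, with `2 + 4 - 4`; for `n = 2` the last two positions coincide
  -- and contribute `0`.
  have key : ∀ l ∈ Finset.Icc 1 n, rootCoeff 0 l * ringelValue n 0 l =
      (if l = 1 then 2 else 0) + ((if l = 2 then (if n = 2 then 0 else 4) else 0)
        + (if l = n then (if n = 2 then 0 else -4) else 0)) := by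
    intro l hl
    simp only [Finset.mem_Icc] at hl
    simp only [rootCoeff, ringelValue]
    split_ifs <;> omega
  rw [h, Finset.sum_congr rfl key, Finset.sum_add_distrib, Finset.sum_add_distrib,
    Finset.sum_ite_eq', Finset.sum_ite_eq', Finset.sum_ite_eq']
  simp only [Finset.mem_Icc]
  split_ifs <;> omega

theorem ringel_eq (n i j : ℕ) (hn : 2 ≤ n) (hi : i ≤ n) (hj : j ≤ n) :
    ringel n i j = ringelValue n i j := by
  rcases Nat.eq_zero_or_pos i with rfl | hi'
  · rcases Nat.eq_zero_or_pos j with rfl | hj'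
    · simp [ringel_zero_zero n hn, ringelValue]
    · exact ringel_zero_left n j hn hj' hj
  · rcases Nat.eq_zero_or_pos j with rfl | hj'
    · exact ringel_zero_right n i hn hi' hi
    · rw [ringel_pos n i j hi' hi hj' hj]
      simp [ringelValue, show i ≠ 0 by omega, show j ≠ 0 by omega]

/-- The Ringel form keeps the upper triangle and half of the diagonal of the symmetric form, so
symmetrizing it recovers the latter; this passes to all roots by bilinearity. -/
theorem form_eq (n i j : ℕ) : form n i j = ringel n i j + ringel n j i := by
  rw [form, ringel, ringel, extendForm, extendForm_eq' n _ j i, extendForm]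
  simp only [Finset.mul_sum, ← Finset.sum_add_distrib]
  refine Finset.sum_congr rfl fun k _ => Finset.sum_congr rfl fun l _ => ?_
  have : simpleForm n k l = simpleRingel n k l + simpleRingel n l k := by
    simp only [simpleRingel, simpleForm]
    split_ifs <;> omega
  rw [this]; ring

theorem halfNorm_eq (n i : ℕ) (hn : 2 ≤ n) (hi : i ≤ n) :
    halfNorm n i = if i = n then 1 else 2 := by
  rw [halfNorm, form_eq, ringel_eq n i i hn hi hi]
  simp only [ringelValue, simpleRingel, simpleForm]
  split_ifs <;> omega

theorem ringel_self (n i : ℕ) : ringel n i i = halfNorm n i := by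
  rw [halfNorm, form_eq]; omega

/-- The off-diagonal entries of the extended Cartan matrix. -/
theorem cartan_cases (n i j : ℕ) (hn : 2 ≤ n) (hi : i ≤ n) (hj : j ≤ n) (hij : i ≠ j) :
    ringel n i j + ringel n j i = halfNorm n i * cartan n i j ∧
      (cartan n i j = 0 ∨ cartan n i j = -1 ∨ (cartan n i j = -2 ∧ i = n)) := by
  -- The norm is `2` for the short root and `4` otherwise, so the division in `cartan` is by an
  -- explicit constant.
  have h1 : form n i i = 2 * (if i = n then 1 else 2) := by
    rw [form_eq, ringel_self n i, halfNorm_eq n i hn hi]; ring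
  rw [halfNorm_eq n i hn hi, cartan, h1, form_eq, ringel_eq n i j hn hi hj,
    ringel_eq n j i hn hj hi]
  simp only [ringelValue, simpleRingel, simpleForm]
  split_ifs <;> omega

/-! ## Quantum Serre relations of small degree -/

section Serre

variable {K : Type*} [Field K] {B : Type*} [Ring B] [Algebra K B]

/-- The quantum Serre expression of degree `m` with coefficients `κ`. -/
def serreSum (κ : ℕ → K) (m : ℕ) (x y : B) : B :=
  ∑ k ∈ Finset.range (m + 1), κ k • (x ^ (m - k) * y * x ^ k)

/-- The coefficients of a quantum Serre expression of degree `m ≤ 3` with parameters `q = q_{ii}`,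
`w = q_{ij}` and `w' = q_{ji}` satisfying `q ^ (m - 1) * w * w' = 1`. -/
def IsSerreCoeff (q w w' : K) (m : ℕ) (κ : ℕ → K) : Prop :=
  (m = 1 ∧ w * w' = 1 ∧ κ 0 = 1 ∧ κ 1 = -w) ∨
  (m = 2 ∧ q * (w * w') = 1 ∧ κ 0 = 1 ∧ κ 1 = -((1 + q) * w) ∧ κ 2 = q * w ^ 2) ∨
  (m = 3 ∧ q ^ 2 * (w * w') = 1 ∧ κ 0 = 1 ∧ κ 1 = -((1 + q + q ^ 2) * w) ∧
    κ 2 = q * (1 + q + q ^ 2) * w ^ 2 ∧ κ 3 = -(q ^ 3 * w ^ 3))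

/-- Quantum Serre expressions are additive on suitably `q`-commuting pairs. -/
theorem serreSum_add {q w w' : K} {m : ℕ} {κ : ℕ → K} (hκ : IsSerreCoeff q w w' m κ)
    {x₁ x₂ y₁ y₂ : B} (hx : x₂ * x₁ = q • (x₁ * x₂)) (hy : x₂ * y₁ = w • (y₁ * x₂))
    (hyx : y₂ * x₁ = w' • (x₁ * y₂)) :
    serreSum κ m (x₁ + x₂) (y₁ + y₂) = serreSum κ m x₁ y₁ + serreSum κ m x₂ y₂ := by
  -- These forms with a tail `b` let every letter of index `1` be moved to the left of every letter
  -- of index `2`. A word contains a single `y`, so no rule for `y₂ y₁` is needed. The coefficients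
  -- of the mixed words then vanish because `q ^ (m - 1) * w * w' = 1`.
  have hx' : ∀ b, x₂ * (x₁ * b) = q • (x₁ * (x₂ * b)) := fun b => by
    rw [← mul_assoc, hx, smul_mul_assoc, mul_assoc]
  have hy' : ∀ b, x₂ * (y₁ * b) = w • (y₁ * (x₂ * b)) := fun b => by
    rw [← mul_assoc, hy, smul_mul_assoc, mul_assoc]
  have hyx' : ∀ b, y₂ * (x₁ * b) = w' • (x₁ * (y₂ * b)) := fun b => by
    rw [← mul_assoc, hyx, smul_mul_assoc, mul_assoc]
  rcases hκ with ⟨rfl, hw, h0, h1⟩ | ⟨rfl, hw, h0, h1, h2⟩ | ⟨rfl, hw, h0, h1, h2, h3⟩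
  · obtain rfl : w' = w⁻¹ := eq_inv_of_mul_eq_one_right hw
    have hw0 : w ≠ 0 := by rintro rfl; simp at hw
    simp only [serreSum, Finset.sum_range_succ, Finset.sum_range_zero, h0, h1, pow_zero, pow_one,
      Nat.sub_self, Nat.sub_zero, mul_one, one_mul, mul_add, add_mul, hy, hyx, smul_add]
    match_scalars <;> field_simp <;> ring
  · have hw0 : w ≠ 0 := by rintro rfl; simp at hw
    have hq0 : q ≠ 0 := by rintro rfl; simp at hw
    obtain rfl : w' = (q * w)⁻¹ := eq_inv_of_mul_eq_one_right (by rw [mul_assoc, hw])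
    simp only [serreSum, Finset.sum_range_succ, Finset.sum_range_zero, h0, h1, h2, pow_zero,
      pow_one, pow_two, Nat.sub_self, Nat.sub_zero, Nat.reduceSub, Nat.reduceAdd,
      mul_one, one_mul, mul_add, add_mul, mul_assoc, hx, hy, hyx,
      hx', hy', hyx', smul_add, mul_smul_comm, smul_mul_assoc, smul_smul]
    match_scalars <;> field_simp <;> ring
  · have hw0 : w ≠ 0 := by rintro rfl; simp at hw
    have hq0 : q ≠ 0 := by rintro rfl; simp at hw
    obtain rfl : w' = (q ^ 2 * w)⁻¹ := eq_inv_of_mul_eq_one_right (by rw [mul_assoc, hw])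
    simp only [serreSum, Finset.sum_range_succ, Finset.sum_range_zero, h0, h1, h2, h3, pow_zero,
      pow_one, pow_succ, Nat.sub_self, Nat.sub_zero, Nat.reduceSub, Nat.reduceAdd,
      mul_one, one_mul, mul_add, add_mul, mul_assoc, hx, hy, hyx,
      hx', hy', hyx', smul_add, mul_smul_comm, smul_mul_assoc, smul_smul]
    match_scalars <;> field_simp <;> ring

end Serre

/-! ## Serre coefficients -/

/-- Nonzero parameters such that `r / s` is not a root of unity. -/
structure IsGeneric {K : Type*} [Field K] (r s : K) : Prop where
  left_ne_zero : r ≠ 0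
  right_ne_zero : s ≠ 0
  pow_ne (k : ℕ) (hk : 0 < k) : r ^ k ≠ s ^ k

section

variable {K : Type*} [Field K] {r s : K}

theorem IsGeneric.ne (h : IsGeneric r s) : r ≠ s := by simpa using h.pow_ne 1 one_pos

theorem IsGeneric.pow (h : IsGeneric r s) (m : ℕ) (hm : 0 < m) : IsGeneric (r ^ m) (s ^ m) where
  left_ne_zero := pow_ne_zero _ h.left_ne_zero
  right_ne_zero := pow_ne_zero _ h.right_ne_zero
  pow_ne k hk := by
    rw [← pow_mul, ← pow_mul]
    exact h.pow_ne _ (Nat.mul_pos hm hk)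

theorem IsGeneric.isGeneric_vertexParam (h : IsGeneric r s) (n i : ℕ) (hn : 2 ≤ n) (hi : i ≤ n) :
    IsGeneric (vertexParam r n i) (vertexParam s n i) := by
  simp only [vertexParam, halfNorm_eq n i hn hi]
  split_ifs
  · simpa using h
  · exact_mod_cast h.pow 2 two_pos

theorem IsGeneric.qInt_one (h : IsGeneric r s) : qInt r s 1 = 1 := by
  simp [qInt, sub_ne_zero.2 h.ne]

theorem IsGeneric.qInt_two (h : IsGeneric r s) : qInt r s 2 = r + s := by
  rw [qInt, div_eq_iff (sub_ne_zero.2 h.ne)]; ring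

theorem IsGeneric.qInt_three (h : IsGeneric r s) : qInt r s 3 = r ^ 2 + r * s + s ^ 2 := by
  rw [qInt, div_eq_iff (sub_ne_zero.2 h.ne)]; ring

theorem IsGeneric.qInt_two_ne_zero (h : IsGeneric r s) : r + s ≠ 0 := fun h0 =>
  h.pow_ne 2 two_pos (by linear_combination (r - s) * h0)

theorem Om_self (r s : K) (n i : ℕ) :
    Om r s n i i = vertexParam r n i / vertexParam s n i := by
  rw [Om, ringel_self, zpow_neg, vertexParam, vertexParam, div_eq_mul_inv]

theorem IsGeneric.Om_ne_zero (h : IsGeneric r s) (n i j : ℕ) : Om r s n i j ≠ 0 :=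
  mul_ne_zero (zpow_ne_zero _ h.left_ne_zero) (zpow_ne_zero _ h.right_ne_zero)

/-- The product of the two constants depends only on the symmetrized form, which is `d_i c_{ij}`.
With `Ω_ii = r_i / s_i` and `m = 1 - c_{ij}` this is the condition `q ^ (m - 1) * w * w' = 1` on
Serre coefficients. -/
theorem IsGeneric.Om_mul_Om (h : IsGeneric r s) (n i j : ℕ) (hn : 2 ≤ n) (hi : i ≤ n) (hj : j ≤ n)
    (hij : i ≠ j) :
    Om r s n j i * Om r s n i j = (vertexParam r n i / vertexParam s n i) ^ cartan n i j := by
  have hr := h.left_ne_zero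
  have hs := h.right_ne_zero
  rw [div_zpow, vertexParam, vertexParam, ← zpow_mul, ← zpow_mul,
    ← (cartan_cases n i j hn hi hj hij).1, Om, Om, zpow_add₀ hr, zpow_add₀ hs, zpow_neg, zpow_neg]
  field_simp

theorem IsGeneric.qFactorial_ne_zero (h : IsGeneric r s) (m : ℕ) : qFactorial r s m ≠ 0 :=
  Finset.prod_ne_zero_iff.2 fun t _ =>
    div_ne_zero (sub_ne_zero.2 (h.pow_ne _ t.succ_pos)) (sub_ne_zero.2 h.ne)

theorem IsGeneric.qBinomial_zero (h : IsGeneric r s) (m : ℕ) : qBinomial r s m 0 = 1 := by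
  have := h.qFactorial_ne_zero m
  rw [qBinomial, Nat.sub_zero, div_eq_one_iff_eq]
  · simp [qFactorial]
  · simpa [qFactorial] using this

theorem IsGeneric.qBinomial_self (h : IsGeneric r s) (m : ℕ) : qBinomial r s m m = 1 := by
  have := h.qFactorial_ne_zero m
  rw [qBinomial, Nat.sub_self, div_eq_one_iff_eq]
  · simp [qFactorial]
  · simpa [qFactorial] using this

theorem IsGeneric.qBinomial_one (h : IsGeneric r s) (m : ℕ) :
    qBinomial r s (m + 1) 1 = qInt r s (m + 1) := by
  have := h.qFactorial_ne_zero m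
  have h1 : qFactorial r s 1 = 1 := by simp [qFactorial, h.qInt_one]
  rw [qBinomial, h1, mul_one, Nat.add_sub_cancel, div_eq_iff this, qFactorial,
    Finset.prod_range_succ, mul_comm, qFactorial]

theorem IsGeneric.qBinomial_three_two (h : IsGeneric r s) :
    qBinomial r s 3 2 = qInt r s 3 := by
  rw [← h.qBinomial_one 2, qBinomial, qBinomial, mul_comm]

/-- The coefficients of the defining relations are quantum Serre coefficients. -/
theorem IsGeneric.isSerreCoeff (h : IsGeneric r s) (n i j : ℕ) (hn : 2 ≤ n) (hi : i ≤ n)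
    (hj : j ≤ n) (hij : i ≠ j) :
    IsSerreCoeff (Om r s n i i) (Om r s n j i) (Om r s n i j) (serreDegree n i j)
      (serreCoeff r s n i j) := by
  have hg := h.isGeneric_vertexParam n i hn hi
  have hw := h.Om_mul_Om n i j hn hi hj hij
  have hr := hg.left_ne_zero
  have hs := hg.right_ne_zero
  rw [Om_self, IsSerreCoeff]
  unfold serreCoeff serreDegree
  rcases (cartan_cases n i j hn hi hj hij).2 with hc | hc | ⟨hc, -⟩ <;> rw [hc] at hw ⊢
  · left
    simp [hg.qBinomial_zero, hg.qBinomial_self, hw]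
  · right; left
    rw [show (1 - (-1 : ℤ)).toNat = 2 from rfl, hw]
    refine ⟨rfl, by field_simp, ?_, ?_, ?_⟩
    · simp [hg.qBinomial_zero]
    · rw [hg.qBinomial_one, hg.qInt_two]
      simp
      field_simp
      ring
    · simp [hg.qBinomial_self]
      field_simp
  · right; right
    rw [show (1 - (-2 : ℤ)).toNat = 3 from rfl, hw]
    refine ⟨rfl, by field_simp, ?_, ?_, ?_, ?_⟩
    · simp [hg.qBinomial_zero]
    · rw [hg.qBinomial_one, hg.qInt_three]
      simp
      field_simp
      ring
    · rw [hg.qBinomial_three_two, hg.qInt_three]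
      simp
      field_simp
      ring
    · simp [hg.qBinomial_self]
      field_simp

end

/-! ## Families satisfying the defining relations -/

section Families

variable {K : Type*} [Field K] (r s : K) {n : ℕ} {A B : Type*} [Ring A] [Algebra K A] [Ring B]
  [Algebra K B]

/-- The family `x` satisfies the defining relations of `U'_{r,s}`. -/
def AffSat (x : Gen n → A) : Prop := ∀ p q, AffRel r s x p q → p = q

/-- The family `x` satisfies the defining relations of `U_{r,s}`. -/
def AffDegSat (x : Gen n ⊕ DegGen → A) : Prop := ∀ p q, AffDegRel r s x p q → p = q

variable {r s}

theorem map_thetaProd (φ : A →ₐ[K] B) (y : Fin (n + 1) → A) :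
    φ (thetaProd y) = thetaProd fun i => φ (y i) := by
  simp only [thetaProd, map_list_prod, List.map_map, Function.comp_def, map_pow]

theorem AffRel.map (φ : A →ₐ[K] B) {x : Gen n → A} {p q : A} (h : AffRel r s x p q) :
    AffRel r s (fun g => φ (x g)) (φ p) (φ q) := by
  cases h with
  | serre_e i j h =>
    simpa [map_sum, map_smul, map_mul, map_pow] using
      AffRel.serre_e (r := r) (s := s) (x := fun g => φ (x g)) i j h
  | serre_f i j h =>
    simpa [map_sum, map_smul, map_mul, map_pow] using
      AffRel.serre_f (r := r) (s := s) (x := fun g => φ (x g)) i j h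
  | _ =>
    simp only [map_mul, map_one, map_sub, map_smul, map_zero, map_thetaProd]
    constructor <;> assumption

theorem AffDegRel.map (φ : A →ₐ[K] B) {x : Gen n ⊕ DegGen → A} {p q : A}
    (h : AffDegRel r s x p q) : AffDegRel r s (fun g => φ (x g)) (φ p) (φ q) := by
  cases h with
  | base h => exact .base (h.map φ)
  | D_e i => simpa only [map_mul, map_smul] using AffDegRel.D_e (x := fun g => φ (x g)) i
  | D_f i => simpa only [map_mul, map_smul] using AffDegRel.D_f (x := fun g => φ (x g)) i
  | Dp_e i => simpa only [map_mul, map_smul] using AffDegRel.Dp_e (x := fun g => φ (x g)) i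
  | Dp_f i => simpa only [map_mul, map_smul] using AffDegRel.Dp_f (x := fun g => φ (x g)) i
  | _ =>
    simp only [map_mul, map_one]
    first
    | exact .D_inv | exact .D_inv' | exact .Dp_inv | exact .Dp_inv' | exact .D_Dp
    | exact .D_om _ | exact .D_omp _ | exact .Dp_om _ | exact .Dp_omp _

/-- The constructors are the same noncommutative polynomials for every family, so each relation
among the images is the image of the relation of the same name. This direction shows that the
generators of the quotient algebra satisfy the relations. -/
theorem AffRel.lift (φ : A →ₐ[K] B) {x : Gen n → A} {p q : B}
    (h : AffRel r s (fun g => φ (x g)) p q) :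
    ∃ p' q', AffRel r s x p' q' ∧ φ p' = p ∧ φ q' = q := by
  cases h with
  | ga_eq => exact ⟨_, _, .ga_eq, by simp [map_thetaProd]⟩
  | gap_eq => exact ⟨_, _, .gap_eq, by simp [map_thetaProd]⟩
  | ga_central g => exact ⟨_, _, .ga_central g, by simp⟩
  | gap_central g => exact ⟨_, _, .gap_central g, by simp⟩
  | ga_inv => exact ⟨_, _, .ga_inv, by simp⟩
  | ga_inv' => exact ⟨_, _, .ga_inv', by simp⟩
  | gap_inv => exact ⟨_, _, .gap_inv, by simp⟩
  | gap_inv' => exact ⟨_, _, .gap_inv', by simp⟩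
  | om_om i j => exact ⟨_, _, .om_om i j, by simp⟩
  | om_omp i j => exact ⟨_, _, .om_omp i j, by simp⟩
  | omp_omp i j => exact ⟨_, _, .omp_omp i j, by simp⟩
  | om_inv i => exact ⟨_, _, .om_inv i, by simp⟩
  | om_inv' i => exact ⟨_, _, .om_inv' i, by simp⟩
  | omp_inv i => exact ⟨_, _, .omp_inv i, by simp⟩
  | omp_inv' i => exact ⟨_, _, .omp_inv' i, by simp⟩
  | om_e i j => exact ⟨_, _, .om_e i j, by simp⟩
  | om_f i j => exact ⟨_, _, .om_f i j, by simp⟩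
  | omp_e i j => exact ⟨_, _, .omp_e i j, by simp⟩
  | omp_f i j => exact ⟨_, _, .omp_f i j, by simp⟩
  | e_f i => exact ⟨_, _, .e_f i, by simp⟩
  | e_f_ne i j h => exact ⟨_, _, .e_f_ne i j h, by simp⟩
  | serre_e i j h => exact ⟨_, _, .serre_e i j h, by simp⟩
  | serre_f i j h => exact ⟨_, _, .serre_f i j h, by simp⟩

theorem AffDegRel.lift (φ : A →ₐ[K] B) {x : Gen n ⊕ DegGen → A} {p q : B}
    (h : AffDegRel r s (fun g => φ (x g)) p q) :
    ∃ p' q', AffDegRel r s x p' q' ∧ φ p' = p ∧ φ q' = q := by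
  cases h with
  | base h =>
    obtain ⟨p', q', h, e⟩ := h.lift φ (x := fun g => x (.inl g))
    exact ⟨p', q', .base h, e⟩
  | D_inv => exact ⟨_, _, .D_inv, by simp⟩
  | D_inv' => exact ⟨_, _, .D_inv', by simp⟩
  | Dp_inv => exact ⟨_, _, .Dp_inv, by simp⟩
  | Dp_inv' => exact ⟨_, _, .Dp_inv', by simp⟩
  | D_Dp => exact ⟨_, _, .D_Dp, by simp⟩
  | D_om i => exact ⟨_, _, .D_om i, by simp⟩
  | D_omp i => exact ⟨_, _, .D_omp i, by simp⟩
  | Dp_om i => exact ⟨_, _, .Dp_om i, by simp⟩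
  | Dp_omp i => exact ⟨_, _, .Dp_omp i, by simp⟩
  | D_e i => exact ⟨_, _, .D_e i, by simp only [map_mul, map_smul, and_self]⟩
  | D_f i => exact ⟨_, _, .D_f i, by simp only [map_mul, map_smul, and_self]⟩
  | Dp_e i => exact ⟨_, _, .Dp_e i, by simp only [map_mul, map_smul, and_self]⟩
  | Dp_f i => exact ⟨_, _, .Dp_f i, by simp only [map_mul, map_smul, and_self]⟩

theorem AffSat.map {x : Gen n → A} (h : AffSat r s x) (φ : A →ₐ[K] B) :
    AffSat r s fun g => φ (x g) := by
  intro p q hpq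
  obtain ⟨p', q', h', rfl, rfl⟩ := hpq.lift φ
  rw [h _ _ h']

variable (r s n) in
theorem UPrime.affSat : AffSat r s (UPrime.gen r s n) := by
  intro p q hpq
  obtain ⟨p', q', h, rfl, rfl⟩ := AffRel.lift (RingQuot.mkAlgHom K _) hpq
  exact RingQuot.mkAlgHom_rel K h

variable (r s n) in
theorem UAff.affDegSat : AffDegSat r s (UAff.gen r s n) := by
  intro p q hpq
  obtain ⟨p', q', h, rfl, rfl⟩ := AffDegRel.lift (RingQuot.mkAlgHom K _) hpq
  exact RingQuot.mkAlgHom_rel K h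

theorem UPrime.exists_hom {x : Gen n → A} (hx : AffSat r s x) :
    ∃ φ : UPrime r s n →ₐ[K] A, ∀ g, φ (UPrime.gen r s n g) = x g := by
  refine ⟨RingQuot.liftAlgHom K ⟨FreeAlgebra.lift K x, fun p q h => hx _ _ ?_⟩, fun g => ?_⟩
  · simpa using h.map (FreeAlgebra.lift K x)
  · rw [UPrime.gen, RingQuot.liftAlgHom_mkAlgHom_apply, FreeAlgebra.lift_ι_apply]

theorem UAff.exists_hom {x : Gen n ⊕ DegGen → A} (hx : AffDegSat r s x) :
    ∃ φ : UAff r s n →ₐ[K] A, ∀ g, φ (UAff.gen r s n g) = x g := by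
  refine ⟨RingQuot.liftAlgHom K ⟨FreeAlgebra.lift K x, fun p q h => hx _ _ ?_⟩, fun g => ?_⟩
  · simpa using h.map (FreeAlgebra.lift K x)
  · rw [UAff.gen, RingQuot.liftAlgHom_mkAlgHom_apply, FreeAlgebra.lift_ι_apply]

/-- A subalgebra containing the generators of `U'_{r,s}` is everything. -/
theorem UPrime.mem_of_gen_mem (S : Subalgebra K (UPrime r s n))
    (h : ∀ g, UPrime.gen r s n g ∈ S) (x : UPrime r s n) : x ∈ S := by
  obtain ⟨y, rfl⟩ := RingQuot.mkAlgHom_surjective K _ x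
  induction y using FreeAlgebra.induction with
  | grade0 c => rw [AlgHom.commutes]; exact S.algebraMap_mem c
  | grade1 g => exact h g
  | mul a b ha hb => rw [map_mul]; exact S.mul_mem ha hb
  | add a b ha hb => rw [map_add]; exact S.add_mem ha hb

/-- A subalgebra containing the generators of `U_{r,s}` is everything. -/
theorem UAff.mem_of_gen_mem (S : Subalgebra K (UAff r s n))
    (h : ∀ g, UAff.gen r s n g ∈ S) (x : UAff r s n) : x ∈ S := by
  obtain ⟨y, rfl⟩ := RingQuot.mkAlgHom_surjective K _ x
  induction y using FreeAlgebra.induction with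
  | grade0 c => rw [AlgHom.commutes]; exact S.algebraMap_mem c
  | grade1 g => exact h g
  | mul a b ha hb => rw [map_mul]; exact S.mul_mem ha hb
  | add a b ha hb => rw [map_add]; exact S.add_mem ha hb

end Families

/-! ## The coproduct -/

section Coproduct

variable {K : Type*} [Field K] {r s : K} {n : ℕ} {A : Type*} [Ring A] [Algebra K A]

/-- The values of the coproduct on a family of generators. -/
def coprodGen (x : Gen n → A) : Gen n → A ⊗[K] A
  | .e i => x (.e i) ⊗ₜ 1 + x (.om i) ⊗ₜ x (.e i)
  | .f i => 1 ⊗ₜ x (.f i) + x (.f i) ⊗ₜ x (.omp i)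
  | g => x g ⊗ₜ x g

/-- The values of the coproduct on a family of generators, including degree generators. -/
def coprodDegGen (x : Gen n ⊕ DegGen → A) : Gen n ⊕ DegGen → A ⊗[K] A
  | .inl g => coprodGen (K := K) (fun g => x (.inl g)) g
  | .inr d => x (.inr d) ⊗ₜ x (.inr d)

theorem thetaProd_tmul (y : Fin (n + 1) → A) :
    thetaProd (fun i => y i ⊗ₜ[K] y i) = thetaProd y ⊗ₜ[K] thetaProd y := by
  unfold thetaProd
  induction List.finRange n with
  | nil => rfl
  | cons k l ih =>
    rw [List.map_cons, List.prod_cons, ih, List.map_cons, List.prod_cons,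
      Algebra.TensorProduct.tmul_pow, Algebra.TensorProduct.tmul_mul_tmul]

theorem serreSum_tmul_one (κ : ℕ → K) (m : ℕ) (x y : A) :
    serreSum κ m (x ⊗ₜ[K] (1 : A)) (y ⊗ₜ[K] (1 : A)) = serreSum κ m x y ⊗ₜ[K] (1 : A) := by
  simp [serreSum, TensorProduct.sum_tmul, TensorProduct.smul_tmul', Algebra.TensorProduct.tmul_pow]

/-- Since `a` and `b` commute, `a ^ (m - k) * b * a ^ k` does not depend on `k` and factors out of
the sum. It is applied to the group-like first factors `ω_i`, `ω_j`. -/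
theorem serreSum_tmul_of_commute (κ : ℕ → K) (m : ℕ) {a b : A} (h : Commute a b) (x y : A) :
    serreSum κ m (a ⊗ₜ[K] x) (b ⊗ₜ[K] y) = (a ^ m * b) ⊗ₜ[K] serreSum κ m x y := by
  simp only [serreSum, TensorProduct.tmul_sum, Algebra.TensorProduct.tmul_pow,
    Algebra.TensorProduct.tmul_mul_tmul, TensorProduct.tmul_smul]
  refine Finset.sum_congr rfl fun k hk => ?_
  rw [mul_assoc, ← (h.pow_left k).eq, ← mul_assoc, ← pow_add,
    Nat.sub_add_cancel (Nat.lt_succ_iff.1 (Finset.mem_range.1 hk))]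

theorem serreSum_tmul_of_commute' {B : Type*} [Ring B] [Algebra K B] (κ : ℕ → K)
    (m : ℕ) {a b : B} (h : Commute a b) (x y : A) :
    serreSum κ m (x ⊗ₜ[K] a) (y ⊗ₜ[K] b) = serreSum κ m x y ⊗ₜ[K] (a ^ m * b) := by
  simp only [serreSum, TensorProduct.sum_tmul, Algebra.TensorProduct.tmul_pow,
    Algebra.TensorProduct.tmul_mul_tmul, ← TensorProduct.smul_tmul']
  refine Finset.sum_congr rfl fun k hk => ?_
  rw [mul_assoc _ b, ← (h.pow_left k).eq, ← mul_assoc (a ^ _), ← pow_add,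
    Nat.sub_add_cancel (Nat.lt_succ_iff.1 (Finset.mem_range.1 hk))]

/-- The quantum Serre expression in the opposite algebra. -/
def serreSumOp (κ : ℕ → K) (m : ℕ) (x y : A) : A :=
  ∑ k ∈ Finset.range (m + 1), κ k • (x ^ k * y * x ^ (m - k))

theorem op_serreSumOp (κ : ℕ → K) (m : ℕ) (x y : A) :
    MulOpposite.op (serreSumOp κ m x y) =
      serreSum κ m (MulOpposite.op x) (MulOpposite.op y) := by
  simp only [serreSumOp, serreSum, Finset.op_sum, MulOpposite.op_smul, MulOpposite.op_mul,
    MulOpposite.op_pow, mul_assoc]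

theorem serreSumOp_one_tmul (κ : ℕ → K) (m : ℕ) (x y : A) :
    serreSumOp κ m ((1 : A) ⊗ₜ[K] x) ((1 : A) ⊗ₜ[K] y) = (1 : A) ⊗ₜ[K] serreSumOp κ m x y := by
  simp [serreSumOp, TensorProduct.tmul_sum, Algebra.TensorProduct.tmul_pow]

theorem serreSumOp_tmul_of_commute {B : Type*} [Ring B] [Algebra K B] (κ : ℕ → K)
    (m : ℕ) {a b : B} (h : Commute a b) (x y : A) :
    serreSumOp κ m (x ⊗ₜ[K] a) (y ⊗ₜ[K] b) = serreSumOp κ m x y ⊗ₜ[K] (a ^ m * b) := by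
  simp only [serreSumOp, TensorProduct.sum_tmul, Algebra.TensorProduct.tmul_pow,
    Algebra.TensorProduct.tmul_mul_tmul, ← TensorProduct.smul_tmul']
  refine Finset.sum_congr rfl fun k hk => ?_
  rw [mul_assoc _ b, ← (h.pow_left (m - k)).eq, ← mul_assoc (a ^ _), ← pow_add,
    Nat.add_sub_cancel' (Nat.lt_succ_iff.1 (Finset.mem_range.1 hk))]

/-- Quantum Serre expressions in the opposite algebra are additive on suitably `q`-commuting
pairs. -/
theorem serreSumOp_add {q w w' : K} {m : ℕ} {κ : ℕ → K} (hκ : IsSerreCoeff q w w' m κ)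
    {x₁ x₂ y₁ y₂ : A} (hx : x₁ * x₂ = q • (x₂ * x₁)) (hy : y₁ * x₂ = w • (x₂ * y₁))
    (hyx : x₁ * y₂ = w' • (y₂ * x₁)) :
    serreSumOp κ m (x₂ + x₁) (y₂ + y₁) = serreSumOp κ m x₂ y₂ + serreSumOp κ m x₁ y₁ := by
  rw [add_comm, add_comm y₂, add_comm (serreSumOp κ m x₂ y₂)]
  apply MulOpposite.op_injective
  simp only [op_serreSumOp, MulOpposite.op_add]
  refine serreSum_add hκ ?_ ?_ ?_
  · rw [← MulOpposite.op_mul, hx]; simp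
  · rw [← MulOpposite.op_mul, hy]; simp
  · rw [← MulOpposite.op_mul, hyx]; simp

/-- In `[Δ(e_i), Δ(f_j)]` the mixed terms cancel because moving `ω_i` past `f_j` and moving `ω'_j`
past `e_i` produce the same scalar `Ω_ji⁻¹`; what remains is `[e_i, f_j] ⊗ ω'_j + ω_i ⊗ [e_i, f_j]`.
The Serre relations come from the additivity of Serre expressions. -/
theorem AffSat.coprodGen (hg : IsGeneric r s) (hn : 2 ≤ n) {x : Gen n → A} (h : AffSat r s x) :
    AffSat r s (coprodGen (K := K) x) := by
  have om_e (i j) := h _ _ (.om_e i j)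
  have om_f (i j) := h _ _ (.om_f i j)
  have omp_e (i j) := h _ _ (.omp_e i j)
  have omp_f (i j) := h _ _ (.omp_f i j)
  have om_om (i j) := h _ _ (.om_om i j)
  have om_omp (i j) := h _ _ (.om_omp i j)
  have omp_omp (i j) := h _ _ (.omp_omp i j)
  have ga_c (g) := h _ _ (.ga_central g)
  have gap_c (g) := h _ _ (.gap_central g)
  intro p q hpq
  cases hpq with
  | ga_eq =>
    simp only [BnAffine.coprodGen]
    rw [thetaProd_tmul, Algebra.TensorProduct.tmul_mul_tmul, ← h _ _ .ga_eq]
  | gap_eq =>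
    simp only [BnAffine.coprodGen]
    rw [thetaProd_tmul, Algebra.TensorProduct.tmul_mul_tmul, ← h _ _ .gap_eq]
  | ga_central g =>
    cases g <;> simp only [BnAffine.coprodGen, mul_add, add_mul,
      Algebra.TensorProduct.tmul_mul_tmul, ga_c, mul_one, one_mul]
  | gap_central g =>
    cases g <;> simp only [BnAffine.coprodGen, mul_add, add_mul,
      Algebra.TensorProduct.tmul_mul_tmul, gap_c, mul_one, one_mul]
  | ga_inv => simp [BnAffine.coprodGen, h _ _ .ga_inv, Algebra.TensorProduct.one_def]
  | ga_inv' => simp [BnAffine.coprodGen, h _ _ .ga_inv', Algebra.TensorProduct.one_def]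
  | gap_inv => simp [BnAffine.coprodGen, h _ _ .gap_inv, Algebra.TensorProduct.one_def]
  | gap_inv' => simp [BnAffine.coprodGen, h _ _ .gap_inv', Algebra.TensorProduct.one_def]
  | om_om i j => simp [BnAffine.coprodGen, om_om i j]
  | om_omp i j => simp [BnAffine.coprodGen, om_omp i j]
  | omp_omp i j => simp [BnAffine.coprodGen, omp_omp i j]
  | om_inv i => simp [BnAffine.coprodGen, h _ _ (.om_inv i), Algebra.TensorProduct.one_def]
  | om_inv' i => simp [BnAffine.coprodGen, h _ _ (.om_inv' i), Algebra.TensorProduct.one_def]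
  | omp_inv i => simp [BnAffine.coprodGen, h _ _ (.omp_inv i), Algebra.TensorProduct.one_def]
  | omp_inv' i => simp [BnAffine.coprodGen, h _ _ (.omp_inv' i), Algebra.TensorProduct.one_def]
  | om_e i j =>
    simp only [BnAffine.coprodGen, mul_add, add_mul, Algebra.TensorProduct.tmul_mul_tmul, om_e,
      om_om i j, mul_one, one_mul, TensorProduct.tmul_smul, ← TensorProduct.smul_tmul', smul_add]
  | om_f i j =>
    simp only [BnAffine.coprodGen, mul_add, add_mul, Algebra.TensorProduct.tmul_mul_tmul, om_f,
      om_omp i j, mul_one, one_mul, TensorProduct.tmul_smul, ← TensorProduct.smul_tmul', smul_add]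
  | omp_e i j =>
    simp only [BnAffine.coprodGen, mul_add, add_mul, Algebra.TensorProduct.tmul_mul_tmul, omp_e,
      om_omp j i, mul_one, one_mul, TensorProduct.tmul_smul, ← TensorProduct.smul_tmul', smul_add]
  | omp_f i j =>
    simp only [BnAffine.coprodGen, mul_add, add_mul, Algebra.TensorProduct.tmul_mul_tmul, omp_f,
      omp_omp i j, mul_one, one_mul, TensorProduct.tmul_smul, ← TensorProduct.smul_tmul', smul_add]
  | e_f i =>
    have key := h _ _ (.e_f i)
    rw [sub_eq_iff_eq_add] at key
    simp only [BnAffine.coprodGen, mul_add, add_mul, Algebra.TensorProduct.tmul_mul_tmul, mul_one,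
      one_mul, key, om_f, omp_e, TensorProduct.tmul_smul, ← TensorProduct.smul_tmul',
      TensorProduct.add_tmul, TensorProduct.tmul_add, TensorProduct.sub_tmul,
      TensorProduct.tmul_sub, smul_sub]
    abel
  | e_f_ne i j hij =>
    have key := h _ _ (.e_f_ne i j hij)
    rw [sub_eq_zero] at key
    simp only [BnAffine.coprodGen, mul_add, add_mul, Algebra.TensorProduct.tmul_mul_tmul, mul_one,
      one_mul, key, om_f, omp_e, TensorProduct.tmul_smul, ← TensorProduct.smul_tmul']
    abel
  | serre_e i j hij =>
    have hκ := hg.isSerreCoeff n i j hn (by omega) (by omega) (by omega)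
    have key : serreSum (serreCoeff r s n i j) (serreDegree n i j) (x (.e i)) (x (.e j)) = 0 :=
      h _ _ (.serre_e i j hij)
    change serreSum _ _ (_ + _) (_ + _) = 0
    -- Here `x₁ = e_i ⊗ 1`, `x₂ = ω_i ⊗ e_i`, and likewise for `j`; the commutation scalars are
    -- `Ω_ii`, `Ω_ji` and `Ω_ij`.
    rw [serreSum_add hκ, serreSum_tmul_one, serreSum_tmul_of_commute _ _ (om_om i j), key,
      TensorProduct.zero_tmul, TensorProduct.tmul_zero, add_zero]
    all_goals simp [om_e, TensorProduct.smul_tmul']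
  | serre_f i j hij =>
    have hκ := hg.isSerreCoeff n i j hn (by omega) (by omega) (by omega)
    have key : serreSumOp (serreCoeff r s n i j) (serreDegree n i j) (x (.f i)) (x (.f j)) = 0 :=
      h _ _ (.serre_f i j hij)
    change serreSumOp _ _ (_ + _) (_ + _) = 0
    rw [serreSumOp_add hκ, serreSumOp_one_tmul,
      serreSumOp_tmul_of_commute _ _ (omp_omp i j), key,
      TensorProduct.zero_tmul, TensorProduct.tmul_zero, add_zero]
    all_goals simp [omp_f, TensorProduct.smul_tmul']

theorem AffDegSat.inl {x : Gen n ⊕ DegGen → A} (h : AffDegSat r s x) :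
    AffSat r s fun g => x (.inl g) := fun _ _ hpq => h _ _ (.base hpq)

theorem AffDegSat.coprodDegGen (hg : IsGeneric r s) (hn : 2 ≤ n) {x : Gen n ⊕ DegGen → A}
    (h : AffDegSat r s x) : AffDegSat r s (coprodDegGen (K := K) x) := by
  intro p q hpq
  cases hpq with
  | base hpq => exact h.inl.coprodGen hg hn _ _ hpq
  | D_inv => simp [BnAffine.coprodDegGen, h _ _ .D_inv, Algebra.TensorProduct.one_def]
  | D_inv' => simp [BnAffine.coprodDegGen, h _ _ .D_inv', Algebra.TensorProduct.one_def]
  | Dp_inv => simp [BnAffine.coprodDegGen, h _ _ .Dp_inv, Algebra.TensorProduct.one_def]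
  | Dp_inv' => simp [BnAffine.coprodDegGen, h _ _ .Dp_inv', Algebra.TensorProduct.one_def]
  | D_Dp => simp [BnAffine.coprodDegGen, h _ _ .D_Dp]
  | D_om i => simp [BnAffine.coprodDegGen, BnAffine.coprodGen, h _ _ (.D_om i)]
  | D_omp i => simp [BnAffine.coprodDegGen, BnAffine.coprodGen, h _ _ (.D_omp i)]
  | Dp_om i => simp [BnAffine.coprodDegGen, BnAffine.coprodGen, h _ _ (.Dp_om i)]
  | Dp_omp i => simp [BnAffine.coprodDegGen, BnAffine.coprodGen, h _ _ (.Dp_omp i)]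
  | D_e i =>
    simp only [BnAffine.coprodDegGen, BnAffine.coprodGen, mul_add, add_mul,
      Algebra.TensorProduct.tmul_mul_tmul, h _ _ (.D_e i), h _ _ (.D_om i), mul_one,
      h _ _ .D_inv, mul_assoc (x (.inl (.om i))), smul_add, TensorProduct.tmul_smul,
      ← TensorProduct.smul_tmul']
  | D_f i =>
    simp only [BnAffine.coprodDegGen, BnAffine.coprodGen, mul_add, add_mul,
      Algebra.TensorProduct.tmul_mul_tmul, h _ _ (.D_f i), h _ _ (.D_omp i), mul_one,
      h _ _ .D_inv, mul_assoc (x (.inl (.omp i))), smul_add, TensorProduct.tmul_smul,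
      ← TensorProduct.smul_tmul']
  | Dp_e i =>
    simp only [BnAffine.coprodDegGen, BnAffine.coprodGen, mul_add, add_mul,
      Algebra.TensorProduct.tmul_mul_tmul, h _ _ (.Dp_e i), h _ _ (.Dp_om i), mul_one,
      h _ _ .Dp_inv, mul_assoc (x (.inl (.om i))), smul_add, TensorProduct.tmul_smul,
      ← TensorProduct.smul_tmul']
  | Dp_f i =>
    simp only [BnAffine.coprodDegGen, BnAffine.coprodGen, mul_add, add_mul,
      Algebra.TensorProduct.tmul_mul_tmul, h _ _ (.Dp_f i), h _ _ (.Dp_omp i), mul_one,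
      h _ _ .Dp_inv, mul_assoc (x (.inl (.omp i))), smul_add, TensorProduct.tmul_smul,
      ← TensorProduct.smul_tmul']

theorem isCoproductOn_iff (x : Gen n → A) (Δ : A →ₐ[K] A ⊗[K] A) :
    IsCoproductOn x Δ ↔ ∀ g, Δ (x g) = coprodGen x g := by
  constructor
  · intro h g
    cases g
    exacts [h.e _, h.f _, h.om _, h.omInv _, h.omp _, h.ompInv _, h.ga, h.gaInv, h.gap, h.gapInv]
  · intro h
    exact ⟨fun i => h _, fun i => h _, fun i => h _, fun i => h _, fun i => h _, fun i => h _,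
      h _, h _, h _, h _⟩

theorem UPrime.exists_coproduct (hg : IsGeneric r s) (hn : 2 ≤ n) :
    ∃ Δ : UPrime r s n →ₐ[K] UPrime r s n ⊗[K] UPrime r s n, UPrime.IsCoproduct r s Δ := by
  obtain ⟨Δ, hΔ⟩ := UPrime.exists_hom ((UPrime.affSat r s n).coprodGen hg hn)
  exact ⟨Δ, (isCoproductOn_iff _ _).2 hΔ⟩

theorem UAff.exists_coproduct (hg : IsGeneric r s) (hn : 2 ≤ n) :
    ∃ Δ : UAff r s n →ₐ[K] UAff r s n ⊗[K] UAff r s n, UAff.IsCoproduct r s Δ := by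
  obtain ⟨Δ, hΔ⟩ := UAff.exists_hom ((UAff.affDegSat r s n).coprodDegGen hg hn)
  exact ⟨Δ, (isCoproductOn_iff _ _).2 fun g => hΔ (.inl g), fun d => hΔ (.inr d)⟩

end Coproduct

/-! ## Weights of the vector representation -/

/-- The exponent of `r` in the eigenvalue `omWeight r s n i k`. -/
def omExp (n i k : ℕ) : ℤ :=
  if i = 0 then
    if k = 1 then 0 else if k = 2 then -2 else if k = inv n 2 then 2 else if k = inv n 1 then 0
    else if k = n + 1 then 0 else if k ≤ n then -2 else 2
  else if i < n then
    if k = i then 2 else if k = inv n i then -2 else 0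
  else
    if k = n then 1 else if k = n + 1 then 0 else if k = inv n n then -1
    else if k < n then -1 else 1

/-- The exponent of `s` in the eigenvalue `omWeight r s n i k`. -/
def omExp' (n i k : ℕ) : ℤ :=
  if i = 0 then
    if k = 1 then 2 else if k = 2 then 0 else if k = inv n 2 then 0 else if k = inv n 1 then -2
    else if k = n + 1 then 0 else if k ≤ n then -2 else 2
  else if i < n then
    if k = i + 1 then 2 else if k = inv n (i + 1) then -2 else 0
  else
    if k = n then -1 else if k = n + 1 then 0 else if k = inv n n then 1
    else if k < n then -1 else 1

/-- The index `p` such that `e_i` is a combination of `E_{pq}` and `E_{q'p'}`. -/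
def rowIdx (n i : ℕ) : ℕ := if i = 0 then inv n 1 else i

/-- The index `q` such that `e_i` is a combination of `E_{pq}` and `E_{q'p'}`. -/
def colIdx (i : ℕ) : ℕ := if i = 0 then 2 else i + 1

variable {K : Type*} [Field K] {r s : K}

theorem omWeight_eq (r s : K) (n i k : ℕ) (hn : 2 ≤ n) :
    omWeight r s n i k = r ^ omExp n i k * s ^ omExp' n i k := by
  unfold omWeight omExp omExp' inv
  split_ifs <;> first | omega | simp

theorem omExp_inv (n i k : ℕ) (hn : 2 ≤ n) (hi : i ≤ n) (hk : 1 ≤ k) (hkn : k ≤ 2 * n + 1) :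
    omExp n i (inv n k) = - omExp n i k ∧ omExp' n i (inv n k) = - omExp' n i k := by
  unfold omExp omExp' inv
  rcases Nat.eq_zero_or_pos i with rfl | hi0
  · obtain h | h | h | h | h | h | h : k = 1 ∨ k = 2 ∨ k = 2 * n + 2 - 2 ∨ k = 2 * n + 2 - 1 ∨
      k = n + 1 ∨ (3 ≤ k ∧ k ≤ n) ∨ (n + 2 ≤ k ∧ k ≤ 2 * n - 1) := by omega
    all_goals
      simp (disch := omega) only [if_pos, if_neg]
      norm_num
  rcases hi.lt_or_eq with hin | rfl
  · simp only [hi0.ne', if_false, hin, if_true]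
    constructor <;> split_ifs <;> omega
  · simp only [hi0.ne', if_false, lt_irrefl]
    constructor <;> split_ifs <;> omega

/-- `e_j` sends `v_q` to a multiple of `v_p`, where `p = rowIdx n j` and `q = colIdx j`, so the
weights of `v_p` and `v_q` differ by the root of vertex `j`. This is `ω_i e_j = Ω_ji e_j ω_i` on the
level of exponents; the other matrix unit `E_{q'p'}` is covered by `omExp_inv`. -/
theorem omExp_rowIdx (n i j : ℕ) (hn : 2 ≤ n) (hi : i ≤ n) (hj : j ≤ n) :
    omExp n i (rowIdx n j) = ringelValue n j i + omExp n i (colIdx j) ∧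
    omExp' n i (rowIdx n j) = -ringelValue n i j + omExp' n i (colIdx j) := by
  unfold omExp omExp' rowIdx colIdx ringelValue simpleRingel simpleForm inv
  rcases Nat.eq_zero_or_pos i with rfl | hi0 <;> rcases Nat.eq_zero_or_pos j with rfl | hj0
  · simp (disch := omega) only [if_pos, if_neg]; norm_num
  · obtain h | h | h | h | h | h : (j = 1 ∧ n = 2) ∨ (j = 2 ∧ n = 2) ∨ (j = 1 ∧ 3 ≤ n) ∨
      (j = 2 ∧ 3 ≤ n) ∨ (3 ≤ j ∧ j < n) ∨ (j = n ∧ 3 ≤ n) := by omega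
    all_goals
      simp (disch := omega) only [if_pos, if_neg]
      norm_num
  · simp only [if_true, hi0.ne', if_false]
    rcases hi.lt_or_eq with hin | rfl
    · simp only [hin, hin.ne, if_true, if_false]
      constructor <;> split_ifs <;> omega
    · simp only [lt_irrefl, if_true, if_false]
      constructor <;> split_ifs <;> omega
  · simp only [hi0.ne', hj0.ne', if_false]
    rcases hi.lt_or_eq with hin | rfl
    · simp only [hin, hin.ne, if_true, if_false]
      constructor <;> split_ifs <;> omega
    · obtain h | h | h : j + 1 < i ∨ j + 1 = i ∨ j = i := by omega
      all_goals
        simp (disch := omega) only [if_pos, if_neg]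
        norm_num

theorem vertexParam_eq (r : K) (n i : ℕ) (hn : 2 ≤ n) (hi : i ≤ n) :
    vertexParam r n i = if i = n then r else r ^ 2 := by
  rw [vertexParam, halfNorm_eq n i hn hi]
  split_ifs
  · simp
  · norm_cast

theorem Om_swap (r s : K) (n i j : ℕ) : Om s r n j i = (Om r s n i j)⁻¹ := by
  rw [Om, Om, mul_inv, zpow_neg, zpow_neg, inv_inv, mul_comm]

theorem IsGeneric.symm (h : IsGeneric r s) : IsGeneric s r :=
  ⟨h.right_ne_zero, h.left_ne_zero, fun k hk => (h.pow_ne k hk).symm⟩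

theorem IsGeneric.omWeight_ne_zero (h : IsGeneric r s) (n i k : ℕ) (hn : 2 ≤ n) :
    omWeight r s n i k ≠ 0 := by
  rw [omWeight_eq _ _ _ _ _ hn]
  exact mul_ne_zero (zpow_ne_zero _ h.left_ne_zero) (zpow_ne_zero _ h.right_ne_zero)

theorem omWeight_inv (r s : K) (n i k : ℕ) (hn : 2 ≤ n) (hi : i ≤ n)
    (hk : 1 ≤ k) (hkn : k ≤ 2 * n + 1) : omWeight r s n i (inv n k) = (omWeight r s n i k)⁻¹ := by
  rw [omWeight_eq _ _ _ _ _ hn, omWeight_eq _ _ _ _ _ hn, (omExp_inv n i k hn hi hk hkn).1,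
    (omExp_inv n i k hn hi hk hkn).2, mul_inv, zpow_neg, zpow_neg]

theorem IsGeneric.omWeight_rowIdx (h : IsGeneric r s) (n i j : ℕ) (hn : 2 ≤ n) (hi : i ≤ n)
    (hj : j ≤ n) :
    omWeight r s n i (rowIdx n j) = Om r s n j i * omWeight r s n i (colIdx j) := by
  have hr := h.left_ne_zero
  have hs := h.right_ne_zero
  rw [omWeight_eq _ _ _ _ _ hn, omWeight_eq _ _ _ _ _ hn, (omExp_rowIdx n i j hn hi hj).1,
    (omExp_rowIdx n i j hn hi hj).2, Om, ringel_eq n j i hn hj hi, ringel_eq n i j hn hi hj,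
    zpow_add₀ hr, zpow_add₀ hs]
  ring

/-- The partial sums of the exponents over the vertices `1, …, j` with the marks of `θ`. -/
theorem sum_omExp (n j m : ℕ) (hn : 2 ≤ n) (hj : j + 1 ≤ n) (hm : 1 ≤ m) (hmn : m ≤ 2 * n + 1) :
    (∑ k ∈ Finset.range j, (if k = 0 then 1 else 2) * omExp n (k + 1) m =
      if m ≤ j then (if m = 1 then 2 else 4)
      else if inv n j ≤ m ∧ 0 < j then (if m = inv n 1 then -2 else -4) else 0) ∧
    (∑ k ∈ Finset.range j, (if k = 0 then 1 else 2) * omExp' n (k + 1) m =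
      if j = 0 then 0
      else if 2 ≤ m ∧ m ≤ j + 1 then (if m = 2 then 2 else 4)
      else if inv n (j + 1) ≤ m ∧ m ≤ inv n 2 then (if m = inv n 2 then -2 else -4) else 0) := by
  induction j with
  | zero => simp; omega
  | succ j ih =>
    obtain ⟨h1, h2⟩ := ih (by omega)
    rw [Finset.sum_range_succ, Finset.sum_range_succ, h1, h2]
    unfold omExp omExp' inv
    simp only [Nat.succ_ne_zero, if_false, show j + 1 < n by omega, if_true]
    constructor <;> split_ifs <;> omega

theorem sum_omExp_eq (n m : ℕ) (hn : 2 ≤ n) (hm : 1 ≤ m) (hmn : m ≤ 2 * n + 1) :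
    (∑ k ∈ Finset.range n, (if k = 0 then 1 else 2) * omExp n (k + 1) m = -omExp n 0 m) ∧
    (∑ k ∈ Finset.range n, (if k = 0 then 1 else 2) * omExp' n (k + 1) m = -omExp' n 0 m) := by
  -- `sum_omExp` stops before the short node `n`, whose exponents have a different shape and are
  -- added separately.
  obtain ⟨j, rfl⟩ : ∃ j, n = j + 1 := ⟨n - 1, by omega⟩
  obtain ⟨h1, h2⟩ := sum_omExp (j + 1) j m hn le_rfl hm hmn
  rw [Finset.sum_range_succ, Finset.sum_range_succ, h1, h2]
  unfold omExp omExp' inv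
  obtain h | h | h | h | h | h | h | h | h | h | h : m = 1 ∨ (m = 2 ∧ j = 1) ∨ (m = 2 ∧ 2 ≤ j) ∨
    (3 ≤ m ∧ m ≤ j) ∨ (3 ≤ m ∧ m = j + 1) ∨ m = j + 2 ∨ (m = j + 3 ∧ j = 1) ∨
    (m = j + 3 ∧ 2 ≤ j) ∨ (j + 4 ≤ m ∧ m ≤ 2 * j + 1) ∨ (m = 2 * j + 2 ∧ 2 ≤ j) ∨
    m = 2 * j + 3 := by omega
  all_goals
    simp (disch := omega) only [if_pos, if_neg]
    norm_num

/-- The weights of `ω_0` and of the finite part of `γ` are inverse to each other. -/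
theorem IsGeneric.omWeight_mul_prod (h : IsGeneric r s) (n m : ℕ) (hn : 2 ≤ n) (hm : 1 ≤ m)
    (hmn : m ≤ 2 * n + 1) :
    omWeight r s n 0 m *
      ∏ k ∈ Finset.range n, omWeight r s n (k + 1) m ^ (if k = 0 then 1 else 2) = 1 := by
  have hr := h.left_ne_zero
  have hs := h.right_ne_zero
  have key : ∀ k ∈ Finset.range n, omWeight r s n (k + 1) m ^ (if k = 0 then 1 else 2) =
      r ^ ((if k = 0 then 1 else 2) * omExp n (k + 1) m) *
        s ^ ((if k = 0 then 1 else 2) * omExp' n (k + 1) m) := by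
    intro k _
    rw [omWeight_eq _ _ _ _ _ hn]
    split_ifs
    · simp
    · rw [mul_pow, mul_comm 2, mul_comm 2, zpow_mul, zpow_mul]; norm_cast
  have hprod : ∀ {x : K} (hx : x ≠ 0) (f : ℕ → ℤ),
      ∏ k ∈ Finset.range n, x ^ f k = x ^ ∑ k ∈ Finset.range n, f k := by
    intro x hx f
    induction Finset.range n using Finset.induction_on with
    | empty => simp
    | insert a t ha ih => rw [Finset.prod_insert ha, Finset.sum_insert ha, ih, zpow_add₀ hx]
  rw [Finset.prod_congr rfl key, Finset.prod_mul_distrib, hprod hr, hprod hs,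
    (sum_omExp_eq n m hn hm hmn).1, (sum_omExp_eq n m hn hm hmn).2, omWeight_eq _ _ _ _ _ hn,
    zpow_neg, zpow_neg]
  field_simp

/-! ## Matrix units and diagonal operators -/

section Operators

variable {K : Type*} [Field K] {n : ℕ}

/-- The basis vector `v_k` of `V`, for `1 ≤ k ≤ 2 n + 1`; zero for other `k`. -/
def bv (K : Type*) [Field K] (n k : ℕ) : V K n := fun p => if (p : ℕ) + 1 = k then 1 else 0

/-- `k` is an index of a basis vector of `V`. -/
def InRange (n k : ℕ) : Prop := 1 ≤ k ∧ k ≤ 2 * n + 1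

theorem bv_succ (p : Fin (2 * n + 1)) : bv K n (p + 1) = Pi.single p 1 := by
  ext q
  simp [bv, Pi.single_apply, Fin.ext_iff]

theorem InRange.exists_fin {k : ℕ} (h : InRange n k) : ∃ p : Fin (2 * n + 1), (p : ℕ) + 1 = k :=
  ⟨⟨k - 1, by have := h.1; have := h.2; omega⟩, by have := h.1; simp; omega⟩

theorem inRange_succ (p : Fin (2 * n + 1)) : InRange n (p + 1) := ⟨by omega, by omega⟩

theorem InRange.inv {k : ℕ} (h : InRange n k) : InRange n (inv n k) := by
  obtain ⟨h1, h2⟩ := h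
  unfold BnAffine.inv InRange
  omega

theorem InRange.inv_inv {k : ℕ} (h : InRange n k) : BnAffine.inv n (BnAffine.inv n k) = k := by
  obtain ⟨h1, h2⟩ := h
  unfold BnAffine.inv
  omega

theorem linearMap_ext {M : Type*} [AddCommMonoid M] [Module K M] {f g : V K n →ₗ[K] M}
    (h : ∀ k, InRange n k → f (bv K n k) = g (bv K n k)) : f = g := by
  refine LinearMap.pi_ext' fun p => LinearMap.ext_ring ?_
  simpa [bv_succ] using h (p + 1) (inRange_succ p)

theorem E_apply_bv (i j : ℕ) {k : ℕ} (hk : InRange n k) :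
    E K n i j (bv K n k) = if j = k then bv K n i else 0 := by
  obtain ⟨p, rfl⟩ := hk.exists_fin
  rw [bv_succ, E, Matrix.toLin'_apply, Matrix.mulVec_single_one]
  ext q
  by_cases h : j = p + 1
  · simp [bv, h]
  · simp [h, Ne.symm h]

theorem diag_apply_bv (w : ℕ → K) {k : ℕ} (hk : InRange n k) :
    diag n w (bv K n k) = w k • bv K n k := by
  rw [diag, LinearMap.sum_apply, Finset.sum_eq_single k]
  · simp [E_apply_bv _ _ hk]
  · intro b _ hb
    simp [E_apply_bv _ _ hk, hb]
  · intro h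
    exact absurd (Finset.mem_Icc.2 hk) h

theorem E_mul_E_of_eq (i l : ℕ) {j k : ℕ} (h : j = k) (h1 : 1 ≤ j) (h2 : j ≤ 2 * n + 1) :
    E K n i j * E K n k l = E K n i l := by
  subst h
  refine linearMap_ext fun m hm => ?_
  rw [Module.End.mul_apply, E_apply_bv _ _ hm, E_apply_bv _ _ hm]
  split_ifs
  · rw [E_apply_bv _ _ ⟨h1, h2⟩, if_pos rfl]
  · rw [map_zero]

theorem bv_eq_zero {k : ℕ} (hk : ¬ InRange n k) : bv K n k = 0 := by
  ext p
  have : ¬ (p : ℕ) + 1 = k := fun h => hk (h ▸ inRange_succ p)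
  simp [bv, this]

/-- No range condition is needed, since `bv` vanishes outside the range. The products below are thus
evaluated by deciding equalities of indices. -/
theorem E_mul_E_of_ne (i l : ℕ) {j k : ℕ} (h : j ≠ k) : E K n i j * E K n k l = 0 := by
  refine linearMap_ext fun m hm => ?_
  rw [Module.End.mul_apply, E_apply_bv _ _ hm]
  split_ifs
  · by_cases hk : InRange n k
    · rw [E_apply_bv _ _ hk, if_neg h]; rfl
    · rw [bv_eq_zero hk, map_zero]; rfl
  · rw [map_zero]; rfl

theorem diag_mul_E (w : ℕ → K) (i j : ℕ) : diag n w * E K n i j = w i • E K n i j := by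
  refine linearMap_ext fun m hm => ?_
  rw [Module.End.mul_apply, LinearMap.smul_apply, E_apply_bv _ _ hm]
  split_ifs
  · by_cases hi : InRange n i
    · rw [diag_apply_bv _ hi]
    · rw [bv_eq_zero hi, map_zero, smul_zero]
  · rw [map_zero, smul_zero]

theorem E_mul_diag (w : ℕ → K) (i j : ℕ) : E K n i j * diag n w = w j • E K n i j := by
  refine linearMap_ext fun m hm => ?_
  rw [Module.End.mul_apply, LinearMap.smul_apply, diag_apply_bv _ hm, map_smul,
    E_apply_bv _ _ hm]
  split_ifs with h
  · rw [h]
  · simp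

theorem diag_congr {w w' : ℕ → K} (h : ∀ k, InRange n k → w k = w' k) : diag n w = diag n w' :=
  Finset.sum_congr rfl fun k hk => by rw [h k (Finset.mem_Icc.1 hk)]

theorem diag_mul_diag (w w' : ℕ → K) : diag n w * diag n w' = diag n fun k => w k * w' k := by
  refine linearMap_ext fun m hm => ?_
  rw [Module.End.mul_apply, diag_apply_bv _ hm, map_smul, diag_apply_bv _ hm,
    diag_apply_bv _ hm, smul_smul, mul_comm (w' m)]

theorem diag_one : diag n (fun _ => (1 : K)) = 1 := by
  refine linearMap_ext fun m hm => ?_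
  rw [diag_apply_bv _ hm, one_smul, Module.End.one_apply]

theorem diag_pow (w : ℕ → K) (m : ℕ) : diag n w ^ m = diag n fun k => w k ^ m := by
  induction m with
  | zero => simp [diag_one]
  | succ m ih => rw [pow_succ, ih, diag_mul_diag]; simp [pow_succ]

theorem diag_smul (c : K) (w : ℕ → K) : c • diag n w = diag n fun k => c * w k := by
  simp [diag, Finset.smul_sum, smul_smul]

theorem diag_sub (w w' : ℕ → K) : diag n w - diag n w' = diag n fun k => w k - w' k := by
  refine linearMap_ext fun m hm => ?_
  rw [LinearMap.sub_apply, diag_apply_bv _ hm, diag_apply_bv _ hm, diag_apply_bv _ hm, sub_smul]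

theorem E_self_eq_diag (i : ℕ) : E K n i i = diag n fun k => if k = i then (1 : K) else 0 := by
  refine linearMap_ext fun m hm => ?_
  rw [E_apply_bv _ _ hm, diag_apply_bv _ hm]
  by_cases h : i = m
  · simp [h]
  · simp [h, Ne.symm h]

theorem diag_add (w w' : ℕ → K) : diag n w + diag n w' = diag n fun k => w k + w' k := by
  simp [diag, add_smul, Finset.sum_add_distrib]

theorem prod_diag (l : List (ℕ → K)) :
    (l.map (diag n)).prod = diag n fun k => (l.map fun w => w k).prod := by
  induction l with
  | nil => simp [diag_one]
  | cons w l ih => simp [ih, diag_mul_diag]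

theorem thetaProd_diag (y : ℕ → ℕ → K) :
    thetaProd (fun i : Fin (n + 1) => diag n (y i)) =
      diag n fun m => ∏ k ∈ Finset.range n, y (k + 1) m ^ (if k = 0 then 1 else 2) := by
  have h1 : ∀ k : Fin n, diag n (y (k.succ : Fin (n + 1))) ^ (if (k : ℕ) = 0 then 1 else 2) =
      diag n fun m => y (k + 1) m ^ (if (k : ℕ) = 0 then 1 else 2) := fun k => by
    rw [diag_pow]; simp
  rw [thetaProd]
  simp only [h1]
  rw [show (List.finRange n).map (fun k : Fin n => diag n
      fun m => y (k + 1) m ^ (if (k : ℕ) = 0 then 1 else 2)) =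
    ((List.finRange n).map (fun k : Fin n =>
      fun m => y (k + 1) m ^ (if (k : ℕ) = 0 then 1 else 2))).map (diag n) by simp,
    prod_diag]
  congr 1
  funext m
  rw [Finset.prod_range fun k => y (k + 1) m ^ (if k = 0 then 1 else 2), ← List.prod_ofFn,
    List.ofFn_eq_map]
  simp [Function.comp_def]

end Operators

/-! ## The evaluation module for the spectral parameter `1` -/

section Evaluation

variable {K : Type*} [Field K] {r s : K} {n : ℕ}

/-- The coefficient of `E_{pq}` in `e_i`. -/
def eCoef (a : K) (i : ℕ) : K := if i = 0 then a else 1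

/-- The coefficient of `E_{q'p'}` in `e_i`. -/
def eCoef' (r s a : K) (i : ℕ) : K := if i = 0 then -(a * (r ^ 2 * s ^ 2)) else -1

/-- The coefficient of `E_{qp}` in `f_i`. -/
def fCoef (r s b : K) (n i : ℕ) : K := if i = 0 then b else if i < n then 1 else r⁻¹ + s⁻¹

/-- The coefficient of `E_{p'q'}` in `f_i`. -/
def fCoef' (r s b : K) (n i : ℕ) : K :=
  if i = 0 then -b else if i < n then -(r * s) ^ (-2 : ℤ) else -(r⁻¹ + s⁻¹)

/-- The operator `e_i`. -/
noncomputable def eOp (r s a : K) (n i : ℕ) : Module.End K (V K n) :=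
  eCoef a i • E K n (rowIdx n i) (colIdx i)
    + eCoef' r s a i • E K n (inv n (colIdx i)) (inv n (rowIdx n i))

/-- The operator `f_i`. -/
noncomputable def fOp (r s b : K) (n i : ℕ) : Module.End K (V K n) :=
  fCoef r s b n i • E K n (colIdx i) (rowIdx n i)
    + fCoef' r s b n i • E K n (inv n (rowIdx n i)) (inv n (colIdx i))

theorem inv_one_inv : inv n (inv n 1) = 1 := by unfold inv; omega

theorem inv_succ_self : inv n (n + 1) = n + 1 := by unfold inv; omega

theorem genOp_e (r s a b : K) (i : Fin (n + 1)) : genOp r s a b n (.e i) = eOp r s a n i := by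
  by_cases h : (i : ℕ) = 0
  · simp only [genOp, eOp, h, eCoef, eCoef', rowIdx, colIdx, if_true, inv_one_inv]
    module
  · simp only [genOp, eOp, h, eCoef, eCoef', rowIdx, colIdx, if_false]
    module

theorem genOp_f (r s a b : K) (i : Fin (n + 1)) : genOp r s a b n (.f i) = fOp r s b n i := by
  by_cases h : (i : ℕ) = 0
  · simp only [genOp, fOp, h, fCoef, fCoef', rowIdx, colIdx, if_true, inv_one_inv]
    module
  · by_cases h' : (i : ℕ) < n
    · simp only [genOp, fOp, h, h', fCoef, fCoef', rowIdx, colIdx, if_true, if_false]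
      module
    · have hi : (i : ℕ) = n := by omega
      have hn : n ≠ 0 := by omega
      simp only [genOp, fOp, hi, hn, lt_irrefl, fCoef, fCoef', rowIdx, colIdx, if_false,
        inv_succ_self]
      module

variable (r s n) in
theorem diag_mul_eOp (a : K) (w : ℕ → K) (i : ℕ) (c : K)
    (h1 : w (rowIdx n i) = c * w (colIdx i))
    (h2 : w (inv n (colIdx i)) = c * w (inv n (rowIdx n i))) :
    diag n w * eOp r s a n i = c • (eOp r s a n i * diag n w) := by
  simp only [eOp, mul_add, add_mul, mul_smul_comm, smul_mul_assoc, diag_mul_E, E_mul_diag, h1, h2]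
  module

variable (r s n) in
theorem diag_mul_fOp (b : K) (w : ℕ → K) (i : ℕ) (c : K)
    (h1 : w (colIdx i) = c * w (rowIdx n i))
    (h2 : w (inv n (rowIdx n i)) = c * w (inv n (colIdx i))) :
    diag n w * fOp r s b n i = c • (fOp r s b n i * diag n w) := by
  simp only [fOp, mul_add, add_mul, mul_smul_comm, smul_mul_assoc, diag_mul_E, E_mul_diag, h1, h2]
  module

theorem rowIdx_inRange {i : ℕ} (hi : i ≤ n) : InRange n (rowIdx n i) := by
  unfold rowIdx InRange inv
  split_ifs <;> omega

theorem colIdx_inRange {i : ℕ} (hn : 2 ≤ n) (hi : i ≤ n) : InRange n (colIdx i) := by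
  unfold colIdx InRange
  split_ifs <;> omega

/-- The parameters `r'`, `s'` of `e_j` are kept separate from those of the weights: interchanging
`r` and `s` in the latter alone gives the relation for `ω'_i`. -/
theorem om_mul_eOp (h : IsGeneric r s) (hn : 2 ≤ n) {i j : ℕ} (hi : i ≤ n) (hj : j ≤ n) (r' s' a : K) :
    diag n (omWeight r s n i) * eOp r' s' a n j =
      Om r s n j i • (eOp r' s' a n j * diag n (omWeight r s n i)) := by
  have h1 := h.omWeight_rowIdx n i j hn hi hj
  have := h.Om_ne_zero n j i
  have := h.omWeight_ne_zero n i (colIdx j) hn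
  refine diag_mul_eOp _ _ _ _ _ _ _ h1 ?_
  rw [omWeight_inv _ _ _ _ _ hn hi (rowIdx_inRange hj).1 (rowIdx_inRange hj).2,
    omWeight_inv _ _ _ _ _ hn hi (colIdx_inRange hn hj).1 (colIdx_inRange hn hj).2, h1]
  field_simp

theorem om_mul_fOp (h : IsGeneric r s) (hn : 2 ≤ n) {i j : ℕ} (hi : i ≤ n) (hj : j ≤ n) (r' s' b : K) :
    diag n (omWeight r s n i) * fOp r' s' b n j =
      (Om r s n j i)⁻¹ • (fOp r' s' b n j * diag n (omWeight r s n i)) := by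
  have h1 := h.omWeight_rowIdx n i j hn hi hj
  have := h.Om_ne_zero n j i
  have := h.omWeight_ne_zero n i (colIdx j) hn
  refine diag_mul_fOp _ _ _ _ _ _ _ (by rw [h1]; field_simp) ?_
  rw [omWeight_inv _ _ _ _ _ hn hi (rowIdx_inRange hj).1 (rowIdx_inRange hj).2,
    omWeight_inv _ _ _ _ _ hn hi (colIdx_inRange hn hj).1 (colIdx_inRange hn hj).2, h1]
  field_simp

theorem eOp_mul_fOp_of_ne (h : IsGeneric r s) (a b : K) (hn : 2 ≤ n)
    {i j : ℕ} (hi : i ≤ n) (hj : j ≤ n) (hij : i ≠ j) :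
    eOp r s a n i * fOp r s b n j = fOp r s b n j * eOp r s a n i := by
  have hr := h.left_ne_zero
  have hs := h.right_ne_zero
  simp only [eOp, fOp, mul_add, add_mul, mul_smul_comm, smul_mul_assoc]
  unfold eCoef eCoef' fCoef fCoef' rowIdx colIdx inv
  rcases Nat.eq_zero_or_pos i with rfl | hi0 <;> rcases Nat.eq_zero_or_pos j with rfl | hj0
  · omega
  · obtain h | h : j = 1 ∨ 1 < j := by omega
    -- Vertices `0` and `1` form the only pair with nonzero products: `e_0 f_1` and `f_1 e_0` both
    -- equal `a E_{1'1}`, as the factor `r² s²` in `e_0` cancels `(r s)⁻²` in `f_1`.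
    · subst h
      simp (disch := omega) only [if_true, if_false, if_pos, if_neg, E_mul_E_of_eq, E_mul_E_of_ne]
      rw [show 2 * n + 2 - (2 * n + 2 - 1) = 1 by omega]
      match_scalars
      simp only [zpow_neg, zpow_ofNat]
      field_simp
    · simp (disch := omega) only [if_true, if_false, if_pos, if_neg, E_mul_E_of_eq, E_mul_E_of_ne]
      simp
  · obtain h | h : i = 1 ∨ 1 < i := by omega
    · subst h
      simp (disch := omega) only [if_true, if_false, if_pos, if_neg, E_mul_E_of_eq, E_mul_E_of_ne]
      rw [show 2 * n + 2 - (2 * n + 2 - 1) = 1 by omega]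
      module
    · simp (disch := omega) only [if_true, if_false, if_pos, if_neg, E_mul_E_of_eq, E_mul_E_of_ne]
      simp
  · obtain h | h | h : j = i + 1 ∨ i = j + 1 ∨ (j ≠ i + 1 ∧ i ≠ j + 1) := by omega
    all_goals
      simp (disch := omega) only [if_true, if_false, if_pos, if_neg, E_mul_E_of_eq, E_mul_E_of_ne]
      simp

theorem eOp_mul_fOp_self_sub (r s a b : K) (hn : 2 ≤ n) {i : ℕ} (hi : i ≤ n) :
    eOp r s a n i * fOp r s b n i - fOp r s b n i * eOp r s a n i =
      diag n fun k =>
        eCoef a i * fCoef r s b n i *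
            ((if k = rowIdx n i then 1 else 0) - (if k = colIdx i then 1 else 0))
          + eCoef' r s a i * fCoef' r s b n i *
            ((if k = inv n (colIdx i) then 1 else 0) - (if k = inv n (rowIdx n i) then 1 else 0)) := by
  simp only [← diag_add, ← diag_smul, ← diag_sub, ← E_self_eq_diag]
  simp only [eOp, fOp, mul_add, add_mul, mul_smul_comm, smul_mul_assoc]
  unfold rowIdx colIdx inv
  rcases Nat.eq_zero_or_pos i with rfl | hi0
  · simp (disch := omega) only [if_true, if_false, if_pos, if_neg, E_mul_E_of_eq, E_mul_E_of_ne]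
    module
  · simp (disch := omega) only [if_true, if_false, if_pos, if_neg, E_mul_E_of_eq, E_mul_E_of_ne]
    module

theorem eOp_mul_fOp_self (h : IsGeneric r s) (hn : 2 ≤ n) {a b : K}
    (hab : a * b = (r * s) ^ (-2 : ℤ)) {i : ℕ} (hi : i ≤ n) :
    eOp r s a n i * fOp r s b n i - fOp r s b n i * eOp r s a n i =
      (vertexParam r n i - vertexParam s n i)⁻¹ •
        (diag n (omWeight r s n i) - diag n (omWeight s r n i)) := by
  have hr := h.left_ne_zero
  have hs := h.right_ne_zero
  have hne := sub_ne_zero.2 (h.isGeneric_vertexParam n i hn hi).ne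
  rw [eOp_mul_fOp_self_sub r s a b hn hi, diag_sub, diag_smul]
  refine diag_congr fun k ⟨hk1, hk2⟩ => ?_
  rw [vertexParam_eq r n i hn hi, vertexParam_eq s n i hn hi] at *
  rw [eq_inv_mul_iff_mul_eq₀ hne]
  simp only [zpow_neg, zpow_ofNat, eCoef, eCoef', fCoef, fCoef', rowIdx, colIdx, omWeight, inv]
    at *
  rcases Nat.eq_zero_or_pos i with rfl | hi0
  · have e1 : -(a * (r ^ 2 * s ^ 2)) * -b = 1 := by
      rw [neg_mul_neg]
      calc _ = a * b * (r * s) ^ 2 := by ring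
        _ = 1 := by rw [hab]; field_simp
    simp only [if_true, hab, e1]
    obtain h | h | h | h | h | h | h : k = 1 ∨ k = 2 ∨ k = 2 * n + 2 - 2 ∨ k = 2 * n + 2 - 1 ∨
      k = n + 1 ∨ (3 ≤ k ∧ k ≤ n) ∨ (n + 2 ≤ k ∧ k ≤ 2 * n - 1) := by omega
    all_goals
      simp (disch := omega) only [if_pos, if_neg]
      field_simp
      try ring
  · rcases hi.lt_or_eq with hin | rfl
    · simp only [hi0.ne', hin, hin.ne, if_true, if_false]
      obtain h | h | h | h | h : k = i ∨ k = i + 1 ∨ k = 2 * n + 2 - i ∨ k = 2 * n + 2 - (i + 1) ∨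
        (k ≠ i ∧ k ≠ i + 1 ∧ k ≠ 2 * n + 2 - i ∧ k ≠ 2 * n + 2 - (i + 1)) := by omega
      all_goals
        simp (disch := omega) only [if_pos, if_neg]
        field_simp
        try ring
    · simp only [hi0.ne', lt_irrefl, if_true, if_false]
      obtain h | h | h | h | h : k = i ∨ k = i + 1 ∨ k = i + 2 ∨ k < i ∨ i + 2 < k := by omega
      all_goals
        simp (disch := omega) only [if_pos, if_neg]
        field_simp
        try ring

theorem eOp_sq (r s a : K) (hn : 2 ≤ n) {i : ℕ} (hi : i < n) : eOp r s a n i ^ 2 = 0 := by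
  simp only [eOp, pow_two, mul_add, add_mul, mul_smul_comm, smul_mul_assoc]
  unfold rowIdx colIdx inv
  rcases Nat.eq_zero_or_pos i with rfl | hi0 <;>
  · simp (disch := omega) only [if_true, if_false, if_pos, if_neg, E_mul_E_of_ne]
    simp

theorem fOp_sq (r s b : K) (hn : 2 ≤ n) {i : ℕ} (hi : i < n) : fOp r s b n i ^ 2 = 0 := by
  simp only [fOp, pow_two, mul_add, add_mul, mul_smul_comm, smul_mul_assoc]
  unfold rowIdx colIdx inv
  rcases Nat.eq_zero_or_pos i with rfl | hi0 <;>
  · simp (disch := omega) only [if_true, if_false, if_pos, if_neg, E_mul_E_of_ne]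
    simp

/-- Together with `eOp_sq` this kills each term of a Serre relation of degree `2` separately. In the
vector representation only the relations of degree `1` require a cancellation. -/
theorem eOp_mul_eOp_mul_eOp (r s a : K) (hn : 2 ≤ n) {i j : ℕ} (hi : i < n) (hj : j ≤ n) :
    eOp r s a n i * eOp r s a n j * eOp r s a n i = 0 := by
  simp only [eOp, mul_add, add_mul, mul_smul_comm, smul_mul_assoc]
  unfold rowIdx colIdx inv
  rcases Nat.eq_zero_or_pos i with rfl | hi0 <;> rcases Nat.eq_zero_or_pos j with rfl | hj0
  · simp (disch := omega) only [if_true, if_false, if_pos, if_neg, E_mul_E_of_ne]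
    simp
  · obtain h | h | h : j = 1 ∨ j = 2 ∨ (j ≠ 1 ∧ j ≠ 2) := by omega
    all_goals
      simp (disch := omega) only [if_true, if_false, if_pos, if_neg, E_mul_E_of_eq, E_mul_E_of_ne]
      simp
  · obtain h | h | h : i = 1 ∨ i = 2 ∨ (i ≠ 1 ∧ i ≠ 2) := by omega
    all_goals
      simp (disch := omega) only [if_true, if_false, if_pos, if_neg, E_mul_E_of_eq, E_mul_E_of_ne]
      simp
  · obtain h | h | h : j = i + 1 ∨ i = j + 1 ∨ (j ≠ i + 1 ∧ i ≠ j + 1) := by omega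
    all_goals
      simp (disch := omega) only [if_true, if_false, if_pos, if_neg, E_mul_E_of_eq, E_mul_E_of_ne]
      simp

/-- The products entering the Serre relations of degree `3`, which involve the short root. -/
theorem eOp_last_products (r s a : K) (hn : 2 ≤ n) {j : ℕ} (hj : j < n) :
    eOp r s a n n ^ 3 = 0 ∧ eOp r s a n n ^ 2 * eOp r s a n j * eOp r s a n n = 0 ∧
      eOp r s a n n * eOp r s a n j * eOp r s a n n ^ 2 = 0 := by
  simp only [eOp, pow_succ, pow_zero, one_mul, mul_add, add_mul, mul_smul_comm, smul_mul_assoc,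
    ← mul_assoc]
  unfold rowIdx colIdx inv
  rcases Nat.eq_zero_or_pos j with rfl | hj0
  · obtain h | h : n = 2 ∨ 3 ≤ n := by omega
    all_goals
      simp (disch := omega) only [if_true, if_false, if_pos, if_neg, E_mul_E_of_eq, E_mul_E_of_ne]
      simp (disch := omega) only [smul_zero, add_zero, zero_add, and_self, zero_mul, E_mul_E_of_ne]
  · obtain h | h : n = j + 1 ∨ n ≠ j + 1 := by omega
    all_goals
      simp (disch := omega) only [if_true, if_false, if_pos, if_neg, E_mul_E_of_eq, E_mul_E_of_ne]
      simp (disch := omega) only [smul_zero, add_zero, zero_add, and_self, zero_mul, E_mul_E_of_ne]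

theorem fOp_mul_fOp_mul_fOp (r s b : K) (hn : 2 ≤ n) {i j : ℕ} (hi : i < n) (hj : j ≤ n) :
    fOp r s b n i * fOp r s b n j * fOp r s b n i = 0 := by
  simp only [fOp, mul_add, add_mul, mul_smul_comm, smul_mul_assoc]
  unfold rowIdx colIdx inv
  rcases Nat.eq_zero_or_pos i with rfl | hi0 <;> rcases Nat.eq_zero_or_pos j with rfl | hj0
  · simp (disch := omega) only [if_true, if_false, if_pos, if_neg, E_mul_E_of_ne]
    simp
  · obtain h | h | h : j = 1 ∨ j = 2 ∨ (j ≠ 1 ∧ j ≠ 2) := by omega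
    all_goals
      simp (disch := omega) only [if_true, if_false, if_pos, if_neg, E_mul_E_of_eq, E_mul_E_of_ne]
      simp
  · obtain h | h | h : i = 1 ∨ i = 2 ∨ (i ≠ 1 ∧ i ≠ 2) := by omega
    all_goals
      simp (disch := omega) only [if_true, if_false, if_pos, if_neg, E_mul_E_of_eq, E_mul_E_of_ne]
      simp
  · obtain h | h | h : j = i + 1 ∨ i = j + 1 ∨ (j ≠ i + 1 ∧ i ≠ j + 1) := by omega
    all_goals
      simp (disch := omega) only [if_true, if_false, if_pos, if_neg, E_mul_E_of_eq, E_mul_E_of_ne]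
      simp

/-- The products entering the Serre relations of degree `3`, which involve the short root. -/
theorem fOp_last_products (r s b : K) (hn : 2 ≤ n) {j : ℕ} (hj : j < n) :
    fOp r s b n n ^ 3 = 0 ∧ fOp r s b n n ^ 2 * fOp r s b n j * fOp r s b n n = 0 ∧
      fOp r s b n n * fOp r s b n j * fOp r s b n n ^ 2 = 0 := by
  simp only [fOp, pow_succ, pow_zero, one_mul, mul_add, add_mul, mul_smul_comm, smul_mul_assoc,
    ← mul_assoc]
  unfold rowIdx colIdx inv
  rcases Nat.eq_zero_or_pos j with rfl | hj0
  · obtain h | h : n = 2 ∨ 3 ≤ n := by omega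
    all_goals
      simp (disch := omega) only [if_true, if_false, if_pos, if_neg, E_mul_E_of_eq, E_mul_E_of_ne]
      simp (disch := omega) only [smul_zero, add_zero, zero_add, and_self, zero_mul, E_mul_E_of_ne]
  · obtain h | h : n = j + 1 ∨ n ≠ j + 1 := by omega
    all_goals
      simp (disch := omega) only [if_true, if_false, if_pos, if_neg, E_mul_E_of_eq, E_mul_E_of_ne]
      simp (disch := omega) only [smul_zero, add_zero, zero_add, and_self, zero_mul, E_mul_E_of_ne]

/-- The pair `{0, 1}` has to be isolated: these vertices are orthogonal, but the Ringel form does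
not vanish on them and their root operators have nonzero products. -/
theorem cartan_eq_zero (n i j : ℕ) (hn : 2 ≤ n) (hi : i ≤ n) (hj : j ≤ n) (hij : i ≠ j)
    (h : cartan n i j = 0) : (i = 0 ∧ j = 1) ∨ (i = 1 ∧ j = 0) ∨
      (j ≠ i + 1 ∧ i ≠ j + 1 ∧ (i = 0 → 3 ≤ j) ∧ (j = 0 → 3 ≤ i)) := by
  have h1 := (cartan_cases n i j hn hi hj hij).1
  rw [h, mul_zero, ringel_eq n i j hn hi hj, ringel_eq n j i hn hj hi] at h1
  unfold ringelValue simpleRingel simpleForm at h1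
  split_ifs at h1 <;> omega

/-- Entries in the row of the short root are even, so a Serre relation of degree `2` has `i < n`,
where `e_i` and `f_i` square to zero. -/
theorem cartan_last_ne (n j : ℕ) (hn : 2 ≤ n) (hj : j < n) : cartan n n j ≠ -1 := by
  intro h
  have h1 := (cartan_cases n n j hn le_rfl hj.le hj.ne').1
  rw [h, halfNorm_eq n n hn le_rfl, ringel_eq n n j hn le_rfl hj.le,
    ringel_eq n j n hn hj.le le_rfl] at h1
  unfold ringelValue simpleRingel simpleForm at h1
  split_ifs at h1 <;> omega

theorem Om_one_zero (r s : K) (hn : 2 ≤ n) : Om r s n 1 0 = (r * s) ^ 2 := by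
  rw [Om, ringel_eq n 0 1 hn (by omega) (by omega), ringel_eq n 1 0 hn (by omega) (by omega)]
  simp [ringelValue, zpow_ofNat, mul_pow]

theorem Om_zero_one (r s : K) (hn : 2 ≤ n) : Om r s n 0 1 = ((r * s) ^ 2)⁻¹ := by
  rw [Om, ringel_eq n 0 1 hn (by omega) (by omega), ringel_eq n 1 0 hn (by omega) (by omega)]
  simp [ringelValue, zpow_neg, zpow_ofNat, mul_pow, mul_comm]

/-- For `{0, 1}` both products are multiples of `E_{2'2}`, in the ratio `Ω_10 = (r s)²`. For every
other orthogonal pair both products vanish, so the scalar is irrelevant. -/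
theorem eOp_mul_eOp_of_cartan (h : IsGeneric r s) (hn : 2 ≤ n) (a : K) {i j : ℕ} (hi : i ≤ n)
    (hj : j ≤ n) (hij : i ≠ j) (hc : cartan n i j = 0) :
    eOp r s a n i * eOp r s a n j = Om r s n j i • (eOp r s a n j * eOp r s a n i) := by
  have hr := h.left_ne_zero
  have hs := h.right_ne_zero
  obtain ⟨rfl, rfl⟩ | ⟨rfl, rfl⟩ | ⟨h1, h2, h3, h4⟩ := cartan_eq_zero n i j hn hi hj hij hc
  · rw [Om_one_zero r s hn]
    simp only [eOp, mul_add, add_mul, mul_smul_comm, smul_mul_assoc]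
    unfold rowIdx colIdx inv eCoef eCoef'
    simp (disch := omega) only [if_true, if_false, if_pos, if_neg, E_mul_E_of_eq, E_mul_E_of_ne]
    module
  · rw [Om_zero_one r s hn]
    simp only [eOp, mul_add, add_mul, mul_smul_comm, smul_mul_assoc]
    unfold rowIdx colIdx inv eCoef eCoef'
    simp (disch := omega) only [if_true, if_false, if_pos, if_neg, E_mul_E_of_eq, E_mul_E_of_ne]
    match_scalars
    field_simp
  · simp only [eOp, mul_add, add_mul, mul_smul_comm, smul_mul_assoc]
    unfold rowIdx colIdx inv eCoef eCoef'
    rcases Nat.eq_zero_or_pos i with rfl | hi0 <;> rcases Nat.eq_zero_or_pos j with rfl | hj0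
    · omega
    · have := h3 rfl
      simp (disch := omega) only [if_true, if_false, if_neg, E_mul_E_of_eq, E_mul_E_of_ne]
      simp
    · have := h4 rfl
      simp (disch := omega) only [if_true, if_false, if_neg, E_mul_E_of_eq, E_mul_E_of_ne]
      simp
    · simp (disch := omega) only [if_true, if_false, if_neg, E_mul_E_of_eq, E_mul_E_of_ne]
      simp

theorem fOp_mul_fOp_of_cartan (h : IsGeneric r s) (hn : 2 ≤ n) (b : K) {i j : ℕ} (hi : i ≤ n)
    (hj : j ≤ n) (hij : i ≠ j) (hc : cartan n i j = 0) :
    fOp r s b n j * fOp r s b n i = Om r s n j i • (fOp r s b n i * fOp r s b n j) := by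
  have hr := h.left_ne_zero
  have hs := h.right_ne_zero
  obtain ⟨rfl, rfl⟩ | ⟨rfl, rfl⟩ | ⟨h1, h2, h3, h4⟩ := cartan_eq_zero n i j hn hi hj hij hc
  · rw [Om_one_zero r s hn]
    simp only [fOp, mul_add, add_mul, mul_smul_comm, smul_mul_assoc]
    unfold rowIdx colIdx inv fCoef fCoef'
    simp (disch := omega) only [if_true, if_false, if_pos, if_neg, E_mul_E_of_eq, E_mul_E_of_ne,
      zpow_neg, zpow_ofNat]
    match_scalars
    field_simp
  · rw [Om_zero_one r s hn]
    simp only [fOp, mul_add, add_mul, mul_smul_comm, smul_mul_assoc]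
    unfold rowIdx colIdx inv fCoef fCoef'
    simp (disch := omega) only [if_true, if_false, if_pos, if_neg, E_mul_E_of_eq, E_mul_E_of_ne,
      zpow_neg, zpow_ofNat]
    match_scalars
    ring
  · simp only [fOp, mul_add, add_mul, mul_smul_comm, smul_mul_assoc]
    unfold rowIdx colIdx inv
    rcases Nat.eq_zero_or_pos i with rfl | hi0 <;> rcases Nat.eq_zero_or_pos j with rfl | hj0
    · omega
    · have := h3 rfl
      simp (disch := omega) only [if_true, if_false, if_neg, E_mul_E_of_eq, E_mul_E_of_ne]
      simp
    · have := h4 rfl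
      simp (disch := omega) only [if_true, if_false, if_neg, E_mul_E_of_eq, E_mul_E_of_ne]
      simp
    · simp (disch := omega) only [if_true, if_false, if_neg, E_mul_E_of_eq, E_mul_E_of_ne]
      simp

end Evaluation

/-! ### The defining relations in the vector representation -/

section EvaluationRelations

variable {K : Type*} [Field K] {r s : K} {n : ℕ}

theorem level_eq_one (h : IsGeneric r s) {a b : K} (hab : a * b = (r * s) ^ (-2 : ℤ)) :
    level r s a b = 1 := by
  have hr := h.left_ne_zero
  have hs := h.right_ne_zero
  rw [level, hab, zpow_neg, zpow_ofNat, mul_inv_cancel₀ (pow_ne_zero _ (mul_ne_zero hr hs))]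

theorem serreSum_eOp_eq_zero (h : IsGeneric r s) (hn : 2 ≤ n) (a : K) {i j : ℕ} (hi : i ≤ n)
    (hj : j ≤ n) (hij : i ≠ j) :
    serreSum (serreCoeff r s n i j) (serreDegree n i j) (eOp r s a n i) (eOp r s a n j) = 0 := by
  have hκ := h.isSerreCoeff n i j hn hi hj hij
  have hc := (cartan_cases n i j hn hi hj hij).2
  rcases hκ with ⟨hm, hw, h0, h1⟩ | ⟨hm, hw, h0, h1, h2⟩ | ⟨hm, hw, h0, h1, h2, h3⟩
  · have hc0 : cartan n i j = 0 := by rw [serreDegree] at hm; omega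
    rw [hm, serreSum]
    simp only [Finset.sum_range_succ, Finset.sum_range_zero, h0, h1]
    simp [eOp_mul_eOp_of_cartan h hn a hi hj hij hc0]
  · have hc0 : cartan n i j = -1 := by rw [serreDegree] at hm; omega
    have hin : i < n := lt_of_le_of_ne hi fun e =>
      cartan_last_ne n j hn (lt_of_le_of_ne hj (e ▸ hij.symm)) (e ▸ hc0)
    rw [hm, serreSum]
    simp only [Finset.sum_range_succ, Finset.sum_range_zero, h0, h1, h2]
    simp [eOp_sq r s a hn hin, eOp_mul_eOp_mul_eOp r s a hn hin hj]
  · have hc0 : i = n := by rw [serreDegree] at hm; omega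
    obtain ⟨e1, e2, e3⟩ := eOp_last_products r s a hn (lt_of_le_of_ne hj (hc0 ▸ hij.symm))
    rw [hm, serreSum, hc0]
    simp only [Finset.sum_range_succ, Finset.sum_range_zero]
    simp [e1, e2, e3]

theorem serreSumOp_fOp_eq_zero (h : IsGeneric r s) (hn : 2 ≤ n) (b : K) {i j : ℕ} (hi : i ≤ n)
    (hj : j ≤ n) (hij : i ≠ j) :
    serreSumOp (serreCoeff r s n i j) (serreDegree n i j) (fOp r s b n i) (fOp r s b n j) = 0 := by
  have hκ := h.isSerreCoeff n i j hn hi hj hij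
  have hc := (cartan_cases n i j hn hi hj hij).2
  rcases hκ with ⟨hm, hw, h0, h1⟩ | ⟨hm, hw, h0, h1, h2⟩ | ⟨hm, hw, h0, h1, h2, h3⟩
  · have hc0 : cartan n i j = 0 := by rw [serreDegree] at hm; omega
    rw [hm, serreSumOp]
    simp only [Finset.sum_range_succ, Finset.sum_range_zero, h0, h1]
    simp [fOp_mul_fOp_of_cartan h hn b hi hj hij hc0]
  · have hc0 : cartan n i j = -1 := by rw [serreDegree] at hm; omega
    have hin : i < n := lt_of_le_of_ne hi fun e =>
      cartan_last_ne n j hn (lt_of_le_of_ne hj (e ▸ hij.symm)) (e ▸ hc0)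
    rw [hm, serreSumOp]
    simp only [Finset.sum_range_succ, Finset.sum_range_zero, h0, h1, h2]
    simp [fOp_sq r s b hn hin, fOp_mul_fOp_mul_fOp r s b hn hin hj]
  · have hc0 : i = n := by rw [serreDegree] at hm; omega
    obtain ⟨e1, e2, e3⟩ := fOp_last_products r s b hn (lt_of_le_of_ne hj (hc0 ▸ hij.symm))
    rw [hm, serreSumOp, hc0]
    simp only [Finset.sum_range_succ, Finset.sum_range_zero]
    simp [e1, e2, e3]

theorem thetaProd_mul_omWeight (h : IsGeneric r s) (hn : 2 ≤ n) :
    diag n (omWeight r s n 0) *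
      thetaProd (fun i : Fin (n + 1) => diag n (omWeight r s n i)) = 1 := by
  rw [thetaProd_diag, diag_mul_diag, ← diag_one]
  exact diag_congr fun m hm => h.omWeight_mul_prod n m hn hm.1 hm.2

theorem diag_mul_inv_omWeight (h : IsGeneric r s) (hn : 2 ≤ n) (i : ℕ) :
    diag n (omWeight r s n i) * diag n (fun k => (omWeight r s n i k)⁻¹) = 1 := by
  rw [diag_mul_diag, ← diag_one]
  exact diag_congr fun m _ => mul_inv_cancel₀ (h.omWeight_ne_zero n i m hn)

theorem diag_comm (w w' : ℕ → K) : diag n w * diag n w' = diag n w' * diag n w := by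
  rw [diag_mul_diag, diag_mul_diag]
  simp only [mul_comm]

/-- The operators of the evaluation module satisfy the defining relations. -/
theorem affSat_genOp (h : IsGeneric r s) (hn : 2 ≤ n) {a b : K}
    (hab : a * b = (r * s) ^ (-2 : ℤ)) : AffSat r s (genOp r s a b n) := by
  have hl := level_eq_one h hab
  have om (i) : genOp r s a b n (.om i) = diag n (omWeight r s n i) := by simp [genOp, hl]
  have omp (i) : genOp r s a b n (.omp i) = diag n (omWeight s r n i) := by simp [genOp, hl]
  have omi (i) : genOp r s a b n (.omInv i) = diag n (fun k => (omWeight r s n i k)⁻¹) := by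
    simp [genOp, hl]
  have ompi (i) : genOp r s a b n (.ompInv i) = diag n (fun k => (omWeight s r n i k)⁻¹) := by
    simp [genOp, hl]
  have ga : genOp r s a b n .ga = 1 := by simp [genOp, hl]
  have gap : genOp r s a b n .gap = 1 := by simp [genOp, hl]
  have gai : genOp r s a b n .gaInv = 1 := by simp [genOp, hl]
  have gapi : genOp r s a b n .gapInv = 1 := by simp [genOp, hl]
  intro p q hpq
  cases hpq with
  | ga_eq => simp only [om, ga]; exact (thetaProd_mul_omWeight h hn).symm
  | gap_eq => simp only [omp, gap]; exact (thetaProd_mul_omWeight h.symm hn).symm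
  | ga_central g => simp [ga]
  | gap_central g => simp [gap]
  | ga_inv => simp [ga, gai]
  | ga_inv' => simp [ga, gai]
  | gap_inv => simp [gap, gapi]
  | gap_inv' => simp [gap, gapi]
  | om_om i j => rw [om, om, diag_comm]
  | om_omp i j => rw [om, omp, diag_comm]
  | omp_omp i j => rw [omp, omp, diag_comm]
  | om_inv i => rw [om, omi, diag_mul_inv_omWeight h hn]
  | om_inv' i => rw [om, omi, diag_comm, diag_mul_inv_omWeight h hn]
  | omp_inv i => rw [omp, ompi, diag_mul_inv_omWeight h.symm hn]
  | omp_inv' i => rw [omp, ompi, diag_comm, diag_mul_inv_omWeight h.symm hn]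
  | om_e i j => rw [om, genOp_e, om_mul_eOp h hn (by omega) (by omega)]
  | om_f i j => rw [om, genOp_f, om_mul_fOp h hn (by omega) (by omega)]
  | omp_e i j =>
    rw [omp, genOp_e, om_mul_eOp h.symm hn (by omega) (by omega), Om_swap]
  | omp_f i j =>
    rw [omp, genOp_f, om_mul_fOp h.symm hn (by omega) (by omega), Om_swap, inv_inv]
  | e_f i =>
    rw [om, omp, genOp_e, genOp_f, eOp_mul_fOp_self h hn hab (by omega)]
  | e_f_ne i j hij =>
    rw [genOp_e, genOp_f, eOp_mul_fOp_of_ne h a b hn (by omega) (by omega) (by omega), sub_self]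
  | serre_e i j hij =>
    rw [genOp_e, genOp_e]
    exact serreSum_eOp_eq_zero h hn a (by omega) (by omega) (by omega)
  | serre_f i j hij =>
    rw [genOp_f, genOp_f]
    exact serreSumOp_fOp_eq_zero h hn b (by omega) (by omega) (by omega)

end EvaluationRelations

/-! ## Twisting by a central unit -/

section Twist

variable {K : Type*} [Field K] {r s : K} {n : ℕ} {A : Type*} [Ring A] [Algebra K A]

variable {C : Type*} [CommRing C] [Algebra K C]

theorem thetaProd_tmul_one (y : Fin (n + 1) → A) :
    thetaProd (fun i => y i ⊗ₜ[K] (1 : C)) = thetaProd y ⊗ₜ[K] (1 : C) :=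
  (map_thetaProd (K := K) (Algebra.TensorProduct.includeLeft : A →ₐ[K] A ⊗[K] C) y).symm

/-- Twisting by powers of a unit of a commutative algebra preserves the defining relations. -/
theorem AffSat.twist {x : Gen n → A} (h : AffSat r s x) (t : Cˣ) :
    AffSat r s fun g => x g ⊗ₜ[K] ((t ^ genDeg g : Cˣ) : C) := by
  intro p q hpq
  cases hpq with
  | ga_eq => simp [genDeg, thetaProd_tmul_one, h _ _ .ga_eq]
  | gap_eq => simp [genDeg, thetaProd_tmul_one, h _ _ .gap_eq]
  | ga_central g => simp [genDeg, h _ _ (.ga_central g)]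
  | gap_central g => simp [genDeg, h _ _ (.gap_central g)]
  | ga_inv => simp [genDeg, h _ _ .ga_inv, Algebra.TensorProduct.one_def]
  | ga_inv' => simp [genDeg, h _ _ .ga_inv', Algebra.TensorProduct.one_def]
  | gap_inv => simp [genDeg, h _ _ .gap_inv, Algebra.TensorProduct.one_def]
  | gap_inv' => simp [genDeg, h _ _ .gap_inv', Algebra.TensorProduct.one_def]
  | om_om i j => simp [genDeg, h _ _ (.om_om i j)]
  | om_omp i j => simp [genDeg, h _ _ (.om_omp i j)]
  | omp_omp i j => simp [genDeg, h _ _ (.omp_omp i j)]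
  | om_inv i => simp [genDeg, h _ _ (.om_inv i), Algebra.TensorProduct.one_def]
  | om_inv' i => simp [genDeg, h _ _ (.om_inv' i), Algebra.TensorProduct.one_def]
  | omp_inv i => simp [genDeg, h _ _ (.omp_inv i), Algebra.TensorProduct.one_def]
  | omp_inv' i => simp [genDeg, h _ _ (.omp_inv' i), Algebra.TensorProduct.one_def]
  | om_e i j =>
    simp only [Algebra.TensorProduct.tmul_mul_tmul, h _ _ (.om_e i j), TensorProduct.smul_tmul',
      mul_comm]
  | om_f i j =>
    simp only [Algebra.TensorProduct.tmul_mul_tmul, h _ _ (.om_f i j), TensorProduct.smul_tmul',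
      mul_comm]
  | omp_e i j =>
    simp only [Algebra.TensorProduct.tmul_mul_tmul, h _ _ (.omp_e i j), TensorProduct.smul_tmul',
      mul_comm]
  | omp_f i j =>
    simp only [Algebra.TensorProduct.tmul_mul_tmul, h _ _ (.omp_f i j), TensorProduct.smul_tmul',
      mul_comm]
  | e_f i =>
    -- `e_i` and `f_i` have opposite degrees, so the twist disappears from their commutator, as it
    -- must to match `ω_i - ω'_i`.
    have e : ((t ^ genDeg (Gen.e i) : Cˣ) : C) * ((t ^ genDeg (Gen.f i) : Cˣ) : C) = 1 := by
      rw [← Units.val_mul, ← zpow_add]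
      simp only [genDeg]
      split_ifs <;> simp
    simp only [Algebra.TensorProduct.tmul_mul_tmul, mul_comm _ ((t ^ genDeg (Gen.e i) : Cˣ) : C),
      e, ← TensorProduct.sub_tmul, h _ _ (.e_f i), ← TensorProduct.smul_tmul']
    simp [genDeg, TensorProduct.sub_tmul]
  | e_f_ne i j hij =>
    simp only [Algebra.TensorProduct.tmul_mul_tmul, mul_comm ((t ^ genDeg (Gen.f j) : Cˣ) : C),
      ← TensorProduct.sub_tmul, h _ _ (.e_f_ne i j hij), TensorProduct.zero_tmul]
  | serre_e i j hij =>
    have key : serreSum (serreCoeff r s n i j) (serreDegree n i j) (x (.e i)) (x (.e j)) = 0 :=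
      h _ _ (.serre_e i j hij)
    have := serreSum_tmul_of_commute' (serreCoeff r s n i j) (serreDegree n i j)
      (Commute.all ((t ^ genDeg (Gen.e i) : Cˣ) : C) ((t ^ genDeg (Gen.e j) : Cˣ) : C))
      (x (.e i)) (x (.e j))
    rw [key, TensorProduct.zero_tmul] at this
    exact this
  | serre_f i j hij =>
    have key : serreSumOp (serreCoeff r s n i j) (serreDegree n i j) (x (.f i)) (x (.f j)) = 0 :=
      h _ _ (.serre_f i j hij)
    have := serreSumOp_tmul_of_commute (serreCoeff r s n i j) (serreDegree n i j)
      (Commute.all ((t ^ genDeg (Gen.f i) : Cˣ) : C) ((t ^ genDeg (Gen.f j) : Cˣ) : C))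
      (x (.f i)) (x (.f j))
    rw [key, TensorProduct.zero_tmul] at this
    exact this

end Twist

/-! ## Operators on `V ⊗ V` of the shape of `R̂(z)` -/

section RData

variable {K : Type*} [Field K] {n : ℕ}

/-- The basis vector `v_j ⊗ v_k` of `V ⊗ V`. -/
def bb (K : Type*) [Field K] (n j k : ℕ) : V K n ⊗[K] V K n := bv K n j ⊗ₜ bv K n k

theorem linearMap_ext₂ {M : Type*} [AddCommMonoid M] [Module K M]
    {f g : V K n ⊗[K] V K n →ₗ[K] M}
    (h : ∀ j k, InRange n j → InRange n k → f (bb K n j k) = g (bb K n j k)) : f = g := by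
  refine TensorProduct.ext (linearMap_ext fun j hj => linearMap_ext fun k hk => ?_)
  exact h j k hj hk

/-- `T` acts on the basis of `V ⊗ V` with coefficients `A` for the exchange of two vectors, `D` for
their preservation, `B` on pairs of conjugate vectors and `S` on squares. -/
structure RData (T : Module.End K (V K n ⊗[K] V K n)) (A D B : ℕ → ℕ → K) (S : K) : Prop where
  self (c : ℕ) (hc : InRange n c) (h : c ≠ n + 1) : T (bb K n c c) = S • bb K n c c
  of_ne (c d : ℕ) (hc : InRange n c) (hd : InRange n d) (h : c ≠ d) (h' : d ≠ inv n c) :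
    T (bb K n c d) = A c d • bb K n d c + D c d • bb K n c d
  conj (c : ℕ) (hc : InRange n c) :
    T (bb K n c (inv n c)) = ∑ i ∈ Finset.Icc 1 (2 * n + 1), B i c • bb K n (inv n i) i

/-- The exponent of `r s` in the coefficients `a_{ij}(z)`. -/
def aExp (n i j : ℕ) : ℤ :=
  if (i < j ∧ i < inv n j) ∨ (j < i ∧ inv n j < i) then -(sgn n i * sgn n j)
  else sgn n i * sgn n j

/-- The coefficients of the exchange of `v_c` and `v_d`. -/
def exchCoef (ρ m z ξ : K) (n c d : ℕ) : K := ρ * (z - 1) * (z - ξ) * m ^ aExp n d c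

/-- The coefficients of the preservation of `v_c ⊗ v_d`. -/
def diagCoef (ρ z ξ : K) (c d : ℕ) : K := (1 - ρ ^ 2) * (z - ξ) * (if d < c then 1 else z)

/-- The coefficients on pairs of conjugate vectors. -/
def conjCoef (ρ z ξ : K) (t : ℕ → K) (n i j : ℕ) : K :=
  if i = j then
    if i ≠ n + 1 then (ρ ^ 2 * z - ξ) * (z - 1)
    else ρ * (z - 1) * (z - ξ) + (ρ ^ 2 - 1) * (ξ - 1) * z
  else if i < j then
    (ρ ^ 2 - 1) * (ξ * t i * (t j)⁻¹ * (z - 1) - if i = inv n j then z - ξ else 0)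
  else
    (ρ ^ 2 - 1) * z * (t i * (t j)⁻¹ * (z - 1) - if i = inv n j then z - ξ else 0)

/-- The standard coefficients, depending on `ρ = r⁻¹ s`, on the gauge parameter `m = r s`, on `z`
and `ξ`, and on the constants `t_i`. -/
def IsStandard (T : Module.End K (V K n ⊗[K] V K n)) (ρ m z ξ : K) (t : ℕ → K) : Prop :=
  RData T (exchCoef ρ m z ξ n) (diagCoef ρ z ξ) (conjCoef ρ z ξ t n) ((z - ρ ^ 2) * (z - ξ))

theorem EE_apply_bb (i j k l : ℕ) {c d : ℕ} (hc : InRange n c) (hd : InRange n d) :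
    EE K n i j k l (bb K n c d) = if j = c ∧ l = d then bb K n i k else 0 := by
  rw [EE, bb, TensorProduct.map_tmul, E_apply_bv _ _ hc, E_apply_bv _ _ hd, bb]
  by_cases h1 : j = c <;> by_cases h2 : l = d <;> simp [h1, h2]

theorem sum_sum_ite_eq {M : Type*} [AddCommMonoid M] {c d : ℕ} (hc : InRange n c)
    (hd : InRange n d) (P : ℕ → ℕ → Prop) [∀ i j, Decidable (P i j)] (f : ℕ → ℕ → M) :
    ∑ i ∈ Finset.Icc 1 (2 * n + 1), ∑ j ∈ Finset.Icc 1 (2 * n + 1) with P i j,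
      (if i = c ∧ j = d then f i j else 0) = if P c d then f c d else 0 := by
  rw [Finset.sum_eq_single_of_mem c (Finset.mem_Icc.2 hc)]
  · rw [Finset.sum_filter, Finset.sum_eq_single_of_mem d (Finset.mem_Icc.2 hd)]
    · simp
    · intro b _ hb
      simp [hb]
  · intro b _ hb
    simp [hb]

theorem Rhat_apply_bb (r s z : K) {c d : ℕ} (hc : InRange n c) (hd : InRange n d) :
    Rhat r s n z (bb K n c d) =
      (if c = d ∧ c ≠ n + 1 then
        ((z - r ^ (-2 : ℤ) * s ^ 2) * (z - xi r s n)) • bb K n c c else 0)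
      + (if c ≠ d ∧ c ≠ inv n d then (aCoeff r s n d c).eval z • bb K n d c else 0)
      + (if d < c ∧ d ≠ inv n c then
        ((1 - r ^ (-2 : ℤ) * s ^ 2) * (z - xi r s n)) • bb K n c d else 0)
      + (if c < d ∧ d ≠ inv n c then
        ((1 - r ^ (-2 : ℤ) * s ^ 2) * z * (z - xi r s n)) • bb K n c d else 0)
      + (if d = inv n c then
          ∑ i ∈ Finset.Icc 1 (2 * n + 1), (bCoeff r s n i c).eval z • bb K n (inv n i) i
        else 0) := by
  simp only [Rhat, RhatSum, LinearMap.add_apply, LinearMap.sum_apply, LinearMap.smul_apply,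
    EE_apply_bb _ _ _ _ hc hd, smul_ite, smul_zero]
  congr 1
  · congr 1
    · congr 1
      · congr 1
        · rw [Finset.sum_filter, Finset.sum_eq_single_of_mem c (Finset.mem_Icc.2 hc)]
          · by_cases h1 : c = d <;> by_cases h2 : c = n + 1 <;> simp [h1, h2]
          · intro b _ hb
            simp [hb]
        · rw [← sum_sum_ite_eq hd hc (fun i j => j ≠ i ∧ j ≠ inv n i)
            (fun i j => (aCoeff r s n i j).eval z • bb K n i j)]
          simp only [and_comm]
      · rw [sum_sum_ite_eq hc hd (fun i j => j < i ∧ j ≠ inv n i)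
          (fun i j => Polynomial.eval z _ • bb K n i j)]
        simp
    · rw [sum_sum_ite_eq hc hd (fun i j => i < j ∧ j ≠ inv n i)
        (fun i j => Polynomial.eval z _ • bb K n i j)]
      simp
  · split_ifs with h
    · refine Finset.sum_congr rfl fun i _ => ?_
      rw [Finset.sum_eq_single_of_mem c (Finset.mem_Icc.2 hc)]
      · simp [h]
      · intro b _ hb
        simp [hb]
    · refine Finset.sum_eq_zero fun i _ => Finset.sum_eq_zero fun j _ => if_neg ?_
      rintro ⟨rfl, rfl⟩
      exact h rfl

theorem Rhat_isStandard {r s : K} (hr : r ≠ 0) (z : K) :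
    IsStandard (Rhat r s n z) (r⁻¹ * s) (r * s) z (xi r s n) (tConst r s n) := by
  have hq : r ^ (-2 : ℤ) * s ^ 2 = (r⁻¹ * s) ^ 2 := by
    rw [zpow_neg, zpow_ofNat, mul_pow, inv_pow]
  constructor
  · intro c hc h
    have h1 := hc.1
    have h2 := hc.2
    rw [Rhat_apply_bb r s z hc hc]
    unfold inv
    simp (disch := omega) only [if_pos, if_neg, if_true, lt_irrefl, false_and, if_false, hq]
    simp [h]
  · intro c d hc hd h h'
    have h1 := hc.1
    have h2 := hc.2
    have h3 := hd.1
    have h4 := hd.2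
    have e : (aCoeff r s n d c).eval z = exchCoef (r⁻¹ * s) (r * s) z (xi r s n) n c d := by
      unfold aCoeff exchCoef aExp
      split_ifs <;> simp
    rw [Rhat_apply_bb r s z hc hd, e, diagCoef]
    unfold inv at *
    obtain h5 | h5 : c < d ∨ d < c := by omega
    · simp (disch := omega) only [if_pos, if_neg, hq]
      module
    · simp (disch := omega) only [if_pos, if_neg, hq]
      module
  · intro c hc
    have h1 := hc.1
    have h2 := hc.2
    rw [Rhat_apply_bb r s z hc hc.inv]
    unfold inv
    simp (disch := omega) only [if_neg, if_true, zero_add]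
    refine Finset.sum_congr rfl fun i _ => ?_
    congr 1
    unfold bCoeff conjCoef
    rw [hq]
    unfold inv
    split_ifs <;> simp

/-- The composition of the flip with the relabelling `v_k ↦ v_{k'}` in both factors. -/
noncomputable def flipInv (K : Type*) [Field K] (n : ℕ) : Module.End K (V K n ⊗[K] V K n) :=
  TensorProduct.map (∑ k ∈ Finset.Icc 1 (2 * n + 1), E K n (inv n k) k)
    (∑ k ∈ Finset.Icc 1 (2 * n + 1), E K n (inv n k) k) ∘ₗ
      (TensorProduct.comm K (V K n) (V K n)).toLinearMap

theorem sum_E_inv_apply_bv {k : ℕ} (hk : InRange n k) :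
    (∑ k ∈ Finset.Icc 1 (2 * n + 1), E K n (inv n k) k) (bv K n k) = bv K n (inv n k) := by
  rw [LinearMap.sum_apply, Finset.sum_eq_single_of_mem k (Finset.mem_Icc.2 hk)]
  · simp [E_apply_bv _ _ hk]
  · intro b _ hb
    simp [E_apply_bv _ _ hk, hb]

theorem flipInv_apply_bb {j k : ℕ} (hj : InRange n j) (hk : InRange n k) :
    flipInv K n (bb K n j k) = bb K n (inv n k) (inv n j) := by
  rw [flipInv, bb, LinearMap.comp_apply, LinearEquiv.coe_coe, TensorProduct.comm_tmul,
    TensorProduct.map_tmul, sum_E_inv_apply_bv hj, sum_E_inv_apply_bv hk, bb]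

theorem flipInv_flipInv : flipInv K n * flipInv K n = 1 :=
  linearMap_ext₂ fun j k hj hk => by
    rw [Module.End.mul_apply, flipInv_apply_bb hj hk, flipInv_apply_bb hk.inv hj.inv, hj.inv_inv,
      hk.inv_inv, Module.End.one_apply]

theorem aExp_inv (n c d : ℕ) (hc : InRange n c) (hd : InRange n d) (h : c ≠ d)
    (h' : d ≠ inv n c) : aExp n (inv n c) (inv n d) = -aExp n d c := by
  obtain ⟨h1, h2⟩ := hc
  obtain ⟨h3, h4⟩ := hd
  unfold aExp sgn inv at *
  split_ifs <;> omega

/-- `v_c ⊗ v_d` goes to `v_{d'} ⊗ v_{c'}`. The order of the two letters is preserved, hence so are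
the diagonal coefficients; each `v_{i'} ⊗ v_i` is fixed, hence so is the conjugate block; the
exponents of the exchange coefficients change sign, which inverts `m`. -/
theorem IsStandard.flipInv {T : Module.End K (V K n ⊗[K] V K n)} {ρ m z ξ : K} {t : ℕ → K}
    (hT : IsStandard T ρ m z ξ t) :
    IsStandard (flipInv K n * T * flipInv K n) ρ m⁻¹ z ξ t := by
  constructor
  · intro c hc h
    have h1 := hc.1
    have h2 := hc.2
    rw [Module.End.mul_apply, Module.End.mul_apply, flipInv_apply_bb hc hc,
      hT.self _ hc.inv (by unfold inv; omega), map_smul, flipInv_apply_bb hc.inv hc.inv, hc.inv_inv]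
  · intro c d hc hd h h'
    have h1 := hc.1
    have h2 := hc.2
    have h3 := hd.1
    have h4 := hd.2
    rw [Module.End.mul_apply, Module.End.mul_apply, flipInv_apply_bb hc hd,
      hT.of_ne _ _ hd.inv hc.inv (by unfold inv at *; omega) (by unfold inv at *; omega), map_add,
      map_smul, map_smul, flipInv_apply_bb hc.inv hd.inv, flipInv_apply_bb hd.inv hc.inv,
      hc.inv_inv, hd.inv_inv]
    congr 2
    · unfold exchCoef
      rw [aExp_inv n c d hc hd h h', zpow_neg, inv_zpow]
    · unfold diagCoef
      congr 1
      unfold inv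
      split_ifs <;> first | rfl | omega
  · intro c hc
    rw [Module.End.mul_apply, Module.End.mul_apply, flipInv_apply_bb hc hc.inv, hc.inv_inv,
      hT.conj c hc, map_sum]
    refine Finset.sum_congr rfl fun i hi => ?_
    have hi := Finset.mem_Icc.1 hi
    rw [map_smul, flipInv_apply_bb (InRange.inv hi) hi, InRange.inv_inv hi]

end RData

/-! ## Intertwining relations in terms of coefficients -/

section Intertwine

variable {K : Type*} [Field K] {n : ℕ}

/-- `x (e ⊗ 1) + y (w ⊗ e)`. -/
noncomputable def skewOp (x y : K) (w e : Module.End K (V K n)) :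
    Module.End K (V K n ⊗[K] V K n) :=
  x • TensorProduct.map e 1 + y • TensorProduct.map w e

theorem skewOp_apply_bb (x y : K) {w e : Module.End K (V K n)} {W : ℕ → K}
    (hw : ∀ k, InRange n k → w (bv K n k) = W k • bv K n k) {c : ℕ} (hc : InRange n c) (d : ℕ) :
    skewOp x y w e (bb K n c d) =
      x • (e (bv K n c) ⊗ₜ bv K n d) + (y * W c) • (bv K n c ⊗ₜ e (bv K n d)) := by
  rw [skewOp, bb, LinearMap.add_apply, LinearMap.smul_apply, LinearMap.smul_apply,
    TensorProduct.map_tmul, TensorProduct.map_tmul, hw c hc, ← TensorProduct.smul_tmul', mul_smul,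
    Module.End.one_apply]

/-- Half of the conditions for an operator with coefficients `A, D, B, S` to intertwine
`x (e ⊗ 1) + w ⊗ e` with `e ⊗ 1 + x (w ⊗ e)`, where `e` maps `v_q` to `α v_p` and `v_P` to `β v_Q`,
and `P = p'`, `Q = q'`. -/
structure LongHalf (A D B : ℕ → ℕ → K) (S : K) (W : ℕ → K) (x : K) (n p q P Q : ℕ) (α β : K) :
    Prop where
  exch_left (k : ℕ) (hk : InRange n k) (h : k ≠ p ∧ k ≠ q ∧ k ≠ P ∧ k ≠ Q) :
    A p k = W k * A q k
  diag_left (k : ℕ) (hk : InRange n k) (h : k ≠ p ∧ k ≠ q ∧ k ≠ P ∧ k ≠ Q) :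
    x * D p k = D q k
  exch_right (k : ℕ) (hk : InRange n k) (h : k ≠ p ∧ k ≠ q ∧ k ≠ P ∧ k ≠ Q) :
    W k * A k p = A k q
  diag_right (k : ℕ) (hk : InRange n k) (h : k ≠ p ∧ k ≠ q ∧ k ≠ P ∧ k ≠ Q) :
    D k p = x * D k q
  qq : x * D p q + W q * A q p = S
  qq' : x * A p q + W q * D q p = x * W q * S
  qp : x * S = x * W p * A q p + D q p
  pq : W p * S = A p q + x * W p * D p q
  conj (j : ℕ) (hj : InRange n j) (h : j ≠ p ∧ j ≠ q ∧ j ≠ P ∧ j ≠ Q) :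
    β * B p j + x * W Q * α * B q j = 0
  qP (i : ℕ) (hi : InRange n i) (h : i ≠ p ∧ i ≠ q ∧ i ≠ P ∧ i ≠ Q) :
    x * α * B i p + W q * β * B i q = 0
  qP_q : x * α * B q p + W q * β * B q q = A q P * β
  qP_p : x * α * B p p + W q * β * B p q = A q P * (x * W P * α)
  qP_P : x * α * B P p + W q * β * B P q = D q P * α
  qP_Q : x * α * B Q p + W q * β * B Q q = D q P * (x * W q * β)
  qQ : x * α * A p Q = β * B p q + x * W Q * α * B q q
  qQ' : x * α * D p Q = x * W p * β * B P q + α * B Q q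
  Qq : W Q * α * D Q p = β * B p Q + x * W Q * α * B q Q
  Qq' : W Q * α * A Q p = x * W p * β * B P Q + α * B Q Q

/-- The combinatorial situation of the vertices `i < n`. -/
structure LongIndices (n p q P Q : ℕ) : Prop where
  hp : InRange n p
  hq : InRange n q
  hP : InRange n P
  hQ : InRange n Q
  invp : P = inv n p
  invq : Q = inv n q
  invP : p = inv n P
  invQ : q = inv n Q
  ne : p ≠ q ∧ p ≠ P ∧ p ≠ Q ∧ q ≠ P ∧ q ≠ Q ∧ P ≠ Q

theorem LongIndices.swap {p q P Q : ℕ} (h : LongIndices n p q P Q) : LongIndices n Q P q p := by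
  obtain ⟨h1, h2, h3, h4, h5, h6, h7, h8, h9⟩ := h
  exact ⟨h4, h3, h2, h1, h8, h7, h6, h5, by omega⟩

/-- `e` maps `v_q` to `α v_p`, `v_P` to `β v_Q`, and the other basis vectors to zero. -/
structure IsLongRoot (e : Module.End K (V K n)) (p q P Q : ℕ) (α β : K) : Prop where
  left : e (bv K n q) = α • bv K n p
  right : e (bv K n P) = β • bv K n Q
  other (k : ℕ) (hk : InRange n k) (h : k ≠ q) (h' : k ≠ P) : e (bv K n k) = 0

theorem IsLongRoot.swap {e : Module.End K (V K n)} {p q P Q : ℕ} {α β : K}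
    (h : IsLongRoot e p q P Q α β) : IsLongRoot e Q P q p β α :=
  ⟨h.right, h.left, fun k hk h1 h2 => h.other k hk h2 h1⟩

theorem sum_eq_four {M : Type*} [AddCommMonoid M] (G : ℕ → M) {p q P Q : ℕ}
    (hI : LongIndices n p q P Q)
    (hG : ∀ i, InRange n i → i ≠ p ∧ i ≠ q ∧ i ≠ P ∧ i ≠ Q → G i = 0) :
    ∑ i ∈ Finset.Icc 1 (2 * n + 1), G i = G p + G q + G P + G Q := by
  obtain ⟨h1, h2, h3, h4, -, -, -, -, h9⟩ := hI
  have hs : ({p, q, P, Q} : Finset ℕ) ⊆ Finset.Icc 1 (2 * n + 1) := by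
    intro i hi
    simp only [Finset.mem_insert, Finset.mem_singleton] at hi
    rcases hi with rfl | rfl | rfl | rfl <;> exact Finset.mem_Icc.2 ‹_›
  rw [← Finset.sum_subset hs]
  · rw [Finset.sum_insert, Finset.sum_insert, Finset.sum_insert, Finset.sum_singleton]
    · simp only [add_assoc]
    all_goals simp only [Finset.mem_insert, Finset.mem_singleton]; omega
  · intro i hi hi'
    simp only [Finset.mem_insert, Finset.mem_singleton, not_or] at hi'
    exact hG i (Finset.mem_Icc.1 hi) hi'

section Long

variable {T : Module.End K (V K n ⊗[K] V K n)} {A D B : ℕ → ℕ → K} {S : K}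
  {w e : Module.End K (V K n)} {W : ℕ → K} {p q P Q : ℕ} {x α β : K}

/-- On the span of the `v_{i'} ⊗ v_i` only the four indices `p, q, P, Q` are moved, and all of them
land on `v_Q ⊗ v_p` and `v_p ⊗ v_Q`. -/
theorem skewOp_sum_long (y : K) (hw : ∀ k, InRange n k → w (bv K n k) = W k • bv K n k)
    (he : IsLongRoot e p q P Q α β) (hI : LongIndices n p q P Q) (f : ℕ → K) :
    skewOp y x w e (∑ i ∈ Finset.Icc 1 (2 * n + 1), f i • bb K n (inv n i) i) =
      (y * β * f p + x * W Q * α * f q) • bb K n Q p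
        + (x * W p * β * f P + y * α * f Q) • bb K n p Q := by
  obtain ⟨h1, h2, h3, h4, h5, h6, h7, h8, h9⟩ := id hI
  rw [map_sum, sum_eq_four _ hI]
  · simp only [map_smul]
    rw [skewOp_apply_bb _ _ hw h1.inv, skewOp_apply_bb _ _ hw h2.inv, skewOp_apply_bb _ _ hw h3.inv,
      skewOp_apply_bb _ _ hw h4.inv, ← h5, ← h6, ← h7, ← h8, he.left, he.right,
      he.other p h1 (by omega) (by omega), he.other Q h4 (by omega) (by omega)]
    simp only [bb, TensorProduct.smul_tmul, TensorProduct.tmul_smul, TensorProduct.zero_tmul,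
      TensorProduct.tmul_zero]
    module
  · intro i hi h
    have h10 := hi.1
    have h11 := hi.2
    rw [map_smul, skewOp_apply_bb _ _ hw hi.inv, he.other i hi (by omega) (by omega),
      he.other (inv n i) hi.inv (by unfold inv at *; omega) (by unfold inv at *; omega)]
    simp

/-- The basis vectors on which `e` acts contain `v_q` or `v_P`. This half treats those with `v_q` in
front, or with `v_q` behind and a first letter other than `v_P`; the rest follow by the symmetry
exchanging `(p, q, α)` and `(Q, P, β)`. Comparing coefficients of basis vectors gives the fields of
`LongHalf`. -/
theorem RData.intertwine_half (hT : RData T A D B S)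
    (hw : ∀ k, InRange n k → w (bv K n k) = W k • bv K n k)
    (he : IsLongRoot e p q P Q α β) (hI : LongIndices n p q P Q)
    (hC : LongHalf A D B S W x n p q P Q α β) {c d : ℕ} (hc : InRange n c) (hd : InRange n d)
    (hcd : c = q ∨ c ≠ P ∧ d = q) :
    T (skewOp x 1 w e (bb K n c d)) = skewOp 1 x w e (T (bb K n c d)) := by
  obtain ⟨h1, h2, h3, h4, h5, h6, h7, h8, h9⟩ := id hI
  have ep := he.other p h1 (by omega) (by omega)
  have eQ := he.other Q h4 (by omega) (by omega)
  have L1 : ∀ y z : K, ∀ d, InRange n d → d ≠ q → d ≠ P →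
      skewOp y z w e (bb K n q d) = (y * α) • bb K n p d := fun y z d hd h h' => by
    rw [skewOp_apply_bb _ _ hw h2, he.left, he.other d hd h h']
    simp [bb, TensorProduct.smul_tmul', mul_smul]
  have L2 : ∀ y z : K, ∀ d, InRange n d → d ≠ q → d ≠ P →
      skewOp y z w e (bb K n d q) = (z * W d * α) • bb K n d p := fun y z d hd h h' => by
    rw [skewOp_apply_bb _ _ hw hd, he.left, he.other d hd h h']
    simp [bb, mul_smul]
  have L3 : ∀ y z : K, skewOp y z w e (bb K n q q) =
      (y * α) • bb K n p q + (z * W q * α) • bb K n q p := fun y z => by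
    rw [skewOp_apply_bb _ _ hw h2, he.left]
    simp [bb, TensorProduct.smul_tmul', mul_smul]
  have L4 : ∀ y z : K, skewOp y z w e (bb K n q P) =
      (y * α) • bb K n p P + (z * W q * β) • bb K n q Q := fun y z => by
    rw [skewOp_apply_bb _ _ hw h2, he.left, he.right]
    simp [bb, TensorProduct.smul_tmul', mul_smul]
  have L5 : ∀ y z : K, skewOp y z w e (bb K n P q) =
      (y * β) • bb K n Q q + (z * W P * α) • bb K n P p := fun y z => by
    rw [skewOp_apply_bb _ _ hw h3, he.left, he.right]
    simp [bb, TensorProduct.smul_tmul', mul_smul]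
  have hconj : ∀ c d, InRange n c → d = inv n c →
      T (bb K n c d) = ∑ i ∈ Finset.Icc 1 (2 * n + 1), B i c • bb K n (inv n i) i := by
    rintro c d hc rfl
    exact hT.conj c hc
  have h10 := hc.1
  have h11 := hc.2
  by_cases hcd' : c = q ∧ d = q
  · obtain ⟨rfl, rfl⟩ := hcd'
    rw [hT.self _ hc (by unfold inv at *; omega), map_smul, L3, L3, map_add, map_smul, map_smul,
      hT.of_ne _ _ h1 h2 (by omega) (by omega), hT.of_ne _ _ h2 h1 (by omega) (by omega)]
    linear_combination (norm := module) (α * hC.qq) • bb K n p d + (α * hC.qq') • bb K n d p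
  obtain ⟨rfl, hdq⟩ | ⟨hcq, hcP, rfl⟩ : c = q ∧ d ≠ q ∨ c ≠ q ∧ c ≠ P ∧ d = q := by omega
  · by_cases hdP : d = P
    -- `v_q ⊗ v_P` is not a conjugate pair, but its image under the skew operator consists of `v_p ⊗
    -- v_P` and `v_q ⊗ v_Q`, which are; `T` then spreads it over all `v_{i'} ⊗ v_i`.
    · subst hdP
      rw [hT.of_ne _ _ h2 h3 (by omega) (by omega), map_add, map_smul, map_smul, L4, L4, L5,
        map_add, map_smul, map_smul, hconj _ _ h1 h5, hconj _ _ h2 h6, Finset.smul_sum,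
        Finset.smul_sum, ← Finset.sum_add_distrib, sum_eq_four _ hI, ← h5, ← h6, ← h7, ← h8]
      · linear_combination (norm := module) hC.qP_q • bb K n Q c + hC.qP_p • bb K n d p
          + hC.qP_P • bb K n p d + hC.qP_Q • bb K n c Q
      · intro i hi h
        linear_combination (norm := module) (hC.qP i hi h) • bb K n (inv n i) i
    rw [L1 _ _ d hd hdq hdP, map_smul]
    by_cases hdp : d = p
    · subst hdp
      rw [hT.self _ hd (by unfold inv at *; omega), hT.of_ne _ _ h2 h1 (by omega) (by omega),
        map_add, map_smul, map_smul, L1 _ _ d h1 hdq hdP, L2 _ _ d h1 hdq hdP]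
      linear_combination (norm := module) (α * hC.qp) • bb K n d d
    by_cases hdQ : d = Q
    -- Here the vector itself is a conjugate pair: `T` spreads it over the whole conjugate block,
    -- and the skew operator brings that block back to two vectors.
    · subst hdQ
      rw [hconj _ _ h2 h6, skewOp_sum_long 1 hw he hI, hT.of_ne _ _ h1 h4 (by omega) (by omega)]
      linear_combination (norm := module) hC.qQ • bb K n d p + hC.qQ' • bb K n p d
    rw [hT.of_ne _ _ h1 hd (by omega) (by omega), hT.of_ne _ _ h2 hd (by omega) (by omega),
      map_add, map_smul, map_smul, L1 _ _ d hd hdq hdP, L2 _ _ d hd hdq hdP]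
    linear_combination (norm := module) (x * α * hC.exch_left d hd ⟨hdp, hdq, hdP, hdQ⟩) • bb K n d p
      + (α * hC.diag_left d hd ⟨hdp, hdq, hdP, hdQ⟩) • bb K n p d
  · rw [L2 _ _ c hc hcq hcP, map_smul]
    by_cases hcp : c = p
    · subst hcp
      rw [hT.self _ hc (by unfold inv at *; omega), hT.of_ne _ _ h1 h2 (by omega) (by omega),
        map_add, map_smul, map_smul, L1 _ _ c h1 hcq hcP, L2 _ _ c h1 hcq hcP]
      linear_combination (norm := module) (α * hC.pq) • bb K n c c
    by_cases hcQ : c = Q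
    · subst hcQ
      rw [hconj _ _ h4 h8, skewOp_sum_long 1 hw he hI, hT.of_ne _ _ h4 h1 (by omega) (by omega)]
      linear_combination (norm := module) hC.Qq • bb K n c p + hC.Qq' • bb K n p c
    rw [hT.of_ne _ _ hc h1 (by omega) (by unfold inv at *; omega),
      hT.of_ne _ _ hc h2 (by omega) (by unfold inv at *; omega),
      map_add, map_smul, map_smul, L1 _ _ c hc hcq hcP, L2 _ _ c hc hcq hcP]
    linear_combination (norm := module) (α * hC.exch_right c hc ⟨hcp, hcq, hcP, hcQ⟩) • bb K n p c
      + (α * W c * hC.diag_right c hc ⟨hcp, hcq, hcP, hcQ⟩) • bb K n c p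

/-- Vectors containing `v_q` or `v_P` are covered by the two halves. On the others the left side is
zero, and the right side can be nonzero only for conjugate pairs, where the two conditions `conj`
make it vanish. -/
theorem RData.intertwine_long (hT : RData T A D B S)
    (hw : ∀ k, InRange n k → w (bv K n k) = W k • bv K n k)
    (he : IsLongRoot e p q P Q α β) (hI : LongIndices n p q P Q)
    (hC : LongHalf A D B S W x n p q P Q α β) (hC' : LongHalf A D B S W x n Q P q p β α) :
    T * skewOp x 1 w e = skewOp 1 x w e * T := by
  refine linearMap_ext₂ fun c d hc hd => ?_
  rw [Module.End.mul_apply, Module.End.mul_apply]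
  by_cases h1 : c = q ∨ c ≠ P ∧ d = q
  · exact hT.intertwine_half hw he hI hC hc hd h1
  by_cases h2 : c = P ∨ c ≠ q ∧ d = P
  · exact hT.intertwine_half hw he.swap hI.swap hC' hc hd h2
  obtain ⟨h1, h2⟩ : (c ≠ q ∧ d ≠ q) ∧ (c ≠ P ∧ d ≠ P) := by omega
  have hz : ∀ y z : K, ∀ c d, InRange n c → InRange n d → c ≠ q → d ≠ q → c ≠ P → d ≠ P →
      skewOp y z w e (bb K n c d) = 0 := fun y z c d hc hd h1 h2 h3 h4 => by
    rw [skewOp_apply_bb _ _ hw hc, he.other c hc h1 h3, he.other d hd h2 h4]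
    simp
  rw [hz _ _ c d hc hd h1.1 h1.2 h2.1 h2.2, map_zero]
  have h10 := hc.1
  have h11 := hc.2
  by_cases h3 : d = inv n c
  · subst h3
    obtain ⟨h1, h2, h3, h4, h5, h6, h7, h8, h9⟩ := id hI
    have h12 : c ≠ p ∧ c ≠ q ∧ c ≠ P ∧ c ≠ Q := by unfold inv at *; omega
    rw [hT.conj c hc, skewOp_sum_long 1 hw he hI]
    linear_combination (norm := module) -(hC.conj c hc h12) • bb K n Q p
      - (hC'.conj c hc (by omega)) • bb K n p Q
  by_cases h4 : c = d
  · subst h4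
    rw [hT.self c hc (by unfold inv at *; omega), map_smul, hz _ _ c c hc hc h1.1 h1.2 h2.1 h2.2,
      smul_zero]
  · rw [hT.of_ne c d hc hd h4 h3, map_add, map_smul, map_smul,
      hz _ _ c d hc hd h1.1 h1.2 h2.1 h2.2, hz _ _ d c hd hc h1.2 h1.1 h2.2 h2.1]
    simp

end Long

/-- The conditions for an operator with coefficients `A, D, B, S` to commute with `e ⊗ 1 + w ⊗ e`,
where `e` maps `v_m` to `α v_p` and `v_P` to `β v_m`, with `P = p'` and `m = n + 1`. -/
structure ShortConds (A D B : ℕ → ℕ → K) (S : K) (W : ℕ → K) (n p m P : ℕ) (α β : K) :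
    Prop where
  left_k (k : ℕ) (hk : InRange n k) (h : k ≠ p ∧ k ≠ m ∧ k ≠ P) : A p k = W k * A m k ∧ D p k = D m k
  km (k : ℕ) (hk : InRange n k) (h : k ≠ p ∧ k ≠ m ∧ k ≠ P) : W k * A k p = A k m ∧ D k p = D k m
  Pk (k : ℕ) (hk : InRange n k) (h : k ≠ p ∧ k ≠ m ∧ k ≠ P) : A m k = A P k * W k ∧ D m k = D P k
  kP (k : ℕ) (hk : InRange n k) (h : k ≠ p ∧ k ≠ m ∧ k ≠ P) : W k * A k m = A k P ∧ D k m = D k P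
  conj (j : ℕ) (hj : InRange n j) (h : j ≠ p ∧ j ≠ m ∧ j ≠ P) :
    β * B p j + α * B m j = 0 ∧ α * B m j + W p * β * B P j = 0
  mm : α * (A p m + D m p) = β * B p m + α * B m m
  mm' : α * (D p m + A m p) = α * B m m + W p * β * B P m
  mp : S = A m p * W p + D m p
  pm : W p * S = A p m + D p m * W p
  mP (i : ℕ) (hi : InRange n i) (h : i ≠ p ∧ i ≠ m ∧ i ≠ P) : α * B i p + β * B i m = 0
  mP_P : α * B P p + β * B P m = D m P * α
  mP_m : α * B m p + β * B m m = (A m P + D m P) * β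
  mP_p : α * B p p + β * B p m = A m P * W P * α
  Pm (i : ℕ) (hi : InRange n i) (h : i ≠ p ∧ i ≠ m ∧ i ≠ P) : β * B i m + W P * α * B i P = 0
  Pm_P : β * B P m + W P * α * B P P = A P m * α
  Pm_m : β * B m m + W P * α * B m P = (A P m + D P m) * β
  Pm_p : β * B p m + W P * α * B p P = D P m * W P * α
  PP : D m P + W P * A P m = S
  PP' : A m P + W P * D P m = W P * S
  pP : W p * β * A p m = β * B p p + α * B m p
  pP' : W p * β * D p m = α * B m p + W p * β * B P p
  Pp : β * D m p = β * B p P + α * B m P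
  Pp' : β * A m p = α * B m P + W p * β * B P P

section Short

variable {T : Module.End K (V K n ⊗[K] V K n)} {A D B : ℕ → ℕ → K} {S : K}
  {w e : Module.End K (V K n)} {W : ℕ → K} {p m P : ℕ} {α β : K}

theorem sum_eq_three {M : Type*} [AddCommMonoid M] (G : ℕ → M) (hp : InRange n p)
    (hP : InRange n P) (hm : InRange n m) (h : p ≠ m ∧ p ≠ P ∧ m ≠ P)
    (hG : ∀ i, InRange n i → i ≠ p ∧ i ≠ m ∧ i ≠ P → G i = 0) :
    ∑ i ∈ Finset.Icc 1 (2 * n + 1), G i = G p + G m + G P := by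
  have hs : ({p, m, P} : Finset ℕ) ⊆ Finset.Icc 1 (2 * n + 1) := by
    intro i hi
    simp only [Finset.mem_insert, Finset.mem_singleton] at hi
    rcases hi with rfl | rfl | rfl <;> exact Finset.mem_Icc.2 ‹_›
  rw [← Finset.sum_subset hs]
  · rw [Finset.sum_insert, Finset.sum_insert, Finset.sum_singleton]
    · simp only [add_assoc]
    all_goals simp only [Finset.mem_insert, Finset.mem_singleton]; omega
  · intro i hi hi'
    simp only [Finset.mem_insert, Finset.mem_singleton, not_or] at hi'
    exact hG i (Finset.mem_Icc.1 hi) hi'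

/-- The short root is treated separately because its middle vector `v_m` is self-conjugate: `v_m ⊗
v_m` belongs to the conjugate block, and `e` acts along a chain `v_P → v_m → v_p` instead of on two
disjoint pairs. No spectral parameter occurs at this node. -/
theorem RData.intertwine_short (hT : RData T A D B S)
    (hw : ∀ k, InRange n k → w (bv K n k) = W k • bv K n k) (hm : m = n + 1)
    (he : IsLongRoot e p m P m α β) (h1 : InRange n p) (hpm : p ≠ n + 1) (hP : P = inv n p)
    (hW : W m = 1) (hC : ShortConds A D B S W n p m P α β) :
    T * skewOp 1 1 w e = skewOp 1 1 w e * T := by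
  refine linearMap_ext₂ fun c d hc hd => ?_
  rw [Module.End.mul_apply, Module.End.mul_apply]
  have h2 : InRange n m := by subst hm; constructor <;> omega
  have h3 : InRange n P := hP ▸ h1.inv
  have b1 := h1.1
  have b2 := h1.2
  have b3 := hc.1
  have b4 := hc.2
  have b5 := hd.1
  have b6 := hd.2
  have hmm : m = inv n m := by unfold inv at *; omega
  have hp : p = inv n P := by unfold inv at *; omega
  have hne : p ≠ m ∧ p ≠ P ∧ m ≠ P := by unfold inv at *; omega
  set L := skewOp 1 1 w e with hL
  have L0 : ∀ c d, InRange n c → InRange n d → c ≠ m → d ≠ m → c ≠ P → d ≠ P →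
      L (bb K n c d) = 0 := fun c d hc hd h1 h2 h3 h4 => by
    rw [hL, skewOp_apply_bb _ _ hw hc, he.other c hc h1 h3, he.other d hd h2 h4]
    simp
  have Lmk : ∀ d, InRange n d → d ≠ m → d ≠ P → L (bb K n m d) = α • bb K n p d :=
    fun d hd h h' => by
    rw [hL, skewOp_apply_bb _ _ hw h2, he.left, he.other d hd h h']
    simp [bb, TensorProduct.smul_tmul']
  have Lkm : ∀ d, InRange n d → d ≠ m → d ≠ P → L (bb K n d m) = (W d * α) • bb K n d p :=
    fun d hd h h' => by
    rw [hL, skewOp_apply_bb _ _ hw hd, he.left, he.other d hd h h']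
    simp [bb, mul_smul]
  have LPk : ∀ d, InRange n d → d ≠ m → d ≠ P → L (bb K n P d) = β • bb K n m d :=
    fun d hd h h' => by
    rw [hL, skewOp_apply_bb _ _ hw h3, he.right, he.other d hd h h']
    simp [bb, TensorProduct.smul_tmul']
  have LkP : ∀ d, InRange n d → d ≠ m → d ≠ P → L (bb K n d P) = (W d * β) • bb K n d m :=
    fun d hd h h' => by
    rw [hL, skewOp_apply_bb _ _ hw hd, he.right, he.other d hd h h']
    simp [bb, mul_smul]
  have Lmm : L (bb K n m m) = α • bb K n p m + α • bb K n m p := by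
    rw [hL, skewOp_apply_bb _ _ hw h2, he.left, hW]
    simp [bb, TensorProduct.smul_tmul']
  have LPP : L (bb K n P P) = β • bb K n m P + (W P * β) • bb K n P m := by
    rw [hL, skewOp_apply_bb _ _ hw h3, he.right]
    simp [bb, TensorProduct.smul_tmul', mul_smul]
  have LmP : L (bb K n m P) = α • bb K n p P + β • bb K n m m := by
    rw [hL, skewOp_apply_bb _ _ hw h2, he.left, he.right, hW]
    simp [bb, TensorProduct.smul_tmul']
  have LPm : L (bb K n P m) = β • bb K n m m + (W P * α) • bb K n P p := by
    rw [hL, skewOp_apply_bb _ _ hw h3, he.left, he.right]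
    simp [bb, TensorProduct.smul_tmul', mul_smul]
  have hconj : ∀ c d, InRange n c → d = inv n c →
      T (bb K n c d) = ∑ i ∈ Finset.Icc 1 (2 * n + 1), B i c • bb K n (inv n i) i := by
    rintro c d hc rfl
    exact hT.conj c hc
  -- In the conjugate block only `i = p, m, P` are moved, and the results lie on `v_m ⊗ v_p` and
  -- `v_p ⊗ v_m`.
  have Lsum : ∀ f : ℕ → K, L (∑ i ∈ Finset.Icc 1 (2 * n + 1), f i • bb K n (inv n i) i) =
      (β * f p + α * f m) • bb K n m p + (α * f m + W p * β * f P) • bb K n p m := fun f => by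
    rw [map_sum, sum_eq_three _ h1 h3 h2 hne]
    · rw [map_smul, map_smul, map_smul, ← hP, ← hmm, ← hp, Lmm, LPk p h1 hne.1 hne.2.1,
        LkP p h1 hne.1 hne.2.1]
      module
    · intro i hi h
      have h10 := hi.1
      have h11 := hi.2
      rw [map_smul, L0 _ _ hi.inv hi (by unfold inv at *; omega) (by omega)
        (by unfold inv at *; omega) (by omega), smul_zero]
  have Tne : ∀ c d, InRange n c → InRange n d → c ≠ d → d ≠ inv n c →
      T (bb K n c d) = A c d • bb K n d c + D c d • bb K n c d := hT.of_ne
  have sum3 : ∀ f g : ℕ → K, (∀ i, InRange n i → i ≠ p ∧ i ≠ m ∧ i ≠ P → f i + g i = 0) →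
      (∑ i ∈ Finset.Icc 1 (2 * n + 1), f i • bb K n (inv n i) i) +
        ∑ i ∈ Finset.Icc 1 (2 * n + 1), g i • bb K n (inv n i) i =
      (f p + g p) • bb K n P p + (f m + g m) • bb K n m m + (f P + g P) • bb K n p P :=
    fun f g h => by
    rw [← Finset.sum_add_distrib, sum_eq_three _ h1 h3 h2 hne, ← hP, ← hmm, ← hp]
    · module
    · intro i hi h'
      rw [← add_smul, h i hi h', zero_smul]
  have npm : m ≠ inv n p := by omega
  have nmp : p ≠ inv n m := by omega
  have nmP : P ≠ inv n m := by omega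
  have nPm : m ≠ inv n P := by omega
  by_cases hcm : c = m
  · subst hcm
    by_cases hdm : d = c
    · subst hdm
      rw [hconj d d h2 hmm, Lsum, Lmm, map_add, map_smul, map_smul,
        Tne p d h1 h2 hne.1 npm, Tne d p h2 h1 hne.1.symm nmp]
      linear_combination (norm := module) hC.mm • bb K n d p + hC.mm' • bb K n p d
    by_cases hdP : d = P
    · subst hdP
      rw [Tne c d h2 h3 hne.2.2 nmP, map_add, map_smul, map_smul, LmP, LPm, map_add, map_smul,
        map_smul, hconj p d h1 hP, hconj c c h2 hmm, Finset.smul_sum, Finset.smul_sum]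
      simp only [smul_smul]
      rw [sum3 _ _ hC.mP]
      linear_combination (norm := module) hC.mP_P • bb K n p d + hC.mP_m • bb K n c c
        + hC.mP_p • bb K n d p
    rw [Lmk d hd hdm hdP, map_smul]
    by_cases hdp : d = p
    · subst hdp
      rw [hT.self d h1 hpm, Tne c d h2 h1 hne.1.symm nmp, map_add, map_smul, map_smul,
        Lmk d hd hdm hdP, Lkm d hd hdm hdP]
      linear_combination (norm := module) (α * hC.mp) • bb K n d d
    have nn := hC.left_k d hd ⟨hdp, hdm, hdP⟩
    rw [Tne p d h1 hd (Ne.symm hdp) (by omega), Tne c d h2 hd (Ne.symm hdm) (by omega), map_add,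
      map_smul, map_smul, Lmk d hd hdm hdP, Lkm d hd hdm hdP]
    linear_combination (norm := module) (α * nn.1) • bb K n d p + (α * nn.2) • bb K n p d
  by_cases hcP : c = P
  · subst hcP
    by_cases hdm : d = m
    · subst hdm
      rw [Tne c d h3 h2 hne.2.2.symm nPm, map_add, map_smul, map_smul, LmP, LPm, map_add, map_smul,
        map_smul, hconj c p h3 hp, hconj d d h2 hmm, Finset.smul_sum, Finset.smul_sum]
      simp only [smul_smul]
      rw [sum3 _ _ hC.Pm]
      linear_combination (norm := module) hC.Pm_P • bb K n p c + hC.Pm_m • bb K n d d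
        + hC.Pm_p • bb K n c p
    by_cases hdP : d = c
    · subst hdP
      rw [hT.self d h3 (by omega), map_smul, LPP, map_add, map_smul, map_smul,
        Tne m d h2 h3 hne.2.2 nmP, Tne d m h3 h2 hne.2.2.symm nPm]
      linear_combination (norm := module) (β * hC.PP) • bb K n m d + (β * hC.PP') • bb K n d m
    rw [LPk d hd hdm hdP, map_smul]
    by_cases hdp : d = p
    · subst hdp
      rw [hconj c d h3 hp, Lsum, Tne m d h2 h1 hne.1.symm nmp]
      linear_combination (norm := module) hC.Pp • bb K n m d + hC.Pp' • bb K n d m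
    have nn := hC.Pk d hd ⟨hdp, hdm, hdP⟩
    rw [Tne m d h2 hd (Ne.symm hdm) (by omega), Tne c d h3 hd (Ne.symm hdP) (by omega), map_add,
      map_smul, map_smul, LPk d hd hdm hdP, LkP d hd hdm hdP]
    linear_combination (norm := module) (β * nn.1) • bb K n d m + (β * nn.2) • bb K n m d
  by_cases hdm : d = m
  · subst hdm
    rw [Lkm c hc hcm hcP, map_smul]
    by_cases hcp : c = p
    · subst hcp
      rw [hT.self c h1 hpm, Tne c d h1 h2 hne.1 npm, map_add, map_smul, map_smul,
        Lmk c hc hcm hcP, Lkm c hc hcm hcP]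
      linear_combination (norm := module) (α * hC.pm) • bb K n c c
    have nn := hC.km c hc ⟨hcp, hcm, hcP⟩
    rw [Tne c p hc h1 hcp (by unfold inv at *; omega), Tne c d hc h2 hcm (by unfold inv at *; omega),
      map_add, map_smul, map_smul, Lmk c hc hcm hcP, Lkm c hc hcm hcP]
    linear_combination (norm := module) (α * nn.1) • bb K n p c + (W c * α * nn.2) • bb K n c p
  by_cases hdP : d = P
  · subst hdP
    rw [LkP c hc hcm hcP, map_smul]
    by_cases hcp : c = p
    · subst hcp
      rw [hconj c d h1 hP, Lsum, Tne c m h1 h2 hne.1 npm]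
      linear_combination (norm := module) hC.pP • bb K n m c + hC.pP' • bb K n c m
    have nn := hC.kP c hc ⟨hcp, hcm, hcP⟩
    rw [Tne c m hc h2 hcm (by unfold inv at *; omega), Tne c d hc h3 hcP (by unfold inv at *; omega),
      map_add, map_smul, map_smul, LPk c hc hcm hcP, LkP c hc hcm hcP]
    linear_combination (norm := module) (β * nn.1) • bb K n m c + (W c * β * nn.2) • bb K n c m
  rw [L0 c d hc hd hcm hdm hcP hdP, map_zero]
  by_cases h4 : d = inv n c
  · have nn := hC.conj c hc (by unfold inv at *; omega)
    rw [hconj c d hc h4, Lsum, nn.1, nn.2, zero_smul, zero_smul, add_zero]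
  by_cases h5 : c = d
  · subst h5
    rw [hT.self c hc (by omega), map_smul, L0 c c hc hd hcm hdm hcP hdP, smul_zero]
  · rw [Tne c d hc hd h5 h4, map_add, map_smul, map_smul, L0 c d hc hd hcm hdm hcP hdP,
      L0 d c hd hc hdm hcm hdP hcP]
    simp

end Short

end Intertwine

/-! ## The intertwining conditions for the coefficients of `R̂(z)` -/

section Conditions

variable {K : Type*} [Field K] {n : ℕ}

set_option maxHeartbeats 1000000 in
-- The constants `t` enter through the ratios `t_{i+1} / t_i` and `t_{(i+1)'} / t_{i'}`, while `z`
-- and `ξ` are free. The parameter `κ` lets one computation serve both `e_i`, with `κ = 1`, and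
-- `f_i`, with `κ = (r s)²` after the substitution `(r, s) ↦ (s⁻¹, r⁻¹)`.
theorem longHalf_lower {r s z ξ κ : K} {t : ℕ → K} (hr : r ≠ 0) (hs : s ≠ 0) (hκ : κ ≠ 0)
    (ht : ∀ k, t k ≠ 0) {i : ℕ} (hi : 1 ≤ i) (hin : i < n) (α : K)
    (htq : t (i + 1) = s ^ 2 * κ * t i)
    (htQ : t (inv n (i + 1)) = r ^ 2 * κ * t (inv n i)) :
    LongHalf (exchCoef (s / r) (r * s) z ξ n) (diagCoef (s / r) z ξ)
      (conjCoef (s / r) z ξ t n) ((z - (s / r) ^ 2) * (z - ξ)) (omWeight r s n i) 1 n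
      i (i + 1) (inv n i) (inv n (i + 1)) α (-(κ * α)) := by
  have h0 : ∀ k, InRange n k → k ≠ i ∧ k ≠ i + 1 ∧ k ≠ inv n i ∧ k ≠ inv n (i + 1) →
      omWeight r s n i k = 1 := fun k hk h => by
    simp (disch := omega) only [omWeight, if_pos, if_neg]
  have h1 : omWeight r s n i i = r ^ 2 := by
    simp (disch := omega) only [omWeight, if_pos, if_neg, if_true, zpow_ofNat]
  have h2 : omWeight r s n i (i + 1) = s ^ 2 := by
    simp (disch := omega) only [omWeight, if_pos, if_neg, if_true, zpow_ofNat]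
  have h3 : omWeight r s n i (inv n (i + 1)) = (s ^ 2)⁻¹ := by
    unfold omWeight inv
    simp (disch := omega) only [if_pos, if_neg, if_true, zpow_neg, zpow_ofNat]
  have h4 : omWeight r s n i (inv n i) = (r ^ 2)⁻¹ := by
    unfold omWeight inv
    simp (disch := omega) only [if_pos, if_neg, if_true, zpow_neg, zpow_ofNat]
  have T0 := ht i
  have T1 := ht (inv n i)
  -- Away from the four special indices, `v_i` and `v_{i+1}` have the same exchange exponents with
  -- `v_k`, in agreement with `ω_i v_k = v_k`.
  have hex : ∀ k, InRange n k → k ≠ i ∧ k ≠ i + 1 ∧ k ≠ inv n i ∧ k ≠ inv n (i + 1) →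
      aExp n k i = aExp n k (i + 1) ∧ aExp n i k = aExp n (i + 1) k := fun k hk h => by
    obtain ⟨a1, a2⟩ := hk
    unfold aExp sgn inv at *
    constructor <;> split_ifs <;> omega
  constructor
  · intro k hk h
    rw [h0 k hk h, exchCoef, exchCoef, (hex k hk h).1, one_mul]
  · intro k hk h
    have : k < i ↔ k < i + 1 := by omega
    simp only [diagCoef, this, one_mul]
  · intro k hk h
    rw [h0 k hk h, exchCoef, exchCoef, (hex k hk h).2, one_mul]
  · intro k hk h
    have : i < k ↔ i + 1 < k := by omega
    simp only [diagCoef, this, one_mul]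
  · simp only [h1, h2, h3, h4, exchCoef, diagCoef, conjCoef, aExp, sgn]
    unfold inv at *
    simp (disch := omega) only [if_pos, if_neg, if_true, if_false, htq, htQ, mul_neg, neg_mul,
      mul_one, neg_neg, zpow_neg, zpow_one, mul_zero, neg_zero, zpow_zero, sub_zero]
    field_simp
    ring
  · simp only [h1, h2, h3, h4, exchCoef, diagCoef, conjCoef, aExp, sgn]
    unfold inv at *
    simp (disch := omega) only [if_pos, if_neg, if_true, if_false, htq, htQ, mul_neg, neg_mul,
      mul_one, neg_neg, zpow_neg, zpow_one, mul_zero, neg_zero, zpow_zero, sub_zero]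
    field_simp
    ring
  · simp only [h1, h2, h3, h4, exchCoef, diagCoef, conjCoef, aExp, sgn]
    unfold inv at *
    simp (disch := omega) only [if_pos, if_neg, if_true, if_false, htq, htQ, mul_neg, neg_mul,
      mul_one, neg_neg, zpow_neg, zpow_one, mul_zero, neg_zero, zpow_zero, sub_zero]
    field_simp
    ring
  · simp only [h1, h2, h3, h4, exchCoef, diagCoef, conjCoef, aExp, sgn]
    unfold inv at *
    simp (disch := omega) only [if_pos, if_neg, if_true, if_false, htq, htQ, mul_neg, neg_mul,
      mul_one, neg_neg, zpow_neg, zpow_one, mul_zero, neg_zero, zpow_zero, sub_zero]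
    field_simp
    ring
  · intro j hj h
    have T2 := ht j
    rw [h3]
    simp only [conjCoef]
    unfold inv at *
    obtain a | a : j < i ∨ i + 1 < j := by omega
    · simp (disch := omega) only [if_pos, if_neg, if_true, if_false, htq]
      field_simp
      ring
    · simp (disch := omega) only [if_pos, if_neg, if_true, if_false, htq]
      field_simp
      ring
  · intro j hj h
    have T2 := ht j
    rw [h2]
    simp only [conjCoef]
    unfold inv at *
    obtain a | a : j < i ∨ i + 1 < j := by omega
    · simp (disch := omega) only [if_pos, if_neg, if_true, if_false, htq]
      field_simp
      ring
    · simp (disch := omega) only [if_pos, if_neg, if_true, if_false, htq]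
      field_simp
      ring
  · simp only [h1, h2, h3, h4, exchCoef, diagCoef, conjCoef, aExp, sgn]
    unfold inv at *
    simp (disch := omega) only [if_pos, if_neg, if_true, if_false, htq, htQ, mul_neg, neg_mul,
      mul_one, neg_neg, zpow_neg, zpow_one, mul_zero, neg_zero, zpow_zero, sub_zero]
    field_simp
    ring
  · simp only [h1, h2, h3, h4, exchCoef, diagCoef, conjCoef, aExp, sgn]
    unfold inv at *
    simp (disch := omega) only [if_pos, if_neg, if_true, if_false, htq, htQ, mul_neg, neg_mul,
      mul_one, neg_neg, zpow_neg, zpow_one, mul_zero, neg_zero, zpow_zero, sub_zero]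
    field_simp
    ring
  · simp only [h1, h2, h3, h4, exchCoef, diagCoef, conjCoef, aExp, sgn]
    unfold inv at *
    simp (disch := omega) only [if_pos, if_neg, if_true, if_false, htq, htQ, mul_neg, neg_mul,
      mul_one, neg_neg, zpow_neg, zpow_one, mul_zero, neg_zero, zpow_zero, sub_zero]
    field_simp
    ring
  · simp only [h1, h2, h3, h4, exchCoef, diagCoef, conjCoef, aExp, sgn]
    unfold inv at *
    simp (disch := omega) only [if_pos, if_neg, if_true, if_false, htq, htQ, mul_neg, neg_mul,
      mul_one, neg_neg, zpow_neg, zpow_one, mul_zero, neg_zero, zpow_zero, sub_zero]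
    field_simp
    ring
  · simp only [h1, h2, h3, h4, exchCoef, diagCoef, conjCoef, aExp, sgn]
    unfold inv at *
    simp (disch := omega) only [if_pos, if_neg, if_true, if_false, htq, htQ, mul_neg, neg_mul,
      mul_one, neg_neg, zpow_neg, zpow_one, mul_zero, neg_zero, zpow_zero, sub_zero]
    field_simp
    ring
  · simp only [h1, h2, h3, h4, exchCoef, diagCoef, conjCoef, aExp, sgn]
    unfold inv at *
    simp (disch := omega) only [if_pos, if_neg, if_true, if_false, htq, htQ, mul_neg, neg_mul,
      mul_one, neg_neg, zpow_neg, zpow_one, mul_zero, neg_zero, zpow_zero, sub_zero]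
    field_simp
    ring
  · simp only [h1, h2, h3, h4, exchCoef, diagCoef, conjCoef, aExp, sgn]
    unfold inv at *
    simp (disch := omega) only [if_pos, if_neg, if_true, if_false, htq, htQ, mul_neg, neg_mul,
      mul_one, neg_neg, zpow_neg, zpow_one, mul_zero, neg_zero, zpow_zero, sub_zero]
    field_simp
    ring
  · simp only [h1, h2, h3, h4, exchCoef, diagCoef, conjCoef, aExp, sgn]
    unfold inv at *
    simp (disch := omega) only [if_pos, if_neg, if_true, if_false, htq, htQ, mul_neg, neg_mul,
      mul_one, neg_neg, zpow_neg, zpow_one, mul_zero, neg_zero, zpow_zero, sub_zero]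
    field_simp
    ring

set_option maxHeartbeats 1000000 in
-- The half of the conditions obtained by exchanging `(p, q, α)` with `(Q, P, β)`; the constants are
-- those of `longHalf_lower`.
theorem longHalf_upper {r s z ξ κ : K} {t : ℕ → K} (hr : r ≠ 0) (hs : s ≠ 0) (hκ : κ ≠ 0)
    (ht : ∀ k, t k ≠ 0) {i : ℕ} (hi : 1 ≤ i) (hin : i < n) (α : K)
    (htq : t (i + 1) = s ^ 2 * κ * t i)
    (htQ : t (inv n (i + 1)) = r ^ 2 * κ * t (inv n i)) :
    LongHalf (exchCoef (s / r) (r * s) z ξ n) (diagCoef (s / r) z ξ)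
      (conjCoef (s / r) z ξ t n) ((z - (s / r) ^ 2) * (z - ξ)) (omWeight r s n i) 1 n
      (inv n (i + 1)) (inv n i) (i + 1) i (-(κ * α)) α := by
  have h0 : ∀ k, InRange n k → k ≠ i ∧ k ≠ i + 1 ∧ k ≠ inv n i ∧ k ≠ inv n (i + 1) →
      omWeight r s n i k = 1 := fun k hk h => by
    simp (disch := omega) only [omWeight, if_pos, if_neg]
  have h1 : omWeight r s n i i = r ^ 2 := by
    simp (disch := omega) only [omWeight, if_pos, if_neg, if_true, zpow_ofNat]
  have h2 : omWeight r s n i (i + 1) = s ^ 2 := by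
    simp (disch := omega) only [omWeight, if_pos, if_neg, if_true, zpow_ofNat]
  have h3 : omWeight r s n i (inv n (i + 1)) = (s ^ 2)⁻¹ := by
    unfold omWeight inv
    simp (disch := omega) only [if_pos, if_neg, if_true, zpow_neg, zpow_ofNat]
  have h4 : omWeight r s n i (inv n i) = (r ^ 2)⁻¹ := by
    unfold omWeight inv
    simp (disch := omega) only [if_pos, if_neg, if_true, zpow_neg, zpow_ofNat]
  have T0 := ht i
  have T1 := ht (inv n i)
  have hex : ∀ k, InRange n k → k ≠ i ∧ k ≠ i + 1 ∧ k ≠ inv n i ∧ k ≠ inv n (i + 1) →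
      aExp n k (inv n (i + 1)) = aExp n k (inv n i) ∧
        aExp n (inv n (i + 1)) k = aExp n (inv n i) k := fun k hk h => by
    obtain ⟨a1, a2⟩ := hk
    unfold aExp sgn inv at *
    constructor <;> split_ifs <;> omega
  constructor
  · intro k hk h
    rw [h0 k hk (by omega), exchCoef, exchCoef, (hex k hk (by omega)).1, one_mul]
  · intro k hk h
    have : k < inv n (i + 1) ↔ k < inv n i := by unfold inv at *; omega
    simp only [diagCoef, this, one_mul]
  · intro k hk h
    rw [h0 k hk (by omega), exchCoef, exchCoef, (hex k hk (by omega)).2, one_mul]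
  · intro k hk h
    have : inv n (i + 1) < k ↔ inv n i < k := by unfold inv at *; omega
    simp only [diagCoef, this, one_mul]
  · simp only [h1, h2, h3, h4, exchCoef, diagCoef, conjCoef, aExp, sgn]
    unfold inv at *
    simp (disch := omega) only [if_pos, if_neg, if_true, if_false, htq, htQ, mul_neg, neg_mul,
      mul_one, neg_neg, zpow_neg, zpow_one, mul_zero, neg_zero, zpow_zero, sub_zero]
    field_simp
    ring
  · simp only [h1, h2, h3, h4, exchCoef, diagCoef, conjCoef, aExp, sgn]
    unfold inv at *
    simp (disch := omega) only [if_pos, if_neg, if_true, if_false, htq, htQ, mul_neg, neg_mul,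
      mul_one, neg_neg, zpow_neg, zpow_one, mul_zero, neg_zero, zpow_zero, sub_zero]
    field_simp
    ring
  · simp only [h1, h2, h3, h4, exchCoef, diagCoef, conjCoef, aExp, sgn]
    unfold inv at *
    simp (disch := omega) only [if_pos, if_neg, if_true, if_false, htq, htQ, mul_neg, neg_mul,
      mul_one, neg_neg, zpow_neg, zpow_one, mul_zero, neg_zero, zpow_zero, sub_zero]
    field_simp
    ring
  · simp only [h1, h2, h3, h4, exchCoef, diagCoef, conjCoef, aExp, sgn]
    unfold inv at *
    simp (disch := omega) only [if_pos, if_neg, if_true, if_false, htq, htQ, mul_neg, neg_mul,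
      mul_one, neg_neg, zpow_neg, zpow_one, mul_zero, neg_zero, zpow_zero, sub_zero]
    field_simp
    ring
  · intro j hj h
    have T2 := ht j
    rw [h1]
    simp only [conjCoef]
    unfold inv at *
    obtain a | a : j < 2 * n + 2 - (i + 1) ∨ 2 * n + 2 - i < j := by omega
    · simp (disch := omega) only [if_pos, if_neg, if_true, if_false, htQ]
      field_simp
      ring
    · simp (disch := omega) only [if_pos, if_neg, if_true, if_false, htQ]
      field_simp
      ring
  · intro j hj h
    have T2 := ht j
    rw [h4]
    simp only [conjCoef]
    unfold inv at *
    obtain a | a : j < 2 * n + 2 - (i + 1) ∨ 2 * n + 2 - i < j := by omega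
    · simp (disch := omega) only [if_pos, if_neg, if_true, if_false, htQ]
      field_simp
      ring
    · simp (disch := omega) only [if_pos, if_neg, if_true, if_false, htQ]
      field_simp
      ring
  · simp only [h1, h2, h3, h4, exchCoef, diagCoef, conjCoef, aExp, sgn]
    unfold inv at *
    simp (disch := omega) only [if_pos, if_neg, if_true, if_false, htq, htQ, mul_neg, neg_mul,
      mul_one, neg_neg, zpow_neg, zpow_one, mul_zero, neg_zero, zpow_zero, sub_zero]
    field_simp
    ring
  · simp only [h1, h2, h3, h4, exchCoef, diagCoef, conjCoef, aExp, sgn]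
    unfold inv at *
    simp (disch := omega) only [if_pos, if_neg, if_true, if_false, htq, htQ, mul_neg, neg_mul,
      mul_one, neg_neg, zpow_neg, zpow_one, mul_zero, neg_zero, zpow_zero, sub_zero]
    field_simp
    ring
  · simp only [h1, h2, h3, h4, exchCoef, diagCoef, conjCoef, aExp, sgn]
    unfold inv at *
    simp (disch := omega) only [if_pos, if_neg, if_true, if_false, htq, htQ, mul_neg, neg_mul,
      mul_one, neg_neg, zpow_neg, zpow_one, mul_zero, neg_zero, zpow_zero, sub_zero]
    field_simp
    ring
  · simp only [h1, h2, h3, h4, exchCoef, diagCoef, conjCoef, aExp, sgn]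
    unfold inv at *
    simp (disch := omega) only [if_pos, if_neg, if_true, if_false, htq, htQ, mul_neg, neg_mul,
      mul_one, neg_neg, zpow_neg, zpow_one, mul_zero, neg_zero, zpow_zero, sub_zero]
    field_simp
    ring
  · simp only [h1, h2, h3, h4, exchCoef, diagCoef, conjCoef, aExp, sgn]
    unfold inv at *
    simp (disch := omega) only [if_pos, if_neg, if_true, if_false, htq, htQ, mul_neg, neg_mul,
      mul_one, neg_neg, zpow_neg, zpow_one, mul_zero, neg_zero, zpow_zero, sub_zero]
    field_simp
    ring
  · simp only [h1, h2, h3, h4, exchCoef, diagCoef, conjCoef, aExp, sgn]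
    unfold inv at *
    simp (disch := omega) only [if_pos, if_neg, if_true, if_false, htq, htQ, mul_neg, neg_mul,
      mul_one, neg_neg, zpow_neg, zpow_one, mul_zero, neg_zero, zpow_zero, sub_zero]
    field_simp
    ring
  · simp only [h1, h2, h3, h4, exchCoef, diagCoef, conjCoef, aExp, sgn]
    unfold inv at *
    simp (disch := omega) only [if_pos, if_neg, if_true, if_false, htq, htQ, mul_neg, neg_mul,
      mul_one, neg_neg, zpow_neg, zpow_one, mul_zero, neg_zero, zpow_zero, sub_zero]
    field_simp
    ring
  · simp only [h1, h2, h3, h4, exchCoef, diagCoef, conjCoef, aExp, sgn]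
    unfold inv at *
    simp (disch := omega) only [if_pos, if_neg, if_true, if_false, htq, htQ, mul_neg, neg_mul,
      mul_one, neg_neg, zpow_neg, zpow_one, mul_zero, neg_zero, zpow_zero, sub_zero]
    field_simp
    ring
end Conditions

/-! ### The intertwining conditions at the affine node -/

section Conditions

variable {K : Type*} [Field K] {n : ℕ}

set_option maxHeartbeats 1000000 in
-- Unlike the conditions at the finite nodes, those at node `0` involve `z` as a parameter of the
-- skew operator and are verified for the value `ξ = t_{1'} / t_1`.
theorem longHalf_zero_left {r s z κ : K} {t : ℕ → K} (hr : r ≠ 0) (hs : s ≠ 0) (hκ : κ ≠ 0)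
    (ht : ∀ k, t k ≠ 0) (hn : 2 ≤ n) (α : K)
    (htq : t 2 = s ^ 2 * κ * t 1)
    (htQ : t (inv n 2) = r ^ 2 * κ * t (inv n 1)) :
    LongHalf (exchCoef (s / r) (r * s) z (t (inv n 1) / t 1) n)
      (diagCoef (s / r) z (t (inv n 1) / t 1))
      (conjCoef (s / r) z (t (inv n 1) / t 1) t n)
      ((z - (s / r) ^ 2) * (z - t (inv n 1) / t 1)) (omWeight r s n 0) z n
      (inv n 1) 2 1 (inv n 2) α (-(r ^ 2 * s ^ 2 * κ * α)) := by
  have h1 : omWeight r s n 0 1 = s ^ 2 := by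
    simp (disch := omega) only [omWeight, if_pos, if_neg, if_true, zpow_ofNat]
  have h2 : omWeight r s n 0 2 = (r ^ 2)⁻¹ := by
    simp (disch := omega) only [omWeight, if_pos, if_neg, if_true, zpow_ofNat, zpow_neg]
  have h3 : omWeight r s n 0 (inv n 2) = r ^ 2 := by
    unfold omWeight inv
    simp (disch := omega) only [if_pos, if_neg, if_true, zpow_neg, zpow_ofNat]
  have h4 : omWeight r s n 0 (inv n 1) = (s ^ 2)⁻¹ := by
    unfold omWeight inv
    simp (disch := omega) only [if_pos, if_neg, if_true, zpow_neg, zpow_ofNat]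
  have T0 := ht 1
  have T1 := ht (inv n 1)
  -- Off the special indices `ω_0` is not the identity: its eigenvalues `(r s)^{∓2}` compensate for
  -- the opposite signs of the exchange exponents of `v_{1'}` and `v_2` with `v_k`.
  have hW : ∀ k, InRange n k → k ≠ 1 ∧ k ≠ 2 ∧ k ≠ inv n 1 ∧ k ≠ inv n 2 →
      omWeight r s n 0 k = if k = n + 1 then 1 else if k ≤ n then (r ^ 2 * s ^ 2)⁻¹ else
        r ^ 2 * s ^ 2 := fun k hk h => by
    simp (disch := omega) only [omWeight, if_pos, if_neg, if_true, zpow_neg, zpow_ofNat, mul_inv]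
  constructor
  · intro k hk h
    obtain ⟨k1, k2⟩ := id hk
    rw [hW k hk (by omega)]
    simp only [exchCoef, aExp, sgn]
    unfold inv at *
    obtain a | a | a : k < n + 1 ∨ k = n + 1 ∨ n + 1 < k := by omega
    · simp (disch := omega) only [if_pos, if_neg, mul_neg, neg_mul, mul_one, neg_neg, zpow_neg,
        zpow_one]
      field_simp
    · simp (disch := omega) only [if_pos, if_neg, mul_neg, neg_mul, mul_one, neg_neg, zpow_neg,
        zpow_one, mul_zero, zero_mul, neg_zero, zpow_zero, one_mul]
    · simp (disch := omega) only [if_pos, if_neg, mul_neg, neg_mul, mul_one, neg_neg, zpow_neg,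
        zpow_one]
      field_simp
  · intro k hk h
    obtain ⟨k1, k2⟩ := id hk
    simp only [diagCoef]
    unfold inv at *
    simp (disch := omega) only [if_pos, if_neg]
    ring
  · intro k hk h
    obtain ⟨k1, k2⟩ := id hk
    rw [hW k hk (by omega)]
    simp only [exchCoef, aExp, sgn]
    unfold inv at *
    obtain a | a | a : k < n + 1 ∨ k = n + 1 ∨ n + 1 < k := by omega
    · simp (disch := omega) only [if_pos, if_neg, mul_neg, neg_mul, mul_one, neg_neg, zpow_neg,
        zpow_one]
      field_simp
    · simp (disch := omega) only [if_pos, if_neg, mul_neg, neg_mul, mul_one, neg_neg, zpow_neg,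
        zpow_one, mul_zero, zero_mul, neg_zero, zpow_zero, one_mul]
    · simp (disch := omega) only [if_pos, if_neg, mul_neg, neg_mul, mul_one, neg_neg, zpow_neg,
        zpow_one]
      field_simp
  · intro k hk h
    obtain ⟨k1, k2⟩ := id hk
    simp only [diagCoef]
    unfold inv at *
    simp (disch := omega) only [if_pos, if_neg]
    ring
  · simp only [h1, h2, h3, h4, exchCoef, diagCoef, conjCoef, aExp, sgn]
    unfold inv at *
    simp (disch := omega) only [if_pos, if_neg, if_true, if_false, htq, htQ, mul_neg, neg_mul,
      mul_one, neg_neg, zpow_neg, zpow_one, mul_zero, neg_zero, zpow_zero, sub_zero]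
    field_simp
    ring
  · simp only [h1, h2, h3, h4, exchCoef, diagCoef, conjCoef, aExp, sgn]
    unfold inv at *
    simp (disch := omega) only [if_pos, if_neg, if_true, if_false, htq, htQ, mul_neg, neg_mul,
      mul_one, neg_neg, zpow_neg, zpow_one, mul_zero, neg_zero, zpow_zero, sub_zero]
    field_simp
    ring
  · simp only [h1, h2, h3, h4, exchCoef, diagCoef, conjCoef, aExp, sgn]
    unfold inv at *
    simp (disch := omega) only [if_pos, if_neg, if_true, if_false, htq, htQ, mul_neg, neg_mul,
      mul_one, neg_neg, zpow_neg, zpow_one, mul_zero, neg_zero, zpow_zero, sub_zero]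
    field_simp
    ring
  · simp only [h1, h2, h3, h4, exchCoef, diagCoef, conjCoef, aExp, sgn]
    unfold inv at *
    simp (disch := omega) only [if_pos, if_neg, if_true, if_false, htq, htQ, mul_neg, neg_mul,
      mul_one, neg_neg, zpow_neg, zpow_one, mul_zero, neg_zero, zpow_zero, sub_zero]
    field_simp
    ring
  · intro j hj h
    obtain ⟨k1, k2⟩ := id hj
    have T2 := ht j
    rw [h3]
    simp only [conjCoef]
    unfold inv at *
    simp (disch := omega) only [if_pos, if_neg, if_true, if_false, htq]
    field_simp
    ring
  · intro j hj h
    obtain ⟨k1, k2⟩ := id hj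
    have T2 := ht j
    rw [h2]
    simp only [conjCoef]
    unfold inv at *
    simp (disch := omega) only [if_pos, if_neg, if_true, if_false, htq]
    field_simp
    ring
  · simp only [h1, h2, h3, h4, exchCoef, diagCoef, conjCoef, aExp, sgn]
    unfold inv at *
    simp (disch := omega) only [if_pos, if_neg, if_true, if_false, htq, htQ, mul_neg, neg_mul,
      mul_one, neg_neg, zpow_neg, zpow_one, mul_zero, neg_zero, zpow_zero, sub_zero]
    field_simp
    ring
  · simp only [h1, h2, h3, h4, exchCoef, diagCoef, conjCoef, aExp, sgn]
    unfold inv at *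
    simp (disch := omega) only [if_pos, if_neg, if_true, if_false, htq, htQ, mul_neg, neg_mul,
      mul_one, neg_neg, zpow_neg, zpow_one, mul_zero, neg_zero, zpow_zero, sub_zero]
    field_simp
    ring
  · simp only [h1, h2, h3, h4, exchCoef, diagCoef, conjCoef, aExp, sgn]
    unfold inv at *
    simp (disch := omega) only [if_pos, if_neg, if_true, if_false, htq, htQ, mul_neg, neg_mul,
      mul_one, neg_neg, zpow_neg, zpow_one, mul_zero, neg_zero, zpow_zero, sub_zero]
    field_simp
    ring
  · simp only [h1, h2, h3, h4, exchCoef, diagCoef, conjCoef, aExp, sgn]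
    unfold inv at *
    simp (disch := omega) only [if_pos, if_neg, if_true, if_false, htq, htQ, mul_neg, neg_mul,
      mul_one, neg_neg, zpow_neg, zpow_one, mul_zero, neg_zero, zpow_zero, sub_zero]
    field_simp
    ring
  · simp only [h1, h2, h3, h4, exchCoef, diagCoef, conjCoef, aExp, sgn]
    unfold inv at *
    simp (disch := omega) only [if_pos, if_neg, if_true, if_false, htq, htQ, mul_neg, neg_mul,
      mul_one, neg_neg, zpow_neg, zpow_one, mul_zero, neg_zero, zpow_zero, sub_zero]
    field_simp
    ring
  · simp only [h1, h2, h3, h4, exchCoef, diagCoef, conjCoef, aExp, sgn]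
    unfold inv at *
    simp (disch := omega) only [if_pos, if_neg, if_true, if_false, htq, htQ, mul_neg, neg_mul,
      mul_one, neg_neg, zpow_neg, zpow_one, mul_zero, neg_zero, zpow_zero, sub_zero]
    field_simp
    ring
  · simp only [h1, h2, h3, h4, exchCoef, diagCoef, conjCoef, aExp, sgn]
    unfold inv at *
    simp (disch := omega) only [if_pos, if_neg, if_true, if_false, htq, htQ, mul_neg, neg_mul,
      mul_one, neg_neg, zpow_neg, zpow_one, mul_zero, neg_zero, zpow_zero, sub_zero]
    field_simp
    ring
  · simp only [h1, h2, h3, h4, exchCoef, diagCoef, conjCoef, aExp, sgn]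
    unfold inv at *
    simp (disch := omega) only [if_pos, if_neg, if_true, if_false, htq, htQ, mul_neg, neg_mul,
      mul_one, neg_neg, zpow_neg, zpow_one, mul_zero, neg_zero, zpow_zero, sub_zero]
    field_simp
    ring

set_option maxHeartbeats 1000000 in
-- The other half for node `0`, with `v_1` in the role of `v_2` and `v_{2'}` in the role of
-- `v_{1'}`.
theorem longHalf_zero_right {r s z κ : K} {t : ℕ → K} (hr : r ≠ 0) (hs : s ≠ 0) (hκ : κ ≠ 0)
    (ht : ∀ k, t k ≠ 0) (hn : 2 ≤ n) (α : K)
    (htq : t 2 = s ^ 2 * κ * t 1)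
    (htQ : t (inv n 2) = r ^ 2 * κ * t (inv n 1)) :
    LongHalf (exchCoef (s / r) (r * s) z (t (inv n 1) / t 1) n)
      (diagCoef (s / r) z (t (inv n 1) / t 1))
      (conjCoef (s / r) z (t (inv n 1) / t 1) t n)
      ((z - (s / r) ^ 2) * (z - t (inv n 1) / t 1)) (omWeight r s n 0) z n
      (inv n 2) 1 2 (inv n 1) (-(r ^ 2 * s ^ 2 * κ * α)) α := by
  have h1 : omWeight r s n 0 1 = s ^ 2 := by
    simp (disch := omega) only [omWeight, if_pos, if_neg, if_true, zpow_ofNat]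
  have h2 : omWeight r s n 0 2 = (r ^ 2)⁻¹ := by
    simp (disch := omega) only [omWeight, if_pos, if_neg, if_true, zpow_ofNat, zpow_neg]
  have h3 : omWeight r s n 0 (inv n 2) = r ^ 2 := by
    unfold omWeight inv
    simp (disch := omega) only [if_pos, if_neg, if_true, zpow_neg, zpow_ofNat]
  have h4 : omWeight r s n 0 (inv n 1) = (s ^ 2)⁻¹ := by
    unfold omWeight inv
    simp (disch := omega) only [if_pos, if_neg, if_true, zpow_neg, zpow_ofNat]
  have T0 := ht 1
  have T1 := ht (inv n 1)
  have hW : ∀ k, InRange n k → k ≠ 1 ∧ k ≠ 2 ∧ k ≠ inv n 1 ∧ k ≠ inv n 2 →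
      omWeight r s n 0 k = if k = n + 1 then 1 else if k ≤ n then (r ^ 2 * s ^ 2)⁻¹ else
        r ^ 2 * s ^ 2 := fun k hk h => by
    simp (disch := omega) only [omWeight, if_pos, if_neg, if_true, zpow_neg, zpow_ofNat, mul_inv]
  constructor
  · intro k hk h
    obtain ⟨k1, k2⟩ := id hk
    rw [hW k hk (by omega)]
    simp only [exchCoef, aExp, sgn]
    unfold inv at *
    obtain a | a | a : k < n + 1 ∨ k = n + 1 ∨ n + 1 < k := by omega
    · simp (disch := omega) only [if_pos, if_neg, mul_neg, neg_mul, mul_one, neg_neg, zpow_neg,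
        zpow_one]
      field_simp
    · simp (disch := omega) only [if_pos, if_neg, mul_neg, neg_mul, mul_one, neg_neg, zpow_neg,
        zpow_one, mul_zero, zero_mul, neg_zero, zpow_zero, one_mul]
    · simp (disch := omega) only [if_pos, if_neg, mul_neg, neg_mul, mul_one, neg_neg, zpow_neg,
        zpow_one]
      field_simp
  · intro k hk h
    obtain ⟨k1, k2⟩ := id hk
    simp only [diagCoef]
    unfold inv at *
    simp (disch := omega) only [if_pos, if_neg]
    ring
  · intro k hk h
    obtain ⟨k1, k2⟩ := id hk
    rw [hW k hk (by omega)]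
    simp only [exchCoef, aExp, sgn]
    unfold inv at *
    obtain a | a | a : k < n + 1 ∨ k = n + 1 ∨ n + 1 < k := by omega
    · simp (disch := omega) only [if_pos, if_neg, mul_neg, neg_mul, mul_one, neg_neg, zpow_neg,
        zpow_one]
      field_simp
    · simp (disch := omega) only [if_pos, if_neg, mul_neg, neg_mul, mul_one, neg_neg, zpow_neg,
        zpow_one, mul_zero, zero_mul, neg_zero, zpow_zero, one_mul]
    · simp (disch := omega) only [if_pos, if_neg, mul_neg, neg_mul, mul_one, neg_neg, zpow_neg,
        zpow_one]
      field_simp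
  · intro k hk h
    obtain ⟨k1, k2⟩ := id hk
    simp only [diagCoef]
    unfold inv at *
    simp (disch := omega) only [if_pos, if_neg]
    ring
  · simp only [h1, h2, h3, h4, exchCoef, diagCoef, conjCoef, aExp, sgn]
    unfold inv at *
    simp (disch := omega) only [if_pos, if_neg, if_true, if_false, htq, htQ, mul_neg, neg_mul,
      mul_one, neg_neg, zpow_neg, zpow_one, mul_zero, neg_zero, zpow_zero, sub_zero]
    field_simp
    ring
  · simp only [h1, h2, h3, h4, exchCoef, diagCoef, conjCoef, aExp, sgn]
    unfold inv at *
    simp (disch := omega) only [if_pos, if_neg, if_true, if_false, htq, htQ, mul_neg, neg_mul,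
      mul_one, neg_neg, zpow_neg, zpow_one, mul_zero, neg_zero, zpow_zero, sub_zero]
    field_simp
    ring
  · simp only [h1, h2, h3, h4, exchCoef, diagCoef, conjCoef, aExp, sgn]
    unfold inv at *
    simp (disch := omega) only [if_pos, if_neg, if_true, if_false, htq, htQ, mul_neg, neg_mul,
      mul_one, neg_neg, zpow_neg, zpow_one, mul_zero, neg_zero, zpow_zero, sub_zero]
    field_simp
    ring
  · simp only [h1, h2, h3, h4, exchCoef, diagCoef, conjCoef, aExp, sgn]
    unfold inv at *
    simp (disch := omega) only [if_pos, if_neg, if_true, if_false, htq, htQ, mul_neg, neg_mul,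
      mul_one, neg_neg, zpow_neg, zpow_one, mul_zero, neg_zero, zpow_zero, sub_zero]
    field_simp
    ring
  · intro j hj h
    obtain ⟨k1, k2⟩ := id hj
    have T2 := ht j
    rw [h4]
    simp only [conjCoef]
    unfold inv at *
    simp (disch := omega) only [if_pos, if_neg, if_true, if_false, htQ]
    field_simp
    ring
  · intro j hj h
    obtain ⟨k1, k2⟩ := id hj
    have T2 := ht j
    rw [h1]
    simp only [conjCoef]
    unfold inv at *
    simp (disch := omega) only [if_pos, if_neg, if_true, if_false, htQ]
    field_simp
    ring
  · simp only [h1, h2, h3, h4, exchCoef, diagCoef, conjCoef, aExp, sgn]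
    unfold inv at *
    simp (disch := omega) only [if_pos, if_neg, if_true, if_false, htq, htQ, mul_neg, neg_mul,
      mul_one, neg_neg, zpow_neg, zpow_one, mul_zero, neg_zero, zpow_zero, sub_zero]
    field_simp
    ring
  · simp only [h1, h2, h3, h4, exchCoef, diagCoef, conjCoef, aExp, sgn]
    unfold inv at *
    simp (disch := omega) only [if_pos, if_neg, if_true, if_false, htq, htQ, mul_neg, neg_mul,
      mul_one, neg_neg, zpow_neg, zpow_one, mul_zero, neg_zero, zpow_zero, sub_zero]
    field_simp
    ring
  · simp only [h1, h2, h3, h4, exchCoef, diagCoef, conjCoef, aExp, sgn]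
    unfold inv at *
    simp (disch := omega) only [if_pos, if_neg, if_true, if_false, htq, htQ, mul_neg, neg_mul,
      mul_one, neg_neg, zpow_neg, zpow_one, mul_zero, neg_zero, zpow_zero, sub_zero]
    field_simp
    ring
  · simp only [h1, h2, h3, h4, exchCoef, diagCoef, conjCoef, aExp, sgn]
    unfold inv at *
    simp (disch := omega) only [if_pos, if_neg, if_true, if_false, htq, htQ, mul_neg, neg_mul,
      mul_one, neg_neg, zpow_neg, zpow_one, mul_zero, neg_zero, zpow_zero, sub_zero]
    field_simp
    ring
  · simp only [h1, h2, h3, h4, exchCoef, diagCoef, conjCoef, aExp, sgn]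
    unfold inv at *
    simp (disch := omega) only [if_pos, if_neg, if_true, if_false, htq, htQ, mul_neg, neg_mul,
      mul_one, neg_neg, zpow_neg, zpow_one, mul_zero, neg_zero, zpow_zero, sub_zero]
    field_simp
    ring
  · simp only [h1, h2, h3, h4, exchCoef, diagCoef, conjCoef, aExp, sgn]
    unfold inv at *
    simp (disch := omega) only [if_pos, if_neg, if_true, if_false, htq, htQ, mul_neg, neg_mul,
      mul_one, neg_neg, zpow_neg, zpow_one, mul_zero, neg_zero, zpow_zero, sub_zero]
    field_simp
    ring
  · simp only [h1, h2, h3, h4, exchCoef, diagCoef, conjCoef, aExp, sgn]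
    unfold inv at *
    simp (disch := omega) only [if_pos, if_neg, if_true, if_false, htq, htQ, mul_neg, neg_mul,
      mul_one, neg_neg, zpow_neg, zpow_one, mul_zero, neg_zero, zpow_zero, sub_zero]
    field_simp
    ring
  · simp only [h1, h2, h3, h4, exchCoef, diagCoef, conjCoef, aExp, sgn]
    unfold inv at *
    simp (disch := omega) only [if_pos, if_neg, if_true, if_false, htq, htQ, mul_neg, neg_mul,
      mul_one, neg_neg, zpow_neg, zpow_one, mul_zero, neg_zero, zpow_zero, sub_zero]
    field_simp
    ring

end Conditions

/-! ### The intertwining conditions at the short node -/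

section Conditions

variable {K : Type*} [Field K] {n : ℕ}

set_option maxHeartbeats 2000000 in
-- Only the ratios of `t_n`, `t_{n+1}` and `t_{n'}` matter, and `z`, `ξ` are free. Both ratios are
-- unchanged by `(r, s) ↦ (s⁻¹, r⁻¹)`, so no analogue of `κ` is needed for `f_n`.
theorem shortConds {r s z ξ : K} {t : ℕ → K} (hr : r ≠ 0) (hs : s ≠ 0)
    (ht : ∀ k, t k ≠ 0) (hn : 2 ≤ n) (α : K)
    (htm : t (n + 1) = t n) (htP : t (inv n n) = s / r * t n) :
    ShortConds (exchCoef (s / r) (r * s) z ξ n) (diagCoef (s / r) z ξ)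
      (conjCoef (s / r) z ξ t n) ((z - (s / r) ^ 2) * (z - ξ)) (omWeight r s n n) n
      n (n + 1) (inv n n) α (-α) := by
  have h1 : omWeight r s n n n = r * s⁻¹ := by
    simp (disch := omega) only [omWeight, if_pos, if_neg, if_true, lt_irrefl, if_false]
  have h2 : omWeight r s n n (n + 1) = 1 := by
    simp (disch := omega) only [omWeight, if_pos, if_neg, if_true, lt_irrefl, if_false]
  have h3 : omWeight r s n n (inv n n) = r⁻¹ * s := by
    unfold omWeight inv
    simp (disch := omega) only [if_pos, if_neg, if_true, lt_irrefl, if_false]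
  have T0 := ht n
  have hW : ∀ k, InRange n k → k ≠ n ∧ k ≠ n + 1 ∧ k ≠ inv n n →
      omWeight r s n n k = if k < n then r⁻¹ * s⁻¹ else r * s := fun k hk h => by
    simp (disch := omega) only [omWeight, if_pos, if_neg, if_true, lt_irrefl, if_false]
  constructor
  · intro k hk h
    obtain ⟨k1, k2⟩ := id hk
    rw [hW k hk (by omega)]
    simp only [exchCoef, diagCoef, aExp, sgn]
    unfold inv at *
    obtain a | a : k < n ∨ n + 1 < k := by omega
    · simp (disch := omega) only [if_pos, if_neg, mul_neg, neg_mul, mul_one, neg_neg, zpow_neg,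
        zpow_one, mul_zero, zero_mul, neg_zero, zpow_zero, and_true, if_true,
        one_mul]
      field_simp
    · simp (disch := omega) only [if_pos, if_neg, mul_neg, neg_mul, mul_one, neg_neg, zpow_neg,
        zpow_one, mul_zero, zero_mul, neg_zero, zpow_zero, and_true, if_true,
        one_mul]
      field_simp
  · intro k hk h
    obtain ⟨k1, k2⟩ := id hk
    rw [hW k hk (by omega)]
    simp only [exchCoef, diagCoef, aExp, sgn]
    unfold inv at *
    obtain a | a : k < n ∨ n + 1 < k := by omega
    · simp (disch := omega) only [if_pos, if_neg, mul_neg, neg_mul, mul_one, neg_neg, zpow_neg,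
        zpow_one, mul_zero, zero_mul, neg_zero, zpow_zero, and_true, if_true,
        one_mul]
      field_simp
    · simp (disch := omega) only [if_pos, if_neg, mul_neg, neg_mul, mul_one, neg_neg, zpow_neg,
        zpow_one, mul_zero, zero_mul, neg_zero, zpow_zero, and_true, if_true,
        one_mul]
      field_simp
  · intro k hk h
    obtain ⟨k1, k2⟩ := id hk
    rw [hW k hk (by omega)]
    simp only [exchCoef, diagCoef, aExp, sgn]
    unfold inv at *
    obtain a | a : k < n ∨ n + 1 < k := by omega
    · simp (disch := omega) only [if_pos, if_neg, mul_neg, neg_mul, mul_one, neg_neg, zpow_neg,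
        zpow_one, mul_zero, zero_mul, neg_zero, zpow_zero, and_true, if_true,
        one_mul]
      field_simp
    · simp (disch := omega) only [if_pos, if_neg, mul_neg, neg_mul, mul_one, neg_neg, zpow_neg,
        zpow_one, mul_zero, zero_mul, neg_zero, zpow_zero, and_true, if_true,
        one_mul]
      field_simp
  · intro k hk h
    obtain ⟨k1, k2⟩ := id hk
    rw [hW k hk (by omega)]
    simp only [exchCoef, diagCoef, aExp, sgn]
    unfold inv at *
    obtain a | a : k < n ∨ n + 1 < k := by omega
    · simp (disch := omega) only [if_pos, if_neg, mul_neg, neg_mul, mul_one, neg_neg, zpow_neg,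
        zpow_one, mul_zero, zero_mul, neg_zero, zpow_zero, and_true, if_true,
        one_mul]
      field_simp
    · simp (disch := omega) only [if_pos, if_neg, mul_neg, neg_mul, mul_one, neg_neg, zpow_neg,
        zpow_one, mul_zero, zero_mul, neg_zero, zpow_zero, and_true, if_true,
        one_mul]
      field_simp
  · intro j hj h
    obtain ⟨k1, k2⟩ := id hj
    have T2 := ht j
    simp only [h1, h3, conjCoef]
    unfold inv at *
    obtain a | a : j < n ∨ n + 1 < j := by omega
    all_goals
      simp (disch := omega) only [if_pos, if_neg, if_true, if_false, htm, htP]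
      constructor <;> (field_simp; ring)
  · simp only [h1, h2, h3, exchCoef, diagCoef, conjCoef, aExp, sgn]
    unfold inv at *
    simp (disch := omega) only [if_pos, if_neg, if_true, if_false, htm, htP, mul_neg, neg_mul,
      mul_one, neg_neg, zpow_neg, zpow_one, mul_zero, zero_mul, neg_zero, zpow_zero, sub_zero, ne_eq,
      not_true, not_false_iff]
    field_simp
    ring
  · simp only [h1, h2, h3, exchCoef, diagCoef, conjCoef, aExp, sgn]
    unfold inv at *
    simp (disch := omega) only [if_pos, if_neg, if_true, if_false, htm, htP, mul_neg, neg_mul,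
      mul_one, neg_neg, zpow_neg, zpow_one, mul_zero, zero_mul, neg_zero, zpow_zero, sub_zero, ne_eq,
      not_true, not_false_iff]
    field_simp
    ring
  · simp only [h1, h2, h3, exchCoef, diagCoef, conjCoef, aExp, sgn]
    unfold inv at *
    simp (disch := omega) only [if_pos, if_neg, if_true, if_false, htm, htP, mul_neg, neg_mul,
      mul_one, neg_neg, zpow_neg, zpow_one, mul_zero, zero_mul, neg_zero, zpow_zero, sub_zero, ne_eq,
      not_true, not_false_iff]
    field_simp
    ring
  · simp only [h1, h2, h3, exchCoef, diagCoef, conjCoef, aExp, sgn]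
    unfold inv at *
    simp (disch := omega) only [if_pos, if_neg, if_true, if_false, htm, htP, mul_neg, neg_mul,
      mul_one, neg_neg, zpow_neg, zpow_one, mul_zero, zero_mul, neg_zero, zpow_zero, sub_zero, ne_eq,
      not_true, not_false_iff]
    field_simp
    ring
  · intro j hj h
    obtain ⟨k1, k2⟩ := id hj
    have T2 := ht j
    simp only [h1, h3, conjCoef]
    unfold inv at *
    obtain a | a : j < n ∨ n + 1 < j := by omega
    all_goals
      simp (disch := omega) only [if_pos, if_neg, if_true, if_false, htm, htP]
      (field_simp; ring)
  · simp only [h1, h2, h3, exchCoef, diagCoef, conjCoef, aExp, sgn]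
    unfold inv at *
    simp (disch := omega) only [if_pos, if_neg, if_true, if_false, htm, htP, mul_neg, neg_mul,
      mul_one, neg_neg, zpow_neg, zpow_one, mul_zero, zero_mul, neg_zero, zpow_zero, sub_zero, ne_eq,
      not_true, not_false_iff]
    field_simp
    ring
  · simp only [h1, h2, h3, exchCoef, diagCoef, conjCoef, aExp, sgn]
    unfold inv at *
    simp (disch := omega) only [if_pos, if_neg, if_true, if_false, htm, htP, mul_neg, neg_mul,
      mul_one, neg_neg, zpow_neg, zpow_one, mul_zero, zero_mul, neg_zero, zpow_zero, sub_zero, ne_eq,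
      not_true, not_false_iff]
    field_simp
    ring
  · simp only [h1, h2, h3, exchCoef, diagCoef, conjCoef, aExp, sgn]
    unfold inv at *
    simp (disch := omega) only [if_pos, if_neg, if_true, if_false, htm, htP, mul_neg, neg_mul,
      mul_one, neg_neg, zpow_neg, zpow_one, mul_zero, zero_mul, neg_zero, zpow_zero, sub_zero, ne_eq,
      not_true, not_false_iff]
    field_simp
    ring
  · intro j hj h
    obtain ⟨k1, k2⟩ := id hj
    have T2 := ht j
    simp only [h1, h3, conjCoef]
    unfold inv at *
    obtain a | a : j < n ∨ n + 1 < j := by omega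
    all_goals
      simp (disch := omega) only [if_pos, if_neg, if_true, if_false, htm, htP]
      (field_simp; ring)
  · simp only [h1, h2, h3, exchCoef, diagCoef, conjCoef, aExp, sgn]
    unfold inv at *
    simp (disch := omega) only [if_pos, if_neg, if_true, if_false, htm, htP, mul_neg, neg_mul,
      mul_one, neg_neg, zpow_neg, zpow_one, mul_zero, zero_mul, neg_zero, zpow_zero, sub_zero, ne_eq,
      not_true, not_false_iff]
    field_simp
    ring
  · simp only [h1, h2, h3, exchCoef, diagCoef, conjCoef, aExp, sgn]
    unfold inv at *
    simp (disch := omega) only [if_pos, if_neg, if_true, if_false, htm, htP, mul_neg, neg_mul,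
      mul_one, neg_neg, zpow_neg, zpow_one, mul_zero, zero_mul, neg_zero, zpow_zero, sub_zero, ne_eq,
      not_true, not_false_iff]
    field_simp
    ring
  · simp only [h1, h2, h3, exchCoef, diagCoef, conjCoef, aExp, sgn]
    unfold inv at *
    simp (disch := omega) only [if_pos, if_neg, if_true, if_false, htm, htP, mul_neg, neg_mul,
      mul_one, neg_neg, zpow_neg, zpow_one, mul_zero, zero_mul, neg_zero, zpow_zero, sub_zero, ne_eq,
      not_true, not_false_iff]
    field_simp
    ring
  · simp only [h1, h2, h3, exchCoef, diagCoef, conjCoef, aExp, sgn]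
    unfold inv at *
    simp (disch := omega) only [if_pos, if_neg, if_true, if_false, htm, htP, mul_neg, neg_mul,
      mul_one, neg_neg, zpow_neg, zpow_one, mul_zero, zero_mul, neg_zero, zpow_zero, sub_zero, ne_eq,
      not_true, not_false_iff]
    field_simp
    ring
  · simp only [h1, h2, h3, exchCoef, diagCoef, conjCoef, aExp, sgn]
    unfold inv at *
    simp (disch := omega) only [if_pos, if_neg, if_true, if_false, htm, htP, mul_neg, neg_mul,
      mul_one, neg_neg, zpow_neg, zpow_one, mul_zero, zero_mul, neg_zero, zpow_zero, sub_zero, ne_eq,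
      not_true, not_false_iff]
    field_simp
    ring
  · simp only [h1, h2, h3, exchCoef, diagCoef, conjCoef, aExp, sgn]
    unfold inv at *
    simp (disch := omega) only [if_pos, if_neg, if_true, if_false, htm, htP, mul_neg, neg_mul,
      mul_one, neg_neg, zpow_neg, zpow_one, mul_zero, zero_mul, neg_zero, zpow_zero, sub_zero, ne_eq,
      not_true, not_false_iff]
    field_simp
    ring
  · simp only [h1, h2, h3, exchCoef, diagCoef, conjCoef, aExp, sgn]
    unfold inv at *
    simp (disch := omega) only [if_pos, if_neg, if_true, if_false, htm, htP, mul_neg, neg_mul,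
      mul_one, neg_neg, zpow_neg, zpow_one, mul_zero, zero_mul, neg_zero, zpow_zero, sub_zero, ne_eq,
      not_true, not_false_iff]
    field_simp
    ring
  · simp only [h1, h2, h3, exchCoef, diagCoef, conjCoef, aExp, sgn]
    unfold inv at *
    simp (disch := omega) only [if_pos, if_neg, if_true, if_false, htm, htP, mul_neg, neg_mul,
      mul_one, neg_neg, zpow_neg, zpow_one, mul_zero, zero_mul, neg_zero, zpow_zero, sub_zero, ne_eq,
      not_true, not_false_iff]
    field_simp
    ring
  · simp only [h1, h2, h3, exchCoef, diagCoef, conjCoef, aExp, sgn]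
    unfold inv at *
    simp (disch := omega) only [if_pos, if_neg, if_true, if_false, htm, htP, mul_neg, neg_mul,
      mul_one, neg_neg, zpow_neg, zpow_one, mul_zero, zero_mul, neg_zero, zpow_zero, sub_zero, ne_eq,
      not_true, not_false_iff]
    field_simp
    ring

end Conditions

/-! ## Intertwining by `R̂(z)` -/

section RhatIntertwine

variable {K : Type*} [Field K] {r s : K} {n : ℕ}

section Standard

variable {T : Module.End K (V K n ⊗[K] V K n)} {z ξ : K} {t : ℕ → K}
  {w e : Module.End K (V K n)} {α β : K}

theorem IsStandard.intertwine_lower (hr : r ≠ 0) (hs : s ≠ 0)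
    (hT : IsStandard T (s / r) (r * s) z ξ t) (ht : ∀ k, t k ≠ 0) {i : ℕ} (hi : 1 ≤ i) (hin : i < n)
    {κ : K} (hκ : κ ≠ 0) (htq : t (i + 1) = s ^ 2 * κ * t i)
    (htQ : t (inv n (i + 1)) = r ^ 2 * κ * t (inv n i))
    (hw : ∀ k, InRange n k → w (bv K n k) = omWeight r s n i k • bv K n k)
    (he : IsLongRoot (n := n) e i (i + 1) (inv n i) (inv n (i + 1)) α (-(κ * α))) :
    T * skewOp 1 1 w e = skewOp 1 1 w e * T := by
  refine hT.intertwine_long hw he ?_ (longHalf_lower hr hs hκ ht hi hin α htq htQ)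
    (longHalf_upper hr hs hκ ht hi hin α htq htQ)
  constructor
  all_goals try unfold InRange
  all_goals try unfold inv
  all_goals omega

theorem IsStandard.intertwine_zero (hr : r ≠ 0) (hs : s ≠ 0) (hn : 2 ≤ n)
    (hT : IsStandard T (s / r) (r * s) z (t (inv n 1) / t 1) t) (ht : ∀ k, t k ≠ 0)
    {κ : K} (hκ : κ ≠ 0) (htq : t 2 = s ^ 2 * κ * t 1)
    (htQ : t (inv n 2) = r ^ 2 * κ * t (inv n 1))
    (hw : ∀ k, InRange n k → w (bv K n k) = omWeight r s n 0 k • bv K n k)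
    (he : IsLongRoot (n := n) e (inv n 1) 2 1 (inv n 2) α (-(r ^ 2 * s ^ 2 * κ * α))) :
    T * skewOp z 1 w e = skewOp 1 z w e * T := by
  refine hT.intertwine_long hw he ?_ (longHalf_zero_left hr hs hκ ht hn α htq htQ)
    (longHalf_zero_right hr hs hκ ht hn α htq htQ)
  constructor
  all_goals try unfold InRange
  all_goals try unfold inv
  all_goals omega

theorem IsStandard.intertwine_last (hr : r ≠ 0) (hs : s ≠ 0) (hn : 2 ≤ n)
    (hT : IsStandard T (s / r) (r * s) z ξ t) (ht : ∀ k, t k ≠ 0)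
    (htm : t (n + 1) = t n) (htP : t (inv n n) = s / r * t n)
    (hw : ∀ k, InRange n k → w (bv K n k) = omWeight r s n n k • bv K n k)
    (he : IsLongRoot (n := n) e n (n + 1) (inv n n) (n + 1) α (-α)) :
    T * skewOp 1 1 w e = skewOp 1 1 w e * T := by
  refine hT.intertwine_short hw rfl he ⟨by omega, by omega⟩ (by omega) rfl ?_
    (shortConds hr hs ht hn α htm htP)
  simp (disch := omega) only [omWeight, if_pos, if_neg, if_true, lt_irrefl, if_false]

end Standard

theorem isLongRoot_sum {p q P Q : ℕ} (hq : InRange n q) (hP : InRange n P) (hqP : q ≠ P)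
    (α β : K) : IsLongRoot (n := n) (α • E K n p q + β • E K n Q P) p q P Q α β where
  left := by simp [E_apply_bv _ _ hq, hqP.symm]
  right := by simp [E_apply_bv _ _ hP, hqP]
  other k hk h h' := by simp [E_apply_bv _ _ hk, h.symm, h'.symm]

theorem tConst_ne_zero (hr : r ≠ 0) (hs : s ≠ 0) (k : ℕ) : tConst r s n k ≠ 0 := by
  unfold tConst
  split_ifs
  exacts [zpow_ne_zero _ hs, inv_ne_zero hs, zpow_ne_zero _ hr]

theorem tConst_succ (hs : s ≠ 0) {i : ℕ} (hin : i < n) :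
    tConst r s n (i + 1) = s ^ 2 * tConst r s n i := by
  simp (disch := omega) only [tConst, if_pos]
  rw [← zpow_natCast, ← zpow_add₀ hs]
  congr 1
  push_cast
  ring

theorem tConst_inv_succ (hr : r ≠ 0) {i : ℕ} (hin : i < n) :
    tConst r s n (inv n (i + 1)) = r ^ 2 * tConst r s n (inv n i) := by
  unfold inv
  simp (disch := omega) only [tConst, if_neg]
  rw [← zpow_natCast, ← zpow_add₀ hr]
  congr 1
  omega

theorem tConst_mid : tConst r s n (n + 1) = tConst r s n n := by
  simp (disch := omega) only [tConst, if_pos, if_neg, lt_irrefl, if_false, if_true]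
  rw [← zpow_neg_one]
  congr 1
  omega

theorem tConst_inv_last (hs : s ≠ 0) (hn : 2 ≤ n) :
    tConst r s n (inv n n) = s / r * tConst r s n n := by
  rw [← tConst_mid]
  unfold inv
  simp (disch := omega) only [tConst, if_pos, if_neg, lt_irrefl, if_false, if_true]
  have : 2 * ((n : ℤ) + 1 - (2 * n + 2 - n : ℕ)) + 1 = -1 := by omega
  rw [this, zpow_neg_one]
  field_simp

/-- This identifies `ξ` with the value for which the conditions at the affine node were established.
-/
theorem xi_eq (hn : 2 ≤ n) :
    xi r s n = tConst r s n (inv n 1) / tConst r s n 1 := by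
  unfold inv
  simp (disch := omega) only [tConst, if_pos, if_neg]
  rw [xi, div_eq_mul_inv, ← zpow_neg]
  congr 2 <;> omega

/-- The operators `e_i` satisfy the intertwining relation with `R̂(z)`. -/
theorem Rhat_intertwine_e (hr : r ≠ 0) (hs : s ≠ 0) (hn : 2 ≤ n) (a z : K) {i : ℕ} (hi : i ≤ n) :
    Rhat r s n z * skewOp (if i = 0 then z else 1) 1 (diag n (omWeight r s n i)) (eOp r s a n i) =
      skewOp 1 (if i = 0 then z else 1) (diag n (omWeight r s n i)) (eOp r s a n i) *
        Rhat r s n z := by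
  have hT : IsStandard (Rhat r s n z) (s / r) (r * s) z (xi r s n) (tConst r s n) := by
    have := Rhat_isStandard (n := n) (s := s) hr z
    rwa [show r⁻¹ * s = s / r by field_simp] at this
  have ht := tConst_ne_zero (n := n) hr hs
  have hw : ∀ k, InRange n k → diag n (omWeight r s n i) (bv K n k) =
    omWeight r s n i k • bv K n k := fun k hk => diag_apply_bv _ hk
  have he : IsLongRoot (n := n) (eOp r s a n i) (rowIdx n i) (colIdx i) (inv n (rowIdx n i))
      (inv n (colIdx i)) (eCoef a i) (eCoef' r s a i) :=
    isLongRoot_sum (colIdx_inRange hn hi) (rowIdx_inRange hi).inv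
      (by unfold colIdx rowIdx inv; split_ifs <;> omega) _ _
  obtain rfl | h1 | rfl : i = 0 ∨ 1 ≤ i ∧ i < n ∨ i = n := by omega
  · simp only [if_true]
    rw [xi_eq hn] at hT
    refine hT.intertwine_zero hr hs hn ht one_ne_zero
      (by rw [mul_one]; exact tConst_succ hs (by omega))
      (by rw [mul_one]; exact tConst_inv_succ hr (by omega)) hw (α := a) ?_
    simp only [rowIdx, colIdx, if_true, eCoef, eCoef', inv_one_inv] at he
    convert he using 2
    ring
  · rw [if_neg (by omega)]
    refine hT.intertwine_lower hr hs ht h1.1 h1.2 one_ne_zero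
      (by rw [mul_one]; exact tConst_succ hs h1.2)
      (by rw [mul_one]; exact tConst_inv_succ hr h1.2) hw (α := 1) ?_
    simp (disch := omega) only [rowIdx, colIdx, if_neg, eCoef, eCoef'] at he
    simpa using he
  · rw [if_neg (by omega)]
    refine hT.intertwine_last hr hs hn ht (tConst_mid) (tConst_inv_last hs hn) hw (α := 1) ?_
    simp (disch := omega) only [rowIdx, colIdx, if_neg, eCoef, eCoef', inv_succ_self] at he
    exact he

/-- `x (1 ⊗ f) + y (f ⊗ w)`. -/
noncomputable def skewOp' (x y : K) (w f : Module.End K (V K n)) :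
    Module.End K (V K n ⊗[K] V K n) :=
  x • TensorProduct.map 1 f + y • TensorProduct.map f w

/-- The relabelling `v_k ↦ v_{k'}`. -/
noncomputable def relabel (K : Type*) [Field K] (n : ℕ) : Module.End K (V K n) :=
  ∑ k ∈ Finset.Icc 1 (2 * n + 1), E K n (inv n k) k

theorem relabel_bv {k : ℕ} (hk : InRange n k) : relabel K n (bv K n k) = bv K n (inv n k) :=
  sum_E_inv_apply_bv hk

theorem relabel_relabel : relabel K n * relabel K n = 1 :=
  linearMap_ext fun k hk => by
    rw [Module.End.mul_apply, relabel_bv hk, relabel_bv hk.inv, hk.inv_inv, Module.End.one_apply]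

theorem flipInv_tmul (a b : V K n) : flipInv K n (a ⊗ₜ b) = relabel K n b ⊗ₜ relabel K n a := by
  rw [flipInv, LinearMap.comp_apply, LinearEquiv.coe_coe, TensorProduct.comm_tmul,
    TensorProduct.map_tmul]
  rfl

theorem flipInv_mul_skewOp' (x y : K) (w f : Module.End K (V K n)) :
    flipInv K n * skewOp' x y w f * flipInv K n =
      skewOp x y (relabel K n * w * relabel K n) (relabel K n * f * relabel K n) := by
  refine TensorProduct.ext' fun a b => ?_
  have h : ∀ a, relabel K n (relabel K n a) = a := LinearMap.congr_fun relabel_relabel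
  simp [Module.End.mul_apply, flipInv_tmul, skewOp, skewOp', h]

theorem omWeight_inv_inv (r s : K) (hn : 2 ≤ n) {i k : ℕ} (hi : i ≤ n) (hk : InRange n k) :
    omWeight s r n i (inv n k) = omWeight s⁻¹ r⁻¹ n i k := by
  rw [omWeight_inv _ _ _ _ _ hn hi hk.1 hk.2, omWeight_eq _ _ _ _ _ hn, omWeight_eq _ _ _ _ _ hn,
    mul_inv, inv_zpow, inv_zpow]

/-- The operators `f_i` satisfy the intertwining relation with `R̂(z)`. -/
theorem Rhat_intertwine_f (hr : r ≠ 0) (hs : s ≠ 0) (hn : 2 ≤ n) (b z : K) {i : ℕ} (hi : i ≤ n) :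
    Rhat r s n z * skewOp' (if i = 0 then z else 1) 1 (diag n (omWeight s r n i)) (fOp r s b n i) =
      skewOp' 1 (if i = 0 then z else 1) (diag n (omWeight s r n i)) (fOp r s b n i) *
        Rhat r s n z := by
  set J := flipInv K n with hJ
  have hJJ : J * J = 1 := flipInv_flipInv
  -- Conjugation by the involution `J` turns `1 ⊗ f + f ⊗ ω'` into an expression of the shape `e ⊗ 1
  -- + ω ⊗ e`, so the results for `e_i` become available.
  suffices h : (J * Rhat r s n z * J) * (J * skewOp' (if i = 0 then z else 1) 1
      (diag n (omWeight s r n i)) (fOp r s b n i) * J) =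
      (J * skewOp' 1 (if i = 0 then z else 1) (diag n (omWeight s r n i)) (fOp r s b n i) * J) *
        (J * Rhat r s n z * J) by
    have key : ∀ x y : Module.End K (V K n ⊗[K] V K n),
        J * ((J * x * J) * (J * y * J)) * J = x * y := fun x y => by
      calc _ = (J * J) * x * (J * J) * y * (J * J) := by simp only [mul_assoc]
        _ = _ := by rw [hJJ]; simp
    rw [← key, h, key]
  rw [hJ, flipInv_mul_skewOp', flipInv_mul_skewOp']
  have hr' := inv_ne_zero hr
  have hs' := inv_ne_zero hs
  -- The conjugated operator is standard for `(s⁻¹, r⁻¹)` in place of `(r, s)`: the quotient `s / r`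
  -- is unchanged and the product `r s` is inverted. The constants `ξ` and `t_i` stay the same.
  have hT : IsStandard (flipInv K n * Rhat r s n z * flipInv K n) (r⁻¹ / s⁻¹) (s⁻¹ * r⁻¹) z
      (xi r s n) (tConst r s n) := by
    have := (Rhat_isStandard (n := n) (s := s) hr z).flipInv
    rwa [show r⁻¹ * s = r⁻¹ / s⁻¹ by rw [div_eq_mul_inv, inv_inv],
      show (r * s)⁻¹ = s⁻¹ * r⁻¹ by rw [mul_inv, mul_comm]] at this
  have ht := tConst_ne_zero (n := n) hr hs
  have hw : ∀ k, InRange n k → (relabel K n * diag n (omWeight s r n i) * relabel K n) (bv K n k) =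
      omWeight s⁻¹ r⁻¹ n i k • bv K n k := fun k hk => by
    rw [Module.End.mul_apply, Module.End.mul_apply, relabel_bv hk, diag_apply_bv _ hk.inv,
      map_smul, relabel_bv hk.inv, hk.inv_inv, omWeight_inv_inv r s hn hi hk]
  have hf : IsLongRoot (n := n) (fOp r s b n i) (inv n (rowIdx n i)) (inv n (colIdx i)) (rowIdx n i)
      (colIdx i) (fCoef' r s b n i) (fCoef r s b n i) := by
    rw [fOp, add_comm]
    exact isLongRoot_sum (colIdx_inRange hn hi).inv (rowIdx_inRange hi)
      (by unfold colIdx rowIdx inv; split_ifs <;> omega) _ _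
  have he : IsLongRoot (n := n) (relabel K n * fOp r s b n i * relabel K n) (rowIdx n i) (colIdx i)
      (inv n (rowIdx n i)) (inv n (colIdx i)) (fCoef' r s b n i) (fCoef r s b n i) := by
    have hp := rowIdx_inRange hi
    have hq := colIdx_inRange hn hi
    constructor
    · rw [Module.End.mul_apply, Module.End.mul_apply, relabel_bv hq, hf.left, map_smul,
        relabel_bv hp.inv, hp.inv_inv]
    · rw [Module.End.mul_apply, Module.End.mul_apply, relabel_bv hp.inv, hp.inv_inv, hf.right,
        map_smul, relabel_bv hq]
    · intro k hk h h'
      rw [Module.End.mul_apply, Module.End.mul_apply, relabel_bv hk, hf.other _ hk.inv, map_zero]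
      · exact fun h0 => h (by rw [← hk.inv_inv, h0, hq.inv_inv])
      · exact fun h0 => h' (by rw [← h0, hk.inv_inv])
  obtain rfl | h1 | rfl : i = 0 ∨ 1 ≤ i ∧ i < n ∨ i = n := by omega
  · simp only [if_true]
    rw [xi_eq hn] at hT
    -- After the substitution the required ratio `r⁻² κ` has to equal `s²`, and `s⁻² κ` has to equal
    -- `r²`, which forces this `κ`.
    refine hT.intertwine_zero hs' hr' hn ht (κ := (r * s) ^ 2)
      (pow_ne_zero _ (mul_ne_zero hr hs)) ?_ ?_ hw (α := -b) ?_
    · rw [tConst_succ hs (by omega : 1 < n)]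
      field_simp
    · rw [tConst_inv_succ hr (by omega : 1 < n)]
      field_simp
    · simp only [rowIdx, colIdx, if_true, fCoef, fCoef', inv_one_inv] at he
      convert he using 2
      field_simp
  · rw [if_neg (by omega)]
    refine hT.intertwine_lower hs' hr' ht h1.1 h1.2 (κ := (r * s) ^ 2)
      (pow_ne_zero _ (mul_ne_zero hr hs)) ?_ ?_ hw (α := -(r * s) ^ (-2 : ℤ)) ?_
    · rw [tConst_succ hs h1.2]
      field_simp
    · rw [tConst_inv_succ hr h1.2]
      field_simp
    · simp (disch := omega) only [rowIdx, colIdx, if_neg, if_pos, fCoef, fCoef'] at he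
      convert he using 2
      rw [zpow_neg, zpow_ofNat]
      field_simp
  · rw [if_neg (by omega)]
    refine hT.intertwine_last hs' hr' hn ht (tConst_mid) ?_ hw (α := -(r⁻¹ + s⁻¹)) ?_
    · rw [tConst_inv_last hs hn]
      field_simp
    · simp (disch := omega) only [rowIdx, colIdx, if_neg, fCoef, fCoef', inv_succ_self] at he
      rwa [neg_neg]

/-- Group-like elements acting diagonally commute with `R̂(z)`. -/
theorem Rhat_commute_diag (hr : r ≠ 0) (z c : K) {w : ℕ → K}
    (hw : ∀ k, InRange n k → w (inv n k) * w k = c) :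
    Rhat r s n z * TensorProduct.map (diag n w) (diag n w) =
      TensorProduct.map (diag n w) (diag n w) * Rhat r s n z := by
  have hT := Rhat_isStandard (n := n) (s := s) hr z
  have hd : ∀ j k, InRange n j → InRange n k → TensorProduct.map (diag n w) (diag n w) (bb K n j k) =
      (w j * w k) • bb K n j k := fun j k hj hk => by
    rw [bb, TensorProduct.map_tmul, diag_apply_bv _ hj, diag_apply_bv _ hk,
      TensorProduct.tmul_smul, ← TensorProduct.smul_tmul', smul_smul, mul_comm (w k)]
  refine linearMap_ext₂ fun j k hj hk => ?_
  rw [Module.End.mul_apply, Module.End.mul_apply, hd j k hj hk, map_smul]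
  by_cases h1 : k = inv n j
  · subst h1
    rw [hT.conj j hj, Finset.smul_sum, map_sum]
    refine Finset.sum_congr rfl fun i hi => ?_
    have hi : InRange n i := Finset.mem_Icc.1 hi
    rw [map_smul, hd _ _ hi.inv hi, hw i hi, mul_comm (w j), hw j hj, smul_comm]
  by_cases h2 : j = k
  · subst h2
    have h3 := hj.1
    have h4 := hj.2
    rw [hT.self j hj (by unfold inv at *; omega), map_smul, hd j j hj hj, smul_comm]
  · rw [hT.of_ne j k hj hk h2 h1, map_add, map_smul, map_smul, hd j k hj hk, hd k j hk hj,
      mul_comm (w k)]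
    module

end RhatIntertwine

/-! ## Tensor products of modules and the intertwining property for scalar spectral parameters -/

section Pair

variable {K : Type*} [Field K] {r s : K} {n : ℕ}

section General

variable {M N M' N' : Type*} [AddCommGroup M] [Module K M] [AddCommGroup N] [Module K N]

/-- The action of the generators on a tensor product of two modules. -/
noncomputable def pairOp (x : Gen n → Module.End K M) (y : Gen n → Module.End K N) :
    Gen n → Module.End K (M ⊗[K] N)
  | .e i => TensorProduct.map (x (.e i)) 1 + TensorProduct.map (x (.om i)) (y (.e i))
  | .f i => TensorProduct.map 1 (y (.f i)) + TensorProduct.map (x (.f i)) (y (.omp i))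
  | g => TensorProduct.map (x g) (y g)

theorem tensorRep_eq_pairOp {A : Type*} [Ring A] [Algebra K A] {x : Gen n → A}
    {Δ : A →ₐ[K] A ⊗[K] A} (hΔ : IsCoproductOn x Δ) (ρ : A →ₐ[K] Module.End K M)
    (σ : A →ₐ[K] Module.End K N) (g : Gen n) :
    tensorRep Δ ρ σ (x g) = pairOp (fun g => ρ (x g)) (fun g => σ (x g)) g := by
  rw [tensorRep, AlgHom.comp_apply, AlgHom.comp_apply, (isCoproductOn_iff _ _).1 hΔ g]
  have h : ∀ a b : A, (Module.endTensorEndAlgHom (R := K) (S := K) (A := K) (M := M) (N := N))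
      (Algebra.TensorProduct.map ρ σ (a ⊗ₜ b)) = TensorProduct.map (ρ a) (σ b) := fun a b => by
    rw [Algebra.TensorProduct.map_tmul, Module.endTensorEndAlgHom_apply]
    rfl
  cases g <;> simp only [coprodGen, map_add, h, map_one, pairOp]

end General

/-- The action of the generators on `V(u)`. -/
noncomputable def evalOp (r s a b : K) (n : ℕ) (u : K) (g : Gen n) : Module.End K (V K n) :=
  u ^ genDeg g • genOp r s a b n g

theorem exists_isEvaluation (h : IsGeneric r s) (hn : 2 ≤ n) {a b : K}
    (hab : a * b = (r * s) ^ (-2 : ℤ)) {u : K} (hu : u ≠ 0) :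
    ∃ ρ : UPrime r s n →ₐ[K] Module.End K (V K n), IsEvaluation r s a b u n ρ := by
  -- The twist with `C = K` lives in `End V ⊗ K`, which is identified with `End V`.
  have h1 := ((affSat_genOp h hn hab).twist (C := K) (Units.mk0 u hu)).map
    (Algebra.TensorProduct.rid K K (Module.End K (V K n))).toAlgHom
  obtain ⟨ρ, hρ⟩ := UPrime.exists_hom h1
  refine ⟨ρ, fun g => ?_⟩
  rw [hρ]
  simp

theorem genOp_om (h : IsGeneric r s) {a b : K} (hab : a * b = (r * s) ^ (-2 : ℤ))
    (i : Fin (n + 1)) : genOp r s a b n (.om i) = diag n (omWeight r s n i) := by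
  rw [genOp, level_eq_one h hab, ite_self, one_smul]

theorem genOp_omp (h : IsGeneric r s) {a b : K} (hab : a * b = (r * s) ^ (-2 : ℤ))
    (i : Fin (n + 1)) : genOp r s a b n (.omp i) = diag n (omWeight s r n i) := by
  rw [genOp, level_eq_one h hab, ite_self, one_smul]

theorem genOp_omInv (h : IsGeneric r s) {a b : K} (hab : a * b = (r * s) ^ (-2 : ℤ))
    (i : Fin (n + 1)) : genOp r s a b n (.omInv i) = diag n fun k => (omWeight r s n i k)⁻¹ := by
  rw [genOp, level_eq_one h hab, ite_self, inv_one, one_smul]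

theorem genOp_ompInv (h : IsGeneric r s) {a b : K} (hab : a * b = (r * s) ^ (-2 : ℤ))
    (i : Fin (n + 1)) : genOp r s a b n (.ompInv i) = diag n fun k => (omWeight s r n i k)⁻¹ := by
  rw [genOp, level_eq_one h hab, ite_self, inv_one, one_smul]

theorem pairOp_evalOp_e (h : IsGeneric r s) {a b : K} (hab : a * b = (r * s) ^ (-2 : ℤ))
    (u v : K) (i : Fin (n + 1)) :
    pairOp (evalOp r s a b n u) (evalOp r s a b n v) (.e i) =
      skewOp (u ^ genDeg (.e i)) (v ^ genDeg (.e i)) (diag n (omWeight r s n i))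
        (eOp r s a n i) := by
  simp only [pairOp, evalOp, genOp_om h hab, genOp_e, skewOp, TensorProduct.map_smul_left,
    TensorProduct.map_smul_right]
  simp [genDeg]

theorem pairOp_evalOp_f (h : IsGeneric r s) {a b : K} (hab : a * b = (r * s) ^ (-2 : ℤ))
    (u v : K) (i : Fin (n + 1)) :
    pairOp (evalOp r s a b n u) (evalOp r s a b n v) (.f i) =
      skewOp' (v ^ genDeg (.f i)) (u ^ genDeg (.f i)) (diag n (omWeight s r n i))
        (fOp r s b n i) := by
  simp only [pairOp, evalOp, genOp_omp h hab, genOp_f, skewOp', TensorProduct.map_smul_left,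
    TensorProduct.map_smul_right]
  simp [genDeg]

theorem smul_skewOp (c x y : K) (w e : Module.End K (V K n)) :
    c • skewOp x y w e = skewOp (c * x) (c * y) w e := by
  simp only [skewOp, smul_add, smul_smul]

theorem smul_skewOp' (c x y : K) (w e : Module.End K (V K n)) :
    c • skewOp' x y w e = skewOp' (c * x) (c * y) w e := by
  simp only [skewOp', smul_add, smul_smul]

/-- The intertwining property of `R̂(u/v)` on generators. -/
theorem Rhat_mul_pairOp (h : IsGeneric r s) (hn : 2 ≤ n) {a b : K}
    (hab : a * b = (r * s) ^ (-2 : ℤ)) {u v : K} (hu : u ≠ 0) (hv : v ≠ 0) (g : Gen n) :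
    Rhat r s n (u / v) * pairOp (evalOp r s a b n u) (evalOp r s a b n v) g =
      pairOp (evalOp r s a b n v) (evalOp r s a b n u) g * Rhat r s n (u / v) := by
  have hr := h.left_ne_zero
  have hs := h.right_ne_zero
  have hD : ∀ w : ℕ → K, (∀ k, InRange n k → w (inv n k) * w k = 1) →
      Rhat r s n (u / v) * TensorProduct.map (diag n w) (diag n w) =
        TensorProduct.map (diag n w) (diag n w) * Rhat r s n (u / v) :=
    fun w hw => Rhat_commute_diag hr _ 1 hw
  have hw : ∀ (r s : K), IsGeneric r s → ∀ i : Fin (n + 1), ∀ k, InRange n k →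
      omWeight r s n i (inv n k) * omWeight r s n i k = 1 := fun r s h i k hk => by
    rw [omWeight_inv _ _ _ _ _ hn (by omega) hk.1 hk.2,
      inv_mul_cancel₀ (h.omWeight_ne_zero n i k hn)]
  have hw' : ∀ (r s : K), IsGeneric r s → ∀ i : Fin (n + 1), ∀ k, InRange n k →
      (omWeight r s n i (inv n k))⁻¹ * (omWeight r s n i k)⁻¹ = 1 := fun r s h i k hk => by
    rw [← mul_inv, hw r s h i k hk, inv_one]
  cases g with
  | e i =>
    rw [pairOp_evalOp_e h hab, pairOp_evalOp_e h hab]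
    -- At node `0` the relation for `z (e ⊗ 1) + ω ⊗ e` is multiplied by `v`, since `v z = u`; at
    -- other nodes nothing changes.
    have key := congrArg (v ^ genDeg (.e i) • ·)
      (Rhat_intertwine_e hr hs hn a (u / v) (i := (i : ℕ)) (by omega))
    beta_reduce at key
    rw [← mul_smul_comm, ← smul_mul_assoc, smul_skewOp, smul_skewOp, mul_one] at key
    have e : v ^ genDeg (.e i) * (if (i : ℕ) = 0 then u / v else 1) = u ^ genDeg (.e i) := by
      simp only [genDeg]
      split_ifs
      · rw [zpow_one, zpow_one, mul_div_cancel₀ _ hv]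
      · simp
    rwa [e] at key
  | f i =>
    rw [pairOp_evalOp_f h hab, pairOp_evalOp_f h hab]
    -- At node `0` the factor is `u⁻¹`, since `u⁻¹ z = v⁻¹`.
    have key := congrArg (u ^ genDeg (.f i) • ·)
      (Rhat_intertwine_f hr hs hn b (u / v) (i := (i : ℕ)) (by omega))
    beta_reduce at key
    rw [← mul_smul_comm, ← smul_mul_assoc, smul_skewOp', smul_skewOp', mul_one] at key
    have e : u ^ genDeg (.f i) * (if (i : ℕ) = 0 then u / v else 1) = v ^ genDeg (.f i) := by
      simp only [genDeg]
      split_ifs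
      · rw [zpow_neg_one, zpow_neg_one]
        field_simp
      · simp
    rwa [e] at key
  | om i => simpa [pairOp, evalOp, genDeg, genOp_om h hab] using hD _ (hw r s h i)
  | omInv i => simpa [pairOp, evalOp, genDeg, genOp_omInv h hab] using hD _ (hw' r s h i)
  | omp i => simpa [pairOp, evalOp, genDeg, genOp_omp h hab] using hD _ (hw s r h.symm i)
  | ompInv i => simpa [pairOp, evalOp, genDeg, genOp_ompInv h hab] using hD _ (hw' s r h.symm i)
  | ga => simp [pairOp, evalOp, genDeg, genOp, level_eq_one h hab]
  | gaInv => simp [pairOp, evalOp, genDeg, genOp, level_eq_one h hab]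
  | gap => simp [pairOp, evalOp, genDeg, genOp, level_eq_one h hab]
  | gapInv => simp [pairOp, evalOp, genDeg, genOp, level_eq_one h hab]

/-- The elements on which two representations are intertwined form a subalgebra. -/
def intertwiningSubalgebra {A M N : Type*} [Ring A] [Algebra K A] [AddCommGroup M] [Module K M]
    [AddCommGroup N] [Module K N] (ρ : A →ₐ[K] Module.End K M) (σ : A →ₐ[K] Module.End K N)
    (T : M →ₗ[K] N) : Subalgebra K A where
  carrier := {x | T ∘ₗ ρ x = σ x ∘ₗ T}
  mul_mem' {x y} hx hy := by
    change T ∘ₗ ρ x = σ x ∘ₗ T at hx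
    change T ∘ₗ ρ y = σ y ∘ₗ T at hy
    change T ∘ₗ ρ (x * y) = σ (x * y) ∘ₗ T
    rw [map_mul, map_mul, Module.End.mul_eq_comp, Module.End.mul_eq_comp, ← LinearMap.comp_assoc,
      hx, LinearMap.comp_assoc, hy, LinearMap.comp_assoc]
  add_mem' {x y} hx hy := by
    change T ∘ₗ ρ x = σ x ∘ₗ T at hx
    change T ∘ₗ ρ y = σ y ∘ₗ T at hy
    change T ∘ₗ ρ (x + y) = σ (x + y) ∘ₗ T
    rw [map_add, map_add, LinearMap.comp_add, LinearMap.add_comp, hx, hy]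
  algebraMap_mem' c := by
    change T ∘ₗ ρ _ = σ _ ∘ₗ T
    rw [AlgHom.commutes, AlgHom.commutes]
    ext
    simp [Module.algebraMap_end_apply]

/-- The intertwining property of `R̂(u/v)` for scalar spectral parameters. -/
theorem exists_evaluations (h : IsGeneric r s) (hn : 2 ≤ n)
    {Δ : UPrime r s n →ₐ[K] UPrime r s n ⊗[K] UPrime r s n} (hΔ : UPrime.IsCoproduct r s Δ)
    {a b : K} (hab : a * b = (r * s) ^ (-2 : ℤ)) :
    ∃ ρ : K → (UPrime r s n →ₐ[K] Module.End K (V K n)),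
      (∀ u : K, u ≠ 0 → IsEvaluation r s a b u n (ρ u)) ∧
      ∀ u v : K, u ≠ 0 → v ≠ 0 → ∀ x : UPrime r s n,
        Rhat r s n (u / v) ∘ₗ tensorRep Δ (ρ u) (ρ v) x =
          tensorRep Δ (ρ v) (ρ u) x ∘ₗ Rhat r s n (u / v) := by
  have : ∀ u : K, ∃ ρ : UPrime r s n →ₐ[K] Module.End K (V K n),
      u ≠ 0 → IsEvaluation r s a b u n ρ := fun u => by
    -- The family has to be defined at `u = 0` as well; the representation with parameter `1` serves
    -- as an arbitrary value there.
    by_cases hu : u = 0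
    · obtain ⟨ρ, -⟩ := exists_isEvaluation h hn hab one_ne_zero
      exact ⟨ρ, fun h => absurd hu h⟩
    · obtain ⟨ρ, hρ⟩ := exists_isEvaluation h hn hab hu
      exact ⟨ρ, fun _ => hρ⟩
  choose ρ hρ using this
  refine ⟨ρ, hρ, fun u v hu hv x => ?_⟩
  refine UPrime.mem_of_gen_mem (intertwiningSubalgebra (tensorRep Δ (ρ u) (ρ v))
    (tensorRep Δ (ρ v) (ρ u)) (Rhat r s n (u / v))) (fun g => ?_) x
  have e : ∀ u, u ≠ 0 → (fun g => ρ u (UPrime.gen r s n g)) = evalOp r s a b n u :=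
    fun u hu => funext fun g => hρ u hu g
  change _ ∘ₗ _ = _ ∘ₗ _
  rw [tensorRep_eq_pairOp hΔ, tensorRep_eq_pairOp hΔ, e u hu, e v hv]
  exact Rhat_mul_pairOp h hn hab hu hv g

end Pair

/-! ## Specialization of Laurent polynomials -/

section Specialization

variable {K : Type*} [Field K]

/-- The homomorphism from Laurent polynomials to a commutative algebra sending `T` to a unit. -/
noncomputable def evalLaurent {B : Type*} [CommRing B] [Algebra K B] (x : Bˣ) :
    LaurentPolynomial K →ₐ[K] B :=
  AddMonoidAlgebra.lift K B ℤ ((Units.coeHom B).comp (zpowersHom Bˣ x))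

theorem evalLaurent_T {B : Type*} [CommRing B] [Algebra K B] (x : Bˣ) (k : ℤ) :
    evalLaurent (K := K) x (LaurentPolynomial.T k) = ((x ^ k : Bˣ) : B) := by
  rw [evalLaurent, LaurentPolynomial.T, AddMonoidAlgebra.lift_single]
  simp

theorem laurent_linearMap_ext {M : Type*} [AddCommMonoid M] [Module K M]
    {f g : LaurentPolynomial K →ₗ[K] M}
    (h : ∀ k : ℤ, f (LaurentPolynomial.T k) = g (LaurentPolynomial.T k)) : f = g := by
  refine LinearMap.ext fun p => ?_
  induction p using LaurentPolynomial.induction_on' with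
  | add p q hp hq => rw [map_add, map_add, hp, hq]
  | C_mul_T k a =>
    rw [← LaurentPolynomial.smul_eq_C_mul, map_smul, map_smul, h]

theorem tensor_laurent_ext {N M : Type*} [AddCommGroup N] [Module K N] [AddCommMonoid M]
    [Module K M] {f g : N ⊗[K] LaurentPolynomial K →ₗ[K] M}
    (h : ∀ (v : N) (k : ℤ), f (v ⊗ₜ LaurentPolynomial.T k) = g (v ⊗ₜ LaurentPolynomial.T k)) :
    f = g := by
  refine TensorProduct.ext (LinearMap.ext fun v => laurent_linearMap_ext fun k => ?_)
  exact h v k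

/-- After multiplication by a power of the variable this becomes an ordinary polynomial that
vanishes at every nonzero element of an infinite field. -/
theorem laurent_eq_zero_of_eval [Infinite K] {p : LaurentPolynomial K}
    (h : ∀ u : Kˣ, evalLaurent (K := K) u p = 0) : p = 0 := by
  obtain ⟨m, q, hq⟩ := p.exists_T_pow
  have e : ∀ u : Kˣ, evalLaurent (K := K) u (Polynomial.toLaurent q) = q.eval (u : K) := fun u => by
    have : (evalLaurent (K := K) u).comp Polynomial.toLaurentAlg = Polynomial.aeval (u : K) := by
      refine Polynomial.algHom_ext ?_
      rw [AlgHom.comp_apply, Polynomial.toLaurentAlg_apply, Polynomial.toLaurent_X,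
        evalLaurent_T, zpow_one, Polynomial.aeval_X]
    exact DFunLike.congr_fun this q
  have hq0 : q = 0 := by
    refine Polynomial.eq_of_infinite_eval_eq _ _ (Set.Infinite.mono ?_
      (Set.Finite.infinite_compl (Set.finite_singleton (0 : K))))
    intro x hx
    have hx' : x ≠ 0 := hx
    have := e (Units.mk0 x hx')
    rw [hq, map_mul, h, zero_mul, Units.val_mk0] at this
    simpa using this.symm
  rw [hq0, map_zero] at hq
  calc p = p * LaurentPolynomial.T m * LaurentPolynomial.T (-(m : ℤ)) := by
        rw [mul_assoc, ← LaurentPolynomial.T_add, add_neg_cancel, LaurentPolynomial.T_zero, mul_one]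
    _ = 0 := by rw [← hq, zero_mul]

/-- Specialization of `M ⊗ K[u, u⁻¹]` at a nonzero scalar. -/
noncomputable def evalTensor (M : Type*) [AddCommGroup M] [Module K M] (u : Kˣ) :
    M ⊗[K] LaurentPolynomial K →ₗ[K] M :=
  (TensorProduct.rid K M).toLinearMap ∘ₗ (evalLaurent u).toLinearMap.lTensor M

theorem evalTensor_tmul {M : Type*} [AddCommGroup M] [Module K M] (u : Kˣ) (m : M)
    (p : LaurentPolynomial K) : evalTensor M u (m ⊗ₜ p) = evalLaurent (K := K) u p • m := by
  simp [evalTensor]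

/-- The coordinates with respect to a basis of `M` are Laurent polynomials. `M` may have infinite
dimension, which is needed when one variable is specialized before the other. -/
theorem eq_zero_of_evalTensor [Infinite K] {M : Type*} [AddCommGroup M] [Module K M]
    {f : M ⊗[K] LaurentPolynomial K} (h : ∀ u : Kˣ, evalTensor M u f = 0) : f = 0 := by
  classical
  let b := Module.Basis.ofVectorSpace K M
  let Φ := (TensorProduct.congr b.repr (LinearEquiv.refl K (LaurentPolynomial K))).trans
    (TensorProduct.finsuppScalarLeft K (LaurentPolynomial K) _)
  have key : ∀ (f : M ⊗[K] LaurentPolynomial K) (u : Kˣ) i,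
      evalLaurent (K := K) u (Φ f i) = b.coord i (evalTensor M u f) := fun f u i => by
    induction f using TensorProduct.induction_on with
    | zero => simp
    | tmul m p => simp [Φ, evalTensor_tmul, mul_comm]
    | add f g hf hg => simp only [map_add, Finsupp.add_apply, hf, hg]
  refine Φ.map_eq_zero_iff.1 (Finsupp.ext fun i => laurent_eq_zero_of_eval fun u => ?_)
  rw [key, h, map_zero]

variable {n : ℕ}

/-- Specialization of `V(u) ⊗ V(v)` at nonzero scalars. -/
noncomputable def evalPair (K : Type*) [Field K] (n : ℕ) (u v : Kˣ) :
    VLaurent K n ⊗[K] VLaurent K n →ₗ[K] V K n ⊗[K] V K n :=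
  TensorProduct.map (evalTensor (V K n) u) (evalTensor (V K n) v)

theorem evalTensor_assoc_symm {M N : Type*} [AddCommGroup M] [Module K M] [AddCommGroup N]
    [Module K N] (u : Kˣ) (X : M ⊗[K] (N ⊗[K] LaurentPolynomial K)) :
    evalTensor (M ⊗[K] N) u ((TensorProduct.assoc K M N (LaurentPolynomial K)).symm X) =
      (evalTensor N u).lTensor M X := by
  have : evalTensor (M ⊗[K] N) u ∘ₗ
      (TensorProduct.assoc K M N (LaurentPolynomial K)).symm.toLinearMap =
      (evalTensor N u).lTensor M := by
    refine TensorProduct.ext (LinearMap.ext fun m => TensorProduct.ext' fun b q => ?_)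
    simp [evalTensor_tmul]
  exact LinearMap.congr_fun this X

theorem eq_zero_of_lTensor_evalTensor [Infinite K] {M N : Type*} [AddCommGroup M] [Module K M]
    [AddCommGroup N] [Module K N] {X : M ⊗[K] (N ⊗[K] LaurentPolynomial K)}
    (h : ∀ u : Kˣ, (evalTensor N u).lTensor M X = 0) : X = 0 := by
  refine (LinearEquiv.map_eq_zero_iff
    (TensorProduct.assoc K M N (LaurentPolynomial K)).symm).1 (eq_zero_of_evalTensor fun u => ?_)
  rw [evalTensor_assoc_symm, h]

/-- The two variables are separated: for each fixed `u`, varying `v` shows that the specialization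
in the first factor alone is zero; varying `u` then gives `X = 0`. -/
theorem eq_zero_of_evalPair [Infinite K] {X : VLaurent K n ⊗[K] VLaurent K n}
    (h : ∀ u v : Kˣ, evalPair K n u v X = 0) : X = 0 := by
  have h1 : ∀ u : Kˣ, (evalTensor (V K n) u).rTensor (VLaurent K n) X = 0 := fun u =>
    eq_zero_of_lTensor_evalTensor fun v => by
      rw [← h u v, ← LinearMap.comp_apply, LinearMap.lTensor_comp_rTensor, evalPair]
  refine (LinearEquiv.map_eq_zero_iff (TensorProduct.comm K (VLaurent K n) (VLaurent K n))).1
    (eq_zero_of_lTensor_evalTensor fun u => ?_)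
  have e : (evalTensor (V K n) u).lTensor (VLaurent K n) ∘ₗ
      (TensorProduct.comm K (VLaurent K n) (VLaurent K n)).toLinearMap =
      (TensorProduct.comm K (V K n) (VLaurent K n)).toLinearMap ∘ₗ
        (evalTensor (V K n) u).rTensor (VLaurent K n) := TensorProduct.ext rfl
  exact (LinearMap.congr_fun e X).trans (by rw [LinearMap.comp_apply, h1, map_zero])

end Specialization

/-! ## Evaluation modules for an indeterminate spectral parameter -/

section Formal

variable {K : Type*} [Field K] {r s : K} {n : ℕ}

/-- The indeterminate as a unit. -/
noncomputable def laurentVar (K : Type*) [Field K] : (LaurentPolynomial K)ˣ where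
  val := LaurentPolynomial.T 1
  inv := LaurentPolynomial.T (-1)
  val_inv := by rw [← LaurentPolynomial.T_add]; simp
  inv_val := by rw [← LaurentPolynomial.T_add]; simp

theorem laurentVar_zpow (k : ℤ) :
    ((laurentVar K ^ k : (LaurentPolynomial K)ˣ) : LaurentPolynomial K) = LaurentPolynomial.T k := by
  induction k with
  | zero => simp
  | succ k ih => rw [zpow_add_one, Units.val_mul, ih, laurentVar, LaurentPolynomial.T_add]
  | pred k ih =>
    rw [zpow_sub_one, Units.val_mul, ih, sub_eq_add_neg, LaurentPolynomial.T_add]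
    rfl

/-- The substitution `u ↦ c u` of Laurent polynomials. -/
noncomputable def dilate (c : Kˣ) : LaurentPolynomial K →ₗ[K] LaurentPolynomial K :=
  (evalLaurent (K := K) (Units.map (algebraMap K (LaurentPolynomial K)).toMonoidHom c *
    laurentVar K)).toLinearMap

theorem dilate_T (c : Kˣ) (k : ℤ) :
    dilate c (LaurentPolynomial.T k) = ((c ^ k : Kˣ) : K) • LaurentPolynomial.T k := by
  rw [dilate, AlgHom.toLinearMap_apply, evalLaurent_T, mul_zpow, ← map_zpow, Units.val_mul,
    laurentVar_zpow, Algebra.smul_def]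
  rfl

/-- The operator `f ⊗ p` acts on `V ⊗ K[u, u⁻¹]` by `f` and by multiplication by `p`. -/
noncomputable def laurentRep (K : Type*) [Field K] (n : ℕ) :
    Module.End K (V K n) ⊗[K] LaurentPolynomial K →ₐ[K] Module.End K (VLaurent K n) :=
  (Module.endTensorEndAlgHom (R := K) (S := K) (A := K)).comp
    (Algebra.TensorProduct.map (AlgHom.id K _) (Algebra.lmul K (LaurentPolynomial K)))

theorem laurentRep_tmul (f : Module.End K (V K n)) (p : LaurentPolynomial K) (v : V K n)
    (q : LaurentPolynomial K) : laurentRep K n (f ⊗ₜ p) (v ⊗ₜ q) = f v ⊗ₜ (p * q) := by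
  rw [laurentRep, AlgHom.comp_apply, Algebra.TensorProduct.map_tmul,
    Module.endTensorEndAlgHom_apply]
  rfl

/-- The action of the generators on `V ⊗ K[u, u⁻¹]`. -/
noncomputable def formalOp (r s a b : K) (n : ℕ) (ρ₀ σ₀ : Kˣ) :
    Gen n ⊕ DegGen → Module.End K (VLaurent K n)
  | .inl g => laurentRep K n (genOp r s a b n g ⊗ₜ
      ((laurentVar K ^ genDeg g : (LaurentPolynomial K)ˣ) : LaurentPolynomial K))
  | .inr .D => TensorProduct.map 1 (dilate ρ₀)
  | .inr .DInv => TensorProduct.map 1 (dilate ρ₀⁻¹)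
  | .inr .Dp => TensorProduct.map 1 (dilate σ₀)
  | .inr .DpInv => TensorProduct.map 1 (dilate σ₀⁻¹)

theorem formalOp_gen (r s a b : K) (ρ₀ σ₀ : Kˣ) (g : Gen n) (v : V K n) (k : ℤ) :
    formalOp r s a b n ρ₀ σ₀ (.inl g) (v ⊗ₜ LaurentPolynomial.T k) =
      genOp r s a b n g v ⊗ₜ LaurentPolynomial.T (k + genDeg g) := by
  rw [formalOp, laurentRep_tmul, laurentVar_zpow, ← LaurentPolynomial.T_add, add_comm (genDeg g)]

theorem map_dilate_tmul (c : Kˣ) (v : V K n) (k : ℤ) :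
    TensorProduct.map (1 : Module.End K (V K n)) (dilate c) (v ⊗ₜ LaurentPolynomial.T k) =
      ((c ^ k : Kˣ) : K) • (v ⊗ₜ LaurentPolynomial.T k) := by
  rw [TensorProduct.map_tmul, dilate_T, TensorProduct.tmul_smul, Module.End.one_apply]

theorem vertexParam_zero_ne_zero (h : r ≠ 0) : vertexParam r n 0 ≠ 0 := zpow_ne_zero _ h

theorem affDegSat_formalOp (h : IsGeneric r s) (hn : 2 ≤ n) {a b : K}
    (hab : a * b = (r * s) ^ (-2 : ℤ)) :
    AffDegSat r s (formalOp r s a b n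
      (Units.mk0 _ (vertexParam_zero_ne_zero (n := n) h.left_ne_zero))
      (Units.mk0 _ (vertexParam_zero_ne_zero (n := n) h.right_ne_zero))) := by
  set ρ₀ := Units.mk0 _ (vertexParam_zero_ne_zero (n := n) h.left_ne_zero) with hρ
  set σ₀ := Units.mk0 _ (vertexParam_zero_ne_zero (n := n) h.right_ne_zero) with hσ
  have hmul : ∀ c d : Kˣ, ∀ v : V K n, ∀ k : ℤ,
      (TensorProduct.map 1 (dilate c)) (TensorProduct.map 1 (dilate d)
        (v ⊗ₜ LaurentPolynomial.T k)) =
      (((c * d) ^ k : Kˣ) : K) • (v ⊗ₜ[K] LaurentPolynomial.T k) := fun c d v k => by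
    rw [map_dilate_tmul, map_smul, map_dilate_tmul, smul_smul, mul_comm c, mul_zpow, Units.val_mul]
  have hcomm : ∀ (c : Kˣ) (g : Gen n), genDeg g = 0 →
      TensorProduct.map 1 (dilate c) * formalOp r s a b n ρ₀ σ₀ (.inl g) =
        formalOp r s a b n ρ₀ σ₀ (.inl g) * TensorProduct.map 1 (dilate c) := fun c g hg => by
    refine tensor_laurent_ext fun v k => ?_
    rw [Module.End.mul_apply, Module.End.mul_apply, formalOp_gen, map_dilate_tmul, map_dilate_tmul,
      map_smul, formalOp_gen, hg, add_zero]
  have hconj : ∀ (c : Kˣ) (g : Gen n),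
      TensorProduct.map 1 (dilate c) * formalOp r s a b n ρ₀ σ₀ (.inl g) *
        TensorProduct.map 1 (dilate c⁻¹) =
        ((c ^ genDeg g : Kˣ) : K) • formalOp r s a b n ρ₀ σ₀ (.inl g) := fun c g => by
    refine tensor_laurent_ext fun v k => ?_
    rw [Module.End.mul_apply, Module.End.mul_apply, LinearMap.smul_apply, map_dilate_tmul, map_smul,
      map_smul, formalOp_gen, map_dilate_tmul, smul_smul, ← Units.val_mul]
    congr 2
    rw [inv_zpow, zpow_add]
    group
  have hone : ∀ c d : Kˣ, c * d = 1 → TensorProduct.map (1 : Module.End K (V K n)) (dilate c) *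
      TensorProduct.map 1 (dilate d) = 1 := fun c d hcd => by
    refine tensor_laurent_ext fun v k => ?_
    rw [Module.End.mul_apply, hmul, hcd, one_zpow, Units.val_one, one_smul, Module.End.one_apply]
  intro p q hpq
  cases hpq with
  | base hpq => exact ((affSat_genOp h hn hab).twist (laurentVar K)).map (laurentRep K n) _ _ hpq
  | D_inv => exact hone _ _ (mul_inv_cancel _)
  | D_inv' => exact hone _ _ (inv_mul_cancel _)
  | Dp_inv => exact hone _ _ (mul_inv_cancel _)
  | Dp_inv' => exact hone _ _ (inv_mul_cancel _)
  | D_Dp =>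
    refine tensor_laurent_ext fun v k => ?_
    rw [Module.End.mul_apply, Module.End.mul_apply]
    simp only [formalOp]
    rw [hmul, hmul, mul_comm ρ₀]
  | D_om i => exact hcomm _ _ rfl
  | D_omp i => exact hcomm _ _ rfl
  | Dp_om i => exact hcomm _ _ rfl
  | Dp_omp i => exact hcomm _ _ rfl
  | D_e i =>
    refine (hconj _ _).trans ?_
    congr 1
    by_cases hi : i = 0
    · subst hi; simp [genDeg, hρ]
    · simp [genDeg, hi]
  | D_f i =>
    refine (hconj _ _).trans ?_
    congr 1
    by_cases hi : i = 0
    · subst hi; simp [genDeg, hρ]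
    · simp [genDeg, hi]
  | Dp_e i =>
    refine (hconj _ _).trans ?_
    congr 1
    by_cases hi : i = 0
    · subst hi; simp [genDeg, hσ]
    · simp [genDeg, hi]
  | Dp_f i =>
    refine (hconj _ _).trans ?_
    congr 1
    by_cases hi : i = 0
    · subst hi; simp [genDeg, hσ]
    · simp [genDeg, hi]

/-! ### Specialization of the operators -/

theorem evalTensor_formalOp (r s a b : K) (ρ₀ σ₀ : Kˣ) (u : Kˣ) (g : Gen n) :
    evalTensor (V K n) u ∘ₗ formalOp r s a b n ρ₀ σ₀ (.inl g) =
      evalOp r s a b n (u : K) g ∘ₗ evalTensor (V K n) u := by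
  refine tensor_laurent_ext fun v k => ?_
  rw [LinearMap.comp_apply, LinearMap.comp_apply, formalOp_gen, evalTensor_tmul, evalTensor_tmul,
    evalLaurent_T, evalLaurent_T, evalOp, LinearMap.smul_apply, map_smul, smul_smul, zpow_add,
    Units.val_mul, mul_comm ((u ^ k : Kˣ) : K), Units.val_zpow_eq_zpow_val u (genDeg g)]

/-- The degree operators rescale the spectral parameter. On a tensor product they rescale `u` and
`v` by the same factor and so leave `u / v` unchanged, which is why they commute with the formal
operator. -/
theorem evalTensor_dilate (c u : Kˣ) :
    evalTensor (V K n) u ∘ₗ TensorProduct.map 1 (dilate c) = evalTensor (V K n) (c * u) := by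
  refine tensor_laurent_ext fun v k => ?_
  rw [LinearMap.comp_apply, map_dilate_tmul, map_smul, evalTensor_tmul, evalTensor_tmul,
    evalLaurent_T, evalLaurent_T, smul_smul, mul_zpow, Units.val_mul]

theorem evalPair_dilate (c u v : Kˣ) :
    evalPair K n u v ∘ₗ TensorProduct.map (TensorProduct.map 1 (dilate c))
      (TensorProduct.map 1 (dilate c)) = evalPair K n (c * u) (c * v) := by
  rw [evalPair, ← TensorProduct.map_comp, evalTensor_dilate, evalTensor_dilate, evalPair]

theorem comp_pairOp {M N M' N' : Type*} [AddCommGroup M] [Module K M] [AddCommGroup N] [Module K N]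
    [AddCommGroup M'] [Module K M'] [AddCommGroup N'] [Module K N'] {x : Gen n → Module.End K M}
    {y : Gen n → Module.End K N} {x' : Gen n → Module.End K M'} {y' : Gen n → Module.End K N'}
    {φ : M →ₗ[K] M'} {ψ : N →ₗ[K] N'} (hx : ∀ g, φ ∘ₗ x g = x' g ∘ₗ φ)
    (hy : ∀ g, ψ ∘ₗ y g = y' g ∘ₗ ψ) (g : Gen n) :
    TensorProduct.map φ ψ ∘ₗ pairOp x y g = pairOp x' y' g ∘ₗ TensorProduct.map φ ψ := by
  have h1 : φ ∘ₗ (1 : Module.End K M) = (1 : Module.End K M') ∘ₗ φ := rfl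
  have h2 : ψ ∘ₗ (1 : Module.End K N) = (1 : Module.End K N') ∘ₗ ψ := rfl
  cases g <;> simp only [pairOp, LinearMap.comp_add, LinearMap.add_comp, ← TensorProduct.map_comp,
    hx, hy, h1, h2]

theorem evalPair_pairOp (r s a b : K) (ρ₀ σ₀ : Kˣ) (u v : Kˣ) (g : Gen n) :
    evalPair K n u v ∘ₗ pairOp (fun g => formalOp r s a b n ρ₀ σ₀ (.inl g))
      (fun g => formalOp r s a b n ρ₀ σ₀ (.inl g)) g =
    pairOp (evalOp r s a b n (u : K)) (evalOp r s a b n (v : K)) g ∘ₗ evalPair K n u v :=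
  comp_pairOp (fun g => evalTensor_formalOp r s a b ρ₀ σ₀ u g)
    (fun g => evalTensor_formalOp r s a b ρ₀ σ₀ v g) g

/-- Specialization of Laurent polynomials in two variables. -/
noncomputable def evalLaurent₂ (u v : Kˣ) :
    LaurentPolynomial K ⊗[K] LaurentPolynomial K →ₐ[K] K :=
  Algebra.TensorProduct.productMap (evalLaurent u) (evalLaurent v)

theorem evalPair_eq (u v : Kˣ) :
    evalPair K n u v = (TensorProduct.rid K _).toLinearMap ∘ₗ
      (evalLaurent₂ u v).toLinearMap.lTensor (V K n ⊗[K] V K n) ∘ₗ (regroup K n).toLinearMap := by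
  refine TensorProduct.ext (TensorProduct.ext' fun a p => TensorProduct.ext' fun b q => ?_)
  simp [evalPair, evalTensor_tmul, evalLaurent₂, regroup, TensorProduct.smul_tmul', smul_smul,
    mul_comm]

theorem evalLaurent₂_comm (u v : Kˣ) (y : LaurentPolynomial K ⊗[K] LaurentPolynomial K) :
    evalLaurent₂ v u (TensorProduct.comm K _ _ y) = evalLaurent₂ u v y := by
  induction y using TensorProduct.induction_on with
  | zero => simp
  | tmul p q => simp [evalLaurent₂, mul_comm]
  | add f g hf hg => rw [map_add, map_add, map_add, hf, hg]

theorem evalLaurent₂_aeval (u v : Kˣ) (p : Polynomial K) :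
    evalLaurent₂ u v (Polynomial.aeval (ratio K) p) = p.eval ((u : K) / v) := by
  rw [← Polynomial.aeval_algHom_apply, ratio, evalLaurent₂, Algebra.TensorProduct.productMap_apply_tmul,
    evalLaurent_T, evalLaurent_T, zpow_one, zpow_neg_one, Units.val_inv_eq_inv_val,
    ← div_eq_mul_inv, Polynomial.coe_aeval_eq_eval]

theorem evalPair_comp_term (u v : Kˣ) (p : Polynomial K) (A : Module.End K (V K n ⊗[K] V K n)) :
    evalPair K n v u ∘ₗ ((regroup K n).symm.toLinearMap ∘ₗ
      TensorProduct.map A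
        ((TensorProduct.comm K (LaurentPolynomial K) (LaurentPolynomial K)).toLinearMap ∘ₗ
          LinearMap.mulLeft K (Polynomial.aeval (ratio K) p)) ∘ₗ
      (regroup K n).toLinearMap) =
    (p.eval ((u : K) / v) • A) ∘ₗ evalPair K n u v := by
  have key : (TensorProduct.rid K _).toLinearMap ∘ₗ
      (evalLaurent₂ v u).toLinearMap.lTensor (V K n ⊗[K] V K n) ∘ₗ TensorProduct.map A
        ((TensorProduct.comm K (LaurentPolynomial K) (LaurentPolynomial K)).toLinearMap ∘ₗ
          LinearMap.mulLeft K (Polynomial.aeval (ratio K) p)) =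
      (p.eval ((u : K) / v) • A) ∘ₗ (TensorProduct.rid K _).toLinearMap ∘ₗ
        (evalLaurent₂ u v).toLinearMap.lTensor (V K n ⊗[K] V K n) := by
    refine TensorProduct.ext' fun x y => ?_
    simp only [LinearMap.comp_apply, TensorProduct.map_tmul, LinearMap.lTensor_tmul,
      LinearEquiv.coe_coe, TensorProduct.rid_tmul, LinearMap.mulLeft_apply,
      AlgHom.toLinearMap_apply, evalLaurent₂_comm, map_mul, evalLaurent₂_aeval, map_smul,
      LinearMap.smul_apply, smul_smul]
    rw [mul_comm (Polynomial.eval _ _)]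
  refine LinearMap.ext fun X => ?_
  have := LinearMap.congr_fun key (regroup K n X)
  simpa only [evalPair_eq, LinearMap.comp_apply, LinearEquiv.coe_coe,
    LinearEquiv.apply_symm_apply] using this

/-- This reduces the formal intertwining property to the scalar one. The parameters are exchanged on
the left because the first factor of the target carries `v`. -/
theorem evalPair_RhatFormal (u v : Kˣ) :
    evalPair K n v u ∘ₗ RhatFormal r s n = Rhat r s n ((u : K) / v) ∘ₗ evalPair K n u v := by
  have key := fun p A X => LinearMap.congr_fun (evalPair_comp_term (n := n) u v p A) X
  refine LinearMap.ext fun X => ?_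
  simp only [LinearMap.comp_apply] at key
  simp only [RhatFormal, Rhat, RhatSum, LinearMap.comp_apply, LinearMap.add_apply,
    LinearMap.sum_apply, map_add, map_sum, key]

theorem tensorRep_groupLike {A M N : Type*} [Ring A] [Algebra K A] [AddCommGroup M] [Module K M]
    [AddCommGroup N] [Module K N] {Δ : A →ₐ[K] A ⊗[K] A} {x : A} (hx : Δ x = x ⊗ₜ x)
    (ρ : A →ₐ[K] Module.End K M) (σ : A →ₐ[K] Module.End K N) :
    tensorRep Δ ρ σ x = TensorProduct.map (ρ x) (σ x) := by
  rw [tensorRep, AlgHom.comp_apply, AlgHom.comp_apply, hx, Algebra.TensorProduct.map_tmul,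
    Module.endTensorEndAlgHom_apply]
  rfl

/-- The intertwining property of `R̂(u/v)` for indeterminates `u` and `v`. -/
theorem exists_formalEvaluation [Infinite K] (h : IsGeneric r s) (hn : 2 ≤ n)
    {Δ : UAff r s n →ₐ[K] UAff r s n ⊗[K] UAff r s n} (hΔ : UAff.IsCoproduct r s Δ)
    {a b : K} (hab : a * b = (r * s) ^ (-2 : ℤ)) :
    ∃ ρ : UAff r s n →ₐ[K] Module.End K (VLaurent K n), IsFormalEvaluation r s a b n ρ ∧
      ∀ x : UAff r s n, RhatFormal r s n ∘ₗ tensorRep Δ ρ ρ x =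
        tensorRep Δ ρ ρ x ∘ₗ RhatFormal r s n := by
  obtain ⟨ρ, hρ⟩ := UAff.exists_hom (affDegSat_formalOp h hn hab)
  refine ⟨ρ, ⟨fun g v k => ?_, fun v k => ?_, fun v k => ?_, fun v k => ?_, fun v k => ?_⟩,
    fun x => ?_⟩
  · rw [hρ, formalOp_gen]
  · rw [hρ, formalOp, map_dilate_tmul]
    simp
  · rw [hρ, formalOp, map_dilate_tmul]
    simp
  · rw [hρ, formalOp, map_dilate_tmul]
    simp
  · rw [hρ, formalOp, map_dilate_tmul]
    simp
  refine UAff.mem_of_gen_mem (intertwiningSubalgebra (tensorRep Δ ρ ρ) (tensorRep Δ ρ ρ)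
    (RhatFormal r s n)) (fun g => ?_) x
  change _ ∘ₗ _ = _ ∘ₗ _
  -- It suffices to compare the two sides after every specialization; `v` comes first because both
  -- sides take values in `V(v) ⊗ V(u)`.
  refine LinearMap.ext fun m => sub_eq_zero.1 (eq_zero_of_evalPair fun v u => ?_)
  have hR := fun (u v : Kˣ) X => LinearMap.congr_fun (evalPair_RhatFormal (r := r) (s := s) (n := n) u v) X
  simp only [LinearMap.comp_apply] at hR
  rw [map_sub, sub_eq_zero, LinearMap.comp_apply, LinearMap.comp_apply, hR]
  have hdil : ∀ (c : Kˣ), tensorRep Δ ρ ρ (UAff.gen r s n g) =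
      TensorProduct.map (TensorProduct.map 1 (dilate c)) (TensorProduct.map 1 (dilate c)) →
      Rhat r s n ((u : K) / v) (evalPair K n u v (tensorRep Δ ρ ρ (UAff.gen r s n g) m)) =
        evalPair K n v u (tensorRep Δ ρ ρ (UAff.gen r s n g) (RhatFormal r s n m)) :=
    fun c hc => by
    have hc' := fun (u v : Kˣ) X => LinearMap.congr_fun (evalPair_dilate (n := n) c u v) X
    simp only [LinearMap.comp_apply] at hc'
    rw [hc, hc', hc', hR, Units.val_mul, Units.val_mul, mul_div_mul_left _ _ c.ne_zero]
  match g with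
  | .inl g =>
    rw [tensorRep_eq_pairOp hΔ.1]
    simp only [hρ]
    have h1 := fun (u v : Kˣ) X => LinearMap.congr_fun (evalPair_pairOp (n := n) r s a b
      (Units.mk0 _ (vertexParam_zero_ne_zero (n := n) h.left_ne_zero))
      (Units.mk0 _ (vertexParam_zero_ne_zero (n := n) h.right_ne_zero)) u v g) X
    simp only [LinearMap.comp_apply] at h1
    rw [h1, h1, hR]
    exact LinearMap.congr_fun (Rhat_mul_pairOp h hn hab u.ne_zero v.ne_zero g) _
  | .inr .D => exact hdil _ (by rw [tensorRep_groupLike (hΔ.2 .D), hρ]; rfl)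
  | .inr .DInv => exact hdil _ (by rw [tensorRep_groupLike (hΔ.2 .DInv), hρ]; rfl)
  | .inr .Dp => exact hdil _ (by rw [tensorRep_groupLike (hΔ.2 .Dp), hρ]; rfl)
  | .inr .DpInv => exact hdil _ (by rw [tensorRep_groupLike (hΔ.2 .DpInv), hρ]; rfl)

end Formal

/-! ## Threefold tensor products -/

section Triple

variable {K : Type*} [Field K] {r s : K} {n : ℕ}

/-- The associator intertwines the two actions on a threefold tensor product. -/
theorem assoc_comp_pairOp {L M N : Type*} [AddCommGroup L] [Module K L] [AddCommGroup M]
    [Module K M] [AddCommGroup N] [Module K N] (x : Gen n → Module.End K L)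
    (y : Gen n → Module.End K M) (z : Gen n → Module.End K N) (g : Gen n) :
    (TensorProduct.assoc K L M N).toLinearMap ∘ₗ pairOp (pairOp x y) z g =
      pairOp x (pairOp y z) g ∘ₗ (TensorProduct.assoc K L M N).toLinearMap := by
  refine TensorProduct.ext_threefold fun a b c => ?_
  cases g <;>
  simp [pairOp, TensorProduct.add_tmul, TensorProduct.tmul_add, add_assoc]

/-- The action of the generators on `V(u) ⊗ V(v) ⊗ V(w)`. -/
noncomputable def tripleOp (r s a b : K) (n : ℕ) (u v w : K) (g : Gen n) :
    Module.End K (V K n ⊗[K] (V K n ⊗[K] V K n)) :=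
  pairOp (evalOp r s a b n u) (pairOp (evalOp r s a b n v) (evalOp r s a b n w)) g

theorem op23_Rhat_mul_tripleOp (h : IsGeneric r s) (hn : 2 ≤ n) {a b : K}
    (hab : a * b = (r * s) ^ (-2 : ℤ)) (u : K) {v w : K} (hv : v ≠ 0) (hw : w ≠ 0) (g : Gen n) :
    op23 (Rhat r s n (v / w)) * tripleOp r s a b n u v w g =
      tripleOp r s a b n u w v g * op23 (Rhat r s n (v / w)) :=
  comp_pairOp (φ := LinearMap.id) (x := evalOp r s a b n u) (x' := evalOp r s a b n u)
    (fun _ => rfl) (fun g => Rhat_mul_pairOp h hn hab hv hw g) g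

theorem op12_Rhat_mul_tripleOp (h : IsGeneric r s) (hn : 2 ≤ n) {a b : K}
    (hab : a * b = (r * s) ^ (-2 : ℤ)) {u v : K} (hu : u ≠ 0) (hv : v ≠ 0) (w : K) (g : Gen n) :
    op12 (Rhat r s n (u / v)) * tripleOp r s a b n u v w g =
      tripleOp r s a b n v u w g * op12 (Rhat r s n (u / v)) := by
  have key := comp_pairOp (ψ := LinearMap.id) (y := evalOp r s a b n w)
    (y' := evalOp r s a b n w) (fun g => Rhat_mul_pairOp h hn hab hu hv g) (fun _ => rfl) g
  refine LinearMap.ext fun y => ?_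
  obtain ⟨y, rfl⟩ := (TensorProduct.assoc K (V K n) (V K n) (V K n)).surjective y
  have h1 := LinearMap.congr_fun (assoc_comp_pairOp (evalOp r s a b n u) (evalOp r s a b n v)
    (evalOp r s a b n w) g) y
  have h2 := LinearMap.congr_fun (assoc_comp_pairOp (evalOp r s a b n v) (evalOp r s a b n u)
    (evalOp r s a b n w) g)
  simp only [LinearMap.comp_apply, LinearEquiv.coe_coe] at h1 h2
  simp only [Module.End.mul_apply, op12, LinearMap.comp_apply, LinearEquiv.coe_coe, tripleOp,
    LinearEquiv.symm_apply_apply]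
  rw [← h1, ← h2, LinearEquiv.symm_apply_apply]
  exact congrArg _ (LinearMap.congr_fun key y)

/-- The difference of the two sides of the Yang–Baxter equation for `R̂`. -/
noncomputable def ybDefect (r s : K) (n : ℕ) (x y z : K) :
    Module.End K (V K n ⊗[K] (V K n ⊗[K] V K n)) :=
  op12 (Rhat r s n z) * (op23 (Rhat r s n y) * op12 (Rhat r s n x))
    - op23 (Rhat r s n x) * (op12 (Rhat r s n y) * op23 (Rhat r s n z))

/-- Both sides of the braid relation are composites of three intertwiners that reverse the order of
`u, v, w`, along the two reduced words of the longest permutation of three letters. Consequently the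
kernel of the difference is stable under the generators. -/
theorem ybDefect_mul_tripleOp (h : IsGeneric r s) (hn : 2 ≤ n) {a b : K}
    (hab : a * b = (r * s) ^ (-2 : ℤ)) {u v w : K} (hu : u ≠ 0) (hv : v ≠ 0) (hw : w ≠ 0)
    (g : Gen n) :
    ybDefect r s n (u / v) (u / w) (v / w) * tripleOp r s a b n u v w g =
      tripleOp r s a b n w v u g * ybDefect r s n (u / v) (u / w) (v / w) := by
  refine LinearMap.ext fun y => ?_
  have h12 := fun {u v : K} (hu : u ≠ 0) (hv : v ≠ 0) (w : K) (y) =>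
    LinearMap.congr_fun (op12_Rhat_mul_tripleOp h hn hab hu hv w g) y
  have h23 := fun (u : K) {v w : K} (hv : v ≠ 0) (hw : w ≠ 0) (y) =>
    LinearMap.congr_fun (op23_Rhat_mul_tripleOp h hn hab u hv hw g) y
  simp only [Module.End.mul_apply] at h12 h23
  simp only [ybDefect, Module.End.mul_apply, LinearMap.sub_apply, map_sub]
  rw [h12 hu hv, h23 v hu hw, h12 hv hw, h23 u hv hw, h12 hu hw, h23 w hu hv]

/-- The basis vector `v_a ⊗ v_b ⊗ v_c`. -/
def tri (K : Type*) [Field K] (n a b c : ℕ) : V K n ⊗[K] (V K n ⊗[K] V K n) :=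
  bv K n a ⊗ₜ (bv K n b ⊗ₜ bv K n c)

theorem linearMap_ext₃ {M : Type*} [AddCommMonoid M] [Module K M]
    {f g : V K n ⊗[K] (V K n ⊗[K] V K n) →ₗ[K] M}
    (h : ∀ a b c, InRange n a → InRange n b → InRange n c → f (tri K n a b c) = g (tri K n a b c)) :
    f = g :=
  TensorProduct.ext (linearMap_ext fun a ha => linearMap_ext₂ fun b c hb hc => h a b c ha hb hc)

theorem op23_tri (T : Module.End K (V K n ⊗[K] V K n)) (a b c : ℕ) :
    op23 T (tri K n a b c) = bv K n a ⊗ₜ T (bb K n b c) := rfl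

theorem op12_tri (T : Module.End K (V K n ⊗[K] V K n)) (a b c : ℕ) :
    op12 T (tri K n a b c) =
      TensorProduct.assoc K (V K n) (V K n) (V K n) (T (bb K n a b) ⊗ₜ bv K n c) := rfl

/-- The image under `F` of `(κ E_{pq} + κ' E_{q'p'}) v_x`. -/
def stepSum {M : Type*} [AddCommGroup M] [Module K M] (n : ℕ) (F : ℕ → M) (κ κ' : K)
    (p q x : ℕ) : M :=
  (if q = x then κ • F p else 0) + (if inv n p = x then κ' • F (inv n q) else 0)

theorem map_combination_bv {M : Type*} [AddCommGroup M] [Module K M] (φ : V K n →ₗ[K] M)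
    (κ κ' : K) (p q : ℕ) {x : ℕ} (hx : InRange n x) :
    φ ((κ • E K n p q + κ' • E K n (inv n q) (inv n p)) (bv K n x)) =
      stepSum n (fun y => φ (bv K n y)) κ κ' p q x := by
  rw [LinearMap.add_apply, LinearMap.smul_apply, LinearMap.smul_apply, E_apply_bv _ _ hx,
    E_apply_bv _ _ hx, stepSum]
  split_ifs <;> simp

theorem genDeg_e_eq (i : Fin (n + 1)) (u : K) :
    u ^ genDeg (.e i) = if (i : ℕ) = 0 then u else 1 := by
  simp only [genDeg]
  split_ifs <;> simp

theorem genDeg_f_eq (i : Fin (n + 1)) (u : K) :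
    u ^ genDeg (.f i) = if (i : ℕ) = 0 then u⁻¹ else 1 := by
  simp only [genDeg]
  split_ifs <;> simp

theorem tripleOp_e_tri (h : IsGeneric r s) {a b : K} (hab : a * b = (r * s) ^ (-2 : ℤ))
    (u v w : K) {i : ℕ} (hi : i < n + 1) {x y z : ℕ} (hx : InRange n x) (hy : InRange n y)
    (hz : InRange n z) :
    tripleOp r s a b n u v w (.e ⟨i, hi⟩) (tri K n x y z) =
      (if i = 0 then u else 1) • stepSum n (fun t => tri K n t y z) (eCoef a i) (eCoef' r s a i)
        (rowIdx n i) (colIdx i) x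
      + ((if i = 0 then v else 1) * omWeight r s n i x) • stepSum n (fun t => tri K n x t z)
        (eCoef a i) (eCoef' r s a i) (rowIdx n i) (colIdx i) y
      + ((if i = 0 then w else 1) * omWeight r s n i x * omWeight r s n i y) •
        stepSum n (fun t => tri K n x y t) (eCoef a i) (eCoef' r s a i) (rowIdx n i) (colIdx i)
          z := by
  have h1 := map_combination_bv (TensorProduct.mk K (V K n) (V K n ⊗[K] V K n) |>.flip (bv K n y ⊗ₜ bv K n z))
    (eCoef a i) (eCoef' r s a i) (rowIdx n i) (colIdx i) hx
  have h2 := map_combination_bv (TensorProduct.mk K (V K n) (V K n ⊗[K] V K n) (bv K n x) ∘ₗ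
    (TensorProduct.mk K (V K n) (V K n) |>.flip (bv K n z)))
    (eCoef a i) (eCoef' r s a i) (rowIdx n i) (colIdx i) hy
  have h3 := map_combination_bv (TensorProduct.mk K (V K n) (V K n ⊗[K] V K n) (bv K n x) ∘ₗ
    (TensorProduct.mk K (V K n) (V K n) (bv K n y)))
    (eCoef a i) (eCoef' r s a i) (rowIdx n i) (colIdx i) hz
  simp only [LinearMap.flip_apply, TensorProduct.mk_apply, LinearMap.comp_apply] at h1 h2 h3
  simp only [tri, ← h1, ← h2, ← h3]
  rw [← eOp]
  simp only [tripleOp, pairOp, evalOp, genOp_om h hab, genOp_e, genDeg_e_eq,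
    LinearMap.add_apply, TensorProduct.map_tmul, LinearMap.smul_apply, Module.End.one_apply,
    diag_apply_bv _ hx, diag_apply_bv _ hy]
  simp only [genDeg, zpow_zero, one_mul, ← TensorProduct.smul_tmul', TensorProduct.tmul_smul,
    TensorProduct.tmul_add, smul_smul, mul_comm, mul_left_comm, mul_assoc, add_assoc]

theorem tripleOp_f_tri (h : IsGeneric r s) {a b : K} (hab : a * b = (r * s) ^ (-2 : ℤ))
    (u v w : K) {i : ℕ} (hi : i < n + 1) {x y z : ℕ} (hx : InRange n x) (hy : InRange n y)
    (hz : InRange n z) :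
    tripleOp r s a b n u v w (.f ⟨i, hi⟩) (tri K n x y z) =
      ((if i = 0 then u⁻¹ else 1) * omWeight s r n i y * omWeight s r n i z) •
        stepSum n (fun t => tri K n t y z) (fCoef r s b n i) (fCoef' r s b n i)
        (colIdx i) (rowIdx n i) x
      + ((if i = 0 then v⁻¹ else 1) * omWeight s r n i z) • stepSum n (fun t => tri K n x t z)
        (fCoef r s b n i) (fCoef' r s b n i) (colIdx i) (rowIdx n i) y
      + (if i = 0 then w⁻¹ else 1) • stepSum n (fun t => tri K n x y t)
        (fCoef r s b n i) (fCoef' r s b n i) (colIdx i) (rowIdx n i) z := by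
  have h1 := map_combination_bv (TensorProduct.mk K (V K n) (V K n ⊗[K] V K n) |>.flip (bv K n y ⊗ₜ bv K n z))
    (fCoef r s b n i) (fCoef' r s b n i) (colIdx i) (rowIdx n i) hx
  have h2 := map_combination_bv (TensorProduct.mk K (V K n) (V K n ⊗[K] V K n) (bv K n x) ∘ₗ
    (TensorProduct.mk K (V K n) (V K n) |>.flip (bv K n z)))
    (fCoef r s b n i) (fCoef' r s b n i) (colIdx i) (rowIdx n i) hy
  have h3 := map_combination_bv (TensorProduct.mk K (V K n) (V K n ⊗[K] V K n) (bv K n x) ∘ₗ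
    (TensorProduct.mk K (V K n) (V K n) (bv K n y)))
    (fCoef r s b n i) (fCoef' r s b n i) (colIdx i) (rowIdx n i) hz
  simp only [LinearMap.flip_apply, TensorProduct.mk_apply, LinearMap.comp_apply] at h1 h2 h3
  simp only [tri, ← h1, ← h2, ← h3]
  rw [← fOp]
  simp only [tripleOp, pairOp, evalOp, genOp_omp h hab, genOp_f, genDeg_f_eq,
    LinearMap.add_apply, TensorProduct.map_tmul, LinearMap.smul_apply, Module.End.one_apply,
    diag_apply_bv _ hz, diag_apply_bv _ hy]
  simp only [genDeg, zpow_zero, one_mul, ← TensorProduct.smul_tmul', TensorProduct.tmul_smul,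
    TensorProduct.tmul_add, smul_smul, mul_comm, mul_left_comm, mul_assoc, add_assoc,
    add_comm]

theorem tripleOp_om_tri (h : IsGeneric r s) {a b : K} (hab : a * b = (r * s) ^ (-2 : ℤ))
    (u v w : K) {i : ℕ} (hi : i < n + 1) {x y z : ℕ} (hx : InRange n x) (hy : InRange n y)
    (hz : InRange n z) :
    tripleOp r s a b n u v w (.om ⟨i, hi⟩) (tri K n x y z) =
      (omWeight r s n i x * omWeight r s n i y * omWeight r s n i z) • tri K n x y z := by
  simp only [tripleOp, pairOp, evalOp, genOp_om h hab, genDeg, zpow_zero, one_smul, tri,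
    TensorProduct.map_tmul, diag_apply_bv _ hx, diag_apply_bv _ hy, diag_apply_bv _ hz,
    ← TensorProduct.smul_tmul', TensorProduct.tmul_smul, smul_smul, mul_comm, mul_left_comm]

theorem tripleOp_omp_tri (h : IsGeneric r s) {a b : K} (hab : a * b = (r * s) ^ (-2 : ℤ))
    (u v w : K) {i : ℕ} (hi : i < n + 1) {x y z : ℕ} (hx : InRange n x) (hy : InRange n y)
    (hz : InRange n z) :
    tripleOp r s a b n u v w (.omp ⟨i, hi⟩) (tri K n x y z) =
      (omWeight s r n i x * omWeight s r n i y * omWeight s r n i z) • tri K n x y z := by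
  simp only [tripleOp, pairOp, evalOp, genOp_omp h hab, genDeg, zpow_zero, one_smul, tri,
    TensorProduct.map_tmul, diag_apply_bv _ hx, diag_apply_bv _ hy, diag_apply_bv _ hz,
    ← TensorProduct.smul_tmul', TensorProduct.tmul_smul, smul_smul, mul_comm, mul_left_comm]

/-- The relation between `e_i` and `f_i` on a threefold tensor product. -/
theorem tripleOp_e_f (h : IsGeneric r s) (hn : 2 ≤ n) {a b : K}
    (hab : a * b = (r * s) ^ (-2 : ℤ)) {u v w : K} (hu : u ≠ 0) (hv : v ≠ 0) (hw : w ≠ 0)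
    (i : Fin (n + 1)) :
    tripleOp r s a b n u v w (.e i) * tripleOp r s a b n u v w (.f i)
        - tripleOp r s a b n u v w (.f i) * tripleOp r s a b n u v w (.e i) =
      (vertexParam r n i - vertexParam s n i)⁻¹ •
        (tripleOp r s a b n u v w (.om i) - tripleOp r s a b n u v w (.omp i)) := by
  obtain ⟨Δ, hΔ⟩ := UPrime.exists_coproduct h hn
  obtain ⟨ρ₁, h₁⟩ := exists_isEvaluation h hn hab hu
  obtain ⟨ρ₂, h₂⟩ := exists_isEvaluation h hn hab hv
  obtain ⟨ρ₃, h₃⟩ := exists_isEvaluation h hn hab hw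
  have key : ∀ g, tripleOp r s a b n u v w g =
      tensorRep Δ ρ₁ (tensorRep Δ ρ₂ ρ₃) (UPrime.gen r s n g) := fun g => by
    rw [tensorRep_eq_pairOp hΔ]
    simp only [tensorRep_eq_pairOp hΔ]
    rw [tripleOp, show evalOp r s a b n u = _ from funext fun g => (h₁ g).symm,
      show evalOp r s a b n v = _ from funext fun g => (h₂ g).symm,
      show evalOp r s a b n w = _ from funext fun g => (h₃ g).symm]
  rw [show tripleOp r s a b n u v w = _ from funext key]
  exact (UPrime.affSat r s n).map (tensorRep Δ ρ₁ (tensorRep Δ ρ₂ ρ₃)) _ _ (AffRel.e_f i)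

end Triple

/-! ## The Yang–Baxter equation on vectors without conjugate pairs -/

section Free

variable {K : Type*} [Field K] {r s : K} {n : ℕ}

theorem op12_tri_of_ne {T : Module.End K (V K n ⊗[K] V K n)} {A D B : ℕ → ℕ → K} {S : K}
    (hT : RData T A D B S) {a b c : ℕ} (ha : InRange n a) (hb : InRange n b) (h : a ≠ b)
    (h' : b ≠ inv n a) :
    op12 T (tri K n a b c) = A a b • tri K n b a c + D a b • tri K n a b c := by
  rw [op12_tri, hT.of_ne a b ha hb h h', TensorProduct.add_tmul, map_add,
    ← TensorProduct.smul_tmul', ← TensorProduct.smul_tmul', map_smul, map_smul]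
  rfl

theorem op23_tri_of_ne {T : Module.End K (V K n ⊗[K] V K n)} {A D B : ℕ → ℕ → K} {S : K}
    (hT : RData T A D B S) {a b c : ℕ} (hb : InRange n b) (hc : InRange n c) (h : b ≠ c)
    (h' : c ≠ inv n b) :
    op23 T (tri K n a b c) = A b c • tri K n a c b + D b c • tri K n a b c := by
  rw [op23_tri, hT.of_ne b c hb hc h h', TensorProduct.tmul_add, TensorProduct.tmul_smul,
    TensorProduct.tmul_smul]
  rfl

theorem op12_tri_self {T : Module.End K (V K n ⊗[K] V K n)} {A D B : ℕ → ℕ → K} {S : K}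
    (hT : RData T A D B S) {a c : ℕ} (ha : InRange n a) (h : a ≠ n + 1) :
    op12 T (tri K n a a c) = S • tri K n a a c := by
  rw [op12_tri, hT.self a ha h, ← TensorProduct.smul_tmul', map_smul]
  rfl

theorem op23_tri_self {T : Module.End K (V K n ⊗[K] V K n)} {A D B : ℕ → ℕ → K} {S : K}
    (hT : RData T A D B S) {a b : ℕ} (hb : InRange n b) (h : b ≠ n + 1) :
    op23 T (tri K n a b b) = S • tri K n a b b := by
  rw [op23_tri, hT.self b hb h, TensorProduct.tmul_smul]
  rfl

theorem aExp_swap (n a b : ℕ) (h : a ≠ b) (h' : b ≠ inv n a) (ha : InRange n a)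
    (hb : InRange n b) : aExp n a b = -aExp n b a := by
  obtain ⟨h1, h2⟩ := ha
  obtain ⟨h3, h4⟩ := hb
  unfold aExp inv at *
  rw [mul_comm (sgn n a)]
  split_ifs <;> omega

/-- The pairs among `a`, `b`, `c` are not conjugate. -/
def ConjFree (n a b c : ℕ) : Prop := b ≠ inv n a ∧ c ≠ inv n a ∧ c ≠ inv n b

/-- Permuting the letters creates no conjugate pair, so only the exchange and diagonal coefficients
of `R̂` occur, as for an `R`-matrix of type `A`. Beyond polynomial identities the computation needs
only that the two exchange factors `m ^ aExp` of a pair are mutually inverse. The middle argument is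
`x * z` because `u / w = (u / v) (v / w)`. -/
theorem ybDefect_conjFree (h : IsGeneric r s) (x z : K) {a b c : ℕ} (ha : InRange n a)
    (hb : InRange n b) (hc : InRange n c) (hf : ConjFree n a b c) :
    ybDefect r s n x (x * z) z (tri K n a b c) = 0 := by
  obtain ⟨h1, h2, h3⟩ := hf
  have hm : r * s ≠ 0 := mul_ne_zero h.left_ne_zero h.right_ne_zero
  have hm' : ∀ i j, i ≠ j → j ≠ inv n i → InRange n i → InRange n j →
      (r * s) ^ aExp n i j * (r * s) ^ aExp n j i = 1 := fun i j hij hij' hi hj => by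
    rw [aExp_swap n i j hij hij' hi hj, zpow_neg, inv_mul_cancel₀ (zpow_ne_zero _ hm)]
  have e1 := Rhat_isStandard (n := n) (s := s) h.left_ne_zero x
  have e2 := Rhat_isStandard (n := n) (s := s) h.left_ne_zero (x * z)
  have e3 := Rhat_isStandard (n := n) (s := s) h.left_ne_zero z
  have h1' : a ≠ inv n b := fun e => h1 (by rw [e, hb.inv_inv])
  have h2' : a ≠ inv n c := fun e => h2 (by rw [e, hc.inv_inv])
  have h3' : b ≠ inv n c := fun e => h3 (by rw [e, hc.inv_inv])
  unfold IsStandard at e1 e2 e3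
  rw [ybDefect, LinearMap.sub_apply]
  simp only [Module.End.mul_apply]
  generalize Rhat r s n x = R₁ at *
  generalize Rhat r s n (x * z) = R₂ at *
  generalize Rhat r s n z = R₃ at *
  generalize r⁻¹ * s = ρ at *
  generalize r * s = m at *
  -- The letter `n + 1` is its own conjugate, so in a vector without conjugate pairs it is never
  -- repeated, and the rule for squares applies to repeated letters.
  have hfix : ∀ k, InRange n k → k ≠ inv n k → k ≠ n + 1 := fun k hk hk' e =>
    hk' (by unfold inv; omega)
  by_cases hab : a = b
  · subst hab
    have ha' := hfix a ha h1
    by_cases hac : a = c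
    · subst hac
      simp only [op12_tri_self e1 ha ha', op23_tri_self e1 ha ha', op12_tri_self e2 ha ha',
        op23_tri_self e2 ha ha', op12_tri_self e3 ha ha', op23_tri_self e3 ha ha', map_smul]
      module
    · have q := hm' a c hac h2 ha hc
      have hlk := Ne.symm hac
      simp only [op12_tri_self e1 ha ha', op23_tri_self e1 ha ha', op12_tri_self e2 ha ha',
        op23_tri_self e2 ha ha', op12_tri_self e3 ha ha', op23_tri_self e3 ha ha',
        op12_tri_of_ne e1 ha hc hac h2, op23_tri_of_ne e1 ha hc hac h2, op12_tri_of_ne e2 ha hc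
        hac h2, op23_tri_of_ne e2 ha hc hac h2, op12_tri_of_ne e3 ha hc hac h2, op23_tri_of_ne
        e3 ha hc hac h2, op12_tri_of_ne e1 hc ha hlk h2', op23_tri_of_ne e1 hc ha hlk h2',
        op12_tri_of_ne e2 hc ha hlk h2', op23_tri_of_ne e2 hc ha hlk h2', op12_tri_of_ne e3 hc
        ha hlk h2', op23_tri_of_ne e3 hc ha hlk h2', map_smul, map_add, exchCoef, diagCoef]
      generalize x - xi r s n = g₁
      generalize x * z - xi r s n = g₂
      generalize z - xi r s n = g₃
      generalize m ^ aExp n a c = α at *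
      generalize m ^ aExp n c a = β at *
      obtain h4 | h4 := Nat.lt_or_gt_of_ne hac
      · simp (disch := omega) only [if_pos, if_neg]
        linear_combination (norm := module)
          (-(ρ ^ 2 * (z - 1) * (x - 1) * g₁ * g₃ * (1 - ρ ^ 2) * g₂ * (x * z)) * q) • tri K n a a c
      · simp (disch := omega) only [if_pos, if_neg]
        linear_combination (norm := module)
          (-(ρ ^ 2 * (z - 1) * (x - 1) * g₁ * g₃ * (1 - ρ ^ 2) * g₂) * q) • tri K n a a c
  · by_cases hac : a = c
    · subst hac
      have ha' := hfix a ha h2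
      have hlk := Ne.symm hab
      simp only [op12_tri_self e1 ha ha', op23_tri_self e1 ha ha', op12_tri_self e2 ha ha',
        op23_tri_self e2 ha ha', op12_tri_self e3 ha ha', op23_tri_self e3 ha ha',
        op12_tri_of_ne e1 ha hb hab h1, op23_tri_of_ne e1 ha hb hab h1, op12_tri_of_ne e2 ha hb
        hab h1, op23_tri_of_ne e2 ha hb hab h1, op12_tri_of_ne e3 ha hb hab h1, op23_tri_of_ne
        e3 ha hb hab h1, op12_tri_of_ne e1 hb ha hlk h1', op23_tri_of_ne e1 hb ha hlk h1',
        op12_tri_of_ne e2 hb ha hlk h1', op23_tri_of_ne e2 hb ha hlk h1', op12_tri_of_ne e3 hb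
        ha hlk h1', op23_tri_of_ne e3 hb ha hlk h1', map_smul, map_add, exchCoef, diagCoef]
      generalize x - xi r s n = g₁
      generalize x * z - xi r s n = g₂
      generalize z - xi r s n = g₃
      generalize m ^ aExp n a b = α at *
      generalize m ^ aExp n b a = β at *
      obtain h4 | h4 := Nat.lt_or_gt_of_ne hab
      · simp (disch := omega) only [if_pos, if_neg]
        module
      · simp (disch := omega) only [if_pos, if_neg]
        module
    · by_cases hbc : b = c
      · subst hbc
        have hb' := hfix b hb h3
        have q := hm' b a (Ne.symm hab) h1' hb ha
        have hlk := Ne.symm (Ne.symm hab)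
        simp only [op12_tri_self e1 hb hb', op23_tri_self e1 hb hb', op12_tri_self e2 hb hb',
          op23_tri_self e2 hb hb', op12_tri_self e3 hb hb', op23_tri_self e3 hb hb',
          op12_tri_of_ne e1 hb ha (Ne.symm hab) h1', op23_tri_of_ne e1 hb ha (Ne.symm hab) h1',
          op12_tri_of_ne e2 hb ha (Ne.symm hab) h1', op23_tri_of_ne e2 hb ha (Ne.symm hab) h1',
          op12_tri_of_ne e3 hb ha (Ne.symm hab) h1', op23_tri_of_ne e3 hb ha (Ne.symm hab) h1',
          op12_tri_of_ne e1 ha hb hlk h1, op23_tri_of_ne e1 ha hb hlk h1, op12_tri_of_ne e2 ha hb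
          hlk h1, op23_tri_of_ne e2 ha hb hlk h1, op12_tri_of_ne e3 ha hb hlk h1, op23_tri_of_ne
          e3 ha hb hlk h1, map_smul, map_add, exchCoef, diagCoef]
        generalize x - xi r s n = g₁
        generalize x * z - xi r s n = g₂
        generalize z - xi r s n = g₃
        generalize m ^ aExp n b a = α at *
        generalize m ^ aExp n a b = β at *
        obtain h4 | h4 := Nat.lt_or_gt_of_ne (Ne.symm hab)
        · simp (disch := omega) only [if_pos, if_neg]
          linear_combination (norm := module)
            ((ρ ^ 2 * (z - 1) * (x - 1) * g₁ * g₃ * (1 - ρ ^ 2) * g₂) * q) • tri K n a b b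
        · simp (disch := omega) only [if_pos, if_neg]
          linear_combination (norm := module)
            ((ρ ^ 2 * (z - 1) * (x - 1) * g₁ * g₃ * (1 - ρ ^ 2) * g₂ * (x * z)) * q) • tri K n a b b
      · have q₁ := hm' a b hab h1 ha hb
        have q₂ := hm' b c hbc h3 hb hc
        have hba := Ne.symm hab
        have hca := Ne.symm hac
        have hcb := Ne.symm hbc
        simp only [op12_tri_of_ne e1 ha hb hab h1, op23_tri_of_ne e1 ha hb hab h1, op12_tri_of_ne
          e2 ha hb hab h1, op23_tri_of_ne e2 ha hb hab h1, op12_tri_of_ne e3 ha hb hab h1,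
          op23_tri_of_ne e3 ha hb hab h1, op12_tri_of_ne e1 hb ha hba h1', op23_tri_of_ne e1 hb ha
          hba h1', op12_tri_of_ne e2 hb ha hba h1', op23_tri_of_ne e2 hb ha hba h1',
          op12_tri_of_ne e3 hb ha hba h1', op23_tri_of_ne e3 hb ha hba h1', op12_tri_of_ne e1 ha
          hc hac h2, op23_tri_of_ne e1 ha hc hac h2, op12_tri_of_ne e2 ha hc hac h2,
          op23_tri_of_ne e2 ha hc hac h2, op12_tri_of_ne e3 ha hc hac h2, op23_tri_of_ne e3 ha hc
          hac h2, op12_tri_of_ne e1 hc ha hca h2', op23_tri_of_ne e1 hc ha hca h2', op12_tri_of_ne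
          e2 hc ha hca h2', op23_tri_of_ne e2 hc ha hca h2', op12_tri_of_ne e3 hc ha hca h2',
          op23_tri_of_ne e3 hc ha hca h2', op12_tri_of_ne e1 hb hc hbc h3, op23_tri_of_ne e1 hb hc
          hbc h3, op12_tri_of_ne e2 hb hc hbc h3, op23_tri_of_ne e2 hb hc hbc h3, op12_tri_of_ne
          e3 hb hc hbc h3, op23_tri_of_ne e3 hb hc hbc h3, op12_tri_of_ne e1 hc hb hcb h3',
          op23_tri_of_ne e1 hc hb hcb h3', op12_tri_of_ne e2 hc hb hcb h3', op23_tri_of_ne e2 hc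
          hb hcb h3', op12_tri_of_ne e3 hc hb hcb h3', op23_tri_of_ne e3 hc hb hcb h3', map_smul,
          map_add, exchCoef, diagCoef]
        generalize x - xi r s n = g₁
        generalize x * z - xi r s n = g₂
        generalize z - xi r s n = g₃
        generalize m ^ aExp n a b = μ₁ at *
        generalize m ^ aExp n b a = μ₂ at *
        generalize m ^ aExp n a c = μ₃ at *
        generalize m ^ aExp n c a = μ₄ at *
        generalize m ^ aExp n b c = μ₅ at *
        generalize m ^ aExp n c b = μ₆ at *
        obtain h4 | h4 := Nat.lt_or_gt_of_ne hab <;> obtain h5 | h5 := Nat.lt_or_gt_of_ne hac <;>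
          obtain h6 | h6 := Nat.lt_or_gt_of_ne hbc <;> (try omega) <;>
          simp (disch := omega) only [if_pos, if_neg]
        -- Only the coefficient of the original vector needs the inversion relations. Exchanging
        -- twice in the first two places and exchanging twice in the last two places come with the
        -- same factor, so the difference is a multiple of `q₁ - q₂`. That factor contains the
        -- diagonal coefficient of `v_a, v_c` at `x * z`, which depends on the order of `a` and `c`.
        all_goals first
          | linear_combination (norm := module)
              ((ρ ^ 2 * (z - 1) * (x - 1) * g₁ * g₃ * (1 - ρ ^ 2) * g₂ * (x * z)) * (q₁ - q₂)) • tri K n a b c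
          | linear_combination (norm := module)
              ((ρ ^ 2 * (z - 1) * (x - 1) * g₁ * g₃ * (1 - ρ ^ 2) * g₂) * (q₁ - q₂)) • tri K n a b c

end Free

/-! ## Maps vanishing on vectors without conjugate pairs -/

section Chain

variable {K : Type*} [Field K] {r s : K} {n : ℕ} {M : Type*} [AddCommGroup M] [Module K M]

theorem map_stepSum {M' : Type*} [AddCommGroup M'] [Module K M'] (φ : M →ₗ[K] M') (F : ℕ → M)
    (κ κ' : K) (p q x : ℕ) :
    φ (stepSum n F κ κ' p q x) = stepSum n (fun t => φ (F t)) κ κ' p q x := by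
  unfold stepSum
  split_ifs <;> simp

/-- The linear map `X` vanishes on vectors without conjugate pairs, and its kernel is stable under
the action on `V(u) ⊗ V(v) ⊗ V(w)`. -/
structure KillsConjFree (r s : K) (n : ℕ) (u v w : K)
    (X : V K n ⊗[K] (V K n ⊗[K] V K n) →ₗ[K] M) : Prop where
  stable (g : Gen n) (y : V K n ⊗[K] (V K n ⊗[K] V K n)) (hy : X y = 0) :
    X (tripleOp r s 1 ((r * s) ^ (-2 : ℤ)) n u v w g y) = 0
  conjFree (a b c : ℕ) (ha : InRange n a) (hb : InRange n b) (hc : InRange n c)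
    (h : ConjFree n a b c) : X (tri K n a b c) = 0

variable {u v w : K} {X : V K n ⊗[K] (V K n ⊗[K] V K n) →ₗ[K] M}

/-- Stability of the kernel turns each basis vector that is already killed into a linear relation
between values of `X` on other basis vectors. This relation and its analogue for `f_i` are the
source of all the equations below. -/
theorem KillsConjFree.e_tri (hX : KillsConjFree r s n u v w X) (h : IsGeneric r s) {i : ℕ}
    (hi : i ≤ n) {x y z : ℕ} (hx : InRange n x) (hy : InRange n y) (hz : InRange n z)
    (h0 : X (tri K n x y z) = 0) :
    (if i = 0 then u else 1) • stepSum n (fun t => X (tri K n t y z)) (eCoef 1 i) (eCoef' r s 1 i)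
        (rowIdx n i) (colIdx i) x
      + ((if i = 0 then v else 1) * omWeight r s n i x) • stepSum n (fun t => X (tri K n x t z))
        (eCoef 1 i) (eCoef' r s 1 i) (rowIdx n i) (colIdx i) y
      + ((if i = 0 then w else 1) * omWeight r s n i x * omWeight r s n i y) •
        stepSum n (fun t => X (tri K n x y t)) (eCoef 1 i) (eCoef' r s 1 i) (rowIdx n i) (colIdx i)
          z = 0 := by
  have key := hX.stable (.e ⟨i, by omega⟩) _ h0
  rw [tripleOp_e_tri h (one_mul _) u v w _ hx hy hz, map_add, map_add, map_smul, map_smul, map_smul,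
    map_stepSum, map_stepSum, map_stepSum] at key
  exact key

theorem KillsConjFree.f_tri (hX : KillsConjFree r s n u v w X) (h : IsGeneric r s) {i : ℕ}
    (hi : i ≤ n) {x y z : ℕ} (hx : InRange n x) (hy : InRange n y) (hz : InRange n z)
    (h0 : X (tri K n x y z) = 0) :
    ((if i = 0 then u⁻¹ else 1) * omWeight s r n i y * omWeight s r n i z) •
        stepSum n (fun t => X (tri K n t y z)) (fCoef r s ((r * s) ^ (-2 : ℤ)) n i)
        (fCoef' r s ((r * s) ^ (-2 : ℤ)) n i) (colIdx i) (rowIdx n i) x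
      + ((if i = 0 then v⁻¹ else 1) * omWeight s r n i z) •
        stepSum n (fun t => X (tri K n x t z)) (fCoef r s ((r * s) ^ (-2 : ℤ)) n i)
        (fCoef' r s ((r * s) ^ (-2 : ℤ)) n i) (colIdx i) (rowIdx n i) y
      + (if i = 0 then w⁻¹ else 1) • stepSum n (fun t => X (tri K n x y t))
        (fCoef r s ((r * s) ^ (-2 : ℤ)) n i) (fCoef' r s ((r * s) ^ (-2 : ℤ)) n i) (colIdx i)
        (rowIdx n i) z = 0 := by
  have key := hX.stable (.f ⟨i, by omega⟩) _ h0
  rw [tripleOp_f_tri h (one_mul _) u v w _ hx hy hz, map_add, map_add, map_smul, map_smul, map_smul,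
    map_stepSum, map_stepSum, map_stepSum] at key
  exact key

/-- A family `T x y` satisfies the relations imposed by `e_i`, for `2 ≤ i ≤ n`, on vectors
`v_x ⊗ v_y`, with a correction `η` for `e_n`. -/
def PairRelations (r s : K) (n : ℕ) (η : K) (T : ℕ → ℕ → M) : Prop :=
  ∀ i x y, 2 ≤ i → i ≤ n → 2 ≤ x → x ≤ 2 * n → 2 ≤ y → y ≤ 2 * n → y ≠ inv n x →
    stepSum n (fun t => T t y) (1 : K) (-1) i (i + 1) x
      + ((if i = n then η else 1) * omWeight r s n i x) •
        stepSum n (fun t => T x t) (1 : K) (-1) i (i + 1) y = 0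

/-- The relation for `e_i` is taken at `v_{i+1} ⊗ v_{i'}`, whose image consists of the two
neighbouring conjugate pairs. -/
theorem PairRelations.lower {η : K} {T : ℕ → ℕ → M} (hT : PairRelations r s n η T) {i : ℕ}
    (hi : 2 ≤ i) (hin : i < n) :
    T i (inv n i) = s ^ 2 • T (i + 1) (inv n (i + 1)) := by
  have key := hT i (i + 1) (inv n i) hi hin.le (by omega) (by omega) (by unfold inv; omega)
    (by unfold inv; omega) (by unfold inv; omega)
  unfold stepSum omWeight inv at key
  unfold inv
  simp (disch := omega) only [if_pos, if_neg, if_true, if_false, zpow_ofNat] at key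
  linear_combination (norm := module) key

theorem PairRelations.upper (hr : r ≠ 0) {η : K} {T : ℕ → ℕ → M} (hT : PairRelations r s n η T)
    {i : ℕ} (hi : 2 ≤ i) (hin : i < n) :
    T (inv n i) i = r ^ 2 • T (inv n (i + 1)) (i + 1) := by
  have key := hT i (inv n i) (i + 1) hi hin.le (by unfold inv; omega) (by unfold inv; omega)
    (by omega) (by omega) (by unfold inv; omega)
  unfold stepSum omWeight inv at key
  unfold inv
  simp (disch := omega) only [if_pos, if_neg, if_true, if_false] at key
  have hr' : r ^ 2 * r ^ (-2 : ℤ) = 1 := by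
    rw [zpow_neg, zpow_ofNat]; exact mul_inv_cancel₀ (pow_ne_zero 2 hr)
  linear_combination (norm := module) r ^ 2 • key - hr' • T (2 * n + 2 - i) i

theorem PairRelations.lower_last (hn : 2 ≤ n) {η : K} {T : ℕ → ℕ → M}
    (hT : PairRelations r s n η T) : T n (inv n n) = η • T (n + 1) (n + 1) := by
  have key := hT n (n + 1) (inv n n) hn le_rfl (by omega) (by omega) (by unfold inv; omega)
    (by unfold inv; omega) (by unfold inv; omega)
  unfold stepSum omWeight inv at key
  unfold inv
  simp (disch := omega) only [if_pos, if_neg, if_true, if_false] at key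
  rw [show 2 * n + 2 - (n + 1) = n + 1 by omega] at key
  linear_combination (norm := module) key

theorem PairRelations.upper_last (hn : 2 ≤ n) (hr : r ≠ 0) (hs : s ≠ 0) {η : K} (hη : η ≠ 0)
    {T : ℕ → ℕ → M} (hT : PairRelations r s n η T) :
    T (inv n n) n = (r * s⁻¹ * η⁻¹) • T (n + 1) (n + 1) := by
  have key := hT n (inv n n) (n + 1) hn le_rfl (by unfold inv; omega) (by unfold inv; omega)
    (by omega) (by omega) (by unfold inv; omega)
  unfold stepSum omWeight inv at key
  unfold inv
  simp (disch := omega) only [if_pos, if_neg, if_true, if_false] at key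
  rw [show 2 * n + 2 - (n + 1) = n + 1 by omega] at key
  have e : r * s⁻¹ * η⁻¹ * (η * (r⁻¹ * s)) = 1 := by field_simp
  linear_combination (norm := module)
    (r * s⁻¹ * η⁻¹) • key - e • T (2 * n + 2 - n) n

/-- Starting at the middle pair and moving outwards along the nodes `n, n - 1, …, 2`, every
conjugate pair becomes an explicit multiple of the middle one. The outermost pair `1, 1'` is not
reached, since `e_1` is not used. -/
theorem PairRelations.eq_smul (hn : 2 ≤ n) (hr : r ≠ 0) (hs : s ≠ 0) {η : K} (hη : η ≠ 0)
    {T : ℕ → ℕ → M} (hT : PairRelations r s n η T) (k : ℕ) (hk : k + 2 ≤ n) :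
    T (n - k) (inv n (n - k)) = (s ^ (2 * k) * η) • T (n + 1) (n + 1) ∧
      T (inv n (n - k)) (n - k) = (r ^ (2 * k) * (r * s⁻¹) * η⁻¹) • T (n + 1) (n + 1) := by
  induction k with
  | zero => simpa using ⟨hT.lower_last hn, hT.upper_last hn hr hs hη⟩
  | succ k ih =>
    obtain ⟨h1, h2⟩ := ih (by omega)
    have h3 := hT.lower (i := n - (k + 1)) (by omega) (by omega)
    have h4 := hT.upper hr (i := n - (k + 1)) (by omega) (by omega)
    rw [show n - (k + 1) + 1 = n - k by omega] at h3 h4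
    rw [h3, h4, h1, h2, smul_smul, smul_smul]
    constructor <;> congr 1 <;> ring

theorem PairRelations.eq_zero (hn : 2 ≤ n) (hr : r ≠ 0) (hs : s ≠ 0) {η : K} (hη : η ≠ 0)
    {T : ℕ → ℕ → M} (hT : PairRelations r s n η T) (h0 : T (n + 1) (n + 1) = 0) (x : ℕ)
    (hx : 2 ≤ x) (hx' : x ≤ 2 * n) : T x (inv n x) = 0 := by
  obtain hx1 | rfl | hx1 := lt_trichotomy x (n + 1)
  · have := (hT.eq_smul hn hr hs hη (n - x) (by omega)).1
    rwa [h0, smul_zero, show n - (n - x) = x by omega] at this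
  · rwa [show inv n (n + 1) = n + 1 by unfold inv; omega]
  · have := (hT.eq_smul hn hr hs hη (x - (n + 2)) (by omega)).2
    rwa [h0, smul_zero, show n - (x - (n + 2)) = inv n x by unfold inv; omega,
      show inv n (inv n x) = x by unfold inv; omega] at this

end Chain

/-! ## Vanishing on the weight space of `ε₁` -/

section FirstWeight

variable {K : Type*} [Field K] {r s : K} {n : ℕ} {M : Type*} [AddCommGroup M] [Module K M]
  {u v w : K} {X : V K n ⊗[K] (V K n ⊗[K] V K n) →ₗ[K] M}

theorem omWeight_one {i : ℕ} (hi : 2 ≤ i) (hin : i ≤ n) :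
    omWeight r s n i 1 = if i = n then r⁻¹ * s⁻¹ else 1 := by
  unfold omWeight inv
  split_ifs <;> first | omega | rfl

/-- With `v_1` in front, both terms carry the same eigenvalue of `ω_i` on `v_1`, which is nonzero
and cancels. -/
theorem KillsConjFree.pairRelations_left (hX : KillsConjFree r s n u v w X) (h : IsGeneric r s) :
    PairRelations r s n 1 fun x y => X (tri K n 1 x y) := by
  intro i x y hi hin hx hx' hy hy' hxy
  have key := hX.e_tri h hin (x := 1) (y := x) (z := y) ⟨by omega, by omega⟩ ⟨by omega, by omega⟩
    ⟨by omega, by omega⟩ (hX.conjFree _ _ _ ⟨by omega, by omega⟩ ⟨by omega, by omega⟩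
    ⟨by omega, by omega⟩ ⟨by unfold inv; omega, by unfold inv; omega, hxy⟩)
  have h1 : ∀ T : ℕ → M, stepSum n T (1 : K) (-1) i (i + 1) 1 = 0 := fun T => by
    unfold stepSum inv
    simp (disch := omega) only [if_neg, add_zero]
  unfold eCoef eCoef' rowIdx colIdx at key
  simp (disch := omega) only [if_neg] at key
  rw [h1, omWeight_one hi hin] at key
  have h2 : (if i = n then r⁻¹ * s⁻¹ else 1) ≠ 0 := by
    split_ifs
    · exact mul_ne_zero (inv_ne_zero h.left_ne_zero) (inv_ne_zero h.right_ne_zero)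
    · exact one_ne_zero
  rw [ite_self, one_mul]
  refine (smul_eq_zero.1 ?_).resolve_left h2
  rw [← key]
  module

/-- With `v_1` in the middle, its `ω_i`-eigenvalue affects only the action on the third factor. It
is `1` for `i < n` and `r⁻¹ s⁻¹` for `i = n`, hence this `η`. -/
theorem KillsConjFree.pairRelations_middle (hX : KillsConjFree r s n u v w X)
    (h : IsGeneric r s) : PairRelations r s n (r⁻¹ * s⁻¹) fun x y => X (tri K n x 1 y) := by
  intro i x y hi hin hx hx' hy hy' hxy
  have key := hX.e_tri h hin (x := x) (y := 1) (z := y) ⟨by omega, by omega⟩ ⟨by omega, by omega⟩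
    ⟨by omega, by omega⟩ (hX.conjFree _ _ _ ⟨by omega, by omega⟩ ⟨by omega, by omega⟩
    ⟨by omega, by omega⟩ ⟨by unfold inv; omega, hxy, by unfold inv; omega⟩)
  have h1 : ∀ T : ℕ → M, stepSum n T (1 : K) (-1) i (i + 1) 1 = 0 := fun T => by
    unfold stepSum inv
    simp (disch := omega) only [if_neg, add_zero]
  unfold eCoef eCoef' rowIdx colIdx at key
  simp (disch := omega) only [if_neg] at key
  rw [h1, omWeight_one hi hin] at key
  rw [← key]
  module

theorem KillsConjFree.pairRelations_right (hX : KillsConjFree r s n u v w X)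
    (h : IsGeneric r s) : PairRelations r s n 1 fun x y => X (tri K n x y 1) := by
  intro i x y hi hin hx hx' hy hy' hxy
  have key := hX.e_tri h hin (x := x) (y := y) (z := 1) ⟨by omega, by omega⟩ ⟨by omega, by omega⟩
    ⟨by omega, by omega⟩ (hX.conjFree _ _ _ ⟨by omega, by omega⟩ ⟨by omega, by omega⟩
    ⟨by omega, by omega⟩ ⟨hxy, by unfold inv; omega, by unfold inv; omega⟩)
  have h1 : ∀ T : ℕ → M, stepSum n T (1 : K) (-1) i (i + 1) 1 = 0 := fun T => by
    unfold stepSum inv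
    simp (disch := omega) only [if_neg, add_zero]
  unfold eCoef eCoef' rowIdx colIdx at key
  simp (disch := omega) only [if_neg] at key
  rw [h1] at key
  rw [← key, ite_self]
  module

/-- The image under `X` of a vector that contains `v_1` twice and `v_{1'}`. -/
theorem KillsConjFree.one_one_inv (hX : KillsConjFree r s n u v w X) (h : IsGeneric r s)
    (hn : 2 ≤ n) :
    X (tri K n 1 1 (inv n 1)) =
      s ^ 4 • X (tri K n 2 1 (inv n 2)) + s ^ 2 • X (tri K n 1 2 (inv n 2)) := by
  have hr := h.left_ne_zero
  have hs := h.right_ne_zero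
  have key := hX.f_tri h (i := 1) (by omega) (x := 1) (y := 1) (z := inv n 2)
    ⟨by omega, by omega⟩ ⟨by omega, by omega⟩ ⟨by unfold inv; omega, by unfold inv; omega⟩
    (hX.conjFree _ _ _ ⟨by omega, by omega⟩ ⟨by omega, by omega⟩
    ⟨by unfold inv; omega, by unfold inv; omega⟩
    ⟨by unfold inv; omega, by unfold inv; omega, by unfold inv; omega⟩)
  unfold stepSum fCoef fCoef' rowIdx colIdx omWeight inv at key
  unfold inv
  simp (disch := omega) only [if_pos, if_neg, if_true, if_false, zpow_neg, zpow_ofNat] at key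
  linear_combination (norm := (match_scalars <;> field_simp <;> ring)) -((r * s) ^ 2 • key)

/-- The image under `X` of a vector that contains `v_1` twice and `v_{1'}`. -/
theorem KillsConjFree.one_inv_one (hX : KillsConjFree r s n u v w X) (h : IsGeneric r s)
    (hn : 2 ≤ n) :
    X (tri K n 1 (inv n 1) 1) =
      s ^ 2 • X (tri K n 2 (inv n 2) 1) + r ^ 2 • X (tri K n 1 (inv n 2) 2) := by
  have hr := h.left_ne_zero
  have hs := h.right_ne_zero
  have key := hX.f_tri h (i := 1) (by omega) (x := 1) (y := inv n 2) (z := 1)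
    ⟨by omega, by omega⟩ ⟨by unfold inv; omega, by unfold inv; omega⟩ ⟨by omega, by omega⟩
    (hX.conjFree _ _ _ ⟨by omega, by omega⟩ ⟨by unfold inv; omega, by unfold inv; omega⟩
    ⟨by omega, by omega⟩ ⟨by unfold inv; omega, by unfold inv; omega, by unfold inv; omega⟩)
  unfold stepSum fCoef fCoef' rowIdx colIdx omWeight inv at key
  unfold inv
  simp (disch := omega) only [if_pos, if_neg, if_true, if_false, zpow_neg, zpow_ofNat] at key
  linear_combination (norm := (match_scalars <;> field_simp <;> ring)) -(r ^ 2 • key)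

/-- The image under `X` of a vector that contains `v_1` twice and `v_{1'}`. -/
theorem KillsConjFree.inv_one_one (hX : KillsConjFree r s n u v w X) (h : IsGeneric r s)
    (hn : 2 ≤ n) :
    X (tri K n (inv n 1) 1 1) =
      r ^ 2 • X (tri K n (inv n 2) 2 1) + (r ^ 2 * (s ^ 2)⁻¹) • X (tri K n (inv n 2) 1 2) := by
  have hr := h.left_ne_zero
  have hs := h.right_ne_zero
  have key := hX.f_tri h (i := 1) (by omega) (x := inv n 2) (y := 1) (z := 1)
    ⟨by unfold inv; omega, by unfold inv; omega⟩ ⟨by omega, by omega⟩ ⟨by omega, by omega⟩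
    (hX.conjFree _ _ _ ⟨by unfold inv; omega, by unfold inv; omega⟩ ⟨by omega, by omega⟩
    ⟨by omega, by omega⟩ ⟨by unfold inv; omega, by unfold inv; omega, by unfold inv; omega⟩)
  unfold stepSum fCoef fCoef' rowIdx colIdx omWeight inv at key
  unfold inv
  simp (disch := omega) only [if_pos, if_neg, if_true, if_false, zpow_neg, zpow_ofNat] at key
  linear_combination (norm := (match_scalars <;> field_simp <;> ring)) -((r ^ 2 * (s ^ 2)⁻¹) • key)

/-- The action of `e_0` on `v_1 ⊗ v_1 ⊗ v_2`, which has no conjugate pair. This brings in the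
spectral parameters. -/
theorem KillsConjFree.zero_one_one_two (hX : KillsConjFree r s n u v w X) (h : IsGeneric r s)
    (hn : 2 ≤ n) :
    (r ^ 2 * u) • X (tri K n (inv n 2) 1 2) + (s ^ 2 * r ^ 2 * v) • X (tri K n 1 (inv n 2) 2) =
      (s ^ 2 * w) • X (tri K n 1 1 (inv n 1)) := by
  have hr := h.left_ne_zero
  have hs := h.right_ne_zero
  have key := hX.e_tri h (i := 0) (by omega) (x := 1) (y := 1) (z := 2)
    ⟨by omega, by omega⟩ ⟨by omega, by omega⟩ ⟨by omega, by omega⟩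
    (hX.conjFree _ _ _ ⟨by omega, by omega⟩ ⟨by omega, by omega⟩ ⟨by omega, by omega⟩
    ⟨by unfold inv; omega, by unfold inv; omega, by unfold inv; omega⟩)
  unfold stepSum eCoef eCoef' rowIdx colIdx omWeight inv at key
  unfold inv
  simp (disch := omega) only [if_pos, if_neg, if_true, if_false, zpow_neg, zpow_ofNat] at key
  linear_combination (norm := (match_scalars <;> field_simp <;> ring)) -((s ^ 2)⁻¹ • key)

theorem KillsConjFree.zero_one_two_one (hX : KillsConjFree r s n u v w X) (h : IsGeneric r s)
    (hn : 2 ≤ n) :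
    (r ^ 2 * u) • X (tri K n (inv n 2) 2 1) + (s ^ 2 * w) • X (tri K n 1 2 (inv n 2)) =
      v • X (tri K n 1 (inv n 1) 1) := by
  have hr := h.left_ne_zero
  have hs := h.right_ne_zero
  have key := hX.e_tri h (i := 0) (by omega) (x := 1) (y := 2) (z := 1)
    ⟨by omega, by omega⟩ ⟨by omega, by omega⟩ ⟨by omega, by omega⟩
    (hX.conjFree _ _ _ ⟨by omega, by omega⟩ ⟨by omega, by omega⟩ ⟨by omega, by omega⟩
    ⟨by unfold inv; omega, by unfold inv; omega, by unfold inv; omega⟩)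
  unfold stepSum eCoef eCoef' rowIdx colIdx omWeight inv at key
  unfold inv
  simp (disch := omega) only [if_pos, if_neg, if_true, if_false, zpow_neg, zpow_ofNat] at key
  linear_combination (norm := (match_scalars <;> field_simp <;> ring)) -((s ^ 2)⁻¹ • key)

/-- The relation obtained from `v_1 ⊗ v_3 ⊗ v_2` by the action of `e_1 e_2 e_0`. -/
theorem KillsConjFree.zero_two_one (hX : KillsConjFree r s n u v w X) (h : IsGeneric r s)
    (hn : 2 ≤ n) :
    (r ^ 2 * u) • X (tri K n (inv n 2) 1 2) = (r ^ 2 * s ^ 4 * w) • X (tri K n 2 1 (inv n 2)) := by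
  have hr := h.left_ne_zero
  have hs := h.right_ne_zero
  have hab := one_mul ((r * s) ^ (-2 : ℤ))
  have r1 : InRange n 1 := ⟨by omega, by omega⟩
  have r2 : InRange n 2 := ⟨by omega, by omega⟩
  have r3 : InRange n 3 := ⟨by omega, by omega⟩
  -- For `n = 2` the vector `v_3` is the middle one and the individual weights differ from those for
  -- `n ≥ 3`. The computation needs only this combination, which is uniform in `n`.
  have hpq : omWeight r s n 0 3 * omWeight r s n 2 1 = omWeight r s n 2 (inv n 2) * (s ^ 2)⁻¹ := by
    unfold omWeight inv
    obtain rfl | h3 : n = 2 ∨ 3 ≤ n := by omega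
    · simp (disch := omega) only [if_pos, if_neg, if_true, if_false, zpow_neg, zpow_ofNat]
      field_simp
    · simp (disch := omega) only [if_pos, if_neg, if_true, if_false, zpow_neg, zpow_ofNat]
      field_simp
  have ht : omWeight r s n 2 (inv n 2) ≠ 0 := h.omWeight_ne_zero n _ _ hn
  have w0 : omWeight r s n 0 1 = s ^ 2 := by
    unfold omWeight
    simp (disch := omega) only [if_pos, if_neg, if_true, if_false, zpow_neg, zpow_ofNat]
  have w1 : omWeight r s n 1 1 = r ^ 2 := by
    unfold omWeight
    simp (disch := omega) only [if_pos, if_neg, if_true, if_false, zpow_neg, zpow_ofNat]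
  have w2 : omWeight r s n 1 2 = s ^ 2 := by
    unfold omWeight
    simp (disch := omega) only [if_pos, if_neg, if_true, if_false, zpow_neg, zpow_ofNat]
  have w3 : omWeight r s n 1 3 = 1 := by
    unfold omWeight inv
    simp (disch := omega) only [if_pos, if_neg, if_true, if_false, zpow_neg, zpow_ofNat]
  have w4 : omWeight r s n 1 (inv n 3) = 1 := by
    unfold omWeight inv
    simp (disch := omega) only [if_pos, if_neg, if_true, if_false, zpow_neg, zpow_ofNat]
  have w5 : omWeight r s n 1 (inv n 2) = (s ^ 2)⁻¹ := by
    unfold omWeight inv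
    simp (disch := omega) only [if_pos, if_neg, if_true, if_false, zpow_neg, zpow_ofNat]
  have E0 : ∀ (F : ℕ → V K n ⊗[K] (V K n ⊗[K] V K n)) (x : ℕ), stepSum n F (eCoef 1 0)
      (eCoef' r s 1 0) (rowIdx n 0) (colIdx 0) x = (if 2 = x then F (inv n 1) else 0)
        + (if 1 = x then -(r ^ 2 * s ^ 2) • F (inv n 2) else 0) := fun F x => by
    simp only [stepSum, eCoef, eCoef', rowIdx, colIdx, if_true, inv_one_inv, one_smul, one_mul]
  have E1 : ∀ (i : ℕ) (hi : i ≠ 0) (F : ℕ → V K n ⊗[K] (V K n ⊗[K] V K n)) (x : ℕ),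
      stepSum n F (eCoef 1 i) (eCoef' r s 1 i) (rowIdx n i) (colIdx i) x =
        (if i + 1 = x then F i else 0) + (if inv n i = x then -F (inv n (i + 1)) else 0) :=
    fun i hi F x => by
      simp only [stepSum, eCoef, eCoef', rowIdx, colIdx, if_neg hi, one_smul, neg_smul]
  have s0 := tripleOp_e_tri (r := r) (s := s) h hab u v w (i := 0) (by omega) r1 r3 r2
  have s1 := tripleOp_e_tri (r := r) (s := s) h hab u v w (i := 2) (by omega) r2.inv r3 r2
  have s2 := tripleOp_e_tri (r := r) (s := s) h hab u v w (i := 2) (by omega) r1 r3 r1.inv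
  have s3 := tripleOp_e_tri (r := r) (s := s) h hab u v w (i := 1) (by omega) r3.inv r3 r2
  have s4 := tripleOp_e_tri (r := r) (s := s) h hab u v w (i := 1) (by omega) r2.inv r2 r2
  have s5 := tripleOp_e_tri (r := r) (s := s) h hab u v w (i := 1) (by omega) r1 r2 r1.inv
  -- This relation links `v_{3'} ⊗ v_3 ⊗ v_1` and `v_{2'} ⊗ v_2 ⊗ v_1` in just the combination in
  -- which they occur. Together with `one_one_inv` it leaves only vectors with `v_1` in the middle.
  have s6 := hX.e_tri h (i := 2) (by omega) r2.inv r3 r1 (hX.conjFree _ _ _ r2.inv r3 r1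
    ⟨by unfold inv; omega, by unfold inv; omega, by unfold inv; omega⟩)
  have hy := hX.stable (.e ⟨1, by omega⟩) _ <| hX.stable (.e ⟨2, by omega⟩) _ <|
    hX.stable (.e ⟨0, by omega⟩) _ <| hX.conjFree 1 3 2 r1 r3 r2
      ⟨by unfold inv; omega, by unfold inv; omega, by unfold inv; omega⟩
  have F1 : ∀ (F : ℕ → M) (x : ℕ), stepSum n F (eCoef 1 2) (eCoef' r s 1 2) (rowIdx n 2)
      (colIdx 2) x = (if 3 = x then F 2 else 0) + (if inv n 2 = x then -F (inv n 3) else 0) :=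
    fun F x => by
      simp only [stepSum, eCoef, eCoef', rowIdx, colIdx, if_neg two_ne_zero, one_smul, neg_smul]
  simp only [E0, E1 1 one_ne_zero, E1 2 two_ne_zero, F1, w0, w1, w2, w3, w4, w5, one_ne_zero,
    two_ne_zero, if_true, if_false, one_mul] at s0 s1 s2 s3 s4 s5 s6
  generalize omWeight r s n 0 3 = p at *
  generalize omWeight r s n 2 1 = q at *
  generalize omWeight r s n 2 (inv n 2) = t at *
  unfold inv at *
  simp (disch := omega) only [if_pos, if_neg, if_true, if_false, zero_add, add_zero, smul_zero]
    at s0 s1 s2 s3 s4 s5 s6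
  simp only [s0, s1, s2, s3, s4, s5, map_add, map_neg, map_smul] at hy
  have h11 := hX.one_one_inv h hn
  unfold inv at h11
  refine sub_eq_zero.1 ((smul_eq_zero.1 ?_).resolve_left ht)
  linear_combination (norm := (match_scalars <;> field_simp <;> ring)) -hy
    - (r ^ 2 * s ^ 2 * u) • s6 + (w * s ^ 2 * p * q * r ^ 2) • h11
    + (w * r ^ 2 * s ^ 6 * hpq) • X (tri K n 2 1 (2 * n + 2 - 2))

/-- The condition on two spectral parameters for the relations among the vectors of weight `ε₁` to be
independent. -/
def GenericPair (r s : K) (n : ℕ) (x y : K) : Prop :=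
  r ^ (2 * n - 2) * (r * s⁻¹) * x ≠ s ^ (2 * n - 2) * y

/-- The relation `zero_two_one` involves only vectors with `v_1` in the middle. Both sides are
multiples of the single unknown of that family, and genericity of `u, w` says that the multiples
differ. This is the first step of a triangular system. -/
theorem KillsConjFree.middle_eq_zero (hX : KillsConjFree r s n u v w X) (h : IsGeneric r s)
    (hn : 2 ≤ n) (huw : GenericPair r s n u w) : X (tri K n (n + 1) 1 (n + 1)) = 0 := by
  have hr := h.left_ne_zero
  have hs := h.right_ne_zero
  have hη : r⁻¹ * s⁻¹ ≠ 0 := mul_ne_zero (inv_ne_zero hr) (inv_ne_zero hs)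
  obtain ⟨h1, h2⟩ := (hX.pairRelations_middle h).eq_smul hn hr hs hη (n - 2) (by omega)
  rw [show n - (n - 2) = 2 by omega] at h1 h2
  have key := hX.zero_two_one h hn
  rw [h1, h2, smul_smul, smul_smul, ← sub_eq_zero, ← sub_smul] at key
  refine (smul_eq_zero.1 key).resolve_left fun e => huw ?_
  have e1 : 2 * n - 2 = 2 * (n - 2) + 2 := by omega
  rw [e1, pow_add, pow_add]
  generalize r ^ (2 * (n - 2)) = R at *
  generalize s ^ (2 * (n - 2)) = S at *
  linear_combination (norm := (field_simp; ring)) r⁻¹ * s⁻¹ * e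

/-- Once the middle family vanishes, the relation `zero_one_one_two` contains only the unknown of
the family with `v_1` in front; genericity of `v, w` makes it zero. -/
theorem KillsConjFree.left_eq_zero (hX : KillsConjFree r s n u v w X) (h : IsGeneric r s)
    (hn : 2 ≤ n) (huw : GenericPair r s n u w) (hvw : GenericPair r s n v w) :
    X (tri K n 1 (n + 1) (n + 1)) = 0 := by
  have hr := h.left_ne_zero
  have hs := h.right_ne_zero
  have hη : r⁻¹ * s⁻¹ ≠ 0 := mul_ne_zero (inv_ne_zero hr) (inv_ne_zero hs)
  have hm := (hX.pairRelations_middle h).eq_zero hn hr hs hη (hX.middle_eq_zero h hn huw)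
  have m1 := hm 2 (by omega) (by omega)
  have m2 := hm (inv n 2) (by unfold inv; omega) (by unfold inv; omega)
  rw [show inv n (inv n 2) = 2 by unfold inv; omega] at m2
  obtain ⟨h1, h2⟩ := (hX.pairRelations_left h).eq_smul hn hr hs one_ne_zero (n - 2) (by omega)
  rw [show n - (n - 2) = 2 by omega] at h1 h2
  have key := hX.zero_one_one_two h hn
  rw [hX.one_one_inv h hn, h1, h2, m1, m2, smul_zero, smul_zero, zero_add, zero_add, smul_smul,
    smul_smul, smul_smul, ← sub_eq_zero, ← sub_smul] at key
  refine (smul_eq_zero.1 key).resolve_left fun e => hvw ?_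
  have e1 : 2 * n - 2 = 2 * (n - 2) + 2 := by omega
  rw [e1, pow_add, pow_add]
  generalize r ^ (2 * (n - 2)) = R at *
  generalize s ^ (2 * (n - 2)) = S at *
  linear_combination (norm := (field_simp; ring)) (s ^ 2)⁻¹ * e

/-- Once the left family vanishes, the relation `zero_one_two_one` contains only the unknown of the
right family; genericity of `u, v` makes it zero. -/
theorem KillsConjFree.right_eq_zero (hX : KillsConjFree r s n u v w X) (h : IsGeneric r s)
    (hn : 2 ≤ n) (huv : GenericPair r s n u v) (huw : GenericPair r s n u w)
    (hvw : GenericPair r s n v w) : X (tri K n (n + 1) (n + 1) 1) = 0 := by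
  have hr := h.left_ne_zero
  have hs := h.right_ne_zero
  have hm := (hX.pairRelations_left h).eq_zero hn hr hs one_ne_zero
    (hX.left_eq_zero h hn huw hvw)
  have m1 := hm 2 (by omega) (by omega)
  have m2 := hm (inv n 2) (by unfold inv; omega) (by unfold inv; omega)
  rw [show inv n (inv n 2) = 2 by unfold inv; omega] at m2
  obtain ⟨h1, h2⟩ := (hX.pairRelations_right h).eq_smul hn hr hs one_ne_zero (n - 2) (by omega)
  rw [show n - (n - 2) = 2 by omega] at h1 h2
  have key := hX.zero_one_two_one h hn
  rw [hX.one_inv_one h hn, h1, h2, m1, m2, smul_zero, smul_zero, add_zero, add_zero, smul_smul,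
    smul_smul, smul_smul, ← sub_eq_zero, ← sub_smul] at key
  refine (smul_eq_zero.1 key).resolve_left fun e => huv ?_
  have e1 : 2 * n - 2 = 2 * (n - 2) + 2 := by omega
  rw [e1, pow_add, pow_add]
  generalize r ^ (2 * (n - 2)) = R at *
  generalize s ^ (2 * (n - 2)) = S at *
  linear_combination (norm := (field_simp; ring)) e

/-- Two of the vectors `v_a`, `v_b`, `v_c` are conjugate, and the third one is `v_o`. -/
def HasPair (n o a b c : ℕ) : Prop :=
  (b = inv n a ∧ c = o) ∨ (c = inv n a ∧ b = o) ∨ (c = inv n b ∧ a = o)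

/-- The three families cover the conjugate pairs other than `1, 1'`. The vectors containing `v_1`
twice and `v_{1'}` are then expressed through those families by `one_one_inv`, `one_inv_one` and
`inv_one_one`. -/
theorem KillsConjFree.hasPair_one (hX : KillsConjFree r s n u v w X) (h : IsGeneric r s)
    (hn : 2 ≤ n) (huv : GenericPair r s n u v) (huw : GenericPair r s n u w)
    (hvw : GenericPair r s n v w) {a b c : ℕ} (ha : InRange n a) (hb : InRange n b)
    (hc : InRange n c) (hp : HasPair n 1 a b c) : X (tri K n a b c) = 0 := by
  have hr := h.left_ne_zero
  have hs := h.right_ne_zero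
  have hη : r⁻¹ * s⁻¹ ≠ 0 := mul_ne_zero (inv_ne_zero hr) (inv_ne_zero hs)
  have m₁ := (hX.pairRelations_left h).eq_zero hn hr hs one_ne_zero (hX.left_eq_zero h hn huw hvw)
  have m₂ := (hX.pairRelations_middle h).eq_zero hn hr hs hη (hX.middle_eq_zero h hn huw)
  have m₃ := (hX.pairRelations_right h).eq_zero hn hr hs one_ne_zero (hX.right_eq_zero h hn huv huw hvw)
  have i2 : inv n (inv n 2) = 2 := by unfold inv; omega
  have j2 : 2 ≤ inv n 2 ∧ inv n 2 ≤ 2 * n := by unfold inv; omega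
  have l1 : X (tri K n 1 1 (inv n 1)) = 0 := by
    rw [hX.one_one_inv h hn, m₁ _ le_rfl (by omega), m₂ _ le_rfl (by omega), smul_zero, smul_zero,
      add_zero]
  have l2 : X (tri K n 1 (inv n 1) 1) = 0 := by
    have := m₁ _ j2.1 j2.2
    rw [i2] at this
    rw [hX.one_inv_one h hn, m₃ _ le_rfl (by omega), this, smul_zero, smul_zero, add_zero]
  have l3 : X (tri K n (inv n 1) 1 1) = 0 := by
    have k2 := m₂ _ j2.1 j2.2
    have k3 := m₃ _ j2.1 j2.2
    rw [i2] at k2 k3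
    rw [hX.inv_one_one h hn, k2, k3, smul_zero, smul_zero, add_zero]
  have cases : ∀ k, InRange n k → k = 1 ∨ k = inv n 1 ∨ 2 ≤ k ∧ k ≤ 2 * n := fun k hk => by
    have h1 := hk.1
    have h2 := hk.2
    unfold inv
    omega
  obtain ⟨rfl, rfl⟩ | ⟨rfl, rfl⟩ | ⟨rfl, rfl⟩ := hp
  · obtain rfl | rfl | ⟨h1, h2⟩ := cases a ha
    · exact l2
    · rwa [inv_one_inv]
    · exact m₃ _ h1 h2
  · obtain rfl | rfl | ⟨h1, h2⟩ := cases a ha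
    · exact l1
    · rwa [inv_one_inv]
    · exact m₂ _ h1 h2
  · obtain rfl | rfl | ⟨h1, h2⟩ := cases b hb
    · exact l1
    · rwa [inv_one_inv]
    · exact m₁ _ h1 h2

end FirstWeight

/-! ## Vanishing on all weight spaces -/

section AllWeights

variable {K : Type*} [Field K] {r s : K} {n : ℕ} {M : Type*} [AddCommGroup M] [Module K M]
  {u v w : K} {X : V K n ⊗[K] (V K n ⊗[K] V K n) →ₗ[K] M}

/-- The map `X` vanishes on the basis vectors with a conjugate pair and the third factor `v_o`. -/
def KillsPairs (n : ℕ) (X : V K n ⊗[K] (V K n ⊗[K] V K n) →ₗ[K] M) (o : ℕ) : Prop :=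
  ∀ a b c, InRange n a → InRange n b → InRange n c → HasPair n o a b c → X (tri K n a b c) = 0

theorem exists_hasPair_of_not_conjFree {a b c : ℕ} (ha : InRange n a) (hb : InRange n b)
    (hc : InRange n c) (h : ¬ConjFree n a b c) : ∃ o, InRange n o ∧ HasPair n o a b c := by
  unfold ConjFree at h
  unfold HasPair
  by_cases h1 : b = inv n a
  · exact ⟨c, hc, Or.inl ⟨h1, rfl⟩⟩
  by_cases h2 : c = inv n a
  · exact ⟨b, hb, Or.inr (Or.inl ⟨h2, rfl⟩)⟩
  · exact ⟨a, ha, Or.inr (Or.inr ⟨by tauto, rfl⟩)⟩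

theorem KillsConjFree.eq_zero_of_killsPairs (hX : KillsConjFree r s n u v w X) {a b c : ℕ}
    (ha : InRange n a) (hb : InRange n b) (hc : InRange n c)
    (h : ∀ o, HasPair n o a b c → KillsPairs n X o) : X (tri K n a b c) = 0 := by
  by_cases hf : ConjFree n a b c
  · exact hX.conjFree a b c ha hb hc hf
  · obtain ⟨o, -, ho'⟩ := exists_hasPair_of_not_conjFree ha hb hc hf
    exact h o ho' a b c ha hb hc ho'

/-- Such a vector has the weight of `v_o`. Replacing one letter `a` by `a'` changes both weights by
the same amount, so the passage from `o` to `o'` is that from `a` to `a'` or from the conjugate of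
`a'` to the conjugate of `a`. -/
theorem HasPair.transition {o o' a a' b c : ℕ} (ha : InRange n a) (ha' : InRange n a')
    (hb : InRange n b) (hc : InRange n c) (h : HasPair n o a b c) (h' : HasPair n o' a' b c)
    (hne : a ≠ a') : (o = a ∧ o' = a') ∨ (o = inv n a' ∧ o' = inv n a) := by
  obtain ⟨h1, h2⟩ := ha
  obtain ⟨h3, h4⟩ := ha'
  obtain ⟨h5, h6⟩ := hb
  obtain ⟨h7, h8⟩ := hc
  unfold HasPair inv at *
  omega

theorem HasPair.rotate {o a b c : ℕ} (ha : InRange n a) (hb : InRange n b) (hc : InRange n c)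
    (h : HasPair n o a b c) : HasPair n o b c a := by
  obtain ⟨h1, h2⟩ := ha
  obtain ⟨h5, h6⟩ := hb
  obtain ⟨h7, h8⟩ := hc
  unfold HasPair inv at *
  omega

/-- If every vector reached from `v_a ⊗ v_b ⊗ v_c` by `κ E_{pq} + κ' E_{q'p'}` in one factor is
annihilated by `X`, then so is the sum of these. -/
theorem KillsConjFree.sum_stepSum_eq_zero (hX : KillsConjFree r s n u v w X) {o p q : ℕ}
    (hp : InRange n p) (hq : InRange n q) (hpq : p ≠ q) (h1 : o = q → KillsPairs n X p)
    (h2 : o = inv n p → KillsPairs n X (inv n q)) {a b c : ℕ} (ha : InRange n a)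
    (hb : InRange n b) (hc : InRange n c) (ho : HasPair n o a b c) (κ κ' : K) :
    stepSum n (fun t => X (tri K n t b c)) κ κ' p q a = 0 ∧
      stepSum n (fun t => X (tri K n a t c)) κ κ' p q b = 0 ∧
      stepSum n (fun t => X (tri K n a b t)) κ κ' p q c = 0 := by
  have hpq' : inv n p ≠ inv n q := fun e => hpq (by rw [← hp.inv_inv, e, hq.inv_inv])
  have fin₁ : ∀ o', (o = q ∧ o' = p) ∨ (o = inv n p ∧ o' = inv n q) → KillsPairs n X o' := by
    rintro o' (⟨h, rfl⟩ | ⟨h, rfl⟩)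
    exacts [h1 h, h2 h]
  -- The second matrix unit arises from the first on replacing `(p, q)` by `(q', p')`, which
  -- interchanges the two alternatives.
  have fin₂ : ∀ o', (o = inv n p ∧ o' = inv n q) ∨ (o = inv n (inv n q) ∧ o' = inv n (inv n p)) →
      KillsPairs n X o' := fun o' h => fin₁ o' (by rwa [hp.inv_inv, hq.inv_inv, or_comm] at h)
  have zero : ∀ (F : ℕ → M) (x : ℕ), (q = x → F p = 0) → (inv n p = x → F (inv n q) = 0) →
      stepSum n F κ κ' p q x = 0 := fun F x hF hF' => by
    rw [stepSum, ite_eq_right_iff.2 fun e => by rw [hF e, smul_zero],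
      ite_eq_right_iff.2 fun e => by rw [hF' e, smul_zero], add_zero]
  refine ⟨zero _ _ ?_ ?_, zero _ _ ?_ ?_, zero _ _ ?_ ?_⟩
  · rintro rfl
    exact hX.eq_zero_of_killsPairs hp hb hc fun o' ho' =>
      fin₁ o' (ho.transition hq hp hb hc ho' hpq.symm)
  · rintro rfl
    exact hX.eq_zero_of_killsPairs hq.inv hb hc fun o' ho' =>
      fin₂ o' (ho.transition hp.inv hq.inv hb hc ho' hpq')
  · rintro rfl
    exact hX.eq_zero_of_killsPairs ha hp hc fun o' ho' =>
      fin₁ o' ((ho.rotate ha hq hc).transition hq hp hc ha (ho'.rotate ha hp hc) hpq.symm)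
  · rintro rfl
    exact hX.eq_zero_of_killsPairs ha hq.inv hc fun o' ho' =>
      fin₂ o' ((ho.rotate ha hp.inv hc).transition hp.inv hq.inv hc ha (ho'.rotate ha hq.inv hc)
        hpq')
  · rintro rfl
    exact hX.eq_zero_of_killsPairs ha hb hp fun o' ho' =>
      fin₁ o' (((ho.rotate ha hb hq).rotate hb hq ha).transition hq hp ha hb
        ((ho'.rotate ha hb hp).rotate hb hp ha) hpq.symm)
  · rintro rfl
    exact hX.eq_zero_of_killsPairs ha hb hq.inv fun o' ho' =>
      fin₂ o' (((ho.rotate ha hb hp.inv).rotate hb hp.inv ha).transition hp.inv hq.inv ha hb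
        ((ho'.rotate ha hb hq.inv).rotate hb hq.inv ha) hpq')

/-- Conjugate letters have inverse eigenvalues, so only the third letter contributes. -/
theorem HasPair.omWeight_mul (h : IsGeneric r s) (hn : 2 ≤ n) {i : ℕ} (hi : i ≤ n) {o a b c : ℕ}
    (ha : InRange n a) (hb : InRange n b) (ho : HasPair n o a b c) :
    omWeight r s n i a * omWeight r s n i b * omWeight r s n i c = omWeight r s n i o := by
  have key : ∀ k, InRange n k → omWeight r s n i k * omWeight r s n i (inv n k) = 1 := fun k hk => by
    rw [omWeight_inv _ _ _ _ _ hn hi hk.1 hk.2, mul_inv_cancel₀ (h.omWeight_ne_zero n i k hn)]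
  obtain ⟨rfl, rfl⟩ | ⟨rfl, rfl⟩ | ⟨rfl, rfl⟩ := ho
  · rw [key a ha, one_mul]
  · rw [mul_right_comm, key a ha, one_mul]
  · rw [mul_assoc, key b hb, mul_one]

/-- Passage from one weight space to the next one along the node `i < n`. -/
theorem KillsConjFree.killsPairs_of_adjacent (hX : KillsConjFree r s n u v w X)
    (h : IsGeneric r s) (hn : 2 ≤ n) (hu : u ≠ 0) (hv : v ≠ 0) (hw : w ≠ 0) {i o : ℕ} (hi : i < n)
    (ho : omWeight r s n i o ≠ omWeight s r n i o)
    (h1 : o = colIdx i → KillsPairs n X (rowIdx n i))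
    (h2 : o = inv n (rowIdx n i) → KillsPairs n X (inv n (colIdx i)))
    (h3 : o = rowIdx n i → KillsPairs n X (colIdx i))
    (h4 : o = inv n (colIdx i) → KillsPairs n X (inv n (rowIdx n i))) : KillsPairs n X o := by
  intro a b c ha hb hc hp
  have hab := one_mul ((r * s) ^ (-2 : ℤ))
  have hpr := rowIdx_inRange (n := n) hi.le
  have hqr := colIdx_inRange hn hi.le
  have hpq : rowIdx n i ≠ colIdx i := by
    unfold rowIdx colIdx inv
    split_ifs <;> omega
  obtain ⟨e1, e2, e3⟩ := hX.sum_stepSum_eq_zero hpr hqr hpq h1 h2 ha hb hc hp (eCoef 1 i)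
    (eCoef' r s 1 i)
  obtain ⟨f1, f2, f3⟩ := hX.sum_stepSum_eq_zero hqr hpr hpq.symm h3 h4 ha hb hc hp
    (fCoef r s ((r * s) ^ (-2 : ℤ)) n i) (fCoef' r s ((r * s) ^ (-2 : ℤ)) n i)
  have he : X (tripleOp r s 1 ((r * s) ^ (-2 : ℤ)) n u v w (.e ⟨i, by omega⟩) (tri K n a b c)) =
      0 := by
    rw [tripleOp_e_tri h hab u v w _ ha hb hc, map_add, map_add, map_smul, map_smul, map_smul,
      map_stepSum, map_stepSum, map_stepSum, e1, e2, e3, smul_zero, smul_zero, smul_zero, add_zero,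
      add_zero]
  have hf : X (tripleOp r s 1 ((r * s) ^ (-2 : ℤ)) n u v w (.f ⟨i, by omega⟩) (tri K n a b c)) =
      0 := by
    rw [tripleOp_f_tri h hab u v w _ ha hb hc, map_add, map_add, map_smul, map_smul, map_smul,
      map_stepSum, map_stepSum, map_stepSum, f1, f2, f3, smul_zero, smul_zero, smul_zero, add_zero,
      add_zero]
  -- Both `e_i y` and `f_i y` are killed by `X`, hence so are `f_i e_i y` and `e_i f_i y`. The
  -- commutator relation then says that the difference of the `ω_i`- and `ω'_i`-eigenvalues times `X
  -- y` is zero.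
  have key := congrArg X (LinearMap.congr_fun (tripleOp_e_f h hn hab hu hv hw ⟨i, by omega⟩)
    (tri K n a b c))
  simp only [LinearMap.sub_apply, LinearMap.smul_apply, Module.End.mul_apply, map_sub, map_smul,
    hX.stable _ _ he, hX.stable _ _ hf] at key
  rw [tripleOp_om_tri h hab u v w _ ha hb hc, tripleOp_omp_tri h hab u v w _ ha hb hc,
    hp.omWeight_mul h hn hi.le ha hb, hp.omWeight_mul h.symm hn hi.le ha hb, map_smul, map_smul,
    sub_zero, ← sub_smul] at key
  refine (smul_eq_zero.1 ((smul_eq_zero.1 key.symm).resolve_left (inv_ne_zero ?_))).resolve_left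
    (sub_ne_zero.2 ho)
  exact sub_ne_zero.2 (h.isGeneric_vertexParam n i hn hi.le).ne

/-- The weights are visited along `1, 2, …, n` by the nodes `1, …, n - 1`, and along `1, 2', 1'` by
the nodes `0` and `1`, followed by `2', …, n'`. The affine node leads to the negative weights
without passing through weight zero. At each step only one of the four neighbour conditions is not
vacuous, and it concerns a weight already treated. -/
theorem KillsConjFree.killsPairs_of_ne (hX : KillsConjFree r s n u v w X)
    (h : IsGeneric r s) (hn : 2 ≤ n) (hu : u ≠ 0) (hv : v ≠ 0) (hw : w ≠ 0)
    (h1 : KillsPairs n X 1) {o : ℕ} (ho : InRange n o) (ho' : o ≠ n + 1) : KillsPairs n X o := by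
  have hs2 := h.pow_ne 2 two_pos
  have hs2' : (r ^ 2)⁻¹ ≠ (s ^ 2)⁻¹ := fun e => hs2 (inv_injective e)
  have up : ∀ k, k + 1 ≤ n → KillsPairs n X (k + 1) := fun k => by
    induction k with
    | zero => exact fun _ => h1
    | succ k ih =>
      intro hk
      refine hX.killsPairs_of_adjacent h hn hu hv hw (i := k + 1) hk ?_ ?_ ?_ ?_ ?_
      · unfold omWeight
        simp (disch := omega) only [if_pos, if_neg, if_true, if_false, zpow_ofNat]
        exact hs2.symm
      · intro _
        rw [rowIdx, if_neg (by omega)]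
        exact ih (by omega)
      all_goals
        unfold rowIdx colIdx inv
        split_ifs <;> omega
  have l2 : KillsPairs n X (inv n 2) := by
    refine hX.killsPairs_of_adjacent h hn hu hv hw (i := 0) (by omega) ?_ ?_ ?_ ?_ ?_
    · unfold omWeight inv
      simp (disch := omega) only [if_pos, if_neg, if_true, if_false, zpow_ofNat]
      exact hs2
    · unfold colIdx inv
      rw [if_pos rfl]
      omega
    · unfold rowIdx inv
      rw [if_pos rfl]
      omega
    · unfold rowIdx inv
      rw [if_pos rfl]
      omega
    · intro _
      rwa [rowIdx, if_pos rfl, inv_one_inv]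
  have l1 : KillsPairs n X (inv n 1) := by
    refine hX.killsPairs_of_adjacent h hn hu hv hw (i := 1) (by omega) ?_ ?_ ?_ ?_ ?_
    · unfold omWeight inv
      simp (disch := omega) only [if_pos, if_neg, if_true, if_false, zpow_ofNat, zpow_neg]
      exact hs2'
    · unfold colIdx inv
      rw [if_neg one_ne_zero]
      omega
    · exact fun _ => l2
    · unfold rowIdx inv
      rw [if_neg one_ne_zero]
      omega
    · unfold colIdx inv
      rw [if_neg one_ne_zero]
      omega
  have down : ∀ k, k + 1 ≤ n → KillsPairs n X (inv n (k + 1)) := fun k => by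
    induction k with
    | zero => exact fun _ => l1
    | succ k ih =>
      intro hk
      refine hX.killsPairs_of_adjacent h hn hu hv hw (i := k + 1) hk ?_ ?_ ?_ ?_ ?_
      · unfold omWeight inv
        simp (disch := omega) only [if_pos, if_neg, if_true, if_false, zpow_ofNat, zpow_neg]
        exact hs2'.symm
      iterate 3
        · unfold rowIdx colIdx inv
          simp (disch := omega) only [if_neg]
          omega
      · intro _
        rw [rowIdx, if_neg (by omega)]
        exact ih (by omega)
  obtain ⟨h2, h3⟩ := ho
  by_cases hlt : o ≤ n
  · obtain ⟨k, rfl⟩ := Nat.exists_eq_add_of_le' h2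
    exact up k hlt
  · have := down (inv n o - 1) (by unfold inv; omega)
    rwa [show inv n (inv n o - 1 + 1) = o by unfold inv; omega] at this

/-- On weight zero `ω_i` and `ω'_i` agree, so the commutator gives no information. The vectors are
instead obtained by applying `f_n` and `f_{n-1}` to vectors already known to be killed. -/
theorem KillsConjFree.killsPairs_middle (hX : KillsConjFree r s n u v w X)
    (h : IsGeneric r s) (hn : 2 ≤ n) (hu : u ≠ 0) (hv : v ≠ 0) (hw : w ≠ 0)
    (h1 : KillsPairs n X 1) : KillsPairs n X (n + 1) := by
  have hr := h.left_ne_zero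
  have hs := h.right_ne_zero
  have hκ : r⁻¹ + s⁻¹ ≠ 0 := by
    have := h.qInt_two_ne_zero
    intro e
    field_simp at e
    exact this (by linear_combination e)
  have hn' : KillsPairs n X n := hX.killsPairs_of_ne h hn hu hv hw h1 ⟨by omega, by omega⟩ (by omega)
  have hom := fun i k => h.symm.omWeight_ne_zero n i k hn
  -- For a pair `j, j'` disjoint from `n, n + 1, n'`, the operator `f_n` changes only the letter `n`
  -- into `n + 1`. Its coefficient `r⁻¹ + s⁻¹` is nonzero.
  have away : ∀ j, 1 ≤ j → j ≤ 2 * n + 1 → j ≠ n → j ≠ n + 1 → j ≠ n + 2 →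
      X (tri K n (n + 1) j (inv n j)) = 0 ∧ X (tri K n j (n + 1) (inv n j)) = 0 ∧
        X (tri K n j (inv n j) (n + 1)) = 0 := by
    intro j hj hj' h2 h3 h4
    have rj : InRange n j := ⟨hj, hj'⟩
    have rn : InRange n n := ⟨by omega, by omega⟩
    have k1 := hX.f_tri h le_rfl rn rj rj.inv (hn' _ _ _ rn rj rj.inv (Or.inr (Or.inr ⟨rfl, rfl⟩)))
    have k2 := hX.f_tri h le_rfl rj rn rj.inv (hn' _ _ _ rj rn rj.inv (Or.inr (Or.inl ⟨rfl, rfl⟩)))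
    have k3 := hX.f_tri h le_rfl rj rj.inv rn (hn' _ _ _ rj rj.inv rn (Or.inl ⟨rfl, rfl⟩))
    unfold stepSum fCoef fCoef' rowIdx colIdx at k1 k2 k3
    have e1 : inv n j ≠ n ∧ inv n j ≠ n + 1 := by unfold inv; omega
    have e2 : inv n (n + 1) = n + 1 := by unfold inv; omega
    have e3 : n ≠ 0 := by omega
    simpa [e1.1.symm, e1.2.symm, e2, e3, h2.symm, h3.symm, hκ, hom] using
      And.intro k1 (And.intro k2 k3)
  have hi : n - 1 ≤ n := by omega
  have rp : InRange n (n - 1) := ⟨by omega, by omega⟩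
  have rm : InRange n (n + 1) := ⟨by omega, by omega⟩
  have rd : InRange n (n + 2) := ⟨by omega, by omega⟩
  have k1 := hX.f_tri h hi rp rm rd (hX.conjFree _ _ _ rp rm rd (by unfold ConjFree inv; omega))
  have k2 := hX.f_tri h hi rp rd rm (hX.conjFree _ _ _ rp rd rm (by unfold ConjFree inv; omega))
  have k3 := hX.f_tri h hi rd rp rm (hX.conjFree _ _ _ rd rp rm (by unfold ConjFree inv; omega))
  have k4 := hX.f_tri h hi rd rm rp (hX.conjFree _ _ _ rd rm rp (by unfold ConjFree inv; omega))
  have k5 := hX.f_tri h hi rm rp rd (hX.conjFree _ _ _ rm rp rd (by unfold ConjFree inv; omega))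
  have k6 := hX.f_tri h hi rm rd rp (hX.conjFree _ _ _ rm rd rp (by unfold ConjFree inv; omega))
  -- For the letters `n, n + 1, n'`, the operator `f_{n-1}` is applied to the arrangements of `n -
  -- 1, n + 1, n + 2`, which contain no conjugate pair. The second vector produced has letters `n -
  -- 1, n + 1, n + 3` and is covered by `away`.
  have near : (X (tri K n n (n + 1) (n + 2)) = 0 ∧ X (tri K n n (n + 2) (n + 1)) = 0 ∧
      X (tri K n (n + 2) n (n + 1)) = 0) ∧ X (tri K n (n + 2) (n + 1) n) = 0 ∧
      X (tri K n (n + 1) n (n + 2)) = 0 ∧ X (tri K n (n + 1) (n + 2) n) = 0 := by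
    obtain ⟨a1, a2, a3⟩ := away (n - 1) (by omega) (by omega) (by omega) (by omega) (by omega)
    obtain ⟨a4, a5, a6⟩ := away (n + 3) (by omega) (by omega) (by omega) (by omega) (by omega)
    rw [show inv n (n - 1) = n + 3 by unfold inv; omega] at a1 a2 a3
    rw [show inv n (n + 3) = n - 1 by unfold inv; omega] at a4 a5 a6
    have e1 : n - 1 ≠ 0 := by omega
    have e2 : n - 1 < n := by omega
    have e3 : n - 1 + 1 = n := by omega
    have e4 : inv n n = n + 2 := by unfold inv; omega
    have e5 : inv n (n - 1) = n + 3 := by unfold inv; omega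
    have e6 : n - 1 ≠ n + 1 ∧ n - 1 ≠ n + 2 ∧ n + 2 ≠ n - 1 := by omega
    unfold stepSum fCoef fCoef' rowIdx colIdx at k1 k2 k3 k4 k5 k6
    simp only [e1, e2, e3, e4, e5, if_true, if_false] at k1 k2 k3 k4 k5 k6
    simp [e6.1, e6.2.1, e6.2.2, a1, a2, a3, a4, a5, a6, hom] at k1 k2 k3 k4 k5 k6
    exact ⟨⟨k1, k2, k3⟩, k4, k5, k6⟩
  obtain ⟨⟨b1, b2, b3⟩, b4, b5, b6⟩ := near
  -- `f_n` applied to `v_n ⊗ v_{n+1} ⊗ v_{n+1}` gives this vector and two vectors covered by `near`.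
  have mid : X (tri K n (n + 1) (n + 1) (n + 1)) = 0 := by
    have rn : InRange n n := ⟨by omega, by omega⟩
    have key := hX.f_tri h le_rfl rn rm rm (hn' _ _ _ rn rm rm
      (Or.inr (Or.inr ⟨by unfold inv; omega, rfl⟩)))
    have e2 : inv n (n + 1) = n + 1 := by unfold inv; omega
    have e3 : n ≠ 0 := by omega
    have e4 : inv n n = n + 2 := by unfold inv; omega
    unfold stepSum fCoef fCoef' rowIdx colIdx at key
    simpa [e2, e3, e4, b1, b2, hκ, hom] using key
  have all : ∀ j, InRange n j → X (tri K n (n + 1) j (inv n j)) = 0 ∧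
      X (tri K n j (n + 1) (inv n j)) = 0 ∧ X (tri K n j (inv n j) (n + 1)) = 0 := by
    intro j hj
    by_cases e1 : j = n
    · subst e1
      rw [show inv j j = j + 2 by unfold inv; omega]
      exact ⟨b5, b1, b2⟩
    by_cases e2 : j = n + 1
    · subst e2
      rw [show inv n (n + 1) = n + 1 by unfold inv; omega]
      exact ⟨mid, mid, mid⟩
    by_cases e3 : j = n + 2
    · subst e3
      rw [show inv n (n + 2) = n by unfold inv; omega]
      exact ⟨b6, b4, b3⟩
    exact away j hj.1 hj.2 e1 e2 e3
  rintro a b c ha hb hc (⟨rfl, rfl⟩ | ⟨rfl, rfl⟩ | ⟨rfl, rfl⟩)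
  exacts [(all a ha).2.2, (all a ha).2.1, (all b hb).1]

/-- A map that vanishes on vectors without conjugate pairs and has a stable kernel vanishes, for
generic spectral parameters. -/
theorem KillsConjFree.eq_zero (hX : KillsConjFree r s n u v w X) (h : IsGeneric r s)
    (hn : 2 ≤ n) (hu : u ≠ 0) (hv : v ≠ 0) (hw : w ≠ 0) (huv : GenericPair r s n u v)
    (huw : GenericPair r s n u w) (hvw : GenericPair r s n v w) : X = 0 := by
  have h1 : KillsPairs n X 1 := fun a b c ha hb hc hp =>
    hX.hasPair_one h hn huv huw hvw ha hb hc hp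
  refine linearMap_ext₃ fun a b c ha hb hc => ?_
  rw [LinearMap.zero_apply]
  by_cases hf : ConjFree n a b c
  · exact hX.conjFree a b c ha hb hc hf
  · obtain ⟨o, ho, hp⟩ := exists_hasPair_of_not_conjFree ha hb hc hf
    by_cases e : o = n + 1
    · subst e
      exact hX.killsPairs_middle h hn hu hv hw h1 a b c ha hb hc hp
    · exact hX.killsPairs_of_ne h hn hu hv hw h1 ho e a b c ha hb hc hp

theorem ybDefect_eq_zero_of_generic (h : IsGeneric r s) (hn : 2 ≤ n) (hu : u ≠ 0) (hv : v ≠ 0)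
    (hw : w ≠ 0) (huv : GenericPair r s n u v) (huw : GenericPair r s n u w)
    (hvw : GenericPair r s n v w) : ybDefect r s n (u / v) (u / w) (v / w) = 0 := by
  refine KillsConjFree.eq_zero (u := u) (v := v) (w := w) ⟨fun g y hy => ?_, fun a b c ha hb hc hf => ?_⟩
    h hn hu hv hw huv huw hvw
  · have key := LinearMap.congr_fun (ybDefect_mul_tripleOp h hn (one_mul _) hu hv hw g) y
    rw [Module.End.mul_apply, Module.End.mul_apply, hy, map_zero] at key
    exact key
  · rw [show u / w = u / v * (v / w) by field_simp]
    exact ybDefect_conjFree h _ _ ha hb hc hf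

end AllWeights

/-! ## The Yang–Baxter equation -/

section Density

open Polynomial

variable {K : Type*} [Field K] {M N L : Type*} [AddCommGroup M] [Module K M] [AddCommGroup N]
  [Module K N] [AddCommGroup L] [Module K L]

/-- The functions `K → M` given by polynomials with coefficients in `M`. -/
def polyFamilies (K M : Type*) [Field K] [AddCommGroup M] [Module K M] : Submodule K (K → M) :=
  Submodule.span K {F | ∃ (k : ℕ) (m : M), F = fun z => z ^ k • m}

theorem monomial_mem_polyFamilies (k : ℕ) (m : M) : (fun z : K => z ^ k • m) ∈ polyFamilies K M :=
  Submodule.subset_span ⟨k, m, rfl⟩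

theorem const_mem_polyFamilies (m : M) : (fun _ : K => m) ∈ polyFamilies K M := by
  simpa using monomial_mem_polyFamilies (K := K) 0 m

theorem eval_smul_mem_polyFamilies (p : K[X]) (m : M) :
    (fun z : K => p.eval z • m) ∈ polyFamilies K M := by
  have : (fun z : K => p.eval z • m) =
      ∑ k ∈ Finset.range (p.natDegree + 1), fun z : K => z ^ k • (p.coeff k • m) := by
    funext z
    rw [Finset.sum_apply, Polynomial.eval_eq_sum_range, Finset.sum_smul]
    refine Finset.sum_congr rfl fun k _ => ?_
    rw [smul_smul, mul_comm]
  rw [this]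
  exact Submodule.sum_mem _ fun k _ => monomial_mem_polyFamilies k _

theorem map_mem_polyFamilies (φ : M →ₗ[K] N) {F : K → M} (hF : F ∈ polyFamilies K M) :
    (fun z => φ (F z)) ∈ polyFamilies K N := by
  refine Submodule.span_induction ?_ ?_ ?_ ?_ hF
  · rintro _ ⟨k, m, rfl⟩
    simpa using monomial_mem_polyFamilies k (φ m)
  · simp only [Pi.zero_apply, map_zero]
    exact ((polyFamilies K N).zero_mem :)
  · intro F G _ _ hF hG
    simp only [Pi.add_apply, map_add]
    exact (add_mem hF hG :)
  · intro c F _ hF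
    simp only [Pi.smul_apply, map_smul]
    exact ((polyFamilies K N).smul_mem c hF :)

theorem map₂_mem_polyFamilies (φ : M →ₗ[K] N →ₗ[K] L) {F : K → M} {G : K → N}
    (hF : F ∈ polyFamilies K M) (hG : G ∈ polyFamilies K N) :
    (fun z => φ (F z) (G z)) ∈ polyFamilies K L := by
  refine Submodule.span_induction ?_ ?_ ?_ ?_ hF
  · rintro _ ⟨k, m, rfl⟩
    refine Submodule.span_induction ?_ ?_ ?_ ?_ hG
    · rintro _ ⟨l, m', rfl⟩
      have e : (fun z : K => φ (z ^ k • m) (z ^ l • m')) = fun z => z ^ (k + l) • φ m m' := by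
        funext z
        rw [map_smul, map_smul, LinearMap.smul_apply, smul_smul, pow_add, mul_comm]
      rw [e]
      exact monomial_mem_polyFamilies _ _
    · simp only [Pi.zero_apply, map_zero]
      exact ((polyFamilies K L).zero_mem :)
    · intro F G _ _ hF hG
      simp only [Pi.add_apply, map_add]
      exact (add_mem hF hG :)
    · intro c F _ hF
      simp only [Pi.smul_apply, map_smul _ c] at hF ⊢
      exact (polyFamilies K L).smul_mem c hF
  · simp only [Pi.zero_apply, map_zero, LinearMap.zero_apply]
    exact ((polyFamilies K L).zero_mem :)
  · intro F G _ _ hF hG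
    simp only [Pi.add_apply, map_add, LinearMap.add_apply]
    exact (add_mem hF hG :)
  · intro c F _ hF
    simp only [Pi.smul_apply, map_smul, LinearMap.smul_apply]
    exact ((polyFamilies K L).smul_mem c hF :)

theorem comp_mul_mem_polyFamilies (x : K) {F : K → M} (hF : F ∈ polyFamilies K M) :
    (fun z => F (x * z)) ∈ polyFamilies K M := by
  refine Submodule.span_induction ?_ ?_ ?_ ?_ hF
  · rintro _ ⟨k, m, rfl⟩
    have e : (fun z : K => (x * z) ^ k • m) = fun z => z ^ k • x ^ k • m := by
      funext z
      rw [smul_smul, mul_pow, mul_comm]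
    rw [e]
    exact monomial_mem_polyFamilies _ _
  · exact (polyFamilies K M).zero_mem
  · intro F G _ _ hF hG
    exact add_mem hF hG
  · intro c F _ hF
    exact (polyFamilies K M).smul_mem c hF

/-- Linear functionals separate points of `M` and turn the family into an ordinary polynomial with
infinitely many zeros. -/
theorem eq_zero_of_mem_polyFamilies [Infinite K] {F : K → M} (hF : F ∈ polyFamilies K M)
    {S : Set K} (hS : S.Finite) (h : ∀ z ∉ S, F z = 0) (z : K) : F z = 0 := by
  refine (Module.forall_dual_apply_eq_zero_iff K (F z)).1 fun φ => ?_
  obtain ⟨p, hp⟩ : ∃ p : K[X], ∀ z, φ (F z) = p.eval z := by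
    refine Submodule.span_induction ?_ ?_ ?_ ?_ hF
    · rintro _ ⟨k, m, rfl⟩
      exact ⟨C (φ m) * X ^ k, fun z => by
        rw [map_smul, eval_mul, eval_C, eval_pow, eval_X, smul_eq_mul, mul_comm]⟩
    · exact ⟨0, fun z => by rw [Pi.zero_apply, map_zero, eval_zero]⟩
    · rintro F G _ _ ⟨p, hp⟩ ⟨q, hq⟩
      exact ⟨p + q, by simp [hp, hq]⟩
    · rintro c F _ ⟨p, hp⟩
      exact ⟨C c * p, by simp [hp]⟩
  have : p = 0 := by
    refine Polynomial.eq_of_infinite_eval_eq _ _ (Set.Infinite.mono ?_ hS.infinite_compl)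
    intro z hz
    change p.eval z = (0 : K[X]).eval z
    rw [← hp, h z hz, map_zero, eval_zero]
  rw [hp, this, eval_zero]

variable {r s : K} {n : ℕ}

theorem Rhat_mem_polyFamilies :
    (fun z => Rhat r s n z) ∈ polyFamilies K (Module.End K (V K n ⊗[K] V K n)) := by
  have e : (fun z => Rhat r s n z) =
      RhatSum r s n fun p (A : Module.End K (V K n ⊗[K] V K n)) z => p.eval z • A := by
    funext z
    simp only [Rhat, RhatSum, Pi.add_apply, Finset.sum_apply]
  rw [e]
  unfold RhatSum
  refine add_mem (add_mem (add_mem (add_mem ?_ ?_) ?_) ?_) ?_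
  · exact sum_mem fun i _ => eval_smul_mem_polyFamilies _ _
  all_goals exact sum_mem fun i _ => sum_mem fun j _ => eval_smul_mem_polyFamilies _ _

theorem op12_Rhat_mem_polyFamilies : (fun z => op12 (Rhat r s n z)) ∈
    polyFamilies K (Module.End K (V K n ⊗[K] (V K n ⊗[K] V K n))) :=
  map_mem_polyFamilies (N := Module.End K (V K n ⊗[K] (V K n ⊗[K] V K n)))
    { toFun := op12
      map_add' := fun A B => by
        simp only [op12, LinearMap.rTensor_add, LinearMap.add_comp, LinearMap.comp_add]
      map_smul' := fun c A => by
        simp only [op12, LinearMap.rTensor_smul, LinearMap.smul_comp, LinearMap.comp_smul,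
          RingHom.id_apply] } Rhat_mem_polyFamilies

theorem op23_Rhat_mem_polyFamilies : (fun z => op23 (Rhat r s n z)) ∈
    polyFamilies K (Module.End K (V K n ⊗[K] (V K n ⊗[K] V K n))) :=
  map_mem_polyFamilies (M := Module.End K (V K n ⊗[K] V K n))
    (N := Module.End K (V K n ⊗[K] (V K n ⊗[K] V K n))) (LinearMap.lTensorHom (V K n)) Rhat_mem_polyFamilies

theorem mul_mem_polyFamilies {F G : K → Module.End K M}
    (hF : F ∈ polyFamilies K (Module.End K M)) (hG : G ∈ polyFamilies K (Module.End K M)) :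
    (fun z => F z * G z) ∈ polyFamilies K (Module.End K M) :=
  map₂_mem_polyFamilies (LinearMap.mul K (Module.End K M)) hF hG

theorem ybDefect_mem_polyFamilies_right (x : K) : (fun z => ybDefect r s n x (x * z) z) ∈
    polyFamilies K (Module.End K (V K n ⊗[K] (V K n ⊗[K] V K n))) :=
  Submodule.sub_mem _ (mul_mem_polyFamilies op12_Rhat_mem_polyFamilies (mul_mem_polyFamilies
      (comp_mul_mem_polyFamilies x op23_Rhat_mem_polyFamilies) (const_mem_polyFamilies _)))
    (mul_mem_polyFamilies (const_mem_polyFamilies _) (mul_mem_polyFamilies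
      (comp_mul_mem_polyFamilies x op12_Rhat_mem_polyFamilies) op23_Rhat_mem_polyFamilies))

theorem ybDefect_mem_polyFamilies_left (z : K) : (fun x => ybDefect r s n x (z * x) z) ∈
    polyFamilies K (Module.End K (V K n ⊗[K] (V K n ⊗[K] V K n))) :=
  Submodule.sub_mem _ (mul_mem_polyFamilies (const_mem_polyFamilies _) (mul_mem_polyFamilies
      (comp_mul_mem_polyFamilies z op23_Rhat_mem_polyFamilies) op12_Rhat_mem_polyFamilies))
    (mul_mem_polyFamilies op23_Rhat_mem_polyFamilies (mul_mem_polyFamilies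
      (comp_mul_mem_polyFamilies z op12_Rhat_mem_polyFamilies) (const_mem_polyFamilies _)))

/-- The defect is polynomial in each of `x = u / v` and `z = v / w` separately. Vanishing is
extended first in `z`, for each fixed admissible `x`, and then in `x`; no density statement in two
variables is needed. -/
theorem ybDefect_eq_zero [Infinite K] (h : IsGeneric r s) (hn : 2 ≤ n) (x z : K) :
    ybDefect r s n x (x * z) z = 0 := by
  have hP : r ^ (2 * n - 2) * (r * s⁻¹) ≠ 0 :=
    mul_ne_zero (pow_ne_zero _ h.left_ne_zero)
      (mul_ne_zero h.left_ne_zero (inv_ne_zero h.right_ne_zero))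
  -- This constant equals `ξ`, so a pair of parameters is generic when its ratio differs from `ξ`.
  set κ := s ^ (2 * n - 2) / (r ^ (2 * n - 2) * (r * s⁻¹)) with hκ
  have hgen : ∀ x y, x ≠ κ * y → GenericPair r s n x y := fun x y hxy e => hxy (by
    rw [hκ, div_mul_eq_mul_div, eq_div_iff hP, mul_comm, e])
  have step : ∀ x, x ≠ 0 → x ≠ κ → ∀ z, ybDefect r s n x (x * z) z = 0 := fun x hx hxκ z =>
    eq_zero_of_mem_polyFamilies (ybDefect_mem_polyFamilies_right x)
      -- With `w = 1`, `v = z` and `u = x z`, the excluded values express `v ≠ 0`, `v / w ≠ κ` and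
      -- `u / w ≠ κ`.
      (S := {0, κ, κ / x}) (Set.toFinite _) (fun z hz => by
        simp only [Set.mem_insert_iff, Set.mem_singleton_iff, not_or] at hz
        obtain ⟨h0, h1, h2⟩ := hz
        have key := ybDefect_eq_zero_of_generic (u := x * z) (v := z) (w := 1) h hn
          (mul_ne_zero hx h0) h0 one_ne_zero
          (hgen _ _ fun e => hxκ (mul_right_cancel₀ h0 e))
          (hgen _ _ fun e => h2 (by rw [eq_div_iff hx, mul_comm, e, mul_one]))
          (hgen _ _ fun e => h1 (by rw [e, mul_one]))
        rwa [mul_div_cancel_right₀ _ h0, div_one, div_one] at key) z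
  have := eq_zero_of_mem_polyFamilies (ybDefect_mem_polyFamilies_left (r := r) (s := s) (n := n) z)
    (S := {0, κ}) (Set.toFinite _) (fun x hx => by
      simp only [Set.mem_insert_iff, Set.mem_singleton_iff, not_or] at hx
      rw [mul_comm z x]
      exact step x hx.1 hx.2 z) x
  rwa [mul_comm z x] at this

end Density

/-! ### Flips of tensor factors and the passage from `R̂` to `R` -/

section Flip

variable {K : Type*} [Field K] {n : ℕ}

/-- The flip of two tensor factors. -/
noncomputable abbrev flipOp (K : Type*) [Field K] (n : ℕ) : Module.End K (V K n ⊗[K] V K n) :=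
  (TensorProduct.comm K (V K n) (V K n)).toLinearMap

theorem op12_mul (A B : Module.End K (V K n ⊗[K] V K n)) : op12 (A * B) = op12 A * op12 B := by
  refine linearMap_ext₃ fun a b c _ _ _ => ?_
  simp [op12, tri, Module.End.mul_apply]

theorem op23_mul (A B : Module.End K (V K n ⊗[K] V K n)) : op23 (A * B) = op23 A * op23 B :=
  LinearMap.lTensor_comp _ _ _

theorem op12_flip_tri (a b c : ℕ) : op12 (flipOp K n) (tri K n a b c) = tri K n b a c := by
  rw [op12_tri]
  rfl

theorem op23_flip_tri (a b c : ℕ) : op23 (flipOp K n) (tri K n a b c) = tri K n a c b := rfl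

theorem op23_flip_mul_self : op23 (flipOp K n) * op23 (flipOp K n) = 1 :=
  linearMap_ext₃ fun a b c _ _ _ => by
    rw [Module.End.mul_apply, op23_flip_tri, op23_flip_tri, Module.End.one_apply]

theorem op_flip_braid : op12 (flipOp K n) * (op23 (flipOp K n) * op12 (flipOp K n)) = op23 (flipOp K n) * (op12 (flipOp K n) * op23 (flipOp K n)) :=
  linearMap_ext₃ fun a b c _ _ _ => by
    simp only [Module.End.mul_apply, op23_flip_tri, op12_flip_tri]

/-- The product of the two flips permutes the three factors cyclically and thereby carries the
places `1, 2` to the places `2, 3`. -/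
theorem op_flip_mul_op12 (A : Module.End K (V K n ⊗[K] V K n)) :
    op12 (flipOp K n) * (op23 (flipOp K n) * op12 A) = op23 A * (op12 (flipOp K n) * op23 (flipOp K n)) := by
  refine linearMap_ext₃ fun a b c _ _ _ => ?_
  simp only [Module.End.mul_apply, op23_flip_tri, op12_flip_tri]
  rw [op12_tri, op23_tri]
  generalize A (bb K n a b) = y
  induction y with
  | zero => rw [TensorProduct.zero_tmul, LinearEquiv.map_zero, LinearMap.map_zero,
      LinearMap.map_zero, TensorProduct.tmul_zero]
  | add y y' h h' => rw [TensorProduct.add_tmul, map_add, map_add, map_add, h, h',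
      TensorProduct.tmul_add]
  | tmul y y' => simp [op12, op23]

theorem op_flip_mul_op23 (A : Module.End K (V K n ⊗[K] V K n)) :
    op23 (flipOp K n) * (op12 (flipOp K n) * op23 A) = op12 A * (op23 (flipOp K n) * op12 (flipOp K n)) := by
  refine linearMap_ext₃ fun a b c _ _ _ => ?_
  simp only [Module.End.mul_apply, op23_flip_tri, op12_flip_tri]
  rw [op12_tri, op23_tri]
  generalize A (bb K n b c) = y
  induction y with
  | zero => rw [TensorProduct.tmul_zero, LinearMap.map_zero, LinearMap.map_zero,
      TensorProduct.zero_tmul, LinearEquiv.map_zero]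
  | add y y' h h' => rw [TensorProduct.tmul_add, map_add, map_add, h, h', TensorProduct.add_tmul,
      map_add]
  | tmul y y' => simp [op12, op23]

/-- The Yang–Baxter equation for `A τ`, `B τ` and `C τ` follows from the braid relation. -/
theorem yangBaxter_of_braid {A B C : Module.End K (V K n ⊗[K] V K n)}
    (h : op12 C * (op23 B * op12 A) = op23 A * (op12 B * op23 C)) :
    op12 (C * flipOp K n) * (op13 (B * flipOp K n) * op23 (A * flipOp K n)) =
      op23 (A * flipOp K n) * (op13 (B * flipOp K n) * op12 (C * flipOp K n)) := by
  have e13 : op13 (B * flipOp K n) = op23 (flipOp K n) * (op12 B * (op12 (flipOp K n) * op23 (flipOp K n))) := by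
    rw [← mul_assoc (op12 B), ← op12_mul]
    rfl
  rw [e13, op12_mul, op23_mul]
  -- All flips are moved to the right; on either side of the equation they combine to the longest
  -- permutation, leaving the two sides of the braid relation in front.
  have l : op12 C * op12 (flipOp K n) * (op23 (flipOp K n) * (op12 B * (op12 (flipOp K n) * op23 (flipOp K n))) * (op23 A * op23 (flipOp K n))) =
      op12 C * (op23 B * op12 A) * (op23 (flipOp K n) * (op12 (flipOp K n) * op23 (flipOp K n))) := by
    calc _ = op12 C * ((op12 (flipOp K n) * (op23 (flipOp K n) * op12 B)) * (op12 (flipOp K n) * (op23 (flipOp K n) * (op23 A * op23 (flipOp K n))))) := by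
          simp only [mul_assoc]
      _ = op12 C * (op23 B * ((op12 (flipOp K n) * (op23 (flipOp K n) * op12 (flipOp K n))) * (op23 (flipOp K n) * (op23 A * op23 (flipOp K n))))) := by
          rw [op_flip_mul_op12]
          simp only [mul_assoc]
      _ = op12 C * (op23 B * (op23 (flipOp K n) * (op12 (flipOp K n) * ((op23 (flipOp K n) * op23 (flipOp K n)) * (op23 A * op23 (flipOp K n)))))) := by
          rw [op_flip_braid]
          simp only [mul_assoc]
      _ = op12 C * (op23 B * ((op23 (flipOp K n) * (op12 (flipOp K n) * op23 A)) * op23 (flipOp K n))) := by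
          rw [op23_flip_mul_self, one_mul]
          simp only [mul_assoc]
      _ = _ := by
          rw [op_flip_mul_op23]
          simp only [mul_assoc]
  have l' : op23 A * op23 (flipOp K n) * (op23 (flipOp K n) * (op12 B * (op12 (flipOp K n) * op23 (flipOp K n))) * (op12 C * op12 (flipOp K n))) =
      op23 A * (op12 B * op23 C) * (op12 (flipOp K n) * (op23 (flipOp K n) * op12 (flipOp K n))) := by
    calc _ = op23 A * ((op23 (flipOp K n) * op23 (flipOp K n)) * (op12 B * ((op12 (flipOp K n) * (op23 (flipOp K n) * op12 C)) * op12 (flipOp K n)))) := by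
          simp only [mul_assoc]
      _ = _ := by
          rw [op23_flip_mul_self, one_mul, op_flip_mul_op12]
          simp only [mul_assoc]
  rw [l, l', h, op_flip_braid]

end Flip

/-! ### The two forms of the Yang–Baxter equation -/

section YangBaxter

variable {K : Type*} [Field K] {r s : K} {n : ℕ}

theorem Rhat_yangBaxter [Infinite K] (h : IsGeneric r s) (hn : 2 ≤ n) {u v w : K} (hv : v ≠ 0) :
    op12 (Rhat r s n (v / w)) ∘ₗ op23 (Rhat r s n (u / w)) ∘ₗ op12 (Rhat r s n (u / v)) =
      op23 (Rhat r s n (u / v)) ∘ₗ op12 (Rhat r s n (u / w)) ∘ₗ op23 (Rhat r s n (v / w)) := by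
  rw [show u / w = u / v * (v / w) by rw [div_mul_div_cancel₀ hv]]
  exact sub_eq_zero.1 (ybDefect_eq_zero h hn (u / v) (v / w))

theorem Rmat_yangBaxter [Infinite K] (h : IsGeneric r s) (hn : 2 ≤ n) {u v w : K} (hv : v ≠ 0) :
    op12 (Rmat r s n (v / w)) ∘ₗ op13 (Rmat r s n (u / w)) ∘ₗ op23 (Rmat r s n (u / v)) =
      op23 (Rmat r s n (u / v)) ∘ₗ op13 (Rmat r s n (u / w)) ∘ₗ op12 (Rmat r s n (v / w)) :=
  yangBaxter_of_braid (Rhat_yangBaxter h hn hv)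

end YangBaxter

end BnAffine

/-! ### Genericity of algebraically independent parameters, and the theorem -/

theorem BnAffine.isGeneric_of_algebraicIndependent {K : Type*} [Field K] [Algebra ℂ K] {r s : K}
    (h : AlgebraicIndependent ℂ ![r, s]) : BnAffine.IsGeneric r s := by
  have inj : ∀ p q : MvPolynomial (Fin 2) ℂ,
      MvPolynomial.aeval ![r, s] p = MvPolynomial.aeval ![r, s] q → p = q := fun p q hpq => h hpq
  refine ⟨fun h0 => ?_, fun h0 => ?_, fun k hk h0 => ?_⟩
  · exact MvPolynomial.X_ne_zero (R := ℂ) (0 : Fin 2) (inj _ _ (by simp [h0]))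
  · exact MvPolynomial.X_ne_zero (R := ℂ) (1 : Fin 2) (inj _ _ (by simp [h0]))
  · have := inj (MvPolynomial.X 0 ^ k) (MvPolynomial.X 1 ^ k) (by simp [h0])
    -- At the point `(1, 0)` the identity `X₀ ^ k = X₁ ^ k` reads `1 = 0`, since `k > 0`.
    have := congrArg (MvPolynomial.eval ![1, 0]) this
    simp [hk.ne'] at this

theorem theorem6p8 {K : Type*} [Field K] [IsAlgClosed K] [Algebra ℂ K] (r s : K)
    (hrs : AlgebraicIndependent ℂ ![r, s]) (n : ℕ) (hn : 2 ≤ n) :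
    -- part (a), for indeterminates `u`, `v` and the algebra with degree generators
    (∃ Δ : BnAffine.UAff r s n →ₐ[K] BnAffine.UAff r s n ⊗[K] BnAffine.UAff r s n,
      BnAffine.UAff.IsCoproduct r s Δ ∧
      ∀ a b : K, a * b = (r * s) ^ (-2 : ℤ) →
        ∃ ρ : BnAffine.UAff r s n →ₐ[K] Module.End K (BnAffine.VLaurent K n),
          BnAffine.IsFormalEvaluation r s a b n ρ ∧
          ∀ x : BnAffine.UAff r s n,
            BnAffine.RhatFormal r s n ∘ₗ BnAffine.tensorRep Δ ρ ρ x =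
              BnAffine.tensorRep Δ ρ ρ x ∘ₗ BnAffine.RhatFormal r s n) ∧
    -- part (a), for nonzero scalars `u`, `v` and the algebra without degree generators
    (∃ Δ : BnAffine.UPrime r s n →ₐ[K] BnAffine.UPrime r s n ⊗[K] BnAffine.UPrime r s n,
      BnAffine.UPrime.IsCoproduct r s Δ ∧
      ∀ a b : K, a * b = (r * s) ^ (-2 : ℤ) →
        ∃ ρ : K → (BnAffine.UPrime r s n →ₐ[K] Module.End K (BnAffine.V K n)),
          (∀ u : K, u ≠ 0 → BnAffine.IsEvaluation r s a b u n (ρ u)) ∧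
          ∀ u v : K, u ≠ 0 → v ≠ 0 → ∀ x : BnAffine.UPrime r s n,
            BnAffine.Rhat r s n (u / v) ∘ₗ BnAffine.tensorRep Δ (ρ u) (ρ v) x =
              BnAffine.tensorRep Δ (ρ v) (ρ u) x ∘ₗ BnAffine.Rhat r s n (u / v)) ∧
    -- part (b)
    (∀ u v w : K, u ≠ 0 → v ≠ 0 → w ≠ 0 →
      BnAffine.op12 (BnAffine.Rmat r s n (v / w)) ∘ₗ
          BnAffine.op13 (BnAffine.Rmat r s n (u / w)) ∘ₗ
          BnAffine.op23 (BnAffine.Rmat r s n (u / v)) =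
        BnAffine.op23 (BnAffine.Rmat r s n (u / v)) ∘ₗ
          BnAffine.op13 (BnAffine.Rmat r s n (u / w)) ∘ₗ
          BnAffine.op12 (BnAffine.Rmat r s n (v / w)) ∧
      BnAffine.op12 (BnAffine.Rhat r s n (v / w)) ∘ₗ
          BnAffine.op23 (BnAffine.Rhat r s n (u / w)) ∘ₗ
          BnAffine.op12 (BnAffine.Rhat r s n (u / v)) =
        BnAffine.op23 (BnAffine.Rhat r s n (u / v)) ∘ₗ
          BnAffine.op12 (BnAffine.Rhat r s n (u / w)) ∘ₗ
          BnAffine.op23 (BnAffine.Rhat r s n (v / w))) := by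
  have hg := BnAffine.isGeneric_of_algebraicIndependent hrs
  -- Infinitely many scalars are needed for specializing Laurent polynomials and for the polynomial
  -- extension in the spectral parameters.
  have : Infinite K := IsAlgClosed.instInfinite
  obtain ⟨Δ, hΔ⟩ := BnAffine.UAff.exists_coproduct hg hn
  obtain ⟨Δ', hΔ'⟩ := BnAffine.UPrime.exists_coproduct hg hn
  exact ⟨⟨Δ, hΔ, fun a b hab => BnAffine.exists_formalEvaluation hg hn hΔ hab⟩,
    ⟨Δ', hΔ', fun a b hab => BnAffine.exists_evaluations hg hn hΔ' hab⟩,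
    fun _ _ _ _ hv _ => ⟨BnAffine.Rmat_yangBaxter hg hn hv, BnAffine.Rhat_yangBaxter hg hn hv⟩⟩
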